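/- **Setting.** A Maya diagram is a set $M\subset\mathbb Z$ containing finitely many non‑negative and missing finitely many negative integers; write $M=(n'\,|\,n)$, where $n$ runs over the filled places $n\ge 0$ and $n'\ge0$ over the empty places $-n'-1$. Let $t(M)$ be the integer for which $M+t(M)$ contains all negative integers but not $0$ (canonical form), and $t'(M)$ the one for which $M+t'(M)$ contains $-1$ but no non‑negative integer (conjugate canonical form). Let $M_1=(n'_1,\dots,n'_{r_4}|n_1,\dots,n_{r_1})$, $M_2=(m'_1,\dots,m'_{r_3}|m_1,\dots,m_{r_2})$ be Maya diagrams (entries decreasing), $t_i=t(M_i)$, $t_i'=t'(M_i)$. Let $\alpha\in\mathbb R\setminus\mathbb Z$ and $\lambda\in\mathbb C$, and let $f_1,\dots,f_r$ be the seed functions $$L^\alpha_{n_j}(x),\quad e^xL^\alpha_{m_j}(-x),\quad x^{-\alpha}L^{-\alpha}_{m_j'}(x),\quad e^xx^{-\alpha}L^{-\alpha}_{n_j'}(-x)$$ ($j\le r_1$, $j\le r_2$, $j\le r_3$, $j\le r_4$ respectively). With $h^\alpha(x,\lambda)=M(-\lambda,\alpha+1,x)$, $\tilde h^\alpha(x,\lambda)=x^{-\alpha}M(-\lambda-\alpha,1-\alpha,x)$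 ($M(a,b,x)={}_1F_1(a;b;x)$) put, for $x>0$, $$\Omega^\alpha_{M_1,M_2}=e^{-(r_2+r_4)x}x^{(\alpha+r_1+r_2)(r_3+r_4)}\mathrm{Wr}[f_1,\dots,f_r],\qquad A[y]=e^{-(r_2+r_4)x}x^{(\alpha+r_1+r_2+1)(r_3+r_4)}\mathrm{Wr}[f_1,\dots,f_r,y],$$ $$\Omega_{M_1,M_2}[h^\alpha]=A[h^\alpha],\qquad \Omega_{M_1,M_2}[\tilde h^\alpha]=e^{-(r_2+r_4)x}x^{(\alpha+r_1+r_2)(r_3+r_4+1)}\mathrm{Wr}[f_1,\dots,f_r,\tilde h^\alpha].$$ Values of these functions at $0$ are limits as $x\to0^+$. Let $\alpha'=\alpha-t_1-t_2$, $\boldsymbol\alpha=\alpha'+r(\mu)+r(\nu)$, where $r(\mu),r(\nu)$ are the numbers of non‑negative elements of $M_1+t_1$, $M_2+t_2$ (so $\boldsymbol\alpha=\alpha+r_1+r_2-r_3-r_4$); a subscript $\mu,\nu$ (resp. $\mu',\nu'$) means that $M_1,M_2$ are replaced by $M_1+t_1,M_2+t_2$ (resp. $M_1+t_1',M_2+t_2'$).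 Write $\Omega=\Omega^\alpha_{M_1,M_2}$. The exceptional Laguerre expression is $$\mathcal L[y]=-\Big(xy''+\big(\boldsymbol\alpha+1-x-2x\tfrac{\Omega'}{\Omega}\big)y'+\big(x\tfrac{\Omega''}{\Omega}+(x-\boldsymbol\alpha)\tfrac{\Omega'}{\Omega}+r_4-r_1\big)y\Big),$$ with weight $\mathcal W=x^{\boldsymbol\alpha}e^{-x}/\Omega^2$ on $(0,\infty)$, maximal operator $\mathcal L_{\max}$ in $L^2((0,\infty),\mathcal W\,dx)$ with domain $\{f: f,f'\in AC_{loc}(0,\infty);\ f,\mathcal L f\in L^2(\mathcal W\,dx)\}$, and form $[f,g](x)=x\mathcal W(x)\,(fg'-f'g)(x)$. Quasi‑derivatives at $0$ are $f^{[0]}(0)=\lim_{x\to0^+}[f,\tilde y_2](x)$ and $f^{[1]}(0)=\lim_{x\to0^+}[f,\tilde y_1](x)$ with $\tilde y_1=-\Omega(0)/\boldsymbol\alpha$, $\tilde y_2=\Omega(0)x^{-\boldsymbol\alpha}$. Put $$u_1=-\frac{\Omega(0)\,\Omega_{M_1,M_2}[h^\alpha(x,\lambda)]}{\boldsymbol\alpha\,\Omega_{M_1,M_2}[h^\alpha(0,\lambda)]},\qquad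 u_2=-\frac{\Omega(0)\,x^{-\boldsymbol\alpha}\,\Omega_{M_1,M_2}[\tilde h^\alpha(x,\lambda)]}{\Omega_{M_1,M_2}[\tilde h^\alpha(0,\lambda)]}.$$ With $x^{(n)}$, $x_{(n)}$ the rising and falling factorials, let $C=C_1C_2C_3$, $D=D_1D_2D_3$, where $C_1=1$ if $t_1=0$, $C_2=1$ if $t_2=0$, $D_1=1$ if $t_1'=0$, $D_2=1$ if $t_2'=0$, and otherwise $$C_1=\frac{(-\lambda)^{(|t_1|)}}{(\alpha+1)^{(|t_1|)}}\ (t_1<0),\quad C_1=\frac{\alpha_{(t_1)}}{\prod_{0\le k<t_1,\,k\notin\{n'_j\}}(-\lambda-k-1)}\ (t_1>0),$$ $$C_2=\frac{(\alpha+1+\lambda)^{(|t_2|)}}{(\alpha-t_1+1)^{(|t_2|)}}\ (t_2<0),\quad C_2=\frac{(\alpha-t_1)_{(t_2)}}{\prod_{0\le k<t_2,\,k\notin\{m'_j\}}(\lambda+\alpha-k)}\ (t_2>0),$$ $$D_1=\frac{(-\alpha)_{(|t_1'|)}}{\prod_{0\le k<|t_1'|,\,k\notin\{n_j\}}(\lambda-k)}\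 (t_1'<0),\quad D_1=\frac{(\lambda+1)^{(t_1')}}{(1-\alpha)^{(t_1')}}\ (t_1'>0),$$ $$D_2=\frac{(-\alpha+t_1')_{(|t_2'|)}}{\prod_{0\le k<|t_2'|,\,k\notin\{m_j\}}(-\lambda-\alpha-1-k)}\ (t_2'<0),\quad D_2=\frac{(-\lambda-\alpha)^{(t_2')}}{(1-\alpha+t_1')^{(t_2')}}\ (t_2'>0),$$ $$C_3=\prod_{j\le r_1,k\le r_3}(m_k'-\alpha-n_j)\prod_{j\le r_2,k\le r_4}(n_k'-\alpha-m_j)\prod_{j\le r_1,k\le r_4}(n_j+n_k'+1)\prod_{j\le r_2,k\le r_3}(m_j+m_k'+1),$$ $$D_3=\prod_{j\le r_1,k\le r_3}(n_j+\alpha-m_k')\prod_{j\le r_2,k\le r_4}(m_j+\alpha-n_k')\prod_{j\le r_1,k\le r_4}(n_j+n_k'+1)\prod_{j\le r_2,k\le r_3}(m_j+m_k'+1).$$ Finally (with $1/\Gamma=0$ at the poles of $\Gamma$) $$\mathfrak C=-\frac{\boldsymbol\alpha\,C\,\Gamma(-\alpha)\,\Omega_{\mu,\nu}[h^{\alpha'}(0,\lambda+t_1)]}{\Gamma(-\lambda-\alpha)\,\Omega(0)},\qquad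 \mathfrak D=-\frac{D\,\Gamma(\alpha)\,\Omega_{\mu',\nu'}[\tilde h^{\alpha-t_1'-t_2'}(0,\lambda+t_1')]}{\Gamma(-\lambda)\,\Omega(0)}.$$ Assume that $\lambda$ is not in the finite set of real numbers consisting of the eigenvalues $n_j$, $-1-n_j'$, $-\alpha-1-m_j$, $m_j'-\alpha$ of the seed functions and the zeros of the denominators of $C$ and $D$ (e.g. any $\lambda\in\mathbb C\setminus\mathbb R$). Let $U$ be Tricomi's function and $\chi_{\mathcal L}(\cdot,\lambda)=A[U(-\lambda,\alpha+1,\cdot)]$. **Proposition.** There are signs $\varepsilon_1,\varepsilon_2\in\{1,-1\}$ depending only on $M_1,M_2$ such that, for all such $\alpha,\lambda$: 1. the values at $0$ of $\Omega$, $\Omega_{M_1,M_2}[h^\alpha]$, $\Omega_{M_1,M_2}[\tilde h^\alpha]$, $\Omega_{\mu,\nu}[h^{\alpha'}(\cdot,\lambda+t_1)]$, $\Omega_{\mu',\nu'}[\tilde h^{\alpha-t_1'-t_2'}(\cdot,\lambda+t_1')]$ exist and are nonzero; $\chi_{\mathcal L}\not\equiv0$; and $(\mathcal L-\lambda)\chi_{\mathcal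 L}=0$ at every $x>0$ with $\Omega(x)\ne0$; 2. $\chi_{\mathcal L}(x,\lambda)=\varepsilon_1\mathfrak C\,u_1(x,\lambda)+\varepsilon_2\mathfrak D\,u_2(x,\lambda)$ for all $x>0$; 3. if $-1<\boldsymbol\alpha<1$, then $\chi_{\mathcal L}^{[0]}(0,\lambda)=\varepsilon_1\mathfrak C$ and $\chi_{\mathcal L}^{[1]}(0,\lambda)=\varepsilon_2\mathfrak D$; 4. if $-1<\boldsymbol\alpha<1$ and $\Omega$ has no zero in $(0,\infty)$, then $\ker(\mathcal L_{\max}-\lambda)=\mathbb C\,\chi_{\mathcal L}(\cdot,\lambda)$, i.e. every deficiency element is a multiple of $\varepsilon_1\mathfrak C u_1+\varepsilon_2\mathfrak D u_2$. -/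

import Mathlib

open Filter Topology MeasureTheory Set

namespace ExceptionalLaguerre

/-! ### Maya diagrams -/

/-- A Maya diagram: a set of integers containing finitely many non-negative integers and missing
finitely many negative integers. The integer `k` is a filled box iff `k ∈ carrier`. -/
structure MayaDiagram where
  carrier : Set ℤ
  finite_filled : {n : ℕ | (n : ℤ) ∈ carrier}.Finite
  finite_empty : {n : ℕ | -(n : ℤ) - 1 ∉ carrier}.Finite

namespace MayaDiagram

/-- The indices `n` of the filled boxes `n ≥ 0`; the entries to the right of the bar in
`M = (n' | n)`. -/
noncomputable def filled (M : MayaDiagram) : Finset ℕ := M.finite_filled.toFinset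

/-- The indices `n'` of the empty boxes `-n' - 1 < 0`; the entries to the left of the bar in
`M = (n' | n)`. -/
noncomputable def empty (M : MayaDiagram) : Finset ℕ := M.finite_empty.toFinset

/-- The shifted diagram `M + t = {k + t : k ∈ M}`. -/
def shift (M : MayaDiagram) (t : ℤ) : MayaDiagram where
  carrier := {k | k - t ∈ M.carrier}
  finite_filled := by
    refine Set.Finite.of_injOn (f := fun n : ℕ => if t ≤ n then (Sum.inl ((n : ℤ) - t).toNat : ℕ ⊕ ℕ)
      else Sum.inr n) (t := (Sum.inl '' {n : ℕ | (n : ℤ) ∈ M.carrier}) ∪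
        (Sum.inr '' {n : ℕ | n < t.toNat})) ?_ ?_ ?_
    · intro n hn
      simp only [Set.mem_ofPred_eq] at hn
      by_cases h : t ≤ n
      · left
        refine ⟨((n : ℤ) - t).toNat, ?_, by simp [h]⟩
        simp only [Set.mem_ofPred_eq]
        rwa [Int.toNat_of_nonneg (by omega)]
      · right
        refine ⟨n, ?_, by simp [h]⟩
        simp only [Set.mem_ofPred_eq]
        omega
    · intro a _ b _ hab
      simp only at hab
      split_ifs at hab <;> simp at hab <;> omega
    · exact (M.finite_filled.image _).union ((Set.finite_lt_nat _).image _)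
  finite_empty := by
    refine Set.Finite.of_injOn (f := fun n : ℕ => if -t ≤ n then (Sum.inl ((n : ℤ) + t).toNat : ℕ ⊕ ℕ)
      else Sum.inr n) (t := (Sum.inl '' {n : ℕ | -(n : ℤ) - 1 ∉ M.carrier}) ∪
        (Sum.inr '' {n : ℕ | n < (-t).toNat})) ?_ ?_ ?_
    · intro n hn
      simp only [Set.mem_ofPred_eq] at hn
      by_cases h : -t ≤ n
      · left
        refine ⟨((n : ℤ) + t).toNat, ?_, by simp [h]⟩
        simp only [Set.mem_ofPred_eq]
        rw [Int.toNat_of_nonneg (by omega)]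
        convert hn using 2
        ring
      · right
        refine ⟨n, ?_, by simp [h]⟩
        simp only [Set.mem_ofPred_eq]
        omega
    · intro a _ b _ hab
      simp only at hab
      split_ifs at hab <;> simp at hab <;> omega
    · exact (M.finite_empty.image _).union ((Set.finite_lt_nat _).image _)

/-- Canonical form: no empty box to the left of the origin, and the box `0` is empty. -/
def IsCanonical (M : MayaDiagram) : Prop :=
  (∀ k : ℤ, k < 0 → k ∈ M.carrier) ∧ (0 : ℤ) ∉ M.carrier

/-- Conjugate canonical form: no filled box to the right of the origin, and the box `-1` is
filled. -/
def IsConjCanonical (M : MayaDiagram) : Prop :=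
  (∀ k : ℤ, 0 ≤ k → k ∉ M.carrier) ∧ (-1 : ℤ) ∈ M.carrier

/-- The shift `t(M)` into canonical form: minus the position of the first empty box. -/
noncomputable def canShift (M : MayaDiagram) : ℤ := -sInf {k : ℤ | k ∉ M.carrier}

/-- The shift `t'(M)` into conjugate canonical form: the last filled box is moved to `-1`. -/
noncomputable def conjShift (M : MayaDiagram) : ℤ := -1 - sSup M.carrier

theorem canShift_spec (M : MayaDiagram) : (M.shift M.canShift).IsCanonical := by
  have hne : {k : ℤ | k ∉ M.carrier}.Nonempty := by
    by_contra h
    rw [Set.not_nonempty_iff_eq_empty] at h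
    refine Set.infinite_univ (α := ℕ) (M.finite_filled.subset fun n _ => ?_)
    by_contra hn
    exact (Set.eq_empty_iff_forall_notMem.1 h n) hn
  have hbdd : BddBelow {k : ℤ | k ∉ M.carrier} := by
    obtain ⟨B, hB⟩ := M.finite_empty.bddAbove
    refine ⟨-(B : ℤ) - 1, fun k hk => ?_⟩
    by_contra hlt
    have h1 : (-k - 1).toNat ∈ {n : ℕ | -(n : ℤ) - 1 ∉ M.carrier} := by
      simp only [Set.mem_ofPred_eq]
      rw [Int.toNat_of_nonneg (by omega)]
      convert hk using 2
      ring
    have := hB h1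
    omega
  have hmem := Int.csInf_mem hne hbdd
  refine ⟨fun k hk => ?_, ?_⟩
  · change k - M.canShift ∈ M.carrier
    by_contra h
    have := csInf_le hbdd h
    simp only [canShift] at this
    omega
  · change (0 : ℤ) - M.canShift ∉ M.carrier
    simpa [canShift] using hmem

theorem conjShift_spec (M : MayaDiagram) : (M.shift M.conjShift).IsConjCanonical := by
  have hne : M.carrier.Nonempty := by
    by_contra h
    rw [Set.not_nonempty_iff_eq_empty] at h
    refine Set.infinite_univ (α := ℕ) (M.finite_empty.subset fun n _ => ?_)
    simp [h]
  have hbdd : BddAbove M.carrier := by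
    obtain ⟨B, hB⟩ := M.finite_filled.bddAbove
    refine ⟨(B : ℤ), fun k hk => ?_⟩
    by_contra hlt
    have h1 : k.toNat ∈ {n : ℕ | (n : ℤ) ∈ M.carrier} := by
      simp only [Set.mem_ofPred_eq]
      rwa [Int.toNat_of_nonneg (by omega)]
    have := hB h1
    omega
  have hmem := Int.csSup_mem hne hbdd
  refine ⟨fun k hk => ?_, ?_⟩
  · change k - M.conjShift ∉ M.carrier
    intro h
    have := le_csSup hbdd h
    simp only [conjShift] at this
    omega
  · change (-1 : ℤ) - M.conjShift ∈ M.carrier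
    simpa [conjShift] using hmem

end MayaDiagram

/-! ### Special functions -/

/-- Rising factorial `x (x+1) ⋯ (x+n-1)`. -/
noncomputable def rising (x : ℂ) (n : ℕ) : ℂ := (ascPochhammer ℂ n).eval x

/-- Falling factorial `x (x-1) ⋯ (x-n+1)`. -/
noncomputable def falling (x : ℂ) (n : ℕ) : ℂ := (descPochhammer ℂ n).eval x

/-- The Laguerre polynomial `L_n^α(x) = ∑_{k ≤ n} (-1)^k binom(n+α, n-k) x^k / k!`. -/
noncomputable def laguerreL (α : ℝ) (n : ℕ) (x : ℝ) : ℂ :=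
  ∑ k ∈ Finset.range (n + 1),
    (-1) ^ k * (rising ((α : ℂ) + k + 1) (n - k) / (n - k).factorial) * (x : ℂ) ^ k / k.factorial

/-- The confluent hypergeometric function `M(a, b, x) = ₁F₁(a; b; x)`. -/
noncomputable def kummerM (a b : ℂ) (x : ℝ) : ℂ :=
  ∑' k : ℕ, rising a k / rising b k * (x : ℂ) ^ k / k.factorial

/-- `f` is, on `(0, ∞)`, the solution of Kummer's equation `x f'' + (b - x) f' - a f = 0` with
`f(x) ~ x^(-a)` as `x → ∞`. -/
def IsTricomiU (a b : ℂ) (f : ℝ → ℂ) : Prop :=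
  (∀ x : ℝ, 0 < x → DifferentiableAt ℝ f x ∧ DifferentiableAt ℝ (deriv f) x ∧
    (x : ℂ) * deriv (deriv f) x + (b - x) * deriv f x - a * f x = 0) ∧
  Tendsto (fun x : ℝ => (x : ℂ) ^ a * f x) atTop (𝓝 1)

open Classical in
/-- Tricomi's confluent hypergeometric function `U(a, b, x)` for `x > 0`, characterised by
`IsTricomiU`. -/
noncomputable def tricomiU (a b : ℂ) : ℝ → ℂ :=
  if h : ∃ f, IsTricomiU a b f then h.choose else 0

/-- `h^α(x, lam) = M(-lam, α+1, x)`. -/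
noncomputable def hFun (α : ℝ) (lam : ℂ) (x : ℝ) : ℂ := kummerM (-lam) (α + 1) x

/-- `h̃^α(x, lam) = x^(-α) M(-lam-α, 1-α, x)`. -/
noncomputable def hTilde (α : ℝ) (lam : ℂ) (x : ℝ) : ℂ :=
  ((x ^ (-α) : ℝ) : ℂ) * kummerM (-lam - α) (1 - α) x

/-! ### Seed functions, Wronskians, Darboux transform -/

/-- The Wronskian `Wr[g₁, …, g_s](x)`. -/
noncomputable def wronskian (l : List (ℝ → ℂ)) (x : ℝ) : ℂ :=
  (Matrix.of fun i j : Fin l.length => iteratedDeriv (i : ℕ) (l.get j) x).det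

/-- The elements of a finite set of indices in decreasing order. -/
noncomputable def decr (s : Finset ℕ) : List ℕ := s.sort (fun a b => b ≤ a)

/-- The seed functions `f₁, …, f_r` for `M₁ = (n' | n)`, `M₂ = (m' | m)`, in this order:
`L_n^α(x)`, `e^x L_m^α(-x)`, `x^(-α) L_{m'}^{-α}(x)`, `e^x x^(-α) L_{n'}^{-α}(-x)`. -/
noncomputable def seeds (α : ℝ) (M₁ M₂ : MayaDiagram) : List (ℝ → ℂ) :=
  (decr M₁.filled).map (fun n x => laguerreL α n x) ++
  (decr M₂.filled).map (fun m x => (Real.exp x : ℂ) * laguerreL α m (-x)) ++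
  (decr M₂.empty).map (fun m x => ((x ^ (-α) : ℝ) : ℂ) * laguerreL (-α) m x) ++
  (decr M₁.empty).map
    (fun n x => (Real.exp x : ℂ) * ((x ^ (-α) : ℝ) : ℂ) * laguerreL (-α) n (-x))

/-- The numbers `r₁, r₂, r₃, r₄` of seed functions of each of the four kinds. -/
noncomputable def num₁ (M₁ : MayaDiagram) : ℕ := M₁.filled.card
noncomputable def num₂ (M₂ : MayaDiagram) : ℕ := M₂.filled.card
noncomputable def num₃ (M₂ : MayaDiagram) : ℕ := M₂.empty.card
noncomputable def num₄ (M₁ : MayaDiagram) : ℕ := M₁.empty.card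

/-- The factor `e^{-(r₂+r₄) x}`. -/
noncomputable def expFactor (M₁ M₂ : MayaDiagram) (x : ℝ) : ℂ :=
  (Real.exp (-((num₂ M₂ : ℝ) + num₄ M₁) * x) : ℂ)

/-- The generalized Laguerre polynomial
`Ω^α_{M₁,M₂}(x) = e^{-(r₂+r₄)x} x^{(α+r₁+r₂)(r₃+r₄)} Wr[f₁, …, f_r](x)`, for `x > 0`. -/
noncomputable def Om (α : ℝ) (M₁ M₂ : MayaDiagram) (x : ℝ) : ℂ :=
  expFactor M₁ M₂ x *
    ((x ^ ((α + num₁ M₁ + num₂ M₂) * (num₃ M₂ + num₄ M₁)) : ℝ) : ℂ) *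
    wronskian (seeds α M₁ M₂) x

/-- The multi-step Darboux transform
`A[y](x) = e^{-(r₂+r₄)x} x^{(α+r₁+r₂+1)(r₃+r₄)} Wr[f₁, …, f_r, y](x)`, for `x > 0`. -/
noncomputable def darboux (α : ℝ) (M₁ M₂ : MayaDiagram) (y : ℝ → ℂ) (x : ℝ) : ℂ :=
  expFactor M₁ M₂ x *
    ((x ^ ((α + num₁ M₁ + num₂ M₂ + 1) * (num₃ M₂ + num₄ M₁)) : ℝ) : ℂ) *
    wronskian (seeds α M₁ M₂ ++ [y]) x

/-- The solution of the first kind `Ω_{M₁,M₂}[h^α(x, lam)]`. -/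
noncomputable def OmFirst (α : ℝ) (lam : ℂ) (M₁ M₂ : MayaDiagram) (x : ℝ) : ℂ :=
  expFactor M₁ M₂ x *
    ((x ^ ((α + num₁ M₁ + num₂ M₂ + 1) * (num₃ M₂ + num₄ M₁)) : ℝ) : ℂ) *
    wronskian (seeds α M₁ M₂ ++ [hFun α lam]) x

/-- The solution of the second kind `Ω_{M₁,M₂}[h̃^α(x, lam)]`, with its own power of `x`. -/
noncomputable def OmSecond (α : ℝ) (lam : ℂ) (M₁ M₂ : MayaDiagram) (x : ℝ) : ℂ :=
  expFactor M₁ M₂ x *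
    ((x ^ ((α + num₁ M₁ + num₂ M₂) * (num₃ M₂ + num₄ M₁ + 1)) : ℝ) : ℂ) *
    wronskian (seeds α M₁ M₂ ++ [hTilde α lam]) x

/-- The value at `0` of a function given on `(0, ∞)`: its limit from the right. -/
noncomputable def valZero (F : ℝ → ℂ) : ℂ := limUnder (𝓝[>] (0 : ℝ)) F

/-- `F` has a nonzero (finite) value at `0`. -/
def HasNonzeroValZero (F : ℝ → ℂ) : Prop :=
  ∃ c : ℂ, c ≠ 0 ∧ Tendsto F (𝓝[>] (0 : ℝ)) (𝓝 c)

/-! ### Parameters and constants -/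

/-- `α' = α - t₁ - t₂`. -/
noncomputable def alphaCan (α : ℝ) (M₁ M₂ : MayaDiagram) : ℝ := α - M₁.canShift - M₂.canShift

/-- `α - t₁' - t₂'`. -/
noncomputable def alphaConj (α : ℝ) (M₁ M₂ : MayaDiagram) : ℝ := α - M₁.conjShift - M₂.conjShift

/-- The order `𝛂 = α' + r(μ) + r(ν)` of the weight at `0`; `r(μ)`, `r(ν)` are the numbers of filled
boxes to the right of the origin in the canonical forms of `M₁`, `M₂`. -/
noncomputable def bAlpha (α : ℝ) (M₁ M₂ : MayaDiagram) : ℝ :=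
  alphaCan α M₁ M₂ + (M₁.shift M₁.canShift).filled.card + (M₂.shift M₂.canShift).filled.card

noncomputable def constC₁ (α : ℝ) (lam : ℂ) (M₁ : MayaDiagram) : ℂ :=
  if M₁.canShift < 0 then
    rising (-lam) M₁.canShift.natAbs / rising (α + 1) M₁.canShift.natAbs
  else if M₁.canShift = 0 then 1
  else falling α M₁.canShift.natAbs /
    ∏ k ∈ Finset.range M₁.canShift.natAbs \ M₁.empty, (-lam - k - 1)

noncomputable def constC₂ (α : ℝ) (lam : ℂ) (M₁ M₂ : MayaDiagram) : ℂ :=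
  if M₂.canShift < 0 then
    rising (α + 1 + lam) M₂.canShift.natAbs / rising (α - M₁.canShift + 1) M₂.canShift.natAbs
  else if M₂.canShift = 0 then 1
  else falling (α - M₁.canShift) M₂.canShift.natAbs /
    ∏ k ∈ Finset.range M₂.canShift.natAbs \ M₂.empty, (lam + α - k)

noncomputable def constC₃ (α : ℝ) (M₁ M₂ : MayaDiagram) : ℂ :=
  (∏ n ∈ M₁.filled, ∏ m' ∈ M₂.empty, ((m' : ℂ) - α - n)) *
  (∏ m ∈ M₂.filled, ∏ n' ∈ M₁.empty, ((n' : ℂ) - α - m)) *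
  (∏ n ∈ M₁.filled, ∏ n' ∈ M₁.empty, ((n : ℂ) + n' + 1)) *
  (∏ m ∈ M₂.filled, ∏ m' ∈ M₂.empty, ((m : ℂ) + m' + 1))

noncomputable def constC (α : ℝ) (lam : ℂ) (M₁ M₂ : MayaDiagram) : ℂ :=
  constC₁ α lam M₁ * constC₂ α lam M₁ M₂ * constC₃ α M₁ M₂

noncomputable def constD₁ (α : ℝ) (lam : ℂ) (M₁ : MayaDiagram) : ℂ :=
  if M₁.conjShift < 0 then
    falling (-α) M₁.conjShift.natAbs /
      ∏ k ∈ Finset.range M₁.conjShift.natAbs \ M₁.filled, (lam - k)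
  else if M₁.conjShift = 0 then 1
  else rising (lam + 1) M₁.conjShift.natAbs / rising (1 - α) M₁.conjShift.natAbs

noncomputable def constD₂ (α : ℝ) (lam : ℂ) (M₁ M₂ : MayaDiagram) : ℂ :=
  if M₂.conjShift < 0 then
    falling (-α + M₁.conjShift) M₂.conjShift.natAbs /
      ∏ k ∈ Finset.range M₂.conjShift.natAbs \ M₂.filled, (-lam - α - 1 - k)
  else if M₂.conjShift = 0 then 1
  else rising (-lam - α) M₂.conjShift.natAbs /
    rising (1 - α + M₁.conjShift) M₂.conjShift.natAbs

noncomputable def constD₃ (α : ℝ) (M₁ M₂ : MayaDiagram) : ℂ :=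
  (∏ n ∈ M₁.filled, ∏ m' ∈ M₂.empty, ((n : ℂ) + α - m')) *
  (∏ m ∈ M₂.filled, ∏ n' ∈ M₁.empty, ((m : ℂ) + α - n')) *
  (∏ n ∈ M₁.filled, ∏ n' ∈ M₁.empty, ((n : ℂ) + n' + 1)) *
  (∏ m ∈ M₂.filled, ∏ m' ∈ M₂.empty, ((m : ℂ) + m' + 1))

noncomputable def constD (α : ℝ) (lam : ℂ) (M₁ M₂ : MayaDiagram) : ℂ :=
  constD₁ α lam M₁ * constD₂ α lam M₁ M₂ * constD₃ α M₁ M₂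

/-- The shifted solution of the first kind `Ω_{μ,ν}[h^{α'}(x, lam + t₁)]`. -/
noncomputable def OmFirstCan (α : ℝ) (lam : ℂ) (M₁ M₂ : MayaDiagram) : ℝ → ℂ :=
  OmFirst (alphaCan α M₁ M₂) (lam + M₁.canShift)
    (M₁.shift M₁.canShift) (M₂.shift M₂.canShift)

/-- The shifted solution of the second kind `Ω_{μ',ν'}[h̃^{α-t₁'-t₂'}(x, lam + t₁')]`. -/
noncomputable def OmSecondConj (α : ℝ) (lam : ℂ) (M₁ M₂ : MayaDiagram) : ℝ → ℂ :=
  OmSecond (alphaConj α M₁ M₂) (lam + M₁.conjShift)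
    (M₁.shift M₁.conjShift) (M₂.shift M₂.conjShift)

noncomputable def frakC (α : ℝ) (lam : ℂ) (M₁ M₂ : MayaDiagram) : ℂ :=
  -((bAlpha α M₁ M₂ : ℂ) * constC α lam M₁ M₂ * Complex.Gamma (-α) *
      valZero (OmFirstCan α lam M₁ M₂)) /
    (Complex.Gamma (-lam - α) * valZero (Om α M₁ M₂))

noncomputable def frakD (α : ℝ) (lam : ℂ) (M₁ M₂ : MayaDiagram) : ℂ :=
  -(constD α lam M₁ M₂ * Complex.Gamma α * valZero (OmSecondConj α lam M₁ M₂)) /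
    (Complex.Gamma (-lam) * valZero (Om α M₁ M₂))

/-- The spectral parameters at which no denominator vanishes: `lam` is neither the eigenvalue of a
seed function (`n`, `-1-n'`, `-α-1-m`, `m'-α`) nor a zero of a denominator of `C` or `D`. With `e`
the first empty and `f` the last filled box of `M₁`, the excluded values of `lam` are the integers
in `[e, 0) ∪ [0, f]`; those of `-lam-α-1` are given likewise by `M₂`. -/
def Admissible (α : ℝ) (lam : ℂ) (M₁ M₂ : MayaDiagram) : Prop :=
  (∀ j : ℤ, min (-M₁.canShift) 0 ≤ j → j < max (-M₁.conjShift) 0 → lam ≠ j) ∧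
  (∀ j : ℤ, min (-M₂.canShift) 0 ≤ j → j < max (-M₂.conjShift) 0 → -lam - α - 1 ≠ j)

theorem admissible_of_im_ne_zero {α : ℝ} {lam : ℂ} (M₁ M₂ : MayaDiagram) (h : lam.im ≠ 0) :
    Admissible α lam M₁ M₂ := by
  refine ⟨fun j _ _ hj => h (by simp [hj]), fun j _ _ hj => h ?_⟩
  have := congrArg Complex.im hj
  simpa using this

/-! ### The exceptional operator -/

/-- The exceptional Laguerre expression: the Darboux partner of the classical expression
`ℓ[y] = -x y'' + (x-α-1) y'`, in the gauge in which `A` as above intertwines the two and the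
symmetric form has weight `x^𝛂 e^{-x} / Ω²`:
`𝓛[y] = -( x y'' + (𝛂 + 1 - x - 2 x Ω'/Ω) y' + (x Ω''/Ω + (x - 𝛂) Ω'/Ω + r₄ - r₁) y )`. -/
noncomputable def Lexpr (α : ℝ) (M₁ M₂ : MayaDiagram) (y : ℝ → ℂ) (x : ℝ) : ℂ :=
  -((x : ℂ) * deriv (deriv y) x +
    ((bAlpha α M₁ M₂ : ℂ) + 1 - x -
      2 * x * (deriv (Om α M₁ M₂) x / Om α M₁ M₂ x)) * deriv y x +
    (x * (deriv (deriv (Om α M₁ M₂)) x / Om α M₁ M₂ x) +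
      (x - (bAlpha α M₁ M₂ : ℂ)) * (deriv (Om α M₁ M₂) x / Om α M₁ M₂ x) +
      (num₄ M₁ : ℂ) - num₁ M₁) * y x)

/-- The weight `x^𝛂 e^{-x} / Ω(x)²` on `(0, ∞)`; `Ω` is real-valued. -/
noncomputable def weight (α : ℝ) (M₁ M₂ : MayaDiagram) (x : ℝ) : ℝ :=
  x ^ bAlpha α M₁ M₂ * Real.exp (-x) / ‖Om α M₁ M₂ x‖ ^ 2

/-- The measure `weight(x) dx` on `(0, ∞)`. -/
noncomputable def weightMeasure (α : ℝ) (M₁ M₂ : MayaDiagram) : Measure ℝ :=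
  (volume.restrict (Ioi 0)).withDensity fun x => ENNReal.ofReal (weight α M₁ M₂ x)

/-- The sesquilinear form `[f, g](x) = x^{𝛂+1} e^{-x} / Ω(x)² * (f g' - f' g)(x)`. -/
noncomputable def bracket (α : ℝ) (M₁ M₂ : MayaDiagram) (f g : ℝ → ℂ) (x : ℝ) : ℂ :=
  ((x * weight α M₁ M₂ x : ℝ) : ℂ) * (f x * deriv g x - deriv f x * g x)

/-- The maximal domain in `L²((0, ∞), weight dx)`. -/
def IsMaxDomain (α : ℝ) (M₁ M₂ : MayaDiagram) (f : ℝ → ℂ) : Prop :=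
  (∀ a b : ℝ, 0 < a → a ≤ b →
    AbsolutelyContinuousOnInterval f a b ∧ AbsolutelyContinuousOnInterval (deriv f) a b) ∧
  MemLp f 2 (weightMeasure α M₁ M₂) ∧ MemLp (Lexpr α M₁ M₂ f) 2 (weightMeasure α M₁ M₂)

/-- `f` is a deficiency element at `lam`: `f ∈ ker(𝓛_max - lam)`. -/
def IsDeficiencyElement (α : ℝ) (lam : ℂ) (M₁ M₂ : MayaDiagram) (f : ℝ → ℂ) : Prop :=
  IsMaxDomain α M₁ M₂ f ∧
  ∀ᵐ x ∂(volume.restrict (Ioi (0 : ℝ))), Lexpr α M₁ M₂ f x = lam * f x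

/-- `ỹ₁ = -Ω(0) / 𝛂`. -/
noncomputable def yTilde₁ (α : ℝ) (M₁ M₂ : MayaDiagram) (_x : ℝ) : ℂ :=
  -(valZero (Om α M₁ M₂)) / (bAlpha α M₁ M₂ : ℂ)

/-- `ỹ₂ = Ω(0) x^{-𝛂}`. -/
noncomputable def yTilde₂ (α : ℝ) (M₁ M₂ : MayaDiagram) (x : ℝ) : ℂ :=
  valZero (Om α M₁ M₂) * ((x ^ (-bAlpha α M₁ M₂) : ℝ) : ℂ)

/-- The quasi-derivative `f^{[0]}(0) = [f, ỹ₂](0)` exists and equals `c`. -/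
def HasQuasiDeriv₀ (α : ℝ) (M₁ M₂ : MayaDiagram) (f : ℝ → ℂ) (c : ℂ) : Prop :=
  Tendsto (bracket α M₁ M₂ f (yTilde₂ α M₁ M₂)) (𝓝[>] 0) (𝓝 c)

/-- The quasi-derivative `f^{[1]}(0) = [f, ỹ₁](0)` exists and equals `c`. -/
def HasQuasiDeriv₁ (α : ℝ) (M₁ M₂ : MayaDiagram) (f : ℝ → ℂ) (c : ℂ) : Prop :=
  Tendsto (bracket α M₁ M₂ f (yTilde₁ α M₁ M₂)) (𝓝[>] 0) (𝓝 c)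

/-- `u₁ = -Ω(0) Ω[h](x) / (𝛂 Ω[h](0))`. -/
noncomputable def u₁ (α : ℝ) (lam : ℂ) (M₁ M₂ : MayaDiagram) (x : ℝ) : ℂ :=
  -(valZero (Om α M₁ M₂) * OmFirst α lam M₁ M₂ x) /
    ((bAlpha α M₁ M₂ : ℂ) * valZero (OmFirst α lam M₁ M₂))

/-- `u₂ = -Ω(0) x^{-𝛂} Ω[h̃](x) / Ω[h̃](0)`. -/
noncomputable def u₂ (α : ℝ) (lam : ℂ) (M₁ M₂ : MayaDiagram) (x : ℝ) : ℂ :=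
  -(valZero (Om α M₁ M₂) * ((x ^ (-bAlpha α M₁ M₂) : ℝ) : ℂ) * OmSecond α lam M₁ M₂ x) /
    valZero (OmSecond α lam M₁ M₂)

/-- The Darboux transform `χ = A[U(-lam, α+1, ·)]` of the classical deficiency element. -/
noncomputable def chi (α : ℝ) (lam : ℂ) (M₁ M₂ : MayaDiagram) : ℝ → ℂ :=
  darboux α M₁ M₂ (tricomiU (-lam) (α + 1))

end ExceptionalLaguerre

open ExceptionalLaguerre

namespace ExceptionalLaguerre
open Asymptotics

/-! All functions in question arise from solutions of the classical equation `x y'' + (α+1-x) y' + λ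
y = 0` by Crum's operator `y ↦ Wr[f₁,…,f_r,y] / Wr[f₁,…,f_r]`, which is linear in `y`. So three
things are needed: how `U` decomposes into the Frobenius solutions `h` and `h̃` at the origin, the
leading coefficients of the Wronskians at the origin, and the growth of `χ` at infinity.

Connection formula. `U` is given only by its equation and its asymptotics. The combination `triF` of
`h` and `h̃` has the right asymptotics: for `-1 < α < 0` and `Re λ < 0` by the integral
representation, and in general by contiguous relations (`triAsymp`). The characterisation is unique
(`isTricomiU_unique`), hence `U = triF`, and by linearity `χ` is the same combination of the
transforms of `h` and `h̃` (`chi_eq`).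

Values at the origin. Sylvester's determinant identity splits Crum's operator into first order
Darboux steps (`crumOp_append`). Near `0` every function is a power of `x` times an analytic
function, and one step multiplies leading coefficients by an explicit factor (`CrumState.snoc`): a
difference of exponents if the seed is of the other kind, a quotient `(μ-λ)/(2e+α+1+s+t)` if it is
of the same kind. As `α` is not an integer, only differences of eigenvalues can vanish, and
`Admissible` excludes this. Written with Gamma functions, the values depend on the index sets of the
diagrams in a way that can be followed through a shift by one. Comparison with the same shift in `C`
gives `constIdent`: up to a sign, `C` converts the value for the canonical forms into the value for
the given diagrams. Conjugation of diagrams turns `C` into `D` (`constD_eq`). This identifies `𝔠`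
and `𝔡` with the coefficients of `χ` along `u₁` and `u₂`.

Differential equation. The Darboux steps give it near the origin, where the Wronskian of the seeds
has no zero; cleared of denominators, it continues analytically to the half-line (`bilin_eq_zero`).

Deficiency elements. `Ω` is a power of `x` times a real polynomial (`Om_qPoly`), so the weight is
`e^(-x)` up to algebraic factors, and `χ`, `χ'` grow algebraically. By Abel's identity the weighted
Wronskian of a deficiency element `f` and `χ` is constant. Square integrability bounds the means of
`|f|` over unit intervals by `X^N e^(X/2)`, and this forces the constant to be zero
(`wronskian_eq_zero_of_growth`), so `f` is a multiple of `χ`. Conversely `weight * |χ|²` is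
`O(x^(-|𝛂|))` at `0` and decays exponentially, so `χ` is square integrable for `|𝛂| < 1`. -/

/-! ### Everywhere convergent power series -/

/-- The coefficients of an everywhere convergent power series. -/
def IsEntireSeq (c : ℕ → ℂ) : Prop := ∀ r : ℝ, Summable fun k => ‖c k‖ * |r| ^ k

/-- The sum of a power series on the real line. -/
noncomputable def powSum (c : ℕ → ℂ) (x : ℝ) : ℂ := ∑' k, c k * (x : ℂ) ^ k

theorem IsEntireSeq.hasSum {c : ℕ → ℂ} (hc : IsEntireSeq c) (x : ℝ) :
    HasSum (fun k => c k * (x : ℂ) ^ k) (powSum c x) := by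
  refine (Summable.of_norm ?_).hasSum
  simpa using hc x

theorem IsEntireSeq.analyticAt {c : ℕ → ℂ} (hc : IsEntireSeq c) (x : ℝ) :
    AnalyticAt ℝ (powSum c) x := by
  have hrad : (FormalMultilinearSeries.ofScalars ℂ c).radius = ⊤ := by
    refine FormalMultilinearSeries.radius_eq_top_of_summable_norm _ fun r => ?_
    refine (hc r).of_nonneg_of_le (fun n => by positivity) fun n => ?_
    rw [NNReal.abs_eq]
    gcongr
    simp
  have h1 := (FormalMultilinearSeries.ofScalars ℂ c).hasFPowerSeriesOnBall (by simp [hrad])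
  have h2 : AnalyticAt ℂ (FormalMultilinearSeries.ofScalars ℂ c).sum (x : ℂ) :=
    h1.analyticAt_of_mem (by simp [hrad])
  have h3 : AnalyticAt ℝ (fun x : ℝ => (x : ℂ)) x := Complex.ofRealCLM.analyticAt x
  have h4 := AnalyticAt.fun_comp (f := fun x : ℝ => (x : ℂ)) (x := x)
    (h2.restrictScalars (𝕜 := ℝ)) h3
  refine h4.congr (Eventually.of_forall fun y => ?_)
  have := FormalMultilinearSeries.ofScalars_sum_eq (E := ℂ) c (y : ℂ)
  simp only [FormalMultilinearSeries.ofScalarsSum] at this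
  simp only []
  rw [this]
  simp [powSum]

theorem IsEntireSeq.deriv_seq {c : ℕ → ℂ} (hc : IsEntireSeq c) :
    IsEntireSeq fun k => (k + 1) * c (k + 1) := by
  intro r
  -- The factor 2 in the radius pays for `k + 1 ≤ 2^(k+1)`; the summand 1 makes the base at least 1,
  -- so that the exponent may rise from `k` to `k + 1`.
  have h := (summable_nat_add_iff 1).2 (hc (2 * (|r| + 1)))
  refine h.of_nonneg_of_le (fun k => by positivity) fun k => ?_
  have h1 : ((k : ℝ) + 1) ≤ 2 ^ (k + 1) := by
    exact_mod_cast (Nat.lt_two_pow_self (n := k + 1)).le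
  have h2 : |r| ^ k ≤ (|r| + 1) ^ (k + 1) := by
    calc |r| ^ k ≤ (|r| + 1) ^ k := by gcongr; linarith
      _ ≤ (|r| + 1) ^ (k + 1) := by
        apply pow_le_pow_right₀ _ (Nat.le_succ k)
        linarith [abs_nonneg r]
  have h3 : ‖((k : ℂ) + 1)‖ = (k : ℝ) + 1 := by
    have : ((k : ℂ) + 1) = (((k : ℝ) + 1 : ℝ) : ℂ) := by push_cast; rfl
    rw [this, Complex.norm_real, Real.norm_of_nonneg (by positivity)]
  rw [norm_mul, h3, abs_of_nonneg (by positivity : 0 ≤ 2 * (|r| + 1)), mul_pow]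
  calc ((k : ℝ) + 1) * ‖c (k + 1)‖ * |r| ^ k ≤ 2 ^ (k + 1) * ‖c (k + 1)‖ * (|r| + 1) ^ (k + 1) := by
        gcongr
    _ = _ := by ring

theorem IsEntireSeq.hasDerivAt {c : ℕ → ℂ} (hc : IsEntireSeq c) (x : ℝ) :
    HasDerivAt (powSum c) (powSum (fun k => (k + 1) * c (k + 1)) x) x := by
  set R : ℝ := |x| + 1
  have hR : 0 ≤ R := by positivity
  have hsum : Summable fun k : ℕ => ‖(k : ℂ) * c k‖ * R ^ (k - 1) := by
    rw [← summable_nat_add_iff 1]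
    have := hc.deriv_seq R
    simpa [abs_of_nonneg hR] using this
  have key := hasDerivAt_tsum_of_isPreconnected (𝕜 := ℝ) (g := fun (k : ℕ) (y : ℝ) => c k * (y : ℂ) ^ k)
    (g' := fun (k : ℕ) (y : ℝ) => c k * (k * (y : ℂ) ^ (k - 1))) hsum Metric.isOpen_ball
    (convex_ball (0 : ℝ) R).isPreconnected
    (fun k y _ => by
      have := ((Complex.ofRealCLM.hasDerivAt (x := y)).pow k).const_mul (c k)
      simpa using this)
    (fun k y hy => by
      simp only [norm_mul, norm_pow, Complex.norm_real]
      have : ‖y‖ ≤ R := by simpa using (mem_ball_zero_iff.1 hy).le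
      calc ‖c k‖ * (‖(k : ℂ)‖ * ‖y‖ ^ (k - 1)) ≤ ‖c k‖ * (‖(k : ℂ)‖ * R ^ (k - 1)) := by gcongr
        _ = _ := by ring)
    (y₀ := 0) (by simp [R]; positivity) (by simpa using (hc.hasSum 0).summable) (y := x) (by simp [R])
  have h0 : Summable fun k : ℕ => c k * (k * (x : ℂ) ^ (k - 1)) := by
    rw [← summable_nat_add_iff 1]
    refine (hc.deriv_seq.hasSum x).summable.congr fun k => ?_
    simp
    ring
  have h1 : ∑' k : ℕ, c k * (k * (x : ℂ) ^ (k - 1)) =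
      powSum (fun k => (k + 1) * c (k + 1)) x := by
    rw [h0.tsum_eq_zero_add]
    simp only [powSum, Nat.cast_zero, zero_mul, mul_zero, zero_add]
    refine tsum_congr fun k => ?_
    simp
    ring
  rw [h1] at key
  exact key

/-- A factor `x` is absorbed as a shift of the coefficients, so that contiguous relations containing
`x` can also be checked coefficient by coefficient. -/
theorem IsEntireSeq.mul_x {c : ℕ → ℂ} (hc : IsEntireSeq c) (x : ℝ) :
    HasSum (fun k => (Nat.casesOn k 0 c : ℂ) * (x : ℂ) ^ k) (x * powSum c x) := by
  rw [← hasSum_nat_add_iff' 1]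
  simp
  refine ((hc.hasSum x).mul_left (x : ℂ)).congr_fun ?_ |> fun h => h
  intro k
  ring

/-! ### Kummer's function -/

theorem rising_zero (x : ℂ) : rising x 0 = 1 := by simp [rising]

theorem rising_succ (x : ℂ) (n : ℕ) : rising x (n + 1) = rising x n * (x + n) := by
  simp [rising, ascPochhammer_succ_eval]

theorem rising_succ_left (x : ℂ) (n : ℕ) : rising x (n + 1) = x * rising (x + 1) n := by
  simp [rising, ascPochhammer_succ_left]

theorem rising_ne_zero {b : ℂ} (hb : ∀ k : ℕ, b + k ≠ 0) (n : ℕ) : rising b n ≠ 0 := by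
  induction n with
  | zero => simp [rising_zero]
  | succ n ih => rw [rising_succ]; exact mul_ne_zero ih (hb n)

/-- The coefficients of `M(a, b, x)`. -/
noncomputable def kummerCoeff (a b : ℂ) (k : ℕ) : ℂ := rising a k / rising b k / k.factorial

theorem kummerM_eq_powSum (a b : ℂ) : kummerM a b = powSum (kummerCoeff a b) := by
  ext x
  simp only [kummerM, powSum, kummerCoeff]
  refine tsum_congr fun k => by ring

/-- Ratio test: consecutive coefficients have quotient `(a+k) / ((b+k)(k+1))`, which tends to 0. -/
theorem isEntireSeq_kummerCoeff (a : ℂ) {b : ℂ} (hb : ∀ k : ℕ, b + k ≠ 0) :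
    IsEntireSeq (kummerCoeff a b) := by
  intro r
  have hlim : Tendsto (fun k : ℕ => ‖(a + k) / (b + k) / (k + 1)‖ * |r|) atTop (𝓝 0) := by
    have h1 : Tendsto (fun k : ℕ => (a + k) / (b + k)) atTop (𝓝 1) := by
      simpa using tendsto_add_mul_div_add_mul_atTop_nhds (𝕜 := ℂ) a b 1 one_ne_zero
    have h2 := tendsto_one_div_add_atTop_nhds_zero_nat (𝕜 := ℂ)
    have h3 := (h1.mul h2).norm.mul_const |r|
    simpa [div_eq_mul_inv] using h3
  refine summable_of_ratio_norm_eventually_le (r := 1 / 2) (by norm_num) ?_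
  filter_upwards [hlim.eventually (gt_mem_nhds (show (0 : ℝ) < 1 / 2 by norm_num))] with k hk
  have hk1 : ((k : ℂ) + 1) ≠ 0 := by exact_mod_cast Nat.succ_ne_zero k
  have : kummerCoeff a b (k + 1) = (a + k) / (b + k) / (k + 1) * kummerCoeff a b k := by
    simp only [kummerCoeff, rising_succ, Nat.factorial_succ]
    have := rising_ne_zero hb k
    have := hb k
    push_cast
    field_simp
  rw [this]
  rw [norm_mul (_ / _), Real.norm_of_nonneg (by positivity), Real.norm_of_nonneg (by positivity),
    pow_succ]
  calc _ = ‖(a + k) / (b + k) / (k + 1)‖ * |r| * (‖kummerCoeff a b k‖ * |r| ^ k) := by ring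
    _ ≤ 1 / 2 * (‖kummerCoeff a b k‖ * |r| ^ k) := by gcongr

theorem kummerM_zero (a b : ℂ) : kummerM a b 0 = 1 := by
  rw [kummerM, tsum_eq_single 0]
  · simp [rising_zero]
  · intro k hk
    simp [hk]

theorem kummerM_analyticAt (a : ℂ) {b : ℂ} (hb : ∀ k : ℕ, b + k ≠ 0) (x : ℝ) :
    AnalyticAt ℝ (kummerM a b) x := by
  rw [kummerM_eq_powSum]
  exact (isEntireSeq_kummerCoeff a hb).analyticAt x

theorem kummerM_hasSum (a : ℂ) {b : ℂ} (hb : ∀ k : ℕ, b + k ≠ 0) (x : ℝ) :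
    HasSum (fun k => kummerCoeff a b k * (x : ℂ) ^ k) (kummerM a b x) := by
  rw [kummerM_eq_powSum]
  exact (isEntireSeq_kummerCoeff a hb).hasSum x

theorem kummerM_hasSum_mul (a : ℂ) {b : ℂ} (hb : ∀ k : ℕ, b + k ≠ 0) (x : ℝ) :
    HasSum (fun k => (Nat.casesOn k 0 (kummerCoeff a b) : ℂ) * (x : ℂ) ^ k)
      (x * kummerM a b x) := by
  rw [kummerM_eq_powSum]
  exact (isEntireSeq_kummerCoeff a hb).mul_x x

theorem add_one_add_ne_zero {b : ℂ} (hb : ∀ k : ℕ, b + k ≠ 0) (k : ℕ) : b + 1 + k ≠ 0 := by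
  have := hb (k + 1)
  push_cast at this
  rwa [add_assoc, add_comm 1]

theorem kummerCoeff_succ_left (a : ℂ) {b : ℂ} (hb : ∀ k : ℕ, b + k ≠ 0) (k : ℕ) :
    (k + 1) * kummerCoeff a b (k + 1) = a / b * kummerCoeff (a + 1) (b + 1) k := by
  have h0 : b ≠ 0 := by simpa using hb 0
  have h1 := rising_ne_zero (add_one_add_ne_zero hb) k
  have h2 : ((k : ℂ) + 1) ≠ 0 := by exact_mod_cast Nat.succ_ne_zero k
  have h3 : (k.factorial : ℂ) ≠ 0 := by exact_mod_cast k.factorial_ne_zero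
  simp only [kummerCoeff, rising_succ_left, Nat.factorial_succ]
  push_cast
  field_simp

theorem kummerM_hasDerivAt (a : ℂ) {b : ℂ} (hb : ∀ k : ℕ, b + k ≠ 0) (x : ℝ) :
    HasDerivAt (kummerM a b) (a / b * kummerM (a + 1) (b + 1) x) x := by
  have h := (isEntireSeq_kummerCoeff a hb).hasDerivAt x
  rw [← kummerM_eq_powSum] at h
  convert h using 1
  have h1 := (kummerM_hasSum (a + 1) (add_one_add_ne_zero hb) x).mul_left (a / b)
  rw [← h1.tsum_eq, powSum]
  refine tsum_congr fun k => ?_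
  rw [kummerCoeff_succ_left a hb]
  ring

theorem hasSum_of_eq {f g : ℕ → ℂ} {s : ℂ} (h : HasSum f s) (e : ∀ k, g k = f k) :
    HasSum g s := by
  rwa [funext e]

/-- A linear relation between power series that holds for all coefficients. -/
theorem eq_zero_of_hasSum_coeff {c : ℕ → ℂ} {s : ℂ} {x : ℝ}
    (h : HasSum (fun k => c k * (x : ℂ) ^ k) s) (hc : ∀ k, c k = 0) : s = 0 := by
  have : (fun k => c k * (x : ℂ) ^ k) = fun _ => 0 := by
    ext k
    simp [hc]
  rw [this] at h
  exact h.unique hasSum_zero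

/-- This and the two following contiguous relations are identities between the coefficients of each
power of `x`. They later move `λ` and `α` by integers in the connection formula. -/
theorem kummerM_contiguous_a (a : ℂ) {b : ℂ} (hb : ∀ k : ℕ, b + k ≠ 0) (x : ℝ) :
    (b - a) * kummerM (a - 1) b x + (2 * a - b + x) * kummerM a b x
      - a * kummerM (a + 1) b x = 0 := by
  have h := (((kummerM_hasSum (a - 1) hb x).mul_left (b - a)).add
    (((kummerM_hasSum a hb x).mul_left (2 * a - b)).add (kummerM_hasSum_mul a hb x))).sub
    ((kummerM_hasSum (a + 1) hb x).mul_left a)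
  have h' : HasSum (fun k => ((b - a) * kummerCoeff (a - 1) b k + ((2 * a - b) * kummerCoeff a b k
      + (Nat.casesOn k 0 (kummerCoeff a b) : ℂ)) - a * kummerCoeff (a + 1) b k) * (x : ℂ) ^ k)
      ((b - a) * kummerM (a - 1) b x + ((2 * a - b) * kummerM a b x + x * kummerM a b x)
      - a * kummerM (a + 1) b x) :=
    hasSum_of_eq h fun k => by ring
  have h0 := eq_zero_of_hasSum_coeff h' fun k => ?_
  · linear_combination h0
  · cases k with
    | zero => simp [kummerCoeff, rising_zero]; ring
    | succ k =>
      have hr := rising_ne_zero hb k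
      have hk := hb k
      have h2 : ((k : ℂ) + 1) ≠ 0 := by exact_mod_cast Nat.succ_ne_zero k
      have h3 : (k.factorial : ℂ) ≠ 0 := by exact_mod_cast k.factorial_ne_zero
      have e1 : rising (a - 1) (k + 1) = (a - 1) * rising a k := by
        rw [rising_succ_left, sub_add_cancel]
      have e2 : a * rising (a + 1) (k + 1) = rising a k * (a + k) * (a + k + 1) := by
        rw [← rising_succ_left, rising_succ, rising_succ]
        push_cast
        ring
      -- The factor `a` stays on the left: solving for the coefficient of `M(a+1, b, x)` would
      -- require `a ≠ 0`.
      have e3 : a * kummerCoeff (a + 1) b (k + 1) = rising a k * (a + k) * (a + k + 1) /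
          (rising b k * (b + k)) / ((k + 1) * k.factorial) := by
        rw [kummerCoeff, rising_succ b, Nat.factorial_succ, ← mul_div_assoc, ← mul_div_assoc, e2]
        push_cast
        ring
      rw [e3]
      simp only [kummerCoeff, e1, rising_succ a, rising_succ b, Nat.factorial_succ]
      push_cast
      field_simp
      ring

theorem kummerM_contiguous_b_sub (a : ℂ) {b : ℂ} (hb : ∀ k : ℕ, b - 1 + k ≠ 0) (x : ℝ) :
    (1 - b) * kummerM a (b - 1) x = (a - b + 1) * kummerM a b x - a * kummerM (a + 1) b x := by
  have hb' : ∀ k : ℕ, b + k ≠ 0 := by simpa using add_one_add_ne_zero hb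
  have h := (((kummerM_hasSum a hb x).mul_left (1 - b)).sub
    ((kummerM_hasSum a hb' x).mul_left (a - b + 1))).add
    ((kummerM_hasSum (a + 1) hb' x).mul_left a)
  have h' : HasSum (fun k => ((1 - b) * kummerCoeff a (b - 1) k - (a - b + 1) * kummerCoeff a b k
      + a * kummerCoeff (a + 1) b k) * (x : ℂ) ^ k)
      ((1 - b) * kummerM a (b - 1) x - (a - b + 1) * kummerM a b x + a * kummerM (a + 1) b x) :=
    hasSum_of_eq h fun k => by ring
  have h0 := eq_zero_of_hasSum_coeff h' fun k => ?_
  · linear_combination h0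
  · have hr := rising_ne_zero hb' k
    have hr' := rising_ne_zero hb k
    have h3 : (k.factorial : ℂ) ≠ 0 := by exact_mod_cast k.factorial_ne_zero
    have e1 : (b - 1) * rising b k = rising (b - 1) k * (b - 1 + k) := by
      rw [← rising_succ, rising_succ_left, sub_add_cancel]
    have e2 : a * rising (a + 1) k = rising a k * (a + k) := by
      rw [← rising_succ_left, rising_succ]
    simp only [kummerCoeff]
    field_simp
    linear_combination (- rising a k) * e1 + rising (b - 1) k * e2

theorem kummerM_contiguous_b_add (a : ℂ) {b : ℂ} (hb : ∀ k : ℕ, b + k ≠ 0) (x : ℝ) :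
    b * (kummerM (a + 1) b x - kummerM a b x) = x * kummerM (a + 1) (b + 1) x := by
  have h := (((kummerM_hasSum (a + 1) hb x).sub (kummerM_hasSum a hb x)).mul_left b).sub
    (kummerM_hasSum_mul (a + 1) (add_one_add_ne_zero hb) x)
  have h' : HasSum (fun k => (b * (kummerCoeff (a + 1) b k - kummerCoeff a b k)
      - (Nat.casesOn k 0 (kummerCoeff (a + 1) (b + 1)) : ℂ)) * (x : ℂ) ^ k)
      (b * (kummerM (a + 1) b x - kummerM a b x) - x * kummerM (a + 1) (b + 1) x) :=
    hasSum_of_eq h fun k => by ring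
  have h0 := eq_zero_of_hasSum_coeff h' fun k => ?_
  · linear_combination h0
  · cases k with
    | zero => simp [kummerCoeff, rising_zero]
    | succ k =>
      have h0 : b ≠ 0 := by simpa using hb 0
      have hr := rising_ne_zero (add_one_add_ne_zero hb) k
      have h2 : ((k : ℂ) + 1) ≠ 0 := by exact_mod_cast Nat.succ_ne_zero k
      have h3 : (k.factorial : ℂ) ≠ 0 := by exact_mod_cast k.factorial_ne_zero
      simp only [kummerCoeff, rising_succ_left a, rising_succ (a + 1), rising_succ_left b,
        Nat.factorial_succ]
      push_cast
      field_simp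
      ring

/-- The two preceding relations combine so that `x M'` is expressed by undifferentiated functions,
one of them with `b` lowered. Kummer's equation and the derivative of `h̃` both rest on this. -/
theorem kummerM_contiguous_deriv (a : ℂ) {b : ℂ} (hb : ∀ k : ℕ, b - 1 + k ≠ 0) (x : ℝ) :
    (b - 1) * kummerM a b x + x * (a / b * kummerM (a + 1) (b + 1) x) =
      (b - 1) * kummerM a (b - 1) x := by
  have hb' : ∀ k : ℕ, b + k ≠ 0 := by simpa using add_one_add_ne_zero hb
  have h0 : b ≠ 0 := by simpa using hb' 0
  have h1 := kummerM_contiguous_b_sub a hb x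
  have h2 := kummerM_contiguous_b_add a hb' x
  field_simp
  linear_combination b * h1 - a * h2

/-- Kummer's differential equation. -/
theorem kummerM_ode (a : ℂ) {b : ℂ} (hb : ∀ k : ℕ, b + k ≠ 0) (x : ℝ) :
    (x : ℂ) * deriv (deriv (kummerM a b)) x + (b - x) * deriv (kummerM a b) x
      - a * kummerM a b x = 0 := by
  have hb1 := add_one_add_ne_zero hb
  have h0 : b ≠ 0 := by simpa using hb 0
  have h1 : b + 1 ≠ 0 := by simpa using hb1 0
  have hd : deriv (kummerM a b) = fun x => a / b * kummerM (a + 1) (b + 1) x := by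
    ext x
    exact (kummerM_hasDerivAt a hb x).deriv
  rw [hd, ((kummerM_hasDerivAt (a + 1) hb1 x).const_mul (a / b)).deriv]
  have e1 := kummerM_contiguous_deriv (a + 1) (b := b + 1) (by simpa using hb) x
  have e2 := kummerM_contiguous_b_add a hb x
  simp only [add_sub_cancel_right] at e1
  field_simp at e1 ⊢
  linear_combination a * e1 + a * (b + 1) * e2


/-! ### Second order linear equations on the half line -/

/-- `y` solves `y'' + Q y' + R y = 0` on `(0, ∞)` and has derivative `y'`. -/
def LinSol (Q R y y' : ℝ → ℂ) : Prop :=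
  ∀ x : ℝ, 0 < x → HasDerivAt y (y' x) x ∧ HasDerivAt y' (-(Q x * y' x + R x * y x)) x

theorem const_of_hasDerivAt_zero {g : ℝ → ℂ} (h : ∀ x : ℝ, 0 < x → HasDerivAt g 0 x) :
    ∃ c, ∀ x : ℝ, 0 < x → g x = c := by
  refine ⟨g 1, fun x hx => ?_⟩
  refine isOpen_Ioi.is_const_of_deriv_eq_zero (isPreconnected_Ioi (a := (0 : ℝ))) (f := g) ?_ ?_ hx
    (mem_Ioi.2 one_pos)
  · exact fun y hy => (h y hy).differentiableAt.differentiableWithinAt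
  · exact fun y hy => (h y hy).deriv

/-- Abel's identity. -/
theorem LinSol.abel {Q R u u' v v' p : ℝ → ℂ} (hu : LinSol Q R u u') (hv : LinSol Q R v v')
    (hp : ∀ x : ℝ, 0 < x → HasDerivAt p (p x * Q x) x) :
    ∃ c, ∀ x : ℝ, 0 < x → p x * (u x * v' x - u' x * v x) = c := by
  refine const_of_hasDerivAt_zero fun x hx => ?_
  have h := (hp x hx).mul (((hu x hx).1.mul (hv x hx).2).sub ((hu x hx).2.mul (hv x hx).1))
  refine h.congr_deriv ?_
  simp only [Pi.mul_apply, Pi.sub_apply]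
  ring

/-- Cramer's rule: `y W(u,v) = u W(y,v) - v W(y,u)`, and by Abel's identity all three Wronskians
become constant after multiplication by `p`. -/
theorem LinSol.eq_of_wronskian {Q R u u' v v' y y' p : ℝ → ℂ} (hu : LinSol Q R u u')
    (hv : LinSol Q R v v') (hy : LinSol Q R y y')
    (hp : ∀ x : ℝ, 0 < x → HasDerivAt p (p x * Q x) x) {c : ℂ} (hc : c ≠ 0)
    (huv : ∀ x : ℝ, 0 < x → p x * (u x * v' x - u' x * v x) = c) :
    ∃ c₁ c₂ : ℂ, ∀ x : ℝ, 0 < x → y x = c₁ * u x + c₂ * v x := by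
  obtain ⟨A, hA⟩ := hy.abel hu hp
  obtain ⟨B, hB⟩ := hy.abel hv hp
  refine ⟨B / c, -A / c, fun x hx => ?_⟩
  have h1 := hA x hx
  have h2 := hB x hx
  have h3 := huv x hx
  field_simp
  rw [← h1, ← h2, ← h3]
  ring

/-- If the solution `χ` grows at most polynomially together with its derivative and the means of
the solution `f` over unit intervals are `O(X^N e^(X/2))`, then the Wronskian of `f` and `χ`
vanishes. -/
theorem wronskian_eq_zero_of_growth {f f' χ χ' : ℝ → ℂ} {p : ℝ → ℝ} {c : ℂ} {C : ℝ} {N : ℕ}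
    {X₀ : ℝ} (hX₀ : 1 ≤ X₀)
    (hf : ∀ x : ℝ, 0 < x → HasDerivAt f (f' x) x)
    (hχ : ∀ x : ℝ, 0 < x → HasDerivAt χ (χ' x) x) (hχ' : ContinuousOn χ' (Ioi 0))
    (hp : ∀ x, 0 < x → 0 < p x) (hpc : ContinuousOn p (Ioi 0))
    (hW : ∀ x : ℝ, 0 < x → (p x : ℂ) * (f x * χ' x - f' x * χ x) = c)
    (bχ : ∀ x, X₀ ≤ x → ‖χ x‖ ≤ C * x ^ N) (bχ' : ∀ x, X₀ ≤ x → ‖χ' x‖ ≤ C * x ^ N)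
    (bp : ∀ x, X₀ ≤ x → p x ≤ C * x ^ N * Real.exp (-x))
    (bf : ∀ X, X₀ ≤ X → ∫ x in X..X + 1, ‖f x‖ ≤ C * X ^ N * Real.exp (X / 2)) : c = 0 := by
  have hC : 0 ≤ C := by
    by_contra h
    have := (norm_nonneg _).trans (bχ X₀ le_rfl)
    have h2 : 0 < X₀ ^ N := by positivity
    nlinarith
  have main : ∀ X, X₀ ≤ X →
      ‖c‖ ≤ 18 * C ^ 3 * ((X + 1) ^ (3 * N) * Real.exp (-(X / 2))) := by
    intro X hX
    have hX0 : 0 < X := by linarith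
    -- The test function `φ` vanishes at both ends of `[X, X+1]`. Substituting `f' χ = f χ' - c/p`
    -- in `(φ f χ)'` removes `f'`, about which nothing is known, and integration leaves `c ∫ φ/p = ∫
    -- E` with `E = φ' f χ + 2 φ f χ'`. The left side is of order at least `|c| e^X`, the right side
    -- at most `e^(X/2)`, up to powers of `X`.
    set φ : ℝ → ℝ := fun x => (x - X) * (X + 1 - x) with hφ
    have hpos : ∀ x ∈ uIcc X (X + 1), 0 < x := by
      intro x hx
      rw [uIcc_of_le (by linarith)] at hx
      linarith [hx.1]
    have hsub : uIcc X (X + 1) ⊆ Ioi 0 := hpos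
    have cf : ContinuousOn f (uIcc X (X + 1)) := fun x hx =>
      (hf x (hpos x hx)).continuousAt.continuousWithinAt
    have cχ : ContinuousOn χ (uIcc X (X + 1)) := fun x hx =>
      (hχ x (hpos x hx)).continuousAt.continuousWithinAt
    have cφ : Continuous φ := by fun_prop
    have cφ' : Continuous fun x => ((φ x : ℝ) : ℂ) := Complex.continuous_ofReal.comp cφ
    have cp : ContinuousOn (fun x => φ x / p x) (uIcc X (X + 1)) :=
      cφ.continuousOn.div (hpc.mono hsub) fun x hx => (hp x (hpos x hx)).ne'
    have cpC : ContinuousOn (fun x => (φ x : ℂ) / (p x : ℂ)) (uIcc X (X + 1)) := by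
      have := Complex.continuous_ofReal.comp_continuousOn cp
      refine this.congr fun x _ => ?_
      simp
    set E : ℝ → ℂ := fun x => ((2 * X + 1 - 2 * x : ℝ) : ℂ) * (f x * χ x) +
      2 * φ x * (f x * χ' x) with hE
    have cE : ContinuousOn E (uIcc X (X + 1)) := by
      refine ((Complex.continuous_ofReal.comp (by fun_prop)).continuousOn.mul (cf.mul cχ)).add
        (((continuous_const.mul cφ').continuousOn).mul (cf.mul (hχ'.mono hsub)))
    have hG : ∀ x ∈ uIcc X (X + 1), HasDerivAt (fun x => (φ x : ℂ) * (f x * χ x))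
        (E x - c * (φ x / p x)) x := by
      intro x hx
      have h0 := hpos x hx
      have d1 : HasDerivAt φ (2 * X + 1 - 2 * x) x := by
        have := ((hasDerivAt_id x).sub_const X).mul ((hasDerivAt_id x).const_sub (X + 1))
        refine this.congr_deriv ?_
        simp
        ring
      have d := d1.ofReal_comp.mul ((hf x h0).mul (hχ x h0))
      refine d.congr_deriv ?_
      have hpx : (p x : ℂ) ≠ 0 := by exact_mod_cast (hp x h0).ne'
      rw [← hW x h0, hE]
      simp only [Pi.mul_apply]
      field_simp
      ring
    have iE : IntervalIntegrable E volume X (X + 1) := cE.intervalIntegrable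
    have iP : IntervalIntegrable (fun x => c * ((φ x : ℂ) / p x)) volume X (X + 1) :=
      (continuousOn_const.mul cpC).intervalIntegrable
    have hint := intervalIntegral.integral_eq_sub_of_hasDerivAt hG (iE.sub iP)
    rw [intervalIntegral.integral_sub iE iP, intervalIntegral.integral_const_mul] at hint
    have hz : (fun x => (φ x : ℂ) * (f x * χ x)) (X + 1) - (fun x => (φ x : ℂ) * (f x * χ x)) X
        = 0 := by simp [hφ]
    rw [hz] at hint
    have hcast : ∫ x in X..X + 1, ((φ x : ℂ) / p x) = ((∫ x in X..X + 1, φ x / p x : ℝ) : ℂ) := by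
      rw [← intervalIntegral.integral_ofReal]
      simp
    rw [hcast] at hint
    have hle : X ≤ X + 1 := by linarith
    -- lower bound
    have hCpos : 0 < C := by
      rcases hC.lt_or_eq with h | h
      · exact h
      · have h1 := bp X hX
        have h2 := hp X hX0
        rw [← h] at h1
        simp at h1
        linarith
    set D : ℝ := C * (X + 1) ^ N
    have hD : 0 < D := by positivity
    -- On the interval `1/p ≥ e^X / D`, and the integral of `φ` is `1/6`.
    have lower : (1 / 6) * (Real.exp X / D) ≤ ∫ x in X..X + 1, φ x / p x := by
      have h6 : ∫ x in X..X + 1, φ x * (Real.exp X / D) = (1 / 6) * (Real.exp X / D) := by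
        rw [intervalIntegral.integral_mul_const]
        congr 1
        have : ∀ x ∈ uIcc X (X + 1), HasDerivAt
            (fun x => (x - X) ^ 2 / 2 - (x - X) ^ 3 / 3) (φ x) x := by
          intro x _
          have h1 := (hasDerivAt_id x).sub_const X
          have := ((h1.pow 2).div_const 2).sub ((h1.pow 3).div_const 3)
          refine this.congr_deriv ?_
          simp [hφ]
          ring
        rw [intervalIntegral.integral_eq_sub_of_hasDerivAt this (cφ.intervalIntegrable _ _)]
        ring
      rw [← h6]
      refine intervalIntegral.integral_mono_on hle
        ((cφ.mul continuous_const).intervalIntegrable _ _) cp.intervalIntegrable fun x hx => ?_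
      have hx0 : 0 < x := by linarith [hx.1]
      have hφ0 : 0 ≤ φ x := mul_nonneg (by linarith [hx.1]) (by linarith [hx.2])
      rw [div_eq_mul_inv (φ x)]
      refine mul_le_mul_of_nonneg_left ?_ hφ0
      rw [le_inv_comm₀ (by positivity) (hp x hx0), inv_div, div_eq_mul_inv, ← Real.exp_neg]
      refine (bp x (hX.trans hx.1)).trans ?_
      have hb : x ^ N ≤ (X + 1) ^ N := pow_le_pow_left₀ hx0.le hx.2 N
      have he : Real.exp (-x) ≤ Real.exp (-X) := Real.exp_le_exp.2 (neg_le_neg hx.1)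
      gcongr
      exact mul_le_mul_of_nonneg_left hb hC
    have upper : ‖∫ x in X..X + 1, E x‖ ≤ 3 * D * (C * X ^ N * Real.exp (X / 2)) := by
      calc ‖∫ x in X..X + 1, E x‖ ≤ ∫ x in X..X + 1, ‖E x‖ :=
            intervalIntegral.norm_integral_le_integral_norm hle
        _ ≤ ∫ x in X..X + 1, 3 * D * ‖f x‖ := by
            refine intervalIntegral.integral_mono_on hle cE.norm.intervalIntegrable
              (continuousOn_const.mul cf.norm).intervalIntegrable fun x hx => ?_
            have hx0 : 0 < x := by linarith [hx.1]
            have hb : C * x ^ N ≤ D :=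
              mul_le_mul_of_nonneg_left (pow_le_pow_left₀ hx0.le hx.2 N) hC
            have h1 := (bχ x (hX.trans hx.1)).trans hb
            have h2 := (bχ' x (hX.trans hx.1)).trans hb
            have h3 : |2 * X + 1 - 2 * x| ≤ 1 := abs_le.2 ⟨by linarith [hx.2], by linarith [hx.1]⟩
            have h4 : |φ x| ≤ 1 := by
              have a1 := hx.1
              have a2 := hx.2
              rw [abs_le]
              constructor <;> simp only [hφ] <;> nlinarith
            calc ‖E x‖ ≤ |2 * X + 1 - 2 * x| * (‖f x‖ * ‖χ x‖) + 2 * |φ x| * (‖f x‖ * ‖χ' x‖) := by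
                  refine (norm_add_le _ _).trans_eq ?_
                  simp only [norm_mul, Complex.norm_real, Real.norm_eq_abs, Complex.norm_ofNat]
              _ ≤ 1 * (‖f x‖ * D) + 2 * 1 * (‖f x‖ * D) := by gcongr
              _ = _ := by ring
        _ = 3 * D * ∫ x in X..X + 1, ‖f x‖ := intervalIntegral.integral_const_mul _ _
        _ ≤ _ := by
            gcongr
            exact bf X hX
    have heq : c * ((∫ x in X..X + 1, φ x / p x : ℝ) : ℂ) = ∫ x in X..X + 1, E x := by
      linear_combination -hint
    have hn : ‖c‖ * ((1 / 6) * (Real.exp X / D)) ≤ 3 * D * (C * X ^ N * Real.exp (X / 2)) := by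
      refine le_trans ?_ upper
      rw [← heq, norm_mul, Complex.norm_real]
      gcongr
      exact lower.trans (le_abs_self _)
    have hee : Real.exp X = Real.exp (X / 2) * Real.exp (X / 2) := by
      rw [← Real.exp_add]
      ring_nf
    have hen : Real.exp (-(X / 2)) * Real.exp (X / 2) = 1 := by
      rw [← Real.exp_add]
      simp
    have hXN : X ^ N ≤ (X + 1) ^ N := by gcongr
    have e1 : ‖c‖ * Real.exp (X / 2) ≤ 18 * D ^ 2 * (C * X ^ N) := by
      have h5 := mul_le_mul_of_nonneg_right hn (by positivity : 0 ≤ 6 * D * Real.exp (-(X / 2)))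
      have l : ‖c‖ * ((1 / 6) * (Real.exp X / D)) * (6 * D * Real.exp (-(X / 2))) =
          ‖c‖ * Real.exp (X / 2) := by
        rw [hee]
        field_simp
        linear_combination ‖c‖ * hen
      have r : 3 * D * (C * X ^ N * Real.exp (X / 2)) * (6 * D * Real.exp (-(X / 2))) =
          18 * D ^ 2 * (C * X ^ N) := by
        linear_combination (18 * D ^ 2 * C * X ^ N) * hen
      rwa [l, r] at h5
    calc ‖c‖ = ‖c‖ * Real.exp (X / 2) * Real.exp (-(X / 2)) := by
          linear_combination (-‖c‖) * hen
      _ ≤ 18 * D ^ 2 * (C * X ^ N) * Real.exp (-(X / 2)) := by gcongr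
      _ ≤ 18 * D ^ 2 * (C * (X + 1) ^ N) * Real.exp (-(X / 2)) := by gcongr
      _ = _ := by
          simp only [D]
          ring
  have hlim : Tendsto (fun X : ℝ => 18 * C ^ 3 * ((X + 1) ^ (3 * N) * Real.exp (-(X / 2)))) atTop
      (𝓝 0) := by
    have h1 := (Real.tendsto_pow_mul_exp_neg_atTop_nhds_zero (3 * N)).comp
      ((tendsto_atTop_add_const_right _ (1 : ℝ) tendsto_id).atTop_div_const (r := 2) (by norm_num))
    have h2 := h1.const_mul (18 * C ^ 3 * 2 ^ (3 * N) * Real.exp (1 / 2))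
    rw [mul_zero] at h2
    refine h2.congr fun X => ?_
    have : Real.exp (-(X / 2)) = Real.exp (1 / 2) * Real.exp (-((X + 1) / 2)) := by
      rw [← Real.exp_add]
      ring_nf
    simp only [Function.comp, id, this, div_pow]
    field_simp
  have h0 : ‖c‖ ≤ 0 := ge_of_tendsto hlim (by
    filter_upwards [eventually_ge_atTop X₀] with X hX using main X hX)
  simpa using h0


/-! ### The classical Laguerre equation -/

/-- `α` is not an integer. -/
def NonInt (α : ℝ) : Prop := ∀ k : ℤ, α ≠ k

theorem NonInt.add_int {α : ℝ} (h : NonInt α) (m : ℤ) : NonInt (α + m) := fun k hk =>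
  h (k - m) (by push_cast; linarith)

theorem NonInt.add_one {α : ℝ} (h : NonInt α) : NonInt (α + 1) := by simpa using h.add_int 1

theorem NonInt.sub_one {α : ℝ} (h : NonInt α) : NonInt (α - 1) := by
  simpa [sub_eq_add_neg] using h.add_int (-1)

theorem NonInt.neg {α : ℝ} (h : NonInt α) : NonInt (-α) := fun k hk =>
  h (-k) (by push_cast; linarith)

theorem NonInt.add_ne {α : ℝ} (h : NonInt α) (m : ℤ) : (α : ℂ) + m ≠ 0 := by
  intro h0
  refine h (-m) ?_
  have : ((α + m : ℝ) : ℂ) = 0 := by push_cast; exact h0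
  have := Complex.ofReal_eq_zero.1 this
  push_cast
  linarith

theorem NonInt.ne_zero {α : ℝ} (h : NonInt α) : (α : ℂ) ≠ 0 := by simpa using h.add_ne 0

theorem NonInt.sub_ne {α : ℝ} (h : NonInt α) (m : ℤ) : (m : ℂ) - α ≠ 0 := by
  have := h.add_ne (-m)
  push_cast at this
  intro h0
  exact this (by linear_combination -h0)

theorem NonInt.first {α : ℝ} (h : NonInt α) (k : ℕ) : (α : ℂ) + 1 + k ≠ 0 := by
  have := h.add_ne (1 + k)
  push_cast at this
  rwa [add_assoc]

theorem NonInt.second {α : ℝ} (h : NonInt α) (k : ℕ) : 1 - (α : ℂ) + k ≠ 0 := by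
  have := h.sub_ne (1 + k)
  push_cast at this
  intro h0
  exact this (by linear_combination h0)

/-- `x y'' + (α + 1 - x) y' + lam y = 0` at the point `x`. -/
def KEq (α : ℝ) (lam : ℂ) (y : ℝ → ℂ) (x : ℝ) : Prop :=
  (x : ℂ) * deriv (deriv y) x + (α + 1 - x) * deriv y x + lam * y x = 0

theorem hasDerivAt_rpow_ofReal (s : ℝ) {x : ℝ} (hx : 0 < x) :
    HasDerivAt (fun x : ℝ => ((x ^ s : ℝ) : ℂ)) (s * ((x ^ (s - 1) : ℝ) : ℂ)) x := by
  have := (Real.hasDerivAt_rpow_const (p := s) (Or.inl hx.ne')).ofReal_comp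
  push_cast at this
  exact this

theorem rpow_mul_self_ofReal (s : ℝ) {x : ℝ} (hx : 0 < x) :
    ((x ^ (s - 1) : ℝ) : ℂ) * x = ((x ^ s : ℝ) : ℂ) := by
  rw [← Complex.ofReal_mul, Real.rpow_sub_one hx.ne']
  field_simp

/-- Differentiation sends both `h` and `h̃` to the parameters `(α+1, λ-1)`. The factors differ, but
the Gamma factors of `triF` absorb the difference. -/
theorem hFun_hasDerivAt {α : ℝ} (hα : NonInt α) (lam : ℂ) (x : ℝ) :
    HasDerivAt (hFun α lam) (-lam / (α + 1) * hFun (α + 1) (lam - 1) x) x := by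
  have := kummerM_hasDerivAt (-lam) hα.first x
  unfold hFun
  convert this using 3
  · ring
  · push_cast
    rfl

theorem hTilde_hasDerivAt {α : ℝ} (hα : NonInt α) (lam : ℂ) {x : ℝ} (hx : 0 < x) :
    HasDerivAt (hTilde α lam) (-α * hTilde (α + 1) (lam - 1) x) x := by
  have h1 := (hasDerivAt_rpow_ofReal (-α) hx).mul
    (kummerM_hasDerivAt (-lam - α) hα.second x)
  refine h1.congr_deriv ?_
  have h2 := kummerM_contiguous_deriv (-lam - α) (b := 1 - α)
    (fun k => by
      have := hα.sub_ne k
      push_cast at this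
      convert this using 1
      ring) x
  have e : ((x ^ (-α) : ℝ) : ℂ) = ((x ^ (-α - 1) : ℝ) : ℂ) * x := (rpow_mul_self_ofReal _ hx).symm
  have e1 : -(α + 1) = -α - 1 := by ring
  have e2 : -(lam - 1) - ((α + 1 : ℝ) : ℂ) = -lam - α := by push_cast; ring
  have e3 : (1 : ℂ) - ((α + 1 : ℝ) : ℂ) = 1 - α - 1 := by push_cast; ring
  rw [hTilde, e1, e2, e3, e]
  push_cast
  linear_combination ((x ^ (-α - 1) : ℝ) : ℂ) * h2

/-- The coefficient of `y'` in the classical equation, divided by `x`. -/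
noncomputable def clQ (α : ℝ) (x : ℝ) : ℂ := (α + 1 - x) / x

/-- The coefficient of `y` in the classical equation, divided by `x`. -/
noncomputable def clR (lam : ℂ) (x : ℝ) : ℂ := lam / x

theorem deriv_deriv_of_hasDerivAt {f f' : ℝ → ℂ} {f'' : ℂ} {x : ℝ}
    (h : ∀ᶠ y in 𝓝 x, HasDerivAt f (f' y) y) (h' : HasDerivAt f' f'' x) :
    deriv (deriv f) x = f'' := by
  have : deriv f =ᶠ[𝓝 x] f' := h.mono fun y hy => hy.deriv
  rw [this.deriv_eq, h'.deriv]

theorem AnalyticAt.eventually_hasDerivAt' {g : ℝ → ℂ} {x : ℝ} (hg : AnalyticAt ℝ g x) :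
    ∀ᶠ y in 𝓝 x, HasDerivAt g (deriv g y) y :=
  hg.eventually_analyticAt.mono fun _ hy => hy.differentiableAt.hasDerivAt

/-- The substitution `y = x^(-α) g`. -/
theorem KEq.rpow_mul {α : ℝ} {lam : ℂ} {g : ℝ → ℂ} {x : ℝ} (hx : 0 < x) (hg : AnalyticAt ℝ g x)
    (h : KEq (-α) (lam + α) g x) : KEq α lam (fun x => ((x ^ (-α) : ℝ) : ℂ) * g x) x := by
  have hx' : (x : ℂ) ≠ 0 := by exact_mod_cast hx.ne'
  have h1 : ∀ᶠ y in 𝓝 x, HasDerivAt (fun x => ((x ^ (-α) : ℝ) : ℂ) * g x)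
      (((-α : ℝ) : ℂ) * ((y ^ (-α - 1) : ℝ) : ℂ) * g y + ((y ^ (-α) : ℝ) : ℂ) * deriv g y) y := by
    filter_upwards [AnalyticAt.eventually_hasDerivAt' hg, Ioi_mem_nhds hx] with y hy hy0
    exact (hasDerivAt_rpow_ofReal (-α) hy0).mul hy
  have h2 := (((hasDerivAt_rpow_ofReal (-α - 1) hx).const_mul ((-α : ℝ) : ℂ)).mul
    hg.differentiableAt.hasDerivAt).add
    ((hasDerivAt_rpow_ofReal (-α) hx).mul hg.deriv.differentiableAt.hasDerivAt)
  have h3 := deriv_deriv_of_hasDerivAt h1 h2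
  have e : ((x ^ (-α) : ℝ) : ℂ) = ((x ^ (-α - 1) : ℝ) : ℂ) * x := (rpow_mul_self_ofReal _ hx).symm
  have e' : ((x ^ (-α - 1) : ℝ) : ℂ) = ((x ^ (-α - 1 - 1) : ℝ) : ℂ) * x :=
    (rpow_mul_self_ofReal _ hx).symm
  simp only [KEq] at h ⊢
  rw [h3, h1.self_of_nhds.deriv, e, e']
  push_cast at h ⊢
  linear_combination ((x ^ (-α - 1 - 1) : ℝ) : ℂ) * x ^ 2 * h

/-- The substitution `y(x) = e^x g(-x)`. -/
theorem KEq.exp_mul {α : ℝ} {lam : ℂ} {g : ℝ → ℂ} {x : ℝ} (hg : AnalyticAt ℝ g (-x))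
    (h : KEq α lam g (-x)) : KEq α (-α - 1 - lam) (fun x => (Real.exp x : ℂ) * g (-x)) x := by
  have hexp : ∀ y : ℝ, HasDerivAt (fun y : ℝ => (Real.exp y : ℂ)) (Real.exp y : ℂ) y := fun y =>
    (Real.hasDerivAt_exp y).ofReal_comp
  have hneg : ∀ᶠ y in 𝓝 x, HasDerivAt g (deriv g (-y)) (-y) :=
    (continuous_neg.tendsto x).eventually (AnalyticAt.eventually_hasDerivAt' hg)
  have hcomp : ∀ (k k' : ℝ → ℂ) (y : ℝ), HasDerivAt k (k' (-y)) (-y) →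
      HasDerivAt (fun y => k (-y)) (-k' (-y)) y := fun k k' y hk => by
    have := hk.scomp y (hasDerivAt_neg y)
    simpa using! this
  have h1 : ∀ᶠ y in 𝓝 x, HasDerivAt (fun x => (Real.exp x : ℂ) * g (-x))
      ((Real.exp y : ℂ) * g (-y) + (Real.exp y : ℂ) * -deriv g (-y)) y := by
    filter_upwards [hneg] with y hy
    exact (hexp y).mul (hcomp g (deriv g) y hy)
  have h2 := ((hexp x).mul (hcomp g (deriv g) x hg.differentiableAt.hasDerivAt)).add
    ((hexp x).mul (hcomp (deriv g) (deriv (deriv g)) x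
      hg.deriv.differentiableAt.hasDerivAt).neg)
  have h3 := deriv_deriv_of_hasDerivAt h1 h2
  simp only [KEq] at h ⊢
  rw [h3, h1.self_of_nhds.deriv]
  simp only [Pi.neg_apply]
  push_cast at h ⊢
  linear_combination (-Complex.exp x) * h

theorem kummerM_kEq {α : ℝ} (hα : NonInt α) (lam : ℂ) (x : ℝ) : KEq α lam (hFun α lam) x := by
  have h3 : (x : ℂ) * deriv (deriv (hFun α lam)) x + (α + 1 - x) * deriv (hFun α lam) x
      - (-lam) * hFun α lam x = 0 := kummerM_ode (-lam) hα.first x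
  simp only [KEq]
  linear_combination h3

theorem hFun_analyticAt {α : ℝ} (hα : NonInt α) (lam : ℂ) (x : ℝ) :
    AnalyticAt ℝ (hFun α lam) x := kummerM_analyticAt _ hα.first x

/-- Facts about the second kind are reduced by this to the first kind with parameters `-α` and
`λ+α`, through `KEq.rpow_mul`. -/
theorem hTilde_eq (α : ℝ) (lam : ℂ) :
    hTilde α lam = fun x => ((x ^ (-α) : ℝ) : ℂ) * hFun (-α) (lam + α) x := by
  ext x
  simp only [hTilde, hFun]
  congr 2
  · ring
  · push_cast
    ring

theorem rpow_analyticAt (s : ℝ) {x : ℝ} (hx : 0 < x) :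
    AnalyticAt ℝ (fun x : ℝ => ((x ^ s : ℝ) : ℂ)) x :=
  AnalyticAt.fun_comp (g := fun x : ℝ => (x : ℂ)) (Complex.ofRealCLM.analyticAt _)
    (Real.contDiffAt_rpow_const_of_ne (p := s) (n := ⊤) hx.ne').analyticAt

theorem hTilde_analyticAt {α : ℝ} (hα : NonInt α) (lam : ℂ) {x : ℝ} (hx : 0 < x) :
    AnalyticAt ℝ (hTilde α lam) x := by
  rw [hTilde_eq]
  exact (rpow_analyticAt _ hx).mul (hFun_analyticAt hα.neg _ x)

theorem hTilde_kEq {α : ℝ} (hα : NonInt α) (lam : ℂ) {x : ℝ} (hx : 0 < x) :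
    KEq α lam (hTilde α lam) x := by
  rw [hTilde_eq]
  exact KEq.rpow_mul hx (hFun_analyticAt hα.neg _ x) (kummerM_kEq hα.neg _ x)

theorem KEq.linSol {α : ℝ} {lam : ℂ} {y : ℝ → ℂ} (h : ∀ x : ℝ, 0 < x → KEq α lam y x)
    (h1 : ∀ x : ℝ, 0 < x → DifferentiableAt ℝ y x)
    (h2 : ∀ x : ℝ, 0 < x → DifferentiableAt ℝ (deriv y) x) :
    LinSol (clQ α) (clR lam) y (deriv y) := by
  intro x hx
  refine ⟨(h1 x hx).hasDerivAt, (h2 x hx).hasDerivAt.congr_deriv ?_⟩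
  have h3 := h x hx
  have hx' : (x : ℂ) ≠ 0 := by exact_mod_cast hx.ne'
  simp only [clQ, clR, KEq] at h3 ⊢
  field_simp
  linear_combination h3

theorem hFun_linSol {α : ℝ} (hα : NonInt α) (lam : ℂ) :
    LinSol (clQ α) (clR lam) (hFun α lam) (deriv (hFun α lam)) :=
  KEq.linSol (fun x _ => kummerM_kEq hα lam x)
    (fun x _ => (hFun_analyticAt hα lam x).differentiableAt)
    (fun x _ => (hFun_analyticAt hα lam x).deriv.differentiableAt)

theorem hTilde_linSol {α : ℝ} (hα : NonInt α) (lam : ℂ) :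
    LinSol (clQ α) (clR lam) (hTilde α lam) (deriv (hTilde α lam)) :=
  KEq.linSol (fun _ hx => hTilde_kEq hα lam hx)
    (fun _ hx => (hTilde_analyticAt hα lam hx).differentiableAt)
    (fun _ hx => (hTilde_analyticAt hα lam hx).deriv.differentiableAt)

/-- The factor `p = x^(α+1) e^(-x)` of Abel's identity. -/
noncomputable def clP (α x : ℝ) : ℝ := x ^ (α + 1) * Real.exp (-x)

theorem clP_pos (α : ℝ) {x : ℝ} (hx : 0 < x) : 0 < clP α x := by
  unfold clP
  positivity

theorem clP_continuousOn (α : ℝ) : ContinuousOn (clP α) (Ioi 0) := by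
  intro x hx
  have : ContinuousAt (fun x : ℝ => x ^ (α + 1)) x :=
    Real.continuousAt_rpow_const x _ (Or.inl (ne_of_gt hx))
  exact (this.mul (by fun_prop)).continuousWithinAt

theorem clP_hasDerivAt (α : ℝ) {x : ℝ} (hx : 0 < x) :
    HasDerivAt (fun x => (clP α x : ℂ)) (clP α x * clQ α x) x := by
  have h1 := (hasDerivAt_rpow_ofReal (α + 1) hx).mul ((hasDerivAt_neg x).exp.ofReal_comp)
  have h2 : (fun x => (clP α x : ℂ)) =
      (fun x : ℝ => ((x ^ (α + 1) : ℝ) : ℂ)) * fun x : ℝ => ((Real.exp (-x) : ℝ) : ℂ) := by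
    ext x
    simp [clP]
  rw [h2]
  refine h1.congr_deriv ?_
  have e := rpow_mul_self_ofReal (α + 1) hx
  have hx' : (x : ℂ) ≠ 0 := by exact_mod_cast hx.ne'
  simp only [clP, clQ]
  rw [← mul_div_assoc, eq_div_iff hx']
  push_cast
  linear_combination ((α + 1) * Complex.exp (-x)) * e

/-- By Abel's identity the left side is constant, and its value is read off as `x → 0`: the powers
of `x` cancel, and the remaining factor `w` is continuous at 0 with `w 0 = -α`. -/
theorem hFun_hTilde_wronskian {α : ℝ} (hα : NonInt α) (lam : ℂ) {x : ℝ} (hx : 0 < x) :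
    (clP α x : ℂ) * (hFun α lam x * deriv (hTilde α lam) x - deriv (hFun α lam) x * hTilde α lam x)
      = -α := by
  obtain ⟨c, hc⟩ := (hFun_linSol hα lam).abel (hTilde_linSol hα lam) (p := fun x => (clP α x : ℂ))
    (fun x hx => clP_hasDerivAt α hx)
  rw [hc x hx]
  set u := hFun α lam
  set g := hFun (-α) (lam + α)
  have ag := hFun_analyticAt hα.neg (lam + α) 0
  have au := hFun_analyticAt hα lam 0
  set w : ℝ → ℂ := fun x => (Real.exp (-x) : ℂ) *
    (u x * (-α * g x + x * deriv g x) - x * deriv u x * g x)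
  have hcont : ContinuousAt w 0 := by
    have c1 : ContinuousAt (fun x : ℝ => (x : ℂ)) 0 := Complex.continuous_ofReal.continuousAt
    have c2 : ContinuousAt (fun x : ℝ => (Real.exp (-x) : ℂ)) 0 :=
      (Complex.continuous_ofReal.comp (by fun_prop)).continuousAt
    exact c2.mul ((au.continuousAt.mul ((continuousAt_const.mul ag.continuousAt).add
      (c1.mul ag.deriv.continuousAt))).sub ((c1.mul au.deriv.continuousAt).mul ag.continuousAt))
  have hw : w 0 = -α := by
    simp [w, u, g, hFun, kummerM_zero]
  have hlim : Tendsto w (𝓝[>] 0) (𝓝 (-α)) := by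
    rw [← hw]
    exact hcont.tendsto.mono_left nhdsWithin_le_nhds
  refine tendsto_nhds_unique (tendsto_const_nhds.congr' ?_) hlim
  filter_upwards [self_mem_nhdsWithin] with y hy
  have hy0 : 0 < y := hy
  rw [← hc y hy]
  have hd : deriv (hTilde α lam) y = ((-α : ℝ) : ℂ) * ((y ^ (-α - 1) : ℝ) : ℂ) * g y
      + ((y ^ (-α) : ℝ) : ℂ) * deriv g y := by
    rw [hTilde_eq]
    exact ((hasDerivAt_rpow_ofReal (-α) hy0).mul
      (hFun_analyticAt hα.neg (lam + α) y).differentiableAt.hasDerivAt).deriv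
  have e := rpow_mul_self_ofReal (-α) hy0
  have e1 : ((y ^ (α + 1) : ℝ) : ℂ) * ((y ^ (-α - 1) : ℝ) : ℂ) = 1 := by
    rw [← Complex.ofReal_mul, ← Real.rpow_add hy0]
    simp
  rw [hd]
  simp only [hTilde_eq, clP, ← e, w, u, g]
  push_cast
  linear_combination (Complex.exp (-y) * (u y * (-α * g y + y * deriv g y) -
    y * deriv u y * g y)) * e1

theorem exists_comb_hFun_hTilde {α : ℝ} (hα : NonInt α) {lam : ℂ} {y y' : ℝ → ℂ}
    (hy : LinSol (clQ α) (clR lam) y y') :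
    ∃ c₁ c₂ : ℂ, ∀ x : ℝ, 0 < x → y x = c₁ * hFun α lam x + c₂ * hTilde α lam x :=
  (hFun_linSol hα lam).eq_of_wronskian (hTilde_linSol hα lam) hy
    (p := fun x => (clP α x : ℂ)) (fun _ hx => clP_hasDerivAt α hx) (neg_ne_zero.2 hα.ne_zero)
    fun _ hx => hFun_hTilde_wronskian hα lam hx


/-! ### The integral representation of Tricomi's function -/

/-- The density `t^(a-1) (1+t)^(α-a)`. -/
noncomputable def triDens (α : ℝ) (a : ℂ) (t : ℝ) : ℂ :=
  (t : ℂ) ^ (a - 1) * ((1 + t : ℝ) : ℂ) ^ ((α : ℂ) - a)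

/-- The integrals `∫ e^(-xt) t^k t^(a-1) (1+t)^(α-a) dt` over `(0, ∞)`. -/
noncomputable def triInt (α : ℝ) (a : ℂ) (k : ℕ) (x : ℝ) : ℂ :=
  ∫ t in Ioi (0 : ℝ), (Real.exp (-x * t) : ℂ) * ((t : ℂ) ^ k * triDens α a t)

theorem continuousAt_ofReal_cpow' (z : ℂ) {t : ℝ} (ht : 0 < t) :
    ContinuousAt (fun t : ℝ => (t : ℂ) ^ z) t :=
  Complex.continuousAt_ofReal_cpow_const t z (Or.inr ht.ne')

theorem triDens_continuousOn (α : ℝ) (a : ℂ) : ContinuousOn (triDens α a) (Ioi 0) := by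
  intro t ht
  have ht0 : 0 < t := ht
  have h2 : ContinuousAt (fun t : ℝ => ((1 + t : ℝ) : ℂ) ^ ((α : ℂ) - a)) t :=
    (continuousAt_ofReal_cpow' _ (by linarith : (0 : ℝ) < 1 + t)).comp
      (f := fun t : ℝ => 1 + t) (by fun_prop)
  exact ((continuousAt_ofReal_cpow' _ ht0).mul h2).continuousWithinAt

theorem norm_triDens (α : ℝ) (a : ℂ) {t : ℝ} (ht : 0 < t) :
    ‖triDens α a t‖ = t ^ (a.re - 1) * (1 + t) ^ (α - a.re) := by
  rw [triDens, norm_mul, Complex.norm_cpow_eq_rpow_re_of_pos ht,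
    Complex.norm_cpow_eq_rpow_re_of_pos (by linarith)]
  simp

theorem norm_triDens_le {α : ℝ} {a : ℂ} (hα : α ≤ 0) (ha : 0 ≤ a.re) {t : ℝ} (ht : 0 < t) :
    ‖triDens α a t‖ ≤ t ^ (a.re - 1) := by
  rw [norm_triDens α a ht]
  have : (1 + t) ^ (α - a.re) ≤ 1 :=
    Real.rpow_le_one_of_one_le_of_nonpos (by linarith) (by linarith)
  exact mul_le_of_le_one_right (by positivity) this

theorem integrableOn_rpow_exp {s x : ℝ} (hs : 0 < s) (hx : 0 < x) :
    IntegrableOn (fun t : ℝ => t ^ (s - 1) * Real.exp (-x * t)) (Ioi 0) := by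
  have := integrableOn_rpow_mul_exp_neg_mul_rpow (p := 1) (s := s - 1) (b := x) (by linarith)
    one_pos hx
  simpa using this

theorem norm_triInt_integrand_le {α : ℝ} {a : ℂ} (hα : α ≤ 0) (ha : 0 ≤ a.re) (k : ℕ) (x : ℝ)
    {t : ℝ} (ht : 0 < t) : ‖(Real.exp (-x * t) : ℂ) * ((t : ℂ) ^ k * triDens α a t)‖ ≤
      t ^ (a.re + k - 1) * Real.exp (-x * t) := by
  rw [norm_mul, norm_mul, Complex.norm_real, norm_pow, Complex.norm_real,
    Real.norm_of_nonneg (Real.exp_pos _).le, Real.norm_of_nonneg ht.le, mul_comm]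
  have h : t ^ (a.re + k - 1) = t ^ k * t ^ (a.re - 1) := by
    rw [← Real.rpow_natCast, ← Real.rpow_add ht]
    ring_nf
  rw [h]
  gcongr
  exact norm_triDens_le hα ha ht

theorem triInt_integrand_continuousOn (α : ℝ) (a : ℂ) (k : ℕ) (x : ℝ) :
    ContinuousOn (fun t : ℝ => (Real.exp (-x * t) : ℂ) * ((t : ℂ) ^ k * triDens α a t))
      (Ioi 0) := by
  refine ContinuousOn.mul ?_ (ContinuousOn.mul ?_ (triDens_continuousOn α a))
  · exact (Complex.continuous_ofReal.comp (by fun_prop)).continuousOn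
  · exact (Complex.continuous_ofReal.pow k).continuousOn

theorem triInt_integrable {α : ℝ} {a : ℂ} (hα : α ≤ 0) (ha : 0 < a.re) (k : ℕ) {x : ℝ}
    (hx : 0 < x) : IntegrableOn
      (fun t : ℝ => (Real.exp (-x * t) : ℂ) * ((t : ℂ) ^ k * triDens α a t)) (Ioi 0) := by
  refine Integrable.mono' (integrableOn_rpow_exp (s := a.re + k) (by positivity) hx)
    ((triInt_integrand_continuousOn α a k x).aestronglyMeasurable measurableSet_Ioi) ?_
  refine (ae_restrict_mem measurableSet_Ioi).mono fun t ht => ?_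
  exact norm_triInt_integrand_le hα ha.le k x ht

theorem triInt_hasDerivAt {α : ℝ} {a : ℂ} (hα : α ≤ 0) (ha : 0 < a.re) (k : ℕ) {x : ℝ}
    (hx : 0 < x) : HasDerivAt (triInt α a k) (-triInt α a (k + 1) x) x := by
  have key := hasDerivAt_integral_of_dominated_loc_of_deriv_le (μ := volume.restrict (Ioi (0 : ℝ)))
    (F := fun (x t : ℝ) => (Real.exp (-x * t) : ℂ) * ((t : ℂ) ^ k * triDens α a t))
    (F' := fun (x t : ℝ) => -((Real.exp (-x * t) : ℂ) * ((t : ℂ) ^ (k + 1) * triDens α a t)))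
    (x₀ := x) (s := Ioi (x / 2)) (bound := fun t => t ^ (a.re + (k + 1 : ℕ) - 1) *
      Real.exp (-(x / 2) * t))
    (Ioi_mem_nhds (by linarith))
    (Eventually.of_forall fun y =>
      (triInt_integrand_continuousOn α a k y).aestronglyMeasurable measurableSet_Ioi)
    (triInt_integrable hα ha k hx)
    ((triInt_integrand_continuousOn α a (k + 1) x).neg.aestronglyMeasurable measurableSet_Ioi)
    ((ae_restrict_mem measurableSet_Ioi).mono fun t ht y hy => by
      have ht0 : 0 < t := ht
      rw [norm_neg]
      refine (norm_triInt_integrand_le hα ha.le (k + 1) y ht).trans ?_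
      have : x / 2 < y := hy
      gcongr)
    (integrableOn_rpow_exp (by positivity) (by linarith))
    ((ae_restrict_mem measurableSet_Ioi).mono fun t ht y hy => by
      have h1 : HasDerivAt (fun y : ℝ => Real.exp (-y * t)) (Real.exp (-y * t) * (-1 * t)) y :=
        ((hasDerivAt_neg y).mul_const t).exp
      have h2 := h1.ofReal_comp.mul_const ((t : ℂ) ^ k * triDens α a t)
      refine h2.congr_deriv ?_
      push_cast
      ring)
  have := key.2
  rw [integral_neg] at this
  exact this

/-- The integral of a total derivative. -/
theorem triInt_relation {α : ℝ} {a : ℂ} (hα : α ≤ 0) (ha : 0 < a.re) {x : ℝ} (hx : 0 < x) :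
    a * triInt α a 0 x + (α + 1 - x) * triInt α a 1 x - x * triInt α a 2 x = 0 := by
  have ha0 : a ≠ 0 := by
    rintro rfl
    simp at ha
  -- The derivative of `G` is the integrand of the relation. `G` vanishes at 0 because `Re a > 0`,
  -- and at infinity because of the exponential.
  set G : ℝ → ℂ := fun t => (Real.exp (-x * t) : ℂ) *
    ((t : ℂ) ^ a * ((1 + t : ℝ) : ℂ) ^ ((α : ℂ) + 1 - a)) with hG
  set I : ℕ → ℝ → ℂ := fun k t => (Real.exp (-x * t) : ℂ) * ((t : ℂ) ^ k * triDens α a t) with hI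
  have hint : ∀ k, IntegrableOn (I k) (Ioi 0) := fun k => triInt_integrable hα ha k hx
  have hcont1 : ∀ t : ℝ, 0 ≤ t →
      ContinuousAt (fun t : ℝ => ((1 + t : ℝ) : ℂ) ^ ((α : ℂ) + 1 - a)) t := fun t ht =>
    (continuousAt_ofReal_cpow' _ (by linarith : (0 : ℝ) < 1 + t)).comp
      (f := fun t : ℝ => 1 + t) (by fun_prop)
  have hd : ∀ t ∈ Ioi (0 : ℝ), HasDerivAt G (a * I 0 t + (α + 1 - x) * I 1 t - x * I 2 t) t := by
    intro t ht
    have ht0 : 0 < t := ht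
    have h1 : HasDerivAt (fun t : ℝ => (Real.exp (-x * t) : ℂ))
        ((Real.exp (-x * t) * (-x * 1) : ℝ) : ℂ) t :=
      (((hasDerivAt_id t).const_mul (-x)).exp).ofReal_comp
    have h2 : HasDerivAt (fun t : ℝ => (t : ℂ) ^ a) (a * (t : ℂ) ^ (a - 1)) t :=
      hasDerivAt_ofReal_cpow_const ht0.ne' ha0
    have h3 : HasDerivAt (fun t : ℝ => ((1 + t : ℝ) : ℂ) ^ ((α : ℂ) + 1 - a))
        (((α : ℂ) + 1 - a) * ((1 + t : ℝ) : ℂ) ^ ((α : ℂ) - a)) t := by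
      rcases eq_or_ne ((α : ℂ) + 1 - a) 0 with h0 | h0
      · simp only [h0, Complex.cpow_zero, zero_mul]
        exact hasDerivAt_const _ _
      · have := (hasDerivAt_ofReal_cpow_const (x := 1 + t) (by linarith) h0).scomp t
          ((hasDerivAt_id t).const_add 1)
        have e : (α : ℂ) + 1 - a - 1 = α - a := by ring
        simpa [e, Function.comp_def] using this
    refine (h1.mul (h2.mul h3)).congr_deriv ?_
    have ht' : (t : ℂ) ≠ 0 := by exact_mod_cast ht0.ne'
    have ht1 : ((1 + t : ℝ) : ℂ) ≠ 0 := by exact_mod_cast (by linarith : (0 : ℝ) < 1 + t).ne'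
    have e1 : (t : ℂ) ^ a = (t : ℂ) ^ (a - 1) * t := by
      nth_rw 1 [← sub_add_cancel a 1]
      rw [Complex.cpow_add _ _ ht', Complex.cpow_one]
    have e2 : ((1 + t : ℝ) : ℂ) ^ ((α : ℂ) + 1 - a) =
        ((1 + t : ℝ) : ℂ) ^ ((α : ℂ) - a) * ((1 + t : ℝ) : ℂ) := by
      rw [show (α : ℂ) + 1 - a = α - a + 1 by ring, Complex.cpow_add _ _ ht1, Complex.cpow_one]
    simp only [hI, triDens, Pi.mul_apply]
    rw [e1, e2]
    push_cast
    ring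
  have hcont : ContinuousWithinAt G (Ici 0) 0 := by
    refine ContinuousAt.continuousWithinAt ?_
    refine ContinuousAt.mul ?_ (ContinuousAt.mul ?_ (hcont1 0 le_rfl))
    · exact (Complex.continuous_ofReal.comp (by fun_prop)).continuousAt
    · exact Complex.continuousAt_ofReal_cpow_const 0 a (Or.inl ha)
  have hlim : Tendsto G atTop (𝓝 0) := by
    have h1 := tendsto_rpow_mul_exp_neg_mul_atTop_nhds_zero (a.re + |α + 1 - a.re|) x hx
    have h2 := h1.const_mul (2 ^ |α + 1 - a.re|)
    rw [mul_zero] at h2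
    refine squeeze_zero_norm' ?_ h2
    filter_upwards [eventually_ge_atTop 1] with t ht
    have ht0 : 0 < t := by linarith
    rw [hG, norm_mul, norm_mul, Complex.norm_real, Complex.norm_cpow_eq_rpow_re_of_pos ht0,
      Complex.norm_cpow_eq_rpow_re_of_pos (by linarith), Real.norm_of_nonneg (Real.exp_pos _).le]
    have h3 : (1 + t) ^ ((α : ℂ) + 1 - a).re ≤ 2 ^ |α + 1 - a.re| * t ^ |α + 1 - a.re| := by
      rw [← Real.mul_rpow (by norm_num) ht0.le]
      calc (1 + t) ^ ((α : ℂ) + 1 - a).re ≤ (1 + t) ^ |α + 1 - a.re| := by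
            refine Real.rpow_le_rpow_of_exponent_le (by linarith) ?_
            simpa using le_abs_self (α + 1 - a.re)
        _ ≤ _ := by
            refine Real.rpow_le_rpow (by linarith) (by linarith) (abs_nonneg _)
    calc Real.exp (-x * t) * (t ^ a.re * (1 + t) ^ ((α : ℂ) + 1 - a).re)
        ≤ Real.exp (-x * t) * (t ^ a.re * (2 ^ |α + 1 - a.re| * t ^ |α + 1 - a.re|)) := by gcongr
      _ = _ := by
        rw [Real.rpow_add ht0]
        ring
  have h := integral_Ioi_of_hasDerivAt_of_tendsto hcont hd
    ((((hint 0).const_mul a).add ((hint 1).const_mul _)).sub ((hint 2).const_mul _)) hlim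
  have i1 : IntegrableOn (fun t => a * I 0 t) (Ioi 0) := (hint 0).const_mul a
  have i2 : IntegrableOn (fun t => ((α : ℂ) + 1 - x) * I 1 t) (Ioi 0) := (hint 1).const_mul _
  have i3 : IntegrableOn (fun t => (x : ℂ) * I 2 t) (Ioi 0) := (hint 2).const_mul _
  have i12 : IntegrableOn (fun t => a * I 0 t + ((α : ℂ) + 1 - x) * I 1 t) (Ioi 0) := i1.add i2
  rw [integral_sub i12 i3, integral_add i1 i2] at h
  simp only [integral_const_mul] at h
  have hG0 : G 0 = 0 := by simp [hG, Complex.zero_cpow ha0]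
  rw [hG0, sub_zero] at h
  exact h

theorem triInt_linSol {α : ℝ} {a : ℂ} (hα : α ≤ 0) (ha : 0 < a.re) :
    LinSol (clQ α) (clR (-a)) (triInt α a 0) (fun x => -triInt α a 1 x) := by
  intro x hx
  refine ⟨triInt_hasDerivAt hα ha 0 hx, (triInt_hasDerivAt hα ha 1 hx).neg.congr_deriv ?_⟩
  have h := triInt_relation hα ha hx
  have hx' : (x : ℂ) ≠ 0 := by exact_mod_cast hx.ne'
  simp only [clQ, clR]
  field_simp
  linear_combination (-1 : ℂ) * h


/-! ### Limits of the integral at the origin and at infinity. -/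

theorem ofReal_cpow_eq_exp {t : ℝ} (ht : 0 < t) (z : ℂ) :
    (t : ℂ) ^ z = Complex.exp (Real.log t * z) := by
  rw [Complex.cpow_def_of_ne_zero (by exact_mod_cast ht.ne'), Complex.ofReal_log ht.le]

/-- The substitution `t = u/(1-u)` produces the Beta integral `B(a, -α)`; its convergence is the
reason for `α < 0`. -/
theorem triDens_integral {α : ℝ} {a : ℂ} (hα : α < 0) (ha : 0 < a.re) :
    IntegrableOn (triDens α a) (Ioi 0) ∧
      Complex.Gamma (a - α) * ∫ t in Ioi (0 : ℝ), triDens α a t =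
        Complex.Gamma a * Complex.Gamma (-α) := by
  set f : ℝ → ℝ := fun u => u / (1 - u) with hf
  have himg : f '' Ioo 0 1 = Ioi 0 := by
    ext t
    constructor
    · rintro ⟨u, ⟨h0, h1⟩, rfl⟩
      exact div_pos h0 (by linarith)
    · intro ht
      have ht0 : 0 < t := ht
      refine ⟨t / (1 + t), ⟨by positivity, by rw [div_lt_one (by linarith)]; linarith⟩, ?_⟩
      simp only [hf]
      field_simp
      ring
  have hd : ∀ u ∈ Ioo (0 : ℝ) 1, HasDerivWithinAt f (1 / (1 - u) ^ 2) (Ioo 0 1) u := by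
    intro u hu
    have h1 : 1 - u ≠ 0 := by linarith [hu.2]
    refine (((hasDerivAt_id u).div ((hasDerivAt_id u).const_sub 1) h1).congr_deriv
      ?_).hasDerivWithinAt
    simp
  have hinj : InjOn f (Ioo 0 1) := by
    intro u hu v hv huv
    have h1 : 1 - u ≠ 0 := by linarith [hu.2]
    have h2 : 1 - v ≠ 0 := by linarith [hv.2]
    simp only [hf] at huv
    rw [div_eq_div_iff h1 h2] at huv
    linarith
  have hpt : ∀ u ∈ Ioo (0 : ℝ) 1, |1 / (1 - u) ^ 2| • triDens α a (f u) =
      (u : ℂ) ^ (a - 1) * (1 - (u : ℂ)) ^ (-(α : ℂ) - 1) := by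
    intro u hu
    have h1 : 0 < 1 - u := by linarith [hu.2]
    have h2 : 0 < f u := div_pos hu.1 h1
    have h3 : 1 + f u = (1 - u)⁻¹ := by
      simp only [hf]
      field_simp
      ring
    have h4 : (1 : ℂ) - u = ((1 - u : ℝ) : ℂ) := by push_cast; rfl
    have h5 : |1 / (1 - u) ^ 2| = Real.exp (-2 * Real.log (1 - u)) := by
      rw [abs_of_nonneg (by positivity), ← Real.exp_log h1, ← Real.exp_nat_mul, one_div,
        ← Real.exp_neg, Real.log_exp]
      push_cast
      ring_nf
    rw [triDens, h3, h4, ofReal_cpow_eq_exp h2, ofReal_cpow_eq_exp (inv_pos.2 h1),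
      ofReal_cpow_eq_exp hu.1, ofReal_cpow_eq_exp h1, h5, Complex.real_smul, Complex.ofReal_exp,
      ← Complex.exp_add, ← Complex.exp_add, ← Complex.exp_add, Real.log_inv]
    congr 1
    simp only [hf]
    rw [Real.log_div hu.1.ne' h1.ne']
    push_cast
    ring
  have hv : 0 < (-(α : ℂ)).re := by simpa using hα
  have hconv := Complex.betaIntegral_convergent ha hv
  rw [intervalIntegrable_iff_integrableOn_Ioo_of_le zero_le_one] at hconv
  constructor
  · rw [← himg, integrableOn_image_iff_integrableOn_abs_deriv_smul measurableSet_Ioo hd hinj]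
    exact hconv.congr_fun (fun u hu => (hpt u hu).symm) measurableSet_Ioo
  · rw [← himg, integral_image_eq_integral_abs_deriv_smul measurableSet_Ioo hd hinj,
      setIntegral_congr_fun measurableSet_Ioo hpt, Complex.Gamma_mul_Gamma_eq_betaIntegral ha hv,
      Complex.betaIntegral, intervalIntegral.integral_of_le zero_le_one,
      integral_Ioc_eq_integral_Ioo, sub_eq_add_neg]

theorem triInt_tendsto_zero {α : ℝ} {a : ℂ} (hα : α < 0) (ha : 0 < a.re) :
    Tendsto (triInt α a 0) (𝓝[>] 0) (𝓝 (∫ t in Ioi (0 : ℝ), triDens α a t)) := by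
  have hi := (triDens_integral hα ha).1
  refine tendsto_integral_filter_of_dominated_convergence (fun t => ‖triDens α a t‖)
    (Eventually.of_forall fun x =>
      (triInt_integrand_continuousOn α a 0 x).aestronglyMeasurable measurableSet_Ioi)
    ?_ hi.norm ?_
  · filter_upwards [self_mem_nhdsWithin] with x hx
    refine (ae_restrict_mem measurableSet_Ioi).mono fun t ht => ?_
    have ht0 : 0 < t := ht
    have hx0 : 0 < x := hx
    rw [norm_mul, Complex.norm_real, Real.norm_of_nonneg (Real.exp_pos _).le, pow_zero, one_mul]
    refine mul_le_of_le_one_left (norm_nonneg _) (Real.exp_le_one_iff.2 ?_)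
    nlinarith
  · refine Eventually.of_forall fun t => ?_
    have h : Tendsto (fun x : ℝ => (Real.exp (-x * t) : ℂ) * ((t : ℂ) ^ 0 * triDens α a t)) (𝓝 0)
        (𝓝 ((Real.exp (-0 * t) : ℂ) * ((t : ℂ) ^ 0 * triDens α a t))) := by
      refine ContinuousAt.tendsto (x := (0 : ℝ)) (f := fun x : ℝ => (Real.exp (-x * t) : ℂ) *
        ((t : ℂ) ^ 0 * triDens α a t)) ?_
      exact (Continuous.mul (Complex.continuous_ofReal.comp (by fun_prop))
        continuous_const).continuousAt
    simp only [neg_zero, zero_mul, Real.exp_zero, Complex.ofReal_one, pow_zero, one_mul] at h ⊢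
    exact h.mono_left nhdsWithin_le_nhds

/-- Scaling of the integration variable. -/
theorem triInt_eq_scaled (α : ℝ) (a : ℂ) (k : ℕ) {x : ℝ} (hx : 0 < x) :
    triInt α a k x = (x : ℂ)⁻¹ * ∫ s in Ioi (0 : ℝ), (Real.exp (-s) : ℂ) *
      (((s / x : ℝ) : ℂ) ^ k * triDens α a (s / x)) := by
  have h := integral_comp_mul_left_Ioi (fun s : ℝ => (Real.exp (-s) : ℂ) *
      (((s / x : ℝ) : ℂ) ^ k * triDens α a (s / x))) 0 hx
  rw [mul_zero, Complex.real_smul, Complex.ofReal_inv] at h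
  rw [← h, triInt]
  refine setIntegral_congr_fun measurableSet_Ioi fun t _ => ?_
  have : x * t / x = t := by field_simp
  simp only [this, neg_mul]

theorem gammaIntegral_integrable {s : ℝ} (hs : 0 < s) :
    IntegrableOn (fun t : ℝ => t ^ (s - 1) * Real.exp (-t)) (Ioi 0) := by
  simpa using integrableOn_rpow_exp hs one_pos

/-- The behaviour of the derivative at the origin. -/
theorem triInt_one_tendsto {α : ℝ} {a : ℂ} (hα : α < 0) (hα' : -1 < α) (ha : 0 < a.re) :
    Tendsto (fun x : ℝ => ((x ^ (α + 1) : ℝ) : ℂ) * triInt α a 1 x) (𝓝[>] 0)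
      (𝓝 (Complex.Gamma (α + 1))) := by
  -- With `s = x t` all powers of `x` disappear except inside `(x+s)^(α-a)`. At `x = 0` the
  -- integrand is `e^(-s) s^α`, and it is dominated by this function because `α - Re a` is negative.
  set F : ℝ → ℝ → ℂ := fun x s => (Real.exp (-s) : ℂ) * ((s : ℂ) ^ a *
    ((x + s : ℝ) : ℂ) ^ ((α : ℂ) - a)) with hF
  have hcongr : ∀ x ∈ Ioi (0 : ℝ), ∫ s in Ioi (0 : ℝ), F x s =
      ((x ^ (α + 1) : ℝ) : ℂ) * triInt α a 1 x := by
    intro x hx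
    have hx0 : 0 < x := hx
    rw [triInt_eq_scaled α a 1 hx0, ← mul_assoc, ← integral_const_mul]
    refine setIntegral_congr_fun measurableSet_Ioi fun s hs => ?_
    have hs0 : 0 < s := hs
    have h1 : 1 + s / x = (x + s) / x := by field_simp
    have h2 : 0 < x + s := by linarith
    simp only [hF, triDens, pow_one]
    have e1 : ((x ^ (α + 1) : ℝ) : ℂ) = Complex.exp (Real.log x * (α + 1)) := by
      rw [Complex.ofReal_cpow hx0.le, ofReal_cpow_eq_exp hx0]
      push_cast
      rfl
    have e2 : (x : ℂ)⁻¹ = Complex.exp (-Real.log x) := by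
      rw [Complex.exp_neg, ← Complex.ofReal_exp, Real.exp_log hx0]
    have e3 : ((s / x : ℝ) : ℂ) = Complex.exp (Real.log s - Real.log x) := by
      rw [← Complex.ofReal_sub, ← Real.log_div hs0.ne' hx0.ne', ← Complex.ofReal_exp,
        Real.exp_log (by positivity)]
    rw [h1, ofReal_cpow_eq_exp (by positivity : 0 < s / x) (a - 1), e3,
      ofReal_cpow_eq_exp (by positivity : 0 < (x + s) / x), ofReal_cpow_eq_exp hs0,
      ofReal_cpow_eq_exp h2, Real.log_div h2.ne' hx0.ne', Real.log_div hs0.ne' hx0.ne', e1, e2,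
      Complex.ofReal_exp]
    simp only [← Complex.exp_add]
    congr 1
    push_cast
    ring
  have hG : Complex.Gamma (α + 1) = ∫ s in Ioi (0 : ℝ), F 0 s := by
    rw [Complex.Gamma_eq_integral (by simp; linarith), Complex.GammaIntegral]
    refine setIntegral_congr_fun measurableSet_Ioi fun s hs => ?_
    have hs0 : 0 < s := hs
    simp only [hF, zero_add]
    rw [← Complex.cpow_add _ _ (by exact_mod_cast hs0.ne')]
    simp
  rw [hG]
  refine Tendsto.congr' (eventually_nhdsWithin_of_forall hcongr) ?_
  refine tendsto_integral_filter_of_dominated_convergence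
    (fun s => s ^ (α + 1 - 1) * Real.exp (-s)) ?_ ?_ (gammaIntegral_integrable (by linarith)) ?_
  · filter_upwards [self_mem_nhdsWithin] with x hx
    refine ContinuousOn.aestronglyMeasurable (fun s hs => ?_) measurableSet_Ioi
    have hs0 : 0 < s := hs
    have hx0 : 0 < x := hx
    refine (ContinuousAt.mul (Complex.continuous_ofReal.comp (by fun_prop)).continuousAt
      ((continuousAt_ofReal_cpow' _ hs0).mul ?_)).continuousWithinAt
    exact (continuousAt_ofReal_cpow' _ (by linarith : (0 : ℝ) < x + s)).comp
      (f := fun t : ℝ => x + t) (by fun_prop)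
  · filter_upwards [self_mem_nhdsWithin] with x hx
    refine (ae_restrict_mem measurableSet_Ioi).mono fun s hs => ?_
    have hs0 : 0 < s := hs
    have hx0 : 0 < x := hx
    simp only [hF]
    rw [norm_mul, norm_mul, Complex.norm_real, Complex.norm_cpow_eq_rpow_re_of_pos hs0,
      Complex.norm_cpow_eq_rpow_re_of_pos (by linarith), Real.norm_of_nonneg (Real.exp_pos _).le,
      mul_comm]
    gcongr
    have h1 : (x + s) ^ ((α : ℂ) - a).re ≤ s ^ ((α : ℂ) - a).re := by
      refine Real.rpow_le_rpow_of_nonpos hs0 (by linarith) ?_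
      simp
      linarith
    calc s ^ a.re * (x + s) ^ ((α : ℂ) - a).re ≤ s ^ a.re * s ^ ((α : ℂ) - a).re := by gcongr
      _ = s ^ (α + 1 - 1) := by
        rw [← Real.rpow_add hs0]
        simp
  · refine (ae_restrict_mem measurableSet_Ioi).mono fun s hs => ?_
    have hs0 : 0 < s := hs
    have : ContinuousAt (fun x => F x s) 0 := by
      refine continuousAt_const.mul (continuousAt_const.mul ?_)
      exact (continuousAt_ofReal_cpow' _ (by linarith : (0 : ℝ) < 0 + s)).comp
        (f := fun t : ℝ => t + s) (by fun_prop)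
    exact this.tendsto.mono_left nhdsWithin_le_nhds

/-- The behaviour at infinity. -/
theorem triInt_tendsto_atTop {α : ℝ} {a : ℂ} (hα : α < 0) (ha : 0 < a.re) :
    Tendsto (fun x : ℝ => (x : ℂ) ^ a * triInt α a 0 x) atTop (𝓝 (Complex.Gamma a)) := by
  -- After the same scaling the last factor is `(1+s/x)^(α-a)`. It tends to 1, and its modulus is at
  -- most 1 since `α < 0 < Re a`.
  set F : ℝ → ℝ → ℂ := fun x s => (Real.exp (-s) : ℂ) * ((s : ℂ) ^ (a - 1) *
    ((1 + s / x : ℝ) : ℂ) ^ ((α : ℂ) - a)) with hF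
  have hcongr : ∀ x ∈ Ioi (0 : ℝ), ∫ s in Ioi (0 : ℝ), F x s =
      (x : ℂ) ^ a * triInt α a 0 x := by
    intro x hx
    have hx0 : 0 < x := hx
    rw [triInt_eq_scaled α a 0 hx0, ← mul_assoc, ← integral_const_mul]
    refine setIntegral_congr_fun measurableSet_Ioi fun s hs => ?_
    have hs0 : 0 < s := hs
    simp only [hF, triDens, pow_zero, one_mul]
    have e2 : (x : ℂ)⁻¹ = Complex.exp (-Real.log x) := by
      rw [Complex.exp_neg, ← Complex.ofReal_exp, Real.exp_log hx0]
    have e3 : (s : ℂ) ^ (a - 1) = (x : ℂ) ^ a * (x : ℂ)⁻¹ * ((s / x : ℝ) : ℂ) ^ (a - 1) := by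
      rw [ofReal_cpow_eq_exp hs0, ofReal_cpow_eq_exp hx0, ofReal_cpow_eq_exp (by positivity),
        e2, Real.log_div hs0.ne' hx0.ne', ← Complex.exp_add, ← Complex.exp_add]
      congr 1
      push_cast
      ring
    rw [e3]
    ring
  have hG : Complex.Gamma a = ∫ s in Ioi (0 : ℝ), (Real.exp (-s) : ℂ) * (s : ℂ) ^ (a - 1) := by
    rw [Complex.Gamma_eq_integral ha, Complex.GammaIntegral]
  rw [hG]
  refine Tendsto.congr' ((eventually_gt_atTop 0).mono hcongr) ?_
  refine tendsto_integral_filter_of_dominated_convergence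
    (fun s => s ^ (a.re - 1) * Real.exp (-s)) ?_ ?_ (gammaIntegral_integrable ha) ?_
  · filter_upwards [eventually_gt_atTop 0] with x hx0
    refine ContinuousOn.aestronglyMeasurable (fun s hs => ?_) measurableSet_Ioi
    have hs0 : 0 < s := hs
    refine (ContinuousAt.mul (Complex.continuous_ofReal.comp (by fun_prop)).continuousAt
      ((continuousAt_ofReal_cpow' _ hs0).mul ?_)).continuousWithinAt
    exact (continuousAt_ofReal_cpow' _ (by positivity : (0 : ℝ) < 1 + s / x)).comp
      (f := fun t : ℝ => 1 + t / x) (by fun_prop)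
  · filter_upwards [eventually_gt_atTop 0] with x hx0
    refine (ae_restrict_mem measurableSet_Ioi).mono fun s hs => ?_
    have hs0 : 0 < s := hs
    simp only [hF]
    rw [norm_mul, norm_mul, Complex.norm_real, Complex.norm_cpow_eq_rpow_re_of_pos hs0,
      Complex.norm_cpow_eq_rpow_re_of_pos (by positivity), Real.norm_of_nonneg (Real.exp_pos _).le,
      mul_comm]
    gcongr
    have h1 : (1 + s / x) ^ ((α : ℂ) - a).re ≤ 1 := by
      refine Real.rpow_le_one_of_one_le_of_nonpos ?_ ?_
      · have : 0 < s / x := by positivity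
        linarith
      · simp
        linarith
    calc s ^ (a - 1).re * (1 + s / x) ^ ((α : ℂ) - a).re ≤ s ^ (a - 1).re * 1 := by gcongr
      _ = s ^ (a.re - 1) := by simp
  · refine (ae_restrict_mem measurableSet_Ioi).mono fun s hs => ?_
    have hs0 : 0 < s := hs
    have h1 : Tendsto (fun x : ℝ => 1 + s / x) atTop (𝓝 1) := by
      simpa using (tendsto_const_nhds.div_atTop tendsto_id).const_add (1 : ℝ)
    have h2 := (continuousAt_ofReal_cpow' ((α : ℂ) - a) one_pos).tendsto.comp h1
    have h3 := (h2.const_mul ((s : ℂ) ^ (a - 1))).const_mul (Real.exp (-s) : ℂ)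
    simpa [hF] using h3


/-! ### Tricomi's function -/

/-- The connection formula for `U(-lam, α+1, x)`. -/
noncomputable def triF (α : ℝ) (lam : ℂ) (x : ℝ) : ℂ :=
  Complex.Gamma (-α) * (Complex.Gamma (-lam - α))⁻¹ * hFun α lam x +
    Complex.Gamma α * (Complex.Gamma (-lam))⁻¹ * hTilde α lam x

/-- The reciprocal Gamma function is entire, so this form of the functional equation holds at the
poles of `Gamma` as well and the relations below need no exceptional `λ`. -/
theorem gamma_inv (s : ℂ) : (Complex.Gamma s)⁻¹ = s * (Complex.Gamma (s + 1))⁻¹ :=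
  Complex.one_div_Gamma_eq_self_mul_one_div_Gamma_add_one s

/-- With the Gamma factors included, the contiguous relations for the `h` part and the `h̃` part
acquire the same coefficients, so they hold for the sum. -/
theorem triF_contiguous_lam {α : ℝ} (hα : NonInt α) (lam : ℂ) (x : ℝ) :
    triF α (lam + 1) x = -(α + 1 + 2 * lam - x) * triF α lam x
      - lam * (lam + α) * triF α (lam - 1) x := by
  have r1 := kummerM_contiguous_a (-lam) hα.first x
  have r2 := kummerM_contiguous_a (-lam - α) hα.second x
  have g1 := gamma_inv (-lam - α - 1)
  have g2 := gamma_inv (-lam - α)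
  have g3 := gamma_inv (-lam - 1)
  have g4 := gamma_inv (-lam)
  rw [show -lam - α - 1 + 1 = -lam - α by ring] at g1
  rw [show -lam - 1 + 1 = -lam by ring] at g3
  simp only [triF, hFun, hTilde]
  rw [show -(lam + 1) - (α : ℂ) = -lam - α - 1 by ring, show -(lam - 1) - (α : ℂ) = -lam - α + 1 by
    ring, show -(lam + 1) = -lam - 1 by ring, show -(lam - 1) = -lam + 1 by ring, g1, g3, g2, g4]
  linear_combination (Complex.Gamma (-α) * (-lam - α) * (Complex.Gamma (-lam - α + 1))⁻¹) * (-1) * r1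
    + (Complex.Gamma α * (-lam) * (Complex.Gamma (-lam + 1))⁻¹ * ((x ^ (-α) : ℝ) : ℂ)) * (-1) * r2

theorem triF_sub_one {α : ℝ} (hα : NonInt α) (lam : ℂ) {x : ℝ} (hx : 0 < x) :
    triF (α - 1) lam x = triF α lam x + lam * triF α (lam - 1) x := by
  have r1 := kummerM_contiguous_b_sub (-lam) (b := α + 1)
    (fun k => by simpa using hα.add_ne k) x
  have r2 := kummerM_contiguous_b_add (-lam - α) hα.second x
  have g2 := gamma_inv (-lam - α)
  have g4 := gamma_inv (-lam)
  have k1 : Complex.Gamma (-α + 1) = -α * Complex.Gamma (-α) :=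
    Complex.Gamma_add_one _ (neg_ne_zero.2 hα.ne_zero)
  have h1 := hα.sub_one.ne_zero
  push_cast at h1
  have k2 : Complex.Gamma α = (α - 1) * Complex.Gamma (α - 1) := by
    have := Complex.Gamma_add_one _ h1
    rwa [sub_add_cancel] at this
  have e : ((x ^ (-(α - 1)) : ℝ) : ℂ) = ((x ^ (-α) : ℝ) : ℂ) * x := by
    rw [← rpow_mul_self_ofReal _ hx]
    congr 3
    ring
  simp only [triF, hFun, hTilde]
  rw [e]
  push_cast
  rw [show -((α : ℂ) - 1) = -α + 1 by ring, show -lam - ((α : ℂ) - 1) = -lam - α + 1 by ring,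
    show -(lam - 1) - (α : ℂ) = -lam - α + 1 by ring, show -(lam - 1) = -lam + 1 by ring,
    show (1 : ℂ) - (α - 1) = 1 - α + 1 by ring, k1, k2, g2, g4]
  rw [show -lam - (α : ℂ) + 1 = -lam - α + 1 by ring] at r2
  rw [show (α : ℂ) + 1 - 1 = α - 1 + 1 by ring] at r1
  linear_combination (Complex.Gamma (-α) * (Complex.Gamma (-lam - α + 1))⁻¹) * r1 -
    (Complex.Gamma (α - 1) * (-lam) * (Complex.Gamma (-lam + 1))⁻¹ * ((x ^ (-α) : ℝ) : ℂ)) * r2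

theorem triF_add_one {α : ℝ} (hα : NonInt α) (lam : ℂ) {x : ℝ} (hx : 0 < x) :
    x * triF (α + 1) lam x = (α + 1 + lam) * triF α lam x + triF α (lam + 1) x := by
  have h := triF_sub_one hα.add_one (lam + 1) hx
  have h' := triF_sub_one hα.add_one lam hx
  have c := triF_contiguous_lam hα.add_one lam x
  simp only [add_sub_cancel_right] at h h'
  rw [h, h', c]
  push_cast
  ring

/-- The family `triF` is closed under differentiation; therefore the growth of all derivatives
follows from the growth of `triF` itself. -/
theorem triF_hasDerivAt {α : ℝ} (hα : NonInt α) (lam : ℂ) {x : ℝ} (hx : 0 < x) :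
    HasDerivAt (triF α lam) (lam * triF (α + 1) (lam - 1) x) x := by
  have h := ((hFun_hasDerivAt hα lam x).const_mul
    (Complex.Gamma (-α) * (Complex.Gamma (-lam - α))⁻¹)).add
    ((hTilde_hasDerivAt hα lam hx).const_mul (Complex.Gamma α * (Complex.Gamma (-lam))⁻¹))
  refine h.congr_deriv ?_
  have h1 : (α : ℂ) + 1 ≠ 0 := by simpa using hα.first 0
  have k1 : Complex.Gamma (-α) = -(α + 1) * Complex.Gamma (-(α + 1)) := by
    have := Complex.Gamma_add_one _ (neg_ne_zero.2 h1)
    rwa [show -((α : ℂ) + 1) + 1 = -α by ring] at this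
  have k2 := Complex.Gamma_add_one _ hα.ne_zero
  have g4 := gamma_inv (-lam)
  simp only [triF]
  push_cast
  rw [show -(lam - 1) - ((α : ℂ) + 1) = -lam - α by ring, show -(lam - 1) = -lam + 1 by ring, k2,
    k1, g4]
  field_simp

theorem triF_linSol {α : ℝ} (hα : NonInt α) (lam : ℂ) :
    LinSol (clQ α) (clR lam) (triF α lam) (deriv (triF α lam)) := by
  set A := Complex.Gamma (-α) * (Complex.Gamma (-lam - α))⁻¹
  set B := Complex.Gamma α * (Complex.Gamma (-lam))⁻¹
  intro x hx
  have h : ∀ y : ℝ, 0 < y → HasDerivAt (triF α lam)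
      (A * deriv (hFun α lam) y + B * deriv (hTilde α lam) y) y := fun y hy =>
    ((hFun_linSol hα lam y hy).1.const_mul A).add ((hTilde_linSol hα lam y hy).1.const_mul B)
  refine ⟨(h x hx).differentiableAt.hasDerivAt, ?_⟩
  have h2 := ((hFun_linSol hα lam x hx).2.const_mul A).add
    ((hTilde_linSol hα lam x hx).2.const_mul B)
  have h3 : deriv (triF α lam) =ᶠ[𝓝 x]
      fun y => A * deriv (hFun α lam) y + B * deriv (hTilde α lam) y := by
    filter_upwards [Ioi_mem_nhds hx] with y hy using (h y hy).deriv
  refine (h2.congr_of_eventuallyEq h3).congr_deriv ?_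
  rw [h3.self_of_nhds]
  simp only [triF]
  ring

theorem triF_analyticAt {α : ℝ} (hα : NonInt α) (lam : ℂ) {x : ℝ} (hx : 0 < x) :
    AnalyticAt ℝ (triF α lam) x :=
  (analyticAt_const.mul (hFun_analyticAt hα lam x)).add
    (analyticAt_const.mul (hTilde_analyticAt hα lam hx))

/-- `x^(-lam) U(-lam, α+1, x) → 1`. -/
def TriAsymp (α : ℝ) (lam : ℂ) : Prop :=
  Tendsto (fun x : ℝ => (x : ℂ) ^ (-lam) * triF α lam x) atTop (𝓝 1)

/-- In this range the integral solves the equation, hence is a combination of `h` and `h̃`. Since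
`-α > 0`, only `h` survives in the limit of the integral at 0; since `α + 1 > 0`, only `h̃` survives
in the limit of `x^(α+1)` times the derivative. The two limits show that the integral is `Γ(-λ)
triF`, whose behaviour at infinity is known. -/
theorem triAsymp_base {α : ℝ} (hα : α < 0) (hα' : -1 < α) {lam : ℂ} (hl : lam.re < 0) :
    TriAsymp α lam := by
  have hN : NonInt α := fun k hk => by
    rw [hk] at hα hα'
    have h1 : k < 0 := by exact_mod_cast hα
    have h2 : -1 < k := by exact_mod_cast hα'
    omega
  have ha : 0 < (-lam).re := by simpa using hl
  have hsol := triInt_linSol hα.le ha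
  rw [neg_neg] at hsol
  obtain ⟨c₁, c₂, hc⟩ := exists_comb_hFun_hTilde hN hsol
  have hG : Complex.Gamma (-lam) ≠ 0 := Complex.Gamma_ne_zero_of_re_pos ha
  have hG' : Complex.Gamma (-lam - α) ≠ 0 := Complex.Gamma_ne_zero_of_re_pos (by
    simp
    linarith)
  -- the coefficient of the regular solution
  have hreg : ∀ lam : ℂ, Tendsto (hFun α lam) (𝓝[>] 0) (𝓝 1) := fun lam => by
    have := (hFun_analyticAt hN lam 0).continuousAt.tendsto.mono_left
      (nhdsWithin_le_nhds (s := Ioi 0))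
    rwa [show hFun α lam 0 = 1 from kummerM_zero _ _] at this
  have hsing : Tendsto (hTilde α lam) (𝓝[>] 0) (𝓝 0) := by
    have h1 : Tendsto (fun x : ℝ => ((x ^ (-α) : ℝ) : ℂ)) (𝓝[>] 0) (𝓝 0) := by
      have : ContinuousAt (fun x : ℝ => ((x ^ (-α) : ℝ) : ℂ)) 0 :=
        Complex.continuous_ofReal.continuousAt.comp
          (Real.continuousAt_rpow_const 0 (-α) (Or.inr (by linarith)))
      have h := this.tendsto.mono_left (nhdsWithin_le_nhds (s := Ioi 0))
      simpa [Real.zero_rpow (by linarith : -α ≠ 0)] using h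
    have h2 := (hFun_analyticAt hN.neg (lam + α) 0).continuousAt.tendsto.mono_left
      (nhdsWithin_le_nhds (s := Ioi 0))
    have := h1.mul h2
    rw [zero_mul] at this
    rwa [hTilde_eq]
  have e1 : c₁ = Complex.Gamma (-lam) * (Complex.Gamma (-α) * (Complex.Gamma (-lam - α))⁻¹) := by
    have h1 := ((hreg lam).const_mul c₁).add (hsing.const_mul c₂)
    rw [mul_one, mul_zero, add_zero] at h1
    have h2 : Tendsto (triInt α (-lam) 0) (𝓝[>] 0) (𝓝 c₁) :=
      h1.congr' (eventually_nhdsWithin_of_forall fun x hx => (hc x hx).symm)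
    have h3 := tendsto_nhds_unique h2 (triInt_tendsto_zero hα ha)
    have h4 := (triDens_integral hα ha).2
    rw [← h3] at h4
    field_simp
    linear_combination h4
  have e2 : c₂ = Complex.Gamma (-lam) * (Complex.Gamma α * (Complex.Gamma (-lam))⁻¹) := by
    have hd : ∀ x : ℝ, 0 < x → triInt α (-lam) 1 x =
        c₁ * (lam / (α + 1)) * hFun (α + 1) (lam - 1) x +
          c₂ * α * hTilde (α + 1) (lam - 1) x := by
      intro x hx
      have h1 := (hsol x hx).1
      have h2 := ((hFun_hasDerivAt hN lam x).const_mul c₁).add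
        ((hTilde_hasDerivAt hN lam hx).const_mul c₂)
      have h3 : triInt α (-lam) 0 =ᶠ[𝓝 x] fun y => c₁ * hFun α lam y + c₂ * hTilde α lam y := by
        filter_upwards [Ioi_mem_nhds hx] with y hy using hc y hy
      have h4 := h1.unique (h2.congr_of_eventuallyEq h3)
      linear_combination -h4
    have l1 : Tendsto (fun x : ℝ => ((x ^ (α + 1) : ℝ) : ℂ)) (𝓝[>] 0) (𝓝 0) := by
      have : ContinuousAt (fun x : ℝ => ((x ^ (α + 1) : ℝ) : ℂ)) 0 :=
        Complex.continuous_ofReal.continuousAt.comp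
          (Real.continuousAt_rpow_const 0 (α + 1) (Or.inr (by linarith)))
      have h := this.tendsto.mono_left (nhdsWithin_le_nhds (s := Ioi 0))
      simpa [Real.zero_rpow (by linarith : α + 1 ≠ 0)] using h
    have l2 := (hFun_analyticAt hN.add_one (lam - 1) 0).continuousAt.tendsto.mono_left
      (nhdsWithin_le_nhds (s := Ioi 0))
    have l3 := (hFun_analyticAt hN.add_one.neg (lam - 1 + (α + 1 : ℝ)) 0).continuousAt.tendsto.mono_left
      (nhdsWithin_le_nhds (s := Ioi 0))
    rw [show hFun (-(α + 1)) (lam - 1 + (α + 1 : ℝ)) 0 = 1 from kummerM_zero _ _] at l3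
    have l4 := ((l1.mul l2).const_mul (c₁ * (lam / (α + 1)))).add (l3.const_mul (c₂ * α))
    rw [zero_mul, mul_zero, zero_add, mul_one] at l4
    have l5 := triInt_one_tendsto hα hα' ha
    have l6 := tendsto_nhds_unique (l4.congr' (eventually_nhdsWithin_of_forall fun x hx => ?_)) l5
    · rw [Complex.Gamma_add_one _ hN.ne_zero] at l6
      have := hN.ne_zero
      field_simp
      refine mul_right_cancel₀ this ?_
      linear_combination l6
    · have hx0 : 0 < x := hx
      rw [hd x hx0, hTilde_eq]
      have e : ((x ^ (α + 1) : ℝ) : ℂ) * ((x ^ (-(α + 1)) : ℝ) : ℂ) = 1 := by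
        rw [← Complex.ofReal_mul, ← Real.rpow_add hx0]
        simp
      linear_combination (-c₂ * α * hFun (-(α + 1)) (lam - 1 + (α + 1 : ℝ)) x) * e
  have hlim := (triInt_tendsto_atTop hα ha).const_mul (Complex.Gamma (-lam))⁻¹
  rw [inv_mul_cancel₀ hG] at hlim
  refine hlim.congr' ?_
  filter_upwards [eventually_gt_atTop 0] with x hx
  rw [hc x hx, e1, e2, triF]
  field_simp

theorem cpow_sub_one_ofReal {x : ℝ} (hx : 0 < x) (z : ℂ) :
    (x : ℂ) ^ (z - 1) = (x : ℂ) ^ z * (x : ℂ)⁻¹ := by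
  rw [Complex.cpow_sub _ _ (by exact_mod_cast hx.ne'), Complex.cpow_one, div_eq_mul_inv]

theorem tendsto_ofReal_inv_atTop : Tendsto (fun x : ℝ => (x : ℂ)⁻¹) atTop (𝓝 0) := by
  have := (Complex.continuous_ofReal.tendsto (0 : ℝ)).comp tendsto_inv_atTop_zero
  simpa [Function.comp_def] using this

theorem TriAsymp.step_lam {α : ℝ} (hα : NonInt α) {lam : ℂ} (h : TriAsymp α lam)
    (h' : TriAsymp α (lam - 1)) : TriAsymp α (lam + 1) := by
  have i := tendsto_ofReal_inv_atTop
  have h1 := ((i.mul h).const_mul (-(α + 1 + 2 * lam))).add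
    (h.add (((i.mul i).mul h').const_mul (-(lam * (lam + α)))))
  simp only [zero_mul, mul_zero, zero_add, add_zero] at h1
  refine h1.congr' ?_
  filter_upwards [eventually_gt_atTop 0] with x hx
  have hx' : (x : ℂ) ≠ 0 := by exact_mod_cast hx.ne'
  have e1 : (x : ℂ) ^ (-(lam + 1)) = (x : ℂ) ^ (-lam) * (x : ℂ)⁻¹ := by
    rw [← cpow_sub_one_ofReal hx]
    ring_nf
  have e2 : (x : ℂ) ^ (-(lam - 1)) = (x : ℂ) ^ (-lam) * x := by
    rw [show -(lam - 1) = -lam + 1 by ring, Complex.cpow_add _ _ hx', Complex.cpow_one]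
  rw [triF_contiguous_lam hα lam x, e1, e2]
  field_simp
  ring

theorem TriAsymp.step_sub {α : ℝ} (hα : NonInt α) {lam : ℂ} (h : TriAsymp α lam)
    (h' : TriAsymp α (lam - 1)) : TriAsymp (α - 1) lam := by
  have i := tendsto_ofReal_inv_atTop
  have h1 := h.add ((i.mul h').const_mul lam)
  simp only [zero_mul, mul_zero, add_zero] at h1
  refine h1.congr' ?_
  filter_upwards [eventually_gt_atTop 0] with x hx
  have hx' : (x : ℂ) ≠ 0 := by exact_mod_cast hx.ne'
  have e2 : (x : ℂ) ^ (-(lam - 1)) = (x : ℂ) ^ (-lam) * x := by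
    rw [show -(lam - 1) = -lam + 1 by ring, Complex.cpow_add _ _ hx', Complex.cpow_one]
  rw [triF_sub_one hα lam hx, e2]
  field_simp

theorem TriAsymp.step_add {α : ℝ} (hα : NonInt α) {lam : ℂ} (h : TriAsymp α lam)
    (h' : TriAsymp α (lam + 1)) : TriAsymp (α + 1) lam := by
  have i := tendsto_ofReal_inv_atTop
  have h1 := ((i.mul h).const_mul (α + 1 + lam)).add h'
  simp only [zero_mul, mul_zero, zero_add] at h1
  refine h1.congr' ?_
  filter_upwards [eventually_gt_atTop 0] with x hx
  have hx' : (x : ℂ) ≠ 0 := by exact_mod_cast hx.ne'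
  have e1 : (x : ℂ) ^ (-(lam + 1)) = (x : ℂ) ^ (-lam) * (x : ℂ)⁻¹ := by
    rw [← cpow_sub_one_ofReal hx]
    ring_nf
  have e : triF (α + 1) lam x = (x : ℂ)⁻¹ * ((α + 1 + lam) * triF α lam x + triF α (lam + 1) x) := by
    rw [← triF_add_one hα lam hx]
    field_simp
  rw [e, e1]
  ring

/-- The three-term relation in `λ` pushes the bound on `Re λ` up by one at a time, for `-1 < α < 0`;
the relations between `α` and `α ± 1` then reach every non-integer `α`. -/
theorem triAsymp {α : ℝ} (hα : NonInt α) (lam : ℂ) : TriAsymp α lam := by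
  have base : ∀ α : ℝ, -1 < α → α < 0 → ∀ lam, TriAsymp α lam := by
    intro α h1 h2
    have hN : NonInt α := fun k hk => by
      rw [hk] at h1 h2
      have h1 : -1 < k := by exact_mod_cast h1
      have h2 : k < 0 := by exact_mod_cast h2
      omega
    have main : ∀ n : ℕ, ∀ lam : ℂ, lam.re < n → TriAsymp α lam := by
      intro n
      induction n using Nat.strong_induction_on with
      | _ n ih =>
        intro lam hl
        by_cases h0 : lam.re < 0
        · exact triAsymp_base h2 h1 h0
        · obtain ⟨m, rfl⟩ : ∃ m, n = m + 1 := Nat.exists_eq_succ_of_ne_zero (by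
            rintro rfl
            simp at hl
            exact h0 hl)
          push_cast at hl
          have a1 := ih m (by omega) (lam - 1) (by simp; linarith)
          have a2 := ih m (by omega) (lam - 1 - 1) (by simp; linarith)
          have := a1.step_lam hN a2
          rwa [sub_add_cancel] at this
    intro lam
    obtain ⟨n, hn⟩ := exists_nat_gt lam.re
    exact main n lam hn
  have up : ∀ (n : ℕ) (α : ℝ), -1 < α → α < 0 → ∀ lam, TriAsymp (α + n) lam := by
    intro n α h1 h2
    induction n with
    | zero => simpa using base α h1 h2
    | succ n ih =>
      intro lam
      have hN : NonInt (α + n) := by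
        have : NonInt α := fun k hk => by
          rw [hk] at h1 h2
          have h1 : -1 < k := by exact_mod_cast h1
          have h2 : k < 0 := by exact_mod_cast h2
          omega
        simpa using this.add_int n
      have := (ih lam).step_add hN (ih (lam + 1))
      push_cast
      rwa [← add_assoc]
  have down : ∀ (n : ℕ) (α : ℝ), -1 < α → α < 0 → ∀ lam, TriAsymp (α - n) lam := by
    intro n α h1 h2
    induction n with
    | zero => simpa using base α h1 h2
    | succ n ih =>
      intro lam
      have hN : NonInt (α - n) := by
        have : NonInt α := fun k hk => by
          rw [hk] at h1 h2
          have h1 : -1 < k := by exact_mod_cast h1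
          have h2 : k < 0 := by exact_mod_cast h2
          omega
        simpa [sub_eq_add_neg] using this.add_int (-n)
      have := (ih lam).step_sub hN (ih (lam - 1))
      push_cast
      rwa [← sub_sub]
  -- As `α` is not an integer, `α - m` lies in the open interval `(-1, 0)`.
  set m := ⌊α⌋ + 1 with hm
  have h1 : -1 < α - m := by
    have := (Int.floor_le α).lt_of_ne fun h => hα _ h.symm
    push_cast [hm]
    linarith
  have h2 : α - m < 0 := by
    have := Int.lt_floor_add_one α
    push_cast [hm]
    linarith
  rcases Int.eq_nat_or_neg m with ⟨n, hn | hn⟩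
  · have := up n _ h1 h2 lam
    rwa [hn, Int.cast_natCast, sub_add_cancel] at this
  · have := down n _ h1 h2 lam
    rw [hn] at this
    simpa using this


/-! ### Growth at infinity -/

/-- `f = O(x^N e^(kx))` at infinity for some `N`. -/
def ExpGrowth (k : ℝ) (f : ℝ → ℂ) : Prop :=
  ∃ N : ℕ, f =O[atTop] fun x : ℝ => x ^ N * Real.exp (k * x)

theorem pow_isBigO_pow {m n : ℕ} (h : m ≤ n) :
    (fun x : ℝ => x ^ m) =O[atTop] fun x : ℝ => x ^ n := by
  refine IsBigO.of_bound 1 ?_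
  filter_upwards [eventually_ge_atTop 1] with x hx
  rw [one_mul, Real.norm_of_nonneg (by positivity), Real.norm_of_nonneg (by positivity)]
  exact pow_le_pow_right₀ hx h

theorem ExpGrowth.mul {k l : ℝ} {f g : ℝ → ℂ} (hf : ExpGrowth k f) (hg : ExpGrowth l g) :
    ExpGrowth (k + l) fun x => f x * g x := by
  obtain ⟨N, hN⟩ := hf
  obtain ⟨M, hM⟩ := hg
  refine ⟨N + M, (hN.mul hM).congr_right fun x => ?_⟩
  rw [add_mul, Real.exp_add, pow_add]
  ring

theorem ExpGrowth.mono {k : ℝ} {f : ℝ → ℂ} {N M : ℕ} (h : N ≤ M)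
    (hf : f =O[atTop] fun x : ℝ => x ^ N * Real.exp (k * x)) :
    f =O[atTop] fun x : ℝ => x ^ M * Real.exp (k * x) :=
  hf.trans ((pow_isBigO_pow h).mul (isBigO_refl _ _))

theorem ExpGrowth.add {k : ℝ} {f g : ℝ → ℂ} (hf : ExpGrowth k f) (hg : ExpGrowth k g) :
    ExpGrowth k fun x => f x + g x := by
  obtain ⟨N, hN⟩ := hf
  obtain ⟨M, hM⟩ := hg
  exact ⟨max N M, (ExpGrowth.mono (le_max_left _ _) hN).add (ExpGrowth.mono (le_max_right _ _) hM)⟩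

theorem expGrowth_const (c : ℂ) : ExpGrowth 0 fun _ => c :=
  ⟨0, by simpa using isBigO_const_const c (one_ne_zero (α := ℝ)) _⟩

theorem ExpGrowth.const_mul {k : ℝ} {f : ℝ → ℂ} (c : ℂ) (hf : ExpGrowth k f) :
    ExpGrowth k fun x => c * f x := by
  simpa using (expGrowth_const c).mul hf

theorem ExpGrowth.congr {k : ℝ} {f g : ℝ → ℂ} (hf : ExpGrowth k f)
    (h : ∀ x : ℝ, 0 < x → g x = f x) : ExpGrowth k g := by
  obtain ⟨N, hN⟩ := hf
  refine ⟨N, hN.congr' ?_ EventuallyEq.rfl⟩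
  filter_upwards [eventually_gt_atTop 0] with x hx using (h x hx).symm

theorem ExpGrowth.sum {ι : Type*} {k : ℝ} {f : ι → ℝ → ℂ} (s : Finset ι)
    (h : ∀ i ∈ s, ExpGrowth k (f i)) : ExpGrowth k fun x => ∑ i ∈ s, f i x := by
  classical
  induction s using Finset.induction_on with
  | empty =>
    refine ⟨0, ?_⟩
    simp only [Finset.sum_empty]
    exact isBigO_zero _ _
  | insert a s ha ih =>
    simp only [Finset.sum_insert ha]
    exact (h a (Finset.mem_insert_self a s)).add
      (ih fun i hi => h i (Finset.mem_insert_of_mem hi))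

theorem ExpGrowth.prod {ι : Type*} {k : ι → ℝ} {f : ι → ℝ → ℂ} (s : Finset ι)
    (h : ∀ i ∈ s, ExpGrowth (k i) (f i)) : ExpGrowth (∑ i ∈ s, k i) fun x => ∏ i ∈ s, f i x := by
  classical
  induction s using Finset.induction_on with
  | empty => simpa using expGrowth_const 1
  | insert a s ha ih =>
    simp only [Finset.prod_insert ha, Finset.sum_insert ha]
    exact (h a (Finset.mem_insert_self a s)).mul
      (ih fun i hi => h i (Finset.mem_insert_of_mem hi))

theorem expGrowth_rpow (s : ℝ) : ExpGrowth 0 fun x : ℝ => ((x ^ s : ℝ) : ℂ) := by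
  refine ⟨⌈s⌉₊, IsBigO.of_bound 1 ?_⟩
  filter_upwards [eventually_ge_atTop 1] with x hx
  have hx0 : 0 < x := by linarith
  rw [Complex.norm_real, Real.norm_of_nonneg (by positivity), Real.norm_of_nonneg (by positivity),
    one_mul, zero_mul, Real.exp_zero, mul_one, ← Real.rpow_natCast]
  exact Real.rpow_le_rpow_of_exponent_le hx (Nat.le_ceil s)

theorem expGrowth_exp (k : ℝ) : ExpGrowth k fun x : ℝ => ((Real.exp (k * x) : ℝ) : ℂ) := by
  refine ⟨0, IsBigO.of_bound 1 (Eventually.of_forall fun x => ?_)⟩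
  simp [Complex.norm_exp]

theorem triF_expGrowth {α : ℝ} (hα : NonInt α) (lam : ℂ) : ExpGrowth 0 (triF α lam) := by
  have h1 : (fun x : ℝ => (x : ℂ) ^ (-lam) * triF α lam x) =O[atTop] fun _ => (1 : ℝ) :=
    (triAsymp hα lam).isBigO_one ℝ
  obtain ⟨N, hN⟩ := expGrowth_rpow lam.re
  have h2 : (fun x : ℝ => (x : ℂ) ^ lam) =O[atTop] fun x : ℝ => x ^ N * Real.exp (0 * x) := by
    refine IsBigO.trans (IsBigO.of_bound 1 ?_) hN
    filter_upwards [eventually_gt_atTop 0] with x hx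
    rw [Complex.norm_cpow_eq_rpow_re_of_pos hx, Complex.norm_real,
      Real.norm_of_nonneg (by positivity), one_mul]
  refine ⟨N, ((h2.mul h1).congr_right fun x => mul_one _).congr' ?_ EventuallyEq.rfl⟩
  filter_upwards [eventually_gt_atTop 0] with x hx
  have hx' : (x : ℂ) ≠ 0 := by exact_mod_cast hx.ne'
  rw [← mul_assoc, ← Complex.cpow_add _ _ hx']
  simp

theorem triF_iteratedDeriv {α : ℝ} (hα : NonInt α) (lam : ℂ) (j : ℕ) :
    ∃ c : ℂ, ∀ x : ℝ, 0 < x → iteratedDeriv j (triF α lam) x = c * triF (α + j) (lam - j) x := by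
  induction j with
  | zero => exact ⟨1, fun x _ => by simp⟩
  | succ j ih =>
    obtain ⟨c, hc⟩ := ih
    refine ⟨c * (lam - j), fun x hx => ?_⟩
    rw [iteratedDeriv_succ]
    have h : iteratedDeriv j (triF α lam) =ᶠ[𝓝 x] fun x => c * triF (α + j) (lam - j) x := by
      filter_upwards [Ioi_mem_nhds hx] with y hy using hc y hy
    have hN : NonInt (α + j) := by simpa using hα.add_int j
    rw [h.deriv_eq, ((triF_hasDerivAt hN (lam - j) hx).const_mul c).deriv]
    push_cast
    rw [add_assoc, sub_sub, mul_assoc]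

theorem triF_iteratedDeriv_expGrowth {α : ℝ} (hα : NonInt α) (lam : ℂ) (j : ℕ) :
    ExpGrowth 0 (iteratedDeriv j (triF α lam)) := by
  obtain ⟨c, hc⟩ := triF_iteratedDeriv hα lam j
  have hN : NonInt (α + j) := by simpa using hα.add_int j
  exact ((triF_expGrowth hN (lam - j)).const_mul c).congr hc

theorem wronskian_eq_zero_of_expGrowth {f f' χ χ' : ℝ → ℂ} {p : ℝ → ℝ} {c : ℂ}
    (hf : ∀ x : ℝ, 0 < x → HasDerivAt f (f' x) x)
    (hχ : ∀ x : ℝ, 0 < x → HasDerivAt χ (χ' x) x) (hχ' : ContinuousOn χ' (Ioi 0))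
    (hp : ∀ x, 0 < x → 0 < p x) (hpc : ContinuousOn p (Ioi 0))
    (hW : ∀ x : ℝ, 0 < x → (p x : ℂ) * (f x * χ' x - f' x * χ x) = c)
    (bχ : ExpGrowth 0 χ) (bχ' : ExpGrowth 0 χ') (bp : ExpGrowth (-1) fun x => (p x : ℂ))
    (bf : ExpGrowth (1 / 2) fun X => ((∫ x in X..X + 1, ‖f x‖ : ℝ) : ℂ)) : c = 0 := by
  obtain ⟨N₁, h₁⟩ := bχ
  obtain ⟨N₂, h₂⟩ := bχ'
  obtain ⟨N₃, h₃⟩ := bp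
  obtain ⟨N₄, h₄⟩ := bf
  set N := max (max N₁ N₂) (max N₃ N₄)
  obtain ⟨C₁, c₁⟩ := (ExpGrowth.mono (M := N) (by simp [N]) h₁).bound
  obtain ⟨C₂, c₂⟩ := (ExpGrowth.mono (M := N) (by simp [N]) h₂).bound
  obtain ⟨C₃, c₃⟩ := (ExpGrowth.mono (M := N) (by simp [N]) h₃).bound
  obtain ⟨C₄, c₄⟩ := (ExpGrowth.mono (M := N) (by simp [N]) h₄).bound
  obtain ⟨X, hX⟩ := eventually_atTop.1 (c₁.and (c₂.and (c₃.and (c₄.and (eventually_ge_atTop 1)))))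
  set C := max (max C₁ C₂) (max C₃ C₄)
  have key : ∀ {D k x : ℝ} {z : ℂ}, D ≤ C → 1 ≤ x → ‖z‖ ≤ D * ‖x ^ N * Real.exp (k * x)‖ →
      ‖z‖ ≤ C * x ^ N * Real.exp (k * x) := by
    intro D k x z hD hx hz
    have hx0 : 0 ≤ x := by linarith
    rw [Real.norm_of_nonneg (by positivity)] at hz
    rw [mul_assoc]
    exact hz.trans (mul_le_mul_of_nonneg_right hD (by positivity))
  have hX1 : 1 ≤ X := (hX X le_rfl).2.2.2.2
  refine wronskian_eq_zero_of_growth (C := C) (N := N) (X₀ := X) hX1 hf hχ hχ' hp hpc hW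
    (fun x hx => ?_) (fun x hx => ?_) (fun x hx => ?_) (fun x hx => ?_)
  · simpa using key (by simp [C]) (hX1.trans hx) (hX x hx).1
  · simpa using key (by simp [C]) (hX1.trans hx) (hX x hx).2.1
  · have := key (by simp [C]) (hX1.trans hx) (hX x hx).2.2.1
    rw [Complex.norm_real, neg_one_mul] at this
    exact (le_abs_self _).trans this
  · have := key (by simp [C]) (hX1.trans hx) (hX x hx).2.2.2.1
    rw [Complex.norm_real, one_div_mul_eq_div] at this
    exact (le_abs_self _).trans this

/-! ### Uniqueness of Tricomi's function -/

/-- If both coefficients vanished, `-λ-α` and `-λ` would both be poles of `Gamma`, and `α` would be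
an integer. -/
theorem gamma_coeff_ne_zero {α : ℝ} (hα : NonInt α) (lam : ℂ) :
    Complex.Gamma (-α) * (Complex.Gamma (-lam - α))⁻¹ ≠ 0 ∨
      Complex.Gamma α * (Complex.Gamma (-lam))⁻¹ ≠ 0 := by
  have h1 : Complex.Gamma (-α) ≠ 0 := Complex.Gamma_ne_zero fun m hm =>
    hα m (by exact_mod_cast neg_injective hm)
  have h2 : Complex.Gamma α ≠ 0 := Complex.Gamma_ne_zero fun m hm =>
    hα (-m) (by exact_mod_cast hm)
  by_contra! h
  obtain ⟨h3, h4⟩ := h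
  rw [mul_eq_zero, inv_eq_zero] at h3 h4
  obtain ⟨m, hm⟩ := Complex.Gamma_eq_zero_iff _ |>.1 (h3.resolve_left h1)
  obtain ⟨n, hn⟩ := Complex.Gamma_eq_zero_iff _ |>.1 (h4.resolve_left h2)
  refine hα (m - n) ?_
  have : (α : ℂ) = ((m - n : ℝ) : ℂ) := by
    push_cast
    linear_combination hn - hm
  have := Complex.ofReal_injective this
  rw [this]
  push_cast
  ring

theorem clP_expGrowth (α : ℝ) : ExpGrowth (-1) fun x => (clP α x : ℂ) := by
  have := (expGrowth_rpow (α + 1)).mul (expGrowth_exp (-1))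
  simp only [zero_add, neg_one_mul] at this
  refine this.congr fun x _ => ?_
  simp [clP]

theorem isTricomiU_triF {α : ℝ} (hα : NonInt α) (lam : ℂ) :
    IsTricomiU (-lam) (α + 1) (triF α lam) := by
  refine ⟨fun x hx => ?_, triAsymp hα lam⟩
  obtain ⟨h1, h2⟩ := triF_linSol hα lam x hx
  refine ⟨h1.differentiableAt, h2.differentiableAt, ?_⟩
  rw [h2.deriv]
  have hx' : (x : ℂ) ≠ 0 := by exact_mod_cast hx.ne'
  simp only [clQ, clR]
  field_simp
  ring

/-- The vanishing criterion for Wronskians asks only for bounds on means over unit intervals; this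
derives them from a pointwise bound. -/
theorem mean_expGrowth {k : ℝ} (hk : 0 ≤ k) {f : ℝ → ℂ} (hc : ContinuousOn f (Ioi 0))
    (hf : ExpGrowth k f) : ExpGrowth k fun X => ((∫ x in X..X + 1, ‖f x‖ : ℝ) : ℂ) := by
  obtain ⟨N, hN⟩ := hf
  obtain ⟨C, hC, hb⟩ := hN.exists_pos
  rw [isBigOWith_iff, eventually_atTop] at hb
  obtain ⟨X₀, hX₀⟩ := hb
  refine ⟨N, IsBigO.of_bound (C * 2 ^ N * Real.exp k) ?_⟩
  filter_upwards [eventually_ge_atTop X₀, eventually_ge_atTop 1] with X h1 h2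
  have hX0 : 0 < X := by linarith
  have hle : ∀ x ∈ Icc X (X + 1), ‖f x‖ ≤ C * ((2 * X) ^ N * Real.exp (k * (X + 1))) := by
    intro x hx
    have hx0 : 0 < x := by linarith [hx.1]
    refine (hX₀ x (h1.trans hx.1)).trans ?_
    rw [Real.norm_of_nonneg (by positivity)]
    have a1 : x ≤ 2 * X := by linarith [hx.2]
    have a2 := hx.2
    gcongr
  have hsub : uIcc X (X + 1) ⊆ Ioi 0 := by
    rw [uIcc_of_le (by linarith)]
    exact fun x hx => lt_of_lt_of_le hX0 hx.1
  have h3 : ∫ x in X..X + 1, ‖f x‖ ≤ ∫ _ in X..X + 1, C * ((2 * X) ^ N * Real.exp (k * (X + 1))) :=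
    intervalIntegral.integral_mono_on (by linarith) (hc.mono hsub).norm.intervalIntegrable
      intervalIntegrable_const hle
  have h4 : 0 ≤ ∫ x in X..X + 1, ‖f x‖ :=
    intervalIntegral.integral_nonneg (by linarith) fun _ _ => norm_nonneg _
  rw [Complex.norm_real, Real.norm_of_nonneg h4, Real.norm_of_nonneg (by positivity)]
  refine h3.trans_eq ?_
  rw [intervalIntegral.integral_const, smul_eq_mul, mul_add, Real.exp_add, mul_pow]
  ring_nf

theorem ExpGrowth.weaken {k l : ℝ} (h : k ≤ l) {f : ℝ → ℂ} (hf : ExpGrowth k f) :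
    ExpGrowth l f := by
  obtain ⟨N, hN⟩ := hf
  refine ⟨N, hN.trans (IsBigO.of_bound 1 ?_)⟩
  filter_upwards [eventually_gt_atTop 0] with x hx
  rw [one_mul, Real.norm_of_nonneg (by positivity), Real.norm_of_nonneg (by positivity)]
  gcongr

/-- Two combinations of independent solutions whose Wronskian vanishes are proportional. -/
theorem exists_multiple_of_det_eq_zero {a b c d : ℂ} (h : a * d - b * c = 0) (hcd : c ≠ 0 ∨ d ≠ 0) :
    ∃ k : ℂ, a = k * c ∧ b = k * d := by
  rcases hcd with hc | hd
  · refine ⟨a / c, by field_simp, ?_⟩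
    field_simp
    linear_combination -h
  · refine ⟨b / d, ?_, by field_simp⟩
    field_simp
    linear_combination h

/-- Both solutions grow at most algebraically, so their weighted Wronskian, a constant, is zero.
Hence `f` is a multiple of `triF`, and the normalisation at infinity makes the factor 1. -/
theorem isTricomiU_unique {α : ℝ} (hα : NonInt α) {lam : ℂ} {f : ℝ → ℂ}
    (hf : IsTricomiU (-lam) (α + 1) f) {x : ℝ} (hx : 0 < x) : f x = triF α lam x := by
  have hsol : LinSol (clQ α) (clR lam) f (deriv f) := by
    refine KEq.linSol (fun x hx => ?_) (fun x hx => (hf.1 x hx).1) fun x hx => (hf.1 x hx).2.1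
    have := (hf.1 x hx).2.2
    simp only [KEq]
    linear_combination this
  have hgrow : ExpGrowth 0 f := by
    have h1 : (fun x : ℝ => (x : ℂ) ^ (-lam) * f x) =O[atTop] fun _ => (1 : ℝ) :=
      hf.2.isBigO_one ℝ
    have h2 : ∀ᶠ x : ℝ in atTop, ‖(x : ℂ) ^ lam‖ ≤ x ^ ⌈lam.re⌉₊ := by
      filter_upwards [eventually_ge_atTop 1] with x hx
      rw [Complex.norm_cpow_eq_rpow_re_of_pos (by linarith), ← Real.rpow_natCast]
      exact Real.rpow_le_rpow_of_exponent_le hx (Nat.le_ceil _)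
    have h3 : (fun x : ℝ => (x : ℂ) ^ lam) =O[atTop]
        fun x : ℝ => x ^ ⌈lam.re⌉₊ * Real.exp (0 * x) := by
      refine IsBigO.of_bound 1 ?_
      filter_upwards [h2] with x hx
      simpa using hx.trans (le_abs_self _)
    refine ⟨_, ((h3.mul h1).congr_right fun x => mul_one _).congr' ?_ EventuallyEq.rfl⟩
    filter_upwards [eventually_gt_atTop 0] with x hx
    have hx' : (x : ℂ) ≠ 0 := by exact_mod_cast hx.ne'
    rw [← mul_assoc, ← Complex.cpow_add _ _ hx']
    simp
  have hcf : ContinuousOn f (Ioi 0) := fun x hx => (hsol x hx).1.continuousAt.continuousWithinAt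
  obtain ⟨w, hw⟩ := hsol.abel (triF_linSol hα lam) (p := fun x => (clP α x : ℂ))
    fun x hx => clP_hasDerivAt α hx
  have hw0 : w = 0 := by
    refine wronskian_eq_zero_of_expGrowth (fun x hx => (hsol x hx).1)
      (fun x hx => (triF_linSol hα lam x hx).1)
      (fun x hx => (triF_linSol hα lam x hx).2.continuousAt.continuousWithinAt)
      (fun x hx => clP_pos α hx) (clP_continuousOn α) hw (triF_expGrowth hα lam) ?_
      (clP_expGrowth α) ((mean_expGrowth le_rfl hcf hgrow).weaken (by norm_num))
    simpa using triF_iteratedDeriv_expGrowth hα lam 1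
  obtain ⟨d₁, d₂, hd⟩ := exists_comb_hFun_hTilde hα hsol
  set c₁ := Complex.Gamma (-α) * (Complex.Gamma (-lam - α))⁻¹ with hc₁
  set c₂ := Complex.Gamma α * (Complex.Gamma (-lam))⁻¹ with hc₂
  have hdet : d₁ * c₂ - d₂ * c₁ = 0 := by
    have h1 := hw 1 one_pos
    have h2 := hFun_hTilde_wronskian hα lam one_pos
    have hcomb : ∀ (g : ℝ → ℂ) (a b : ℂ),
        (∀ x : ℝ, 0 < x → g x = a * hFun α lam x + b * hTilde α lam x) →
        deriv g 1 = a * deriv (hFun α lam) 1 + b * deriv (hTilde α lam) 1 := by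
      intro g a b hg
      have e : g =ᶠ[𝓝 1] fun x => a * hFun α lam x + b * hTilde α lam x := by
        filter_upwards [Ioi_mem_nhds one_pos] with y hy using hg y hy
      rw [e.deriv_eq]
      exact (((hFun_linSol hα lam 1 one_pos).1.const_mul a).add
        ((hTilde_linSol hα lam 1 one_pos).1.const_mul b)).deriv
    rw [hw0, hd 1 one_pos, hcomb f d₁ d₂ hd, hcomb (triF α lam) c₁ c₂ fun _ _ => rfl,
      show triF α lam 1 = c₁ * hFun α lam 1 + c₂ * hTilde α lam 1 from rfl] at h1
    have h3 : (d₁ * c₂ - d₂ * c₁) * -α = 0 := by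
      rw [← h2]
      linear_combination h1
    exact (mul_eq_zero.1 h3).resolve_right (neg_ne_zero.2 hα.ne_zero)
  obtain ⟨k, hk₁, hk₂⟩ := exists_multiple_of_det_eq_zero hdet (gamma_coeff_ne_zero hα lam)
  have hfk : ∀ x : ℝ, 0 < x → f x = k * triF α lam x := fun x hx => by
    rw [hd x hx, hk₁, hk₂, triF]
    ring
  have hk : k = 1 := by
    have h1 := (triAsymp hα lam).const_mul k
    rw [mul_one] at h1
    refine tendsto_nhds_unique (h1.congr' ?_) hf.2
    filter_upwards [eventually_gt_atTop 0] with x hx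
    rw [hfk x hx]
    ring
  rw [hfk x hx, hk, one_mul]

/-- The choice in `tricomiU` is arbitrary for `x ≤ 0`, so the equality is confined to the half-line.
-/
theorem tricomiU_eq {α : ℝ} (hα : NonInt α) (lam : ℂ) {x : ℝ} (hx : 0 < x) :
    tricomiU (-lam) (α + 1) x = triF α lam x := by
  have hex : ∃ f, IsTricomiU (-lam) (α + 1) f := ⟨_, isTricomiU_triF hα lam⟩
  rw [tricomiU, dif_pos hex]
  exact isTricomiU_unique hα hex.choose_spec hx


/-! ### Wronskians -/

/-- The determinant of the leading block of an infinite matrix. -/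
def leadDet (e : ℕ → ℕ → ℂ) (n : ℕ) : ℂ := (Matrix.of fun i j : Fin n => e i j).det

/-- The leading block of size `n` bordered by row `r` and column `c`. -/
def borderDet (e : ℕ → ℕ → ℂ) (n r c : ℕ) : ℂ :=
  (Matrix.of fun i j : Fin (n + 1) => e (if (i : ℕ) < n then i else r) (if (j : ℕ) < n then j else c)).det

theorem borderDet_self (e : ℕ → ℕ → ℂ) (n : ℕ) : borderDet e n n n = leadDet e (n + 1) := by
  unfold borderDet leadDet
  congr 1
  ext i j
  simp only [Matrix.of_apply]
  congr 1 <;> split_ifs <;> omega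

/-- Sylvester's identity by Schur complements: with `A` the leading block and `S` its Schur
complement, a bordered determinant is `det A * S r c`, and the block of size `n + 2` is `det A`
times a two by two determinant of entries of `S`. -/
theorem leadDet_mul_leadDet (e : ℕ → ℕ → ℂ) (n : ℕ) (h : leadDet e n ≠ 0) :
    leadDet e (n + 2) * leadDet e n = borderDet e n n n * borderDet e n (n + 1) (n + 1) -
      borderDet e n n (n + 1) * borderDet e n (n + 1) n := by
  set A : Matrix (Fin n) (Fin n) ℂ := Matrix.of fun i j : Fin n => e i j with hA
  have hdet : IsUnit A.det := isUnit_iff_ne_zero.2 h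
  let _ := Matrix.invertibleOfIsUnitDet A hdet
  set S : ℕ → ℕ → ℂ := fun r c =>
    e r c - ∑ k : Fin n, (∑ l : Fin n, e r l * (⅟A) l k) * e k c with hS
  have hb : ∀ r c, borderDet e n r c = A.det * S r c := by
    intro r c
    have h1 := Matrix.det_fromBlocks₁₁ A (Matrix.of fun (i : Fin n) (_ : Fin 1) => e i c)
      (Matrix.of fun (_ : Fin 1) (j : Fin n) => e r j) (Matrix.of fun (_ _ : Fin 1) => e r c)
    rw [Matrix.det_fin_one] at h1
    simp only [Matrix.sub_apply, Matrix.mul_apply, Matrix.of_apply] at h1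
    rw [← h1, borderDet, ← Matrix.det_submatrix_equiv_self finSumFinEquiv]
    congr 1
    ext i j
    rcases i with i | i <;> rcases j with j | j <;> simp [hA]
  have h2 := Matrix.det_fromBlocks₁₁ A (Matrix.of fun (i : Fin n) (j : Fin 2) => e i (n + j))
      (Matrix.of fun (i : Fin 2) (j : Fin n) => e (n + i) j)
      (Matrix.of fun (i j : Fin 2) => e (n + i) (n + j))
  rw [Matrix.det_fin_two] at h2
  simp only [Matrix.sub_apply, Matrix.mul_apply, Matrix.of_apply] at h2
  have h3 : leadDet e (n + 2) = A.det * (S n n * S (n + 1) (n + 1) - S n (n + 1) * S (n + 1) n) := by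
    rw [leadDet, ← Matrix.det_submatrix_equiv_self finSumFinEquiv]
    simp only [hS]
    refine Eq.trans ?_ h2
    congr 1
    ext i j
    rcases i with i | i <;> rcases j with j | j <;> simp [hA]
  rw [h3, hb, hb, hb, hb]
  change _ * A.det = _
  ring

theorem hasDerivAt_det {n : ℕ} {M : ℝ → Matrix (Fin n) (Fin n) ℂ} {M' : Matrix (Fin n) (Fin n) ℂ}
    {x : ℝ} (h : ∀ i j, HasDerivAt (fun x => M x i j) (M' i j) x) :
    HasDerivAt (fun x => (M x).det) (∑ i, ((M x).updateRow i (M' i)).det) x := by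
  have e : (fun x => (M x).det) = fun x => ∑ σ : Equiv.Perm (Fin n),
      ((Equiv.Perm.sign σ : ℤ) : ℂ) * ∏ i, M x i (σ i) := by
    ext x
    rw [← Matrix.det_transpose, Matrix.det_apply']
    rfl
  rw [e]
  have h1 : ∀ σ : Equiv.Perm (Fin n), HasDerivAt (fun x => ((Equiv.Perm.sign σ : ℤ) : ℂ) *
      ∏ i, M x i (σ i)) (((Equiv.Perm.sign σ : ℤ) : ℂ) *
        ∑ i, (∏ j ∈ Finset.univ.erase i, M x j (σ j)) * M' i (σ i)) x := fun σ => by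
    have := HasDerivAt.fun_finsetProd (u := Finset.univ) (f := fun i x => M x i (σ i))
      (f' := fun i => M' i (σ i)) (x := x) fun i _ => h i (σ i)
    simpa only [smul_eq_mul] using this.const_mul _
  refine (HasDerivAt.fun_sum fun σ _ => h1 σ).congr_deriv ?_
  simp only [Finset.mul_sum]
  rw [Finset.sum_comm]
  refine Finset.sum_congr rfl fun i _ => ?_
  rw [← Matrix.det_transpose, Matrix.det_apply']
  refine Finset.sum_congr rfl fun σ _ => ?_
  congr 1
  rw [← Finset.mul_prod_erase Finset.univ _ (Finset.mem_univ i), mul_comm]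
  congr 1
  · simp
  · refine Finset.prod_congr rfl fun j hj => ?_
    simp [Matrix.updateRow_ne (Finset.ne_of_mem_erase hj)]

/-- The matrix of all derivatives of the functions in a list. -/
noncomputable def jet (l : List (ℝ → ℂ)) (x : ℝ) (i j : ℕ) : ℂ := iteratedDeriv i (l.getD j 0) x

theorem wronskian_eq_leadDet (l : List (ℝ → ℂ)) (x : ℝ) :
    wronskian l x = leadDet (jet l x) l.length := by
  unfold wronskian leadDet jet
  congr 1
  ext i j
  simp

/-- All functions in the list are analytic at `x`. -/
def AnaAt (l : List (ℝ → ℂ)) (x : ℝ) : Prop := ∀ f ∈ l, AnalyticAt ℝ f x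

theorem AnaAt.getD {l : List (ℝ → ℂ)} {x : ℝ} (h : AnaAt l x) (j : ℕ) :
    AnalyticAt ℝ (l.getD j 0) x := by
  rw [List.getD_eq_getElem?_getD]
  cases hj : l[j]? with
  | none => exact analyticAt_const
  | some f => exact h f (List.mem_of_getElem? hj)

theorem analyticAt_iteratedDeriv {f : ℝ → ℂ} {x : ℝ} (hf : AnalyticAt ℝ f x) (n : ℕ) :
    AnalyticAt ℝ (iteratedDeriv n f) x := by
  induction n with
  | zero => simpa using hf
  | succ n ih =>
    rw [iteratedDeriv_succ]
    exact ih.deriv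

theorem AnaAt.jet_analyticAt {l : List (ℝ → ℂ)} {x : ℝ} (h : AnaAt l x) (i j : ℕ) :
    AnalyticAt ℝ (fun x => jet l x i j) x := analyticAt_iteratedDeriv (h.getD j) i

theorem AnaAt.wronskian {l : List (ℝ → ℂ)} {x : ℝ} (h : AnaAt l x) :
    AnalyticAt ℝ (wronskian l) x := by
  have e : ExceptionalLaguerre.wronskian l = fun x => ∑ σ : Equiv.Perm (Fin l.length),
      ((Equiv.Perm.sign σ : ℤ) : ℂ) * ∏ i, jet l x (σ i : Fin l.length) (i : Fin l.length) := by
    ext x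
    rw [wronskian_eq_leadDet, leadDet, Matrix.det_apply']
    rfl
  rw [e]
  refine Finset.analyticAt_fun_sum _ fun σ _ => analyticAt_const.mul ?_
  exact Finset.analyticAt_fun_prod _ fun i _ => h.jet_analyticAt _ _

theorem AnaAt.append {l l' : List (ℝ → ℂ)} {x : ℝ} (h : AnaAt l x) (h' : AnaAt l' x) :
    AnaAt (l ++ l') x := fun f hf => (List.mem_append.1 hf).elim (h f) (h' f)

theorem AnaAt.append_singleton {l : List (ℝ → ℂ)} {f : ℝ → ℂ} {x : ℝ} (h : AnaAt l x)
    (hf : AnalyticAt ℝ f x) : AnaAt (l ++ [f]) x := h.append (by simpa [AnaAt] using hf)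

/-- Differentiating any row but the last makes it equal to the next row. Only the last row
contributes, and it becomes the row of derivatives of order `l.length + 1`. -/
theorem deriv_wronskian_append {l : List (ℝ → ℂ)} {y : ℝ → ℂ} {x : ℝ} (h : AnaAt l x)
    (hy : AnalyticAt ℝ y x) :
    deriv (wronskian (l ++ [y])) x =
      borderDet (jet (l ++ [y]) x) l.length (l.length + 1) l.length := by
  set L := l ++ [y] with hL
  have hLn : L.length = l.length + 1 := by simp [hL]
  set n := l.length
  have hana : AnaAt L x := h.append_singleton hy
  have e : wronskian L = fun x => (Matrix.of fun i j : Fin (n + 1) => jet L x i j).det := by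
    ext x
    rw [wronskian_eq_leadDet, hLn]
    rfl
  have hd := hasDerivAt_det (M := fun x => Matrix.of fun i j : Fin (n + 1) => jet L x i j)
    (M' := Matrix.of fun i j : Fin (n + 1) => jet L x (i + 1) j) (x := x) fun i j => by
      have := (hana.jet_analyticAt i j).differentiableAt.hasDerivAt
      refine this.congr_deriv ?_
      simp only [jet, Matrix.of_apply]
      rw [iteratedDeriv_succ]
  rw [e, hd.deriv, Fin.sum_univ_castSucc]
  rw [Finset.sum_eq_zero, zero_add, borderDet]
  · congr 1
    ext i j
    have hj : (if (j : ℕ) < n then (j : ℕ) else n) = j := by split_ifs <;> omega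
    rcases Fin.eq_castSucc_or_eq_last i with ⟨k, rfl⟩ | rfl
    · rw [Matrix.updateRow_ne (Fin.castSucc_lt_last k).ne]
      simp [hj]
    · simp [hj]
  · intro i _
    refine Matrix.det_zero_of_row_eq (i := i.castSucc) (j := i.succ) (Fin.castSucc_lt_succ).ne ?_
    rw [Matrix.updateRow_self, Matrix.updateRow_ne (Fin.castSucc_lt_succ).ne']
    ext j
    simp

/-- The value at `y` of the monic operator annihilating the functions in `l`. -/
noncomputable def crumOp (l : List (ℝ → ℂ)) (y : ℝ → ℂ) (x : ℝ) : ℂ :=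
  wronskian (l ++ [y]) x / wronskian l x

theorem jet_append_left {l l' : List (ℝ → ℂ)} (x : ℝ) (i : ℕ) {j : ℕ} (hj : j < l.length) :
    jet (l ++ l') x i j = jet l x i j := by
  simp only [jet]
  rw [List.getD_append _ _ _ _ hj]

theorem jet_append_last (l : List (ℝ → ℂ)) (y : ℝ → ℂ) (x : ℝ) (i : ℕ) :
    jet (l ++ [y]) x i l.length = iteratedDeriv i y x := by
  simp [jet]

theorem borderDet_congr {e e' : ℕ → ℕ → ℂ} {n r c c' : ℕ} (h : ∀ i j, j < n → e i j = e' i j)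
    (hc : ∀ i, e i c = e' i c') : borderDet e n r c = borderDet e' n r c' := by
  unfold borderDet
  congr 1
  ext i j
  simp only [Matrix.of_apply]
  by_cases hj : (j : ℕ) < n
  · simp only [hj, if_true]
    exact h _ _ hj
  · simp only [hj, if_false]
    exact hc _

theorem leadDet_congr {e e' : ℕ → ℕ → ℂ} {n : ℕ} (h : ∀ i j, j < n → e i j = e' i j) :
    leadDet e n = leadDet e' n := by
  unfold leadDet
  congr 1
  ext i j
  exact h _ _ j.2

/-- One step of Crum's iteration. -/
theorem wronskian_append_append {l : List (ℝ → ℂ)} {f y : ℝ → ℂ} {x : ℝ} (h : AnaAt l x)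
    (hf : AnalyticAt ℝ f x) (hy : AnalyticAt ℝ y x) (h0 : wronskian l x ≠ 0) :
    wronskian (l ++ [f] ++ [y]) x * wronskian l x =
      wronskian (l ++ [f]) x * deriv (wronskian (l ++ [y])) x -
        wronskian (l ++ [y]) x * deriv (wronskian (l ++ [f])) x := by
  set n := l.length with hn
  set e := jet (l ++ [f] ++ [y]) x with he
  have c1 : ∀ i j, j < n → e i j = jet l x i j := fun i j hj => by
    rw [he, List.append_assoc, jet_append_left x i hj]
  have c2 : ∀ i j, j < n → e i j = jet (l ++ [f]) x i j := fun i j hj => by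
    rw [c1 i j hj, jet_append_left x i hj]
  have c3 : ∀ i j, j < n → e i j = jet (l ++ [y]) x i j := fun i j hj => by
    rw [c1 i j hj, jet_append_left x i hj]
  have cf : ∀ i, e i n = jet (l ++ [f]) x i n := fun i => by
    rw [he, jet_append_left x i (by simp [n])]
  have cy : ∀ i, e i (n + 1) = jet (l ++ [y]) x i n := fun i => by
    rw [hn, jet_append_last, he, show l.length + 1 = (l ++ [f]).length by simp, jet_append_last]
  have hl : wronskian l x = leadDet e n := by
    rw [wronskian_eq_leadDet, leadDet_congr c1]
  have hlf : wronskian (l ++ [f]) x = borderDet e n n n := by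
    rw [wronskian_eq_leadDet, borderDet_congr c2 cf, borderDet_self]
    simp [n]
  have hly : wronskian (l ++ [y]) x = borderDet e n n (n + 1) := by
    rw [wronskian_eq_leadDet, borderDet_congr c3 cy, borderDet_self]
    simp [n]
  have hlfy : wronskian (l ++ [f] ++ [y]) x = leadDet e (n + 2) := by
    rw [wronskian_eq_leadDet]
    simp [n, he]
  rw [deriv_wronskian_append h hf, deriv_wronskian_append h hy, hl, hlf, hly, hlfy,
    leadDet_mul_leadDet e n (by rwa [← hl]), borderDet_congr c2 cf,
    borderDet_congr (r := n + 1) c3 cy, borderDet_congr (r := n + 1) c2 cf]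

/-- Crum's operator for `l ++ [f]` is the one for `l` followed by the Darboux step `z ↦ z' - (φ'/φ)
z`, where `φ` is the transform of `f` by `l`. Everything about long Wronskians is proved by
iterating this step. -/
theorem crumOp_append {l : List (ℝ → ℂ)} {f y : ℝ → ℂ} {x : ℝ} (h : AnaAt l x)
    (hf : AnalyticAt ℝ f x) (hy : AnalyticAt ℝ y x) (h0 : wronskian l x ≠ 0)
    (hf0 : wronskian (l ++ [f]) x ≠ 0) :
    crumOp (l ++ [f]) y x =
      deriv (crumOp l y) x - deriv (crumOp l f) x / crumOp l f x * crumOp l y x := by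
  have hd : ∀ g, AnalyticAt ℝ g x → deriv (crumOp l g) x =
      (deriv (wronskian (l ++ [g])) x * wronskian l x -
        wronskian (l ++ [g]) x * deriv (wronskian l) x) / wronskian l x ^ 2 := fun g hg =>
    ((h.append_singleton hg).wronskian.differentiableAt.hasDerivAt.div
      h.wronskian.differentiableAt.hasDerivAt h0).deriv
  have key := wronskian_append_append h hf hy h0
  rw [hd y hy, hd f hf]
  simp only [crumOp]
  field_simp
  linear_combination (wronskian l x) * key


/-! ### Germs at the origin -/

/-- `y` is, to the right of `0`, the product of `x^e` and an analytic function with value `c`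
at `0`. -/
def HasGerm (e : ℝ) (c : ℂ) (y : ℝ → ℂ) : Prop :=
  ∃ g : ℝ → ℂ, AnalyticAt ℝ g 0 ∧ g 0 = c ∧ ∀ᶠ x in 𝓝[>] 0, y x = ((x ^ e : ℝ) : ℂ) * g x

/-- An identity valid to the right of 0 can be differentiated there because it holds in a full
neighbourhood of each small `x > 0`. -/
theorem eventually_nhds_of_nhdsGT {P : ℝ → Prop} (h : ∀ᶠ x in 𝓝[>] (0 : ℝ), P x) :
    ∀ᶠ x in 𝓝[>] (0 : ℝ), ∀ᶠ u in 𝓝 x, P u := by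
  filter_upwards [eventually_eventually_nhdsWithin.2 h, self_mem_nhdsWithin] with x hx hx0
  rwa [isOpen_Ioi.nhdsWithin_eq hx0] at hx

theorem nhdsGT_of_nhds {P : ℝ → Prop} (h : ∀ᶠ x in 𝓝 (0 : ℝ), P x) : ∀ᶠ x in 𝓝[>] (0 : ℝ), P x :=
  h.filter_mono nhdsWithin_le_nhds

theorem rpow_add_ofReal {x : ℝ} (hx : 0 < x) (e e' : ℝ) :
    ((x ^ (e + e') : ℝ) : ℂ) = ((x ^ e : ℝ) : ℂ) * ((x ^ e' : ℝ) : ℂ) := by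
  rw [Real.rpow_add hx, Complex.ofReal_mul]

theorem HasGerm.congr {e : ℝ} {c : ℂ} {y y' : ℝ → ℂ} (h : HasGerm e c y)
    (hy : ∀ᶠ x in 𝓝[>] 0, y' x = y x) : HasGerm e c y' := by
  obtain ⟨g, hg, hc, h⟩ := h
  exact ⟨g, hg, hc, by filter_upwards [h, hy] with x h1 h2; rw [h2, h1]⟩

theorem HasGerm.mul {e e' : ℝ} {c c' : ℂ} {y y' : ℝ → ℂ} (h : HasGerm e c y)
    (h' : HasGerm e' c' y') : HasGerm (e + e') (c * c') fun x => y x * y' x := by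
  obtain ⟨g, hg, hc, h⟩ := h
  obtain ⟨g', hg', hc', h'⟩ := h'
  refine ⟨fun x => g x * g' x, hg.mul hg', by simp only [hc, hc'], ?_⟩
  filter_upwards [h, h', self_mem_nhdsWithin] with x h1 h2 hx
  rw [h1, h2, rpow_add_ofReal hx]
  ring

theorem hasGerm_rpow (e : ℝ) : HasGerm e 1 fun x => ((x ^ e : ℝ) : ℂ) :=
  ⟨fun _ => 1, analyticAt_const, rfl, Eventually.of_forall fun x => by simp⟩

theorem hasGerm_of_analyticAt {g : ℝ → ℂ} (hg : AnalyticAt ℝ g 0) : HasGerm 0 (g 0) g :=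
  ⟨g, hg, rfl, Eventually.of_forall fun x => by simp⟩

theorem HasGerm.tendsto {c : ℂ} {y : ℝ → ℂ} (h : HasGerm 0 c y) :
    Tendsto y (𝓝[>] 0) (𝓝 c) := by
  obtain ⟨g, hg, rfl, h⟩ := h
  refine Tendsto.congr' ?_ (hg.continuousAt.tendsto.mono_left nhdsWithin_le_nhds)
  filter_upwards [h] with x hx
  simp [hx]

theorem HasGerm.eventually_ne {e : ℝ} {c : ℂ} {y : ℝ → ℂ} (h : HasGerm e c y) (hc : c ≠ 0) :
    ∀ᶠ x in 𝓝[>] 0, y x ≠ 0 := by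
  obtain ⟨g, hg, rfl, h⟩ := h
  filter_upwards [h, nhdsGT_of_nhds (hg.continuousAt.eventually_ne hc), self_mem_nhdsWithin]
    with x h1 h2 hx
  rw [h1]
  exact mul_ne_zero (by exact_mod_cast (Real.rpow_pos_of_pos hx e).ne') h2

theorem hasDerivAt_rpow_mul (e : ℝ) {g : ℝ → ℂ} {g' : ℂ} {x : ℝ} (hx : 0 < x)
    (hg : HasDerivAt g g' x) : HasDerivAt (fun x => ((x ^ e : ℝ) : ℂ) * g x)
      (((x ^ (e - 1) : ℝ) : ℂ) * (e * g x + x * g')) x := by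
  refine ((hasDerivAt_rpow_ofReal e hx).mul hg).congr_deriv ?_
  rw [← rpow_mul_self_ofReal e hx]
  ring

theorem eventually_hasDerivAt_of_germ {e : ℝ} {g y : ℝ → ℂ} (hg : AnalyticAt ℝ g 0)
    (h : ∀ᶠ x in 𝓝[>] 0, y x = ((x ^ e : ℝ) : ℂ) * g x) :
    ∀ᶠ x in 𝓝[>] 0, HasDerivAt y (((x ^ (e - 1) : ℝ) : ℂ) * (e * g x + x * deriv g x)) x := by
  filter_upwards [eventually_nhds_of_nhdsGT h,
    nhdsGT_of_nhds (AnalyticAt.eventually_hasDerivAt' hg), self_mem_nhdsWithin] with x h1 h2 hx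
  exact (hasDerivAt_rpow_mul e hx h2).congr_of_eventuallyEq h1

/-! ### Iterated Darboux transformations near the origin -/

/-- `y` is an eigenfunction on `(0, ∞)` of the classical expression. -/
def IsEig (α : ℝ) (lam : ℂ) (y : ℝ → ℂ) : Prop :=
  ∀ x : ℝ, 0 < x → AnalyticAt ℝ y x ∧ KEq α lam y x

/-- The logarithmic derivative of the Wronskian. -/
noncomputable def logW (F : List (ℝ → ℂ)) (x : ℝ) : ℂ := deriv (wronskian F) x / wronskian F x

/-- `x z'' + (α + 1 + N - x) z' + (ρ + lam) z = 0` at the point `x`. -/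
def DEq (α N : ℝ) (ρ : ℝ → ℂ) (lam : ℂ) (z : ℝ → ℂ) (x : ℝ) : Prop :=
  (x : ℂ) * deriv (deriv z) x + (α + 1 + N - x) * deriv z x + (ρ x + lam) * z x = 0

/-- The potential in the equation satisfied by the transforms by `F`. -/
noncomputable def crumPot (F : List (ℝ → ℂ)) (x : ℝ) : ℂ :=
  -(F.length : ℂ) + logW F x + 2 * x * deriv (logW F) x

theorem analyticAt_hasDerivAt {g : ℝ → ℂ} {x : ℝ} (h : AnalyticAt ℝ g x) :
    HasDerivAt g (deriv g x) x := h.differentiableAt.hasDerivAt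

/-- With `w = f'/f`, the new equation is the derivative of the equation of `z`, minus `w` times that
equation, minus `z` times the derivative of the Riccati equation of `w`. Differentiating `x z''`
raises the coefficient of the first derivative by one; the eigenvalue `mu` drops out when the
Riccati equation is differentiated. -/
theorem DEq.darboux {α N : ℝ} {ρ z f : ℝ → ℂ} {lam mu : ℂ} {x : ℝ}
    (hz : AnalyticAt ℝ z x) (hf : AnalyticAt ℝ f x) (hρ : AnalyticAt ℝ ρ x) (hf0 : f x ≠ 0)
    (hze : ∀ᶠ u in 𝓝 x, DEq α N ρ lam z u) (hfe : ∀ᶠ u in 𝓝 x, DEq α N ρ mu f u) :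
    DEq α (N + 1) (fun u => ρ u - 1 + deriv f u / f u +
        2 * u * deriv (fun u => deriv f u / f u) u) lam
      (fun u => deriv z u - deriv f u / f u * z u) x := by
  set w : ℝ → ℂ := fun u => deriv f u / f u with hw
  have hwa : AnalyticAt ℝ w x := hf.deriv.div hf hf0
  have hZ' : ∀ᶠ u in 𝓝 x, HasDerivAt (fun u => deriv z u - w u * z u)
      (deriv (deriv z) u - (deriv w u * z u + w u * deriv z u)) u := by
    filter_upwards [hz.eventually_analyticAt, hwa.eventually_analyticAt] with u h1 h2
    exact (analyticAt_hasDerivAt h1.deriv).sub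
      ((analyticAt_hasDerivAt h2).mul (analyticAt_hasDerivAt h1))
  have hZ'' : deriv (deriv fun u => deriv z u - w u * z u) x = deriv (deriv (deriv z)) x -
      ((deriv (deriv w) x * z x + deriv w x * deriv z x) +
        (deriv w x * deriv z x + w x * deriv (deriv z) x)) := by
    refine deriv_deriv_of_hasDerivAt hZ' ?_
    have d1 := analyticAt_hasDerivAt hz
    have d2 := analyticAt_hasDerivAt hz.deriv
    have d3 := analyticAt_hasDerivAt hz.deriv.deriv
    have e1 := analyticAt_hasDerivAt hwa
    have e2 := analyticAt_hasDerivAt hwa.deriv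
    exact d3.sub ((e2.mul d1).add (e1.mul d2))
  have hlin : HasDerivAt (fun u : ℝ => ((α : ℂ) + 1 + N - u)) (-1) x := by
    simpa using (Complex.ofRealCLM.hasDerivAt (x := x)).const_sub ((α : ℂ) + 1 + N)
  have hid : HasDerivAt (fun u : ℝ => (u : ℂ)) 1 x := by
    exact (Complex.ofRealCLM.hasDerivAt (x := x)).congr_deriv (by simp)
  have dE : (deriv (deriv z) x + x * deriv (deriv (deriv z)) x) +
      (-1 * deriv z x + (α + 1 + N - x) * deriv (deriv z) x) +
      (deriv ρ x * z x + (ρ x + lam) * deriv z x) = 0 := by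
    have h1 := ((hid.mul (analyticAt_hasDerivAt hz.deriv.deriv)).add
      (hlin.mul (analyticAt_hasDerivAt hz.deriv))).add
      (((analyticAt_hasDerivAt hρ).add_const lam).mul (analyticAt_hasDerivAt hz))
    have h2 := h1.congr_of_eventuallyEq (f₁ := fun _ => 0)
      (hze.mono fun u hu => by simpa [DEq] using hu.symm)
    have := h2.unique (hasDerivAt_const x (0 : ℂ))
    simpa using this
  have hw' : ∀ᶠ u in 𝓝 x, deriv w u = deriv (deriv f) u / f u - w u ^ 2 := by
    filter_upwards [hf.eventually_analyticAt, hf.continuousAt.eventually_ne hf0] with u h1 h2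
    have : deriv w u = _ := ((analyticAt_hasDerivAt h1.deriv).div (analyticAt_hasDerivAt h1) h2).deriv
    rw [this]
    simp only [hw]
    field_simp
  have ric : ∀ᶠ u : ℝ in 𝓝 x, (u : ℂ) * (deriv w u + w u ^ 2) + (α + 1 + N - u) * w u + (ρ u + mu) = 0 := by
    filter_upwards [hw', hf.continuousAt.eventually_ne hf0, hfe] with u h1 h2 h3
    rw [h1]
    simp only [hw]
    field_simp
    simp only [DEq] at h3
    linear_combination f u * h3
  have dR : (1 * (deriv w x + w x ^ 2) + x * (deriv (deriv w) x + 2 * w x * deriv w x)) +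
      (-1 * w x + (α + 1 + N - x) * deriv w x) + deriv ρ x = 0 := by
    have h1 := ((hid.mul ((analyticAt_hasDerivAt hwa.deriv).add
      ((analyticAt_hasDerivAt hwa).pow 2))).add
      (hlin.mul (analyticAt_hasDerivAt hwa))).add
      ((analyticAt_hasDerivAt hρ).add_const mu)
    have h2 := h1.congr_of_eventuallyEq (f₁ := fun _ => 0)
      (ric.mono fun u hu => by simpa using hu.symm)
    have := h2.unique (hasDerivAt_const x (0 : ℂ))
    simpa using this
  have h0 := hze.self_of_nhds
  simp only [DEq] at h0 ⊢
  rw [hZ'', hZ'.self_of_nhds.deriv]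
  push_cast
  linear_combination dE - w x * h0 - z x * dR

/-- The exponent at `0` of the transforms of `h` (`τ = false`) and `h̃` (`τ = true`). -/
def expo (α : ℝ) (s t : ℕ) (τ : Bool) : ℝ := if τ then -α - s else -t

/-- After transforming by `s` eigenfunctions analytic at `0` and by `t` of the other kind, the
Wronskian has leading coefficient `ω` at `0`, and the leading coefficient of an eigenfunction of
kind `τ` has been multiplied by `R τ lam`. -/
structure CrumState (α : ℝ) (F : List (ℝ → ℂ)) (s t : ℕ) (ω : ℂ) (R : Bool → ℂ → ℂ) : Prop where
  len : F.length = s + t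
  ana : ∀ x : ℝ, 0 < x → AnaAt F x
  wr : HasGerm (-((α + s) * t)) ω (wronskian F)
  ne : ω ≠ 0
  val : ∀ τ lam c y, IsEig α lam y → HasGerm (expo α 0 0 τ) c y →
    HasGerm (expo α s t τ) (c * R τ lam) (crumOp F y)
  ode : ∀ᶠ x in 𝓝[>] 0, ∀ lam y, IsEig α lam y →
    DEq α F.length (crumPot F) lam (crumOp F y) x

theorem wronskian_nil (x : ℝ) : wronskian [] x = 1 := by simp [wronskian]

theorem crumOp_nil (y : ℝ → ℂ) : crumOp [] y = y := by
  ext x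
  simp [crumOp, wronskian]

theorem crumState_nil (α : ℝ) : CrumState α [] 0 0 1 fun _ _ => 1 where
  len := rfl
  ana := fun x _ f hf => by simp at hf
  wr := by
    have := hasGerm_of_analyticAt (g := fun _ => (1 : ℂ)) analyticAt_const
    simpa [show wronskian [] = fun _ => (1 : ℂ) from funext wronskian_nil] using this
  ne := one_ne_zero
  val := fun τ lam c y _ h => by simpa [crumOp_nil] using h
  ode := by
    filter_upwards [self_mem_nhdsWithin] with x hx lam y hy
    have h0 : logW [] = fun _ => 0 := by
      ext x
      simp [logW, show wronskian [] = fun _ => (1 : ℂ) from funext wronskian_nil]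
    have := (hy x hx).2
    simpa [DEq, crumPot, crumOp_nil, h0, KEq] using this

theorem CrumState.eventually_ne {α : ℝ} {F : List (ℝ → ℂ)} {s t : ℕ} {ω : ℂ} {R : Bool → ℂ → ℂ}
    (h : CrumState α F s t ω R) : ∀ᶠ x in 𝓝[>] 0, wronskian F x ≠ 0 := h.wr.eventually_ne h.ne

theorem crumOp_analyticAt {F : List (ℝ → ℂ)} {y : ℝ → ℂ} {x : ℝ} (h : AnaAt F x)
    (hy : AnalyticAt ℝ y x) (h0 : wronskian F x ≠ 0) : AnalyticAt ℝ (crumOp F y) x :=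
  (h.append_singleton hy).wronskian.div h.wronskian h0

theorem logW_analyticAt {F : List (ℝ → ℂ)} {x : ℝ} (h : AnaAt F x) (h0 : wronskian F x ≠ 0) :
    AnalyticAt ℝ (logW F) x := h.wronskian.deriv.div h.wronskian h0

theorem analyticAt_ofReal (x : ℝ) : AnalyticAt ℝ (fun x : ℝ => (x : ℂ)) x :=
  Complex.ofRealCLM.analyticAt x

theorem crumPot_analyticAt {F : List (ℝ → ℂ)} {x : ℝ} (h : AnaAt F x) (h0 : wronskian F x ≠ 0) :
    AnalyticAt ℝ (crumPot F) x := by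
  have := logW_analyticAt h h0
  exact (analyticAt_const.add this).add
    ((analyticAt_const.mul (analyticAt_ofReal x)).mul this.deriv)

theorem logW_append {F : List (ℝ → ℂ)} {f : ℝ → ℂ} {x : ℝ} (h : AnaAt F x)
    (hf : AnalyticAt ℝ f x) (h0 : wronskian F x ≠ 0) (hf0 : wronskian (F ++ [f]) x ≠ 0) :
    logW (F ++ [f]) x = logW F x + deriv (crumOp F f) x / crumOp F f x := by
  have hd : deriv (crumOp F f) x = (deriv (wronskian (F ++ [f])) x * wronskian F x -
        wronskian (F ++ [f]) x * deriv (wronskian F) x) / wronskian F x ^ 2 :=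
    ((h.append_singleton hf).wronskian.differentiableAt.hasDerivAt.div
      h.wronskian.differentiableAt.hasDerivAt h0).deriv
  rw [hd]
  simp only [logW, crumOp]
  field_simp
  ring

theorem DEq.congr {α N N' : ℝ} {ρ ρ' z z' : ℝ → ℂ} {lam : ℂ} {x : ℝ} (h : DEq α N ρ lam z x)
    (hN : N' = N) (hρ : ρ' x = ρ x) (hz : z' =ᶠ[𝓝 x] z) : DEq α N' ρ' lam z' x := by
  subst hN
  simp only [DEq] at h ⊢
  rw [hz.deriv.deriv_eq, hz.deriv_eq, hz.self_of_nhds, hρ]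
  exact h

/-- Logarithmic derivatives of successive Wronskians differ by that of the new transformed seed
(`logW_append`), so the increments `-1 + w + 2 x w'` of the potential add up to `crumPot`. -/
theorem CrumState.ode_append {α : ℝ} {F : List (ℝ → ℂ)} {s t : ℕ} {ω : ℂ} {R : Bool → ℂ → ℂ}
    (h : CrumState α F s t ω R) {f : ℝ → ℂ} {mu : ℂ} (hf : IsEig α mu f)
    (hf0 : ∀ᶠ x in 𝓝[>] 0, wronskian (F ++ [f]) x ≠ 0) :
    ∀ᶠ x in 𝓝[>] 0, ∀ lam y, IsEig α lam y →
      DEq α (F ++ [f]).length (crumPot (F ++ [f])) lam (crumOp (F ++ [f]) y) x := by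
  filter_upwards [eventually_nhds_of_nhdsGT h.eventually_ne, eventually_nhds_of_nhdsGT hf0,
    eventually_nhds_of_nhdsGT h.ode, self_mem_nhdsWithin] with x h1 h2 h3 hx lam y hy
  have hpos : ∀ᶠ u in 𝓝 x, 0 < u := Ioi_mem_nhds hx
  have w0 := h1.self_of_nhds
  have hz := crumOp_analyticAt (h.ana x hx) (hy x hx).1 w0
  have hzf := crumOp_analyticAt (h.ana x hx) (hf x hx).1 w0
  have key := DEq.darboux hz hzf (crumPot_analyticAt (h.ana x hx) w0)
    (div_ne_zero h2.self_of_nhds w0) (h3.mono fun u hu => hu lam y hy)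
    (h3.mono fun u hu => hu mu f hf)
  refine key.congr (by simp) ?_ ?_
  · have e1 : logW (F ++ [f]) =ᶠ[𝓝 x]
        fun u => logW F u + deriv (crumOp F f) u / crumOp F f u := by
      filter_upwards [h1, h2, hpos] with u g1 g2 hu
      exact logW_append (h.ana u hu) (hf u hu).1 g1 g2
    have hw : AnalyticAt ℝ (fun u => deriv (crumOp F f) u / crumOp F f u) x :=
      hzf.deriv.div hzf (div_ne_zero h2.self_of_nhds w0)
    simp only [crumPot]
    have e2 : deriv (fun u => logW F u + deriv (crumOp F f) u / crumOp F f u) x = _ :=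
      ((analyticAt_hasDerivAt (logW_analyticAt (h.ana x hx) w0)).add
        (analyticAt_hasDerivAt hw)).deriv
    rw [e1.deriv_eq, e1.self_of_nhds, e2]
    simp
    ring
  · filter_upwards [h1, h2, hpos] with u g1 g2 hu
    exact crumOp_append (h.ana u hu) (hf u hu).1 (hy u hu).1 g1 g2

/-- The factor by which the leading coefficients of the transforms of kind `τ` change when an
eigenfunction of kind `σ` is added. -/
noncomputable def stepFac (α : ℝ) (s t : ℕ) (σ : Bool) (mu : ℂ) (τ : Bool) (lam : ℂ) : ℂ :=
  if τ = σ then (mu - lam) / (2 * expo α s t σ + α + 1 + s + t) else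
    (expo α s t τ : ℂ) - expo α s t σ

/-- A seed of kind `σ` leaves the exponent of kind `σ` unchanged and lowers the other one by one. -/
theorem expo_step_self (α : ℝ) (s t : ℕ) (σ : Bool) :
    expo α (s + (!σ).toNat) (t + σ.toNat) σ = expo α s t σ := by
  cases σ <;> simp [expo]

theorem expo_step_ne (α : ℝ) (s t : ℕ) {σ τ : Bool} (h : τ ≠ σ) :
    expo α (s + (!σ).toNat) (t + σ.toNat) τ = expo α s t τ - 1 := by
  cases σ <;> cases τ <;> simp [expo] at h ⊢ <;> ring

/-- This number is the coefficient at `x = 0` of the first derivative in the equation of the regular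
part. It equals `α + 1 + s - t` or `1 - α - s + t`, which is never zero. -/
theorem two_expo_add_ne {α : ℝ} (hα : NonInt α) (s t : ℕ) (σ : Bool) :
    2 * (expo α s t σ : ℂ) + α + 1 + s + t ≠ 0 := by
  cases σ
  · have := hα.add_ne (1 + s - t)
    simp only [expo]
    push_cast at this ⊢
    intro h0
    refine this ?_
    simp at h0
    linear_combination h0
  · have := hα.sub_ne (1 - s + t)
    simp only [expo]
    push_cast at this ⊢
    intro h0
    refine this ?_
    linear_combination h0

/-- The terms with `1/x` and `ρ` may be singular at 0. They are the same for two solutions with the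
same exponent and cancel when the two equations are combined, so their behaviour never has to be
determined. -/
theorem DEq.rpow_mul {α N e : ℝ} {ρ g z : ℝ → ℂ} {lam : ℂ} {x : ℝ} (hx : 0 < x)
    (hg : AnalyticAt ℝ g x) (hz : ∀ᶠ u in 𝓝 x, z u = ((u ^ e : ℝ) : ℂ) * g u)
    (h : DEq α N ρ lam z x) :
    (x : ℂ) * deriv (deriv g) x + (2 * e + α + 1 + N - x) * deriv g x +
      ((e * (e - 1) + (α + 1 + N - x) * e) / x + ρ x + lam) * g x = 0 := by
  have hx' : (x : ℂ) ≠ 0 := by exact_mod_cast hx.ne'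
  have h1 : ∀ᶠ u in 𝓝 x, HasDerivAt z
      (((u ^ (e - 1) : ℝ) : ℂ) * (e * g u + u * deriv g u)) u := by
    filter_upwards [eventually_eventually_nhds.2 hz, AnalyticAt.eventually_hasDerivAt' hg,
      Ioi_mem_nhds hx] with u h1 h2 hu
    exact (hasDerivAt_rpow_mul e hu h2).congr_of_eventuallyEq h1
  have hid : HasDerivAt (fun u : ℝ => (u : ℂ)) 1 x := by
    exact (Complex.ofRealCLM.hasDerivAt (x := x)).congr_deriv (by simp)
  have h2 := hasDerivAt_rpow_mul (e - 1) hx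
    (((analyticAt_hasDerivAt hg).const_mul (e : ℂ)).add (hid.mul (analyticAt_hasDerivAt hg.deriv)))
  have h3 := deriv_deriv_of_hasDerivAt h1 h2
  simp only [DEq] at h
  rw [h3, h1.self_of_nhds.deriv, hz.self_of_nhds, ← rpow_mul_self_ofReal e hx,
    ← rpow_mul_self_ofReal (e - 1) hx] at h
  have hp : ((x ^ (e - 1 - 1) : ℝ) : ℂ) ≠ 0 := by
    exact_mod_cast (Real.rpow_pos_of_pos hx _).ne'
  have hq : ((x ^ (e - 1 - 1) : ℝ) : ℂ) * x * x ≠ 0 := mul_ne_zero (mul_ne_zero hp hx') hx'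
  refine (mul_eq_zero.1 ?_).resolve_left hq
  rw [← h]
  simp only [Pi.add_apply, Pi.mul_apply]
  field_simp
  push_cast
  ring

/-- Write the old transforms as `x^e G` and, for the new seed, `x^e' Gf`. The step gives `x^(e-1)
((e-e') G + x (G' - (Gf'/Gf) G))`. For different kinds the leading coefficient is `(e-e') G(0)`; for
equal kinds the first term disappears, and the value of the bracket at 0 has to come from the
differential equations. -/
theorem CrumState.snoc {α : ℝ} (hα : NonInt α) {F : List (ℝ → ℂ)} {s t : ℕ} {ω : ℂ}
    {R : Bool → ℂ → ℂ} (h : CrumState α F s t ω R) {f : ℝ → ℂ} {mu cf : ℂ} {σ : Bool}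
    (hf : IsEig α mu f) (hfg : HasGerm (expo α 0 0 σ) cf f) (hc : cf ≠ 0) (hR : R σ mu ≠ 0) :
    CrumState α (F ++ [f]) (s + (!σ).toNat) (t + σ.toNat) (ω * (cf * R σ mu))
      fun τ lam => R τ lam * stepFac α s t σ mu τ lam := by
  have hzf := h.val σ mu cf f hf hfg
  have hc' : cf * R σ mu ≠ 0 := mul_ne_zero hc hR
  have hw : HasGerm (-((α + (s + (!σ).toNat : ℕ)) * (t + σ.toNat : ℕ))) (ω * (cf * R σ mu))
      (wronskian (F ++ [f])) := by
    have h1 := h.wr.mul hzf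
    have h2 : -((α + (s + (!σ).toNat : ℕ)) * (t + σ.toNat : ℕ)) =
        -((α + s) * t) + expo α s t σ := by
      cases σ <;> simp [expo] <;> ring
    rw [h2]
    refine h1.congr ?_
    filter_upwards [h.eventually_ne] with x hx
    rw [crumOp, mul_div_cancel₀ _ hx]
  have hω : ω * (cf * R σ mu) ≠ 0 := mul_ne_zero h.ne hc'
  have hf0 := hw.eventually_ne hω
  refine ⟨?_, fun x hx => (h.ana x hx).append_singleton (hf x hx).1, hw, hω, ?_,
    h.ode_append hf hf0⟩
  · have := h.len
    cases σ <;> simp [this] <;> omega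
  intro τ lam c y hy hyg
  obtain ⟨Gf, hGf, hGf0, hGfe⟩ := hzf
  obtain ⟨G, hG, hG0, hGe⟩ := h.val τ lam c y hy hyg
  have hGfne : Gf 0 ≠ 0 := hGf0 ▸ hc'
  set e := expo α s t τ with he
  set e' := expo α s t σ with he'
  have hnew : ∀ᶠ x in 𝓝[>] 0, crumOp (F ++ [f]) y x =
      ((x ^ (e - 1) : ℝ) : ℂ) * ((e - e') * G x + x * (deriv G x - deriv Gf x / Gf x * G x)) := by
    filter_upwards [h.eventually_ne, hf0, eventually_hasDerivAt_of_germ hG hGe, hGe,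
      eventually_hasDerivAt_of_germ hGf hGfe, hGfe,
      nhdsGT_of_nhds (hGf.continuousAt.eventually_ne hGfne), self_mem_nhdsWithin]
      with x h1 h2 h3 h4 h5 h6 h7 hx
    have hx' : (x : ℂ) ≠ 0 := by exact_mod_cast (ne_of_gt hx)
    have hp : ((x ^ (e' - 1) : ℝ) : ℂ) ≠ 0 := by
      exact_mod_cast (Real.rpow_pos_of_pos hx _).ne'
    rw [crumOp_append (h.ana x hx) (hf x hx).1 (hy x hx).1 h1 h2, h3.deriv, h5.deriv, h4, h6,
      ← rpow_mul_self_ofReal e hx, ← rpow_mul_self_ofReal e' hx]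
    field_simp
    ring
  have hV : AnalyticAt ℝ (fun x => deriv G x - deriv Gf x / Gf x * G x) 0 :=
    hG.deriv.sub ((hGf.deriv.div hGf hGfne).mul hG)
  by_cases hτ : τ = σ
  · subst hτ
    rw [expo_step_self]
    refine ⟨_, hV, ?_, ?_⟩
    · have hode : ∀ᶠ x : ℝ in 𝓝[>] (0 : ℝ),
          (x : ℂ) * (Gf x * deriv (deriv G) x - G x * deriv (deriv Gf) x) +
          (2 * e + α + 1 + (s + t) - x) * (Gf x * deriv G x - G x * deriv Gf x) +
          (lam - mu) * (Gf x * G x) = 0 := by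
        filter_upwards [h.ode, eventually_nhds_of_nhdsGT hGe, eventually_nhds_of_nhdsGT hGfe,
          nhdsGT_of_nhds hG.eventually_analyticAt, nhdsGT_of_nhds hGf.eventually_analyticAt,
          self_mem_nhdsWithin] with x h1 h2 h3 h4 h5 hx
        have k1 := DEq.rpow_mul hx h4 h2 (h1 lam y hy)
        have k2 := DEq.rpow_mul hx h5 h3 (h1 mu f hf)
        rw [h.len] at k1 k2
        push_cast at k1 k2
        have hee : e' = e := he'.trans he.symm
        rw [hee] at k2
        linear_combination Gf x * k1 - G x * k2
      have hcont : ContinuousAt (fun x : ℝ =>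
          (x : ℂ) * (Gf x * deriv (deriv G) x - G x * deriv (deriv Gf) x) +
          (2 * e + α + 1 + (s + t) - x) * (Gf x * deriv G x - G x * deriv Gf x) +
          (lam - mu) * (Gf x * G x)) 0 := by
        have a1 := hG.continuousAt
        have a2 := hG.deriv.continuousAt
        have a3 := hG.deriv.deriv.continuousAt
        have b1 := hGf.continuousAt
        have b2 := hGf.deriv.continuousAt
        have b3 := hGf.deriv.deriv.continuousAt
        fun_prop
      have hlim := tendsto_nhds_unique
        ((tendsto_const_nhds (x := (0 : ℂ))).congr' (hode.mono fun x hx => hx.symm))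
        (hcont.tendsto.mono_left nhdsWithin_le_nhds)
      have hd := two_expo_add_ne hα s t τ
      rw [← he] at hd
      simp only [stepFac, if_true]
      rw [← he, ← mul_assoc, ← hG0]
      simp only [Complex.ofReal_zero, zero_mul, zero_add, sub_zero] at hlim
      rw [mul_div_assoc', eq_div_iff hd, ← mul_left_inj' hGfne]
      field_simp
      linear_combination -hlim
    · filter_upwards [hnew, self_mem_nhdsWithin] with x h1 hx
      rw [h1, ← he, ← rpow_mul_self_ofReal e hx]
      ring
  · rw [expo_step_ne α s t hτ]
    refine ⟨_, (analyticAt_const.mul hG).add ((analyticAt_ofReal 0).mul hV), ?_, hnew⟩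
    simp only [stepFac, hτ, if_false, ← he, ← he']
    simp [hG0]
    ring


/-! ### Laguerre seeds -/

/-- The value `L_n^α(0)`. -/
noncomputable def lagVal (α : ℝ) (n : ℕ) : ℂ := rising (α + 1) n / n.factorial

theorem rising_add (x : ℂ) (k m : ℕ) : rising x (k + m) = rising x k * rising (x + k) m := by
  induction m with
  | zero => simp [rising_zero]
  | succ m ih =>
    rw [← add_assoc, rising_succ, rising_succ, ih]
    push_cast
    ring

theorem rising_neg_natCast (n k : ℕ) : rising (-(n : ℂ)) k =
    if k ≤ n then (-1) ^ k * (n.factorial : ℂ) / (n - k).factorial else 0 := by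
  induction k with
  | zero =>
    have : (n.factorial : ℂ) ≠ 0 := by exact_mod_cast n.factorial_ne_zero
    simp [rising_zero, this]
  | succ k ih =>
    rw [rising_succ, ih]
    rcases lt_trichotomy k n with h | h | h
    · rw [if_pos h.le, if_pos (Nat.succ_le_of_lt h)]
      obtain ⟨d, rfl⟩ := Nat.exists_eq_add_of_lt h
      have e1 : k + d + 1 - k = d + 1 := by omega
      have e2 : k + d + 1 - (k + 1) = d := by omega
      rw [e1, e2, Nat.factorial_succ d]
      have : (d.factorial : ℂ) ≠ 0 := by exact_mod_cast d.factorial_ne_zero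
      have h1 : (d : ℂ) + 1 ≠ 0 := by exact_mod_cast d.succ_ne_zero
      push_cast
      field_simp
      ring
    · subst h
      simp
    · rw [if_neg (by omega), if_neg (by omega), zero_mul]

theorem laguerreL_eq {α : ℝ} (hα : NonInt α) (n : ℕ) (x : ℝ) :
    laguerreL α n x = lagVal α n * hFun α n x := by
  have hr : ∀ k, rising ((α : ℂ) + 1) k ≠ 0 := fun k => rising_ne_zero hα.first k
  have hs : kummerM (-(n : ℂ)) (α + 1) x = ∑ k ∈ Finset.range (n + 1),
      rising (-(n : ℂ)) k / rising (α + 1) k * (x : ℂ) ^ k / k.factorial := by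
    unfold kummerM
    refine tsum_eq_sum fun k hk => ?_
    rw [rising_neg_natCast, if_neg (by simpa using hk)]
    simp
  rw [hFun, hs, laguerreL, Finset.mul_sum]
  refine Finset.sum_congr rfl fun k hk => ?_
  have hkn : k ≤ n := by simpa [Nat.lt_succ_iff] using hk
  rw [rising_neg_natCast, if_pos hkn, lagVal]
  have h1 : rising ((α : ℂ) + 1) n = rising (α + 1) k * rising (α + k + 1) (n - k) := by
    have := rising_add ((α : ℂ) + 1) k (n - k)
    rw [Nat.add_sub_cancel' hkn] at this
    rw [this]
    congr 2
    ring
  rw [h1]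
  have f1 : (n.factorial : ℂ) ≠ 0 := by exact_mod_cast n.factorial_ne_zero
  have f2 : ((n - k).factorial : ℂ) ≠ 0 := by exact_mod_cast (n - k).factorial_ne_zero
  have f3 : (k.factorial : ℂ) ≠ 0 := by exact_mod_cast k.factorial_ne_zero
  have := hr k
  field_simp

theorem hFun_zero (α : ℝ) (lam : ℂ) : hFun α lam 0 = 1 := by
  rw [hFun, kummerM_zero]

theorem lagVal_ne_zero {α : ℝ} (hα : NonInt α) (n : ℕ) : lagVal α n ≠ 0 :=
  div_ne_zero (rising_ne_zero hα.first n) (by exact_mod_cast n.factorial_ne_zero)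

theorem laguerreL_analyticAt (α : ℝ) (n : ℕ) (x : ℝ) : AnalyticAt ℝ (laguerreL α n) x := by
  refine Finset.analyticAt_fun_sum _ fun k _ => ?_
  have := analyticAt_ofReal x
  fun_prop

theorem laguerreL_zero {α : ℝ} (hα : NonInt α) (n : ℕ) : laguerreL α n 0 = lagVal α n := by
  rw [laguerreL_eq hα, hFun_zero, mul_one]

theorem KEq.const_mul {α : ℝ} {lam : ℂ} {y : ℝ → ℂ} {x : ℝ} (c : ℂ) (h : KEq α lam y x) :
    KEq α lam (fun x => c * y x) x := by
  simp only [KEq] at h ⊢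
  have e1 : deriv (fun x => c * y x) = fun x => c * deriv y x := by
    ext u
    exact deriv_const_mul_field c
  rw [e1, deriv_const_mul_field]
  linear_combination c * h

theorem laguerreL_kEq {α : ℝ} (hα : NonInt α) (n : ℕ) (x : ℝ) : KEq α n (laguerreL α n) x := by
  rw [show laguerreL α n = fun x => lagVal α n * hFun α n x from funext (laguerreL_eq hα n)]
  exact (kummerM_kEq hα _ x).const_mul _

theorem laguerreL_neg_analyticAt (α : ℝ) (n : ℕ) (x : ℝ) :
    AnalyticAt ℝ (fun x => laguerreL α n (-x)) x := by
  refine Finset.analyticAt_fun_sum _ fun k _ => ?_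
  have : AnalyticAt ℝ (fun x : ℝ => ((-x : ℝ) : ℂ)) x := by
    convert (analyticAt_ofReal x).neg using 1
    ext u
    simp
  fun_prop

theorem exp_analyticAt_ofReal (x : ℝ) : AnalyticAt ℝ (fun x : ℝ => (Real.exp x : ℂ)) x :=
  AnalyticAt.fun_comp (g := fun x : ℝ => (x : ℂ)) (Complex.ofRealCLM.analyticAt _)
    (analyticAt_rexp (x := x))

theorem exp_mul_laguerreL_analyticAt (α : ℝ) (n : ℕ) (x : ℝ) :
    AnalyticAt ℝ (fun x => (Real.exp x : ℂ) * laguerreL α n (-x)) x :=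
  (exp_analyticAt_ofReal x).mul (laguerreL_neg_analyticAt α n x)

/-- Seed functions of one kind, with their eigenvalues and their leading coefficients at `0`. -/
structure GoodSeeds (α : ℝ) (τ : Bool) (l : List ((ℝ → ℂ) × ℂ × ℂ)) : Prop where
  eig : ∀ p ∈ l, IsEig α p.2.1 p.1
  germ : ∀ p ∈ l, HasGerm (expo α 0 0 τ) p.2.2 p.1
  ne : ∀ p ∈ l, p.2.2 ≠ 0
  nodup : (l.map fun p => p.2.1).Nodup

/-- The product of all differences of an entry and a later one. -/
noncomputable def vdm : List ℂ → ℂ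
  | [] => 1
  | a :: l => (l.map fun b => a - b).prod * vdm l

theorem vdm_append (l l' : List ℂ) : vdm (l ++ l') =
    vdm l * vdm l' * (l.map fun a => (l'.map fun b => a - b).prod).prod := by
  induction l with
  | nil => simp [vdm]
  | cons a l ih =>
    simp only [List.cons_append, vdm, ih, List.map_append, List.prod_append, List.map_cons,
      List.prod_cons]
    ring

theorem vdm_append_singleton (l : List ℂ) (b : ℂ) :
    vdm (l ++ [b]) = vdm l * (l.map fun a => a - b).prod := by
  rw [vdm_append]
  simp [vdm]

theorem GoodSeeds.of_append {α : ℝ} {τ : Bool} {l l' : List ((ℝ → ℂ) × ℂ × ℂ)}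
    (h : GoodSeeds α τ (l ++ l')) : GoodSeeds α τ l where
  eig := fun p hp => h.eig p (List.mem_append_left _ hp)
  germ := fun p hp => h.germ p (List.mem_append_left _ hp)
  ne := fun p hp => h.ne p (List.mem_append_left _ hp)
  nodup := by
    have := h.nodup
    rw [List.map_append] at this
    exact this.of_append_left

theorem GoodSeeds.prod_ne_zero {α : ℝ} {τ : Bool} {l : List ((ℝ → ℂ) × ℂ × ℂ)}
    {p : (ℝ → ℂ) × ℂ × ℂ} (h : GoodSeeds α τ (l ++ [p])) :
    (l.map fun q => q.2.1 - p.2.1).prod ≠ 0 := by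
  refine List.prod_ne_zero fun h0 => ?_
  obtain ⟨q, hq, hq0⟩ := List.mem_map.1 h0
  have := h.nodup
  rw [List.map_append, List.nodup_append] at this
  exact this.2.2 _ (List.mem_map_of_mem (f := fun p => p.2.1) hq) p.2.1 (by simp)
    (sub_eq_zero.1 hq0)

/-- The factors `R` and `ω` of `CrumState` for `A` of the first and `B` of the second kind. -/
noncomputable def crumR (α : ℝ) (A B : List ((ℝ → ℂ) × ℂ × ℂ)) (τ : Bool) (lam : ℂ) : ℂ :=
  if τ then (∏ k ∈ Finset.range A.length, (-(α : ℂ) - k)) * (B.map fun p => p.2.1 - lam).prod /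
    ∏ j ∈ Finset.range B.length, (1 - (α : ℂ) - A.length + j)
  else (A.map fun p => p.2.1 - lam).prod / (∏ k ∈ Finset.range A.length, ((α : ℂ) + 1 + k)) *
    ∏ j ∈ Finset.range B.length, ((α : ℂ) + A.length - j)

/-- The product of the leading coefficients met by the successive seeds. Each Vandermonde product
collects differences of eigenvalues within a kind, the denominators come from the steps between
equal kinds, and the power with exponent `B.length` records the passage of each element of `B`
through all of `A`. -/
noncomputable def crumOmega (α : ℝ) (A B : List ((ℝ → ℂ) × ℂ × ℂ)) : ℂ :=
  (A.map fun p => p.2.2).prod * vdm (A.map fun p => p.2.1) /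
    (∏ i ∈ Finset.range A.length, ∏ k ∈ Finset.range i, ((α : ℂ) + 1 + k)) *
  ((B.map fun p => p.2.2).prod * vdm (B.map fun p => p.2.1) *
    (∏ k ∈ Finset.range A.length, (-(α : ℂ) - k)) ^ B.length /
    (∏ j ∈ Finset.range B.length, ∏ l ∈ Finset.range j, (1 - (α : ℂ) - A.length + l)))

theorem NonInt.prod_first {α : ℝ} (hα : NonInt α) (s : ℕ) :
    ∏ k ∈ Finset.range s, ((α : ℂ) + 1 + k) ≠ 0 :=
  Finset.prod_ne_zero_iff.2 fun k _ => hα.first k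

theorem NonInt.prod_neg_sub {α : ℝ} (hα : NonInt α) (s : ℕ) :
    ∏ k ∈ Finset.range s, (-(α : ℂ) - k) ≠ 0 := by
  refine Finset.prod_ne_zero_iff.2 fun k _ h0 => ?_
  have := hα.add_ne k
  push_cast at this
  exact this (by linear_combination -h0)

theorem NonInt.prod_add_sub {α : ℝ} (hα : NonInt α) (s t : ℕ) :
    ∏ j ∈ Finset.range t, ((α : ℂ) + s - j) ≠ 0 := by
  refine Finset.prod_ne_zero_iff.2 fun k _ h0 => ?_
  have := hα.add_ne (s - k)
  push_cast at this
  exact this (by linear_combination h0)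

theorem NonInt.prod_second {α : ℝ} (hα : NonInt α) (s t : ℕ) :
    ∏ j ∈ Finset.range t, (1 - (α : ℂ) - s + j) ≠ 0 := by
  refine Finset.prod_ne_zero_iff.2 fun k _ h0 => ?_
  have := hα.sub_ne (1 - s + k)
  push_cast at this
  exact this (by linear_combination h0)

theorem CrumState.congr {α : ℝ} {F F' : List (ℝ → ℂ)} {s t s' t' : ℕ} {ω ω' : ℂ}
    {R R' : Bool → ℂ → ℂ} (h : CrumState α F s t ω R) (hF : F' = F) (hs : s' = s) (ht : t' = t)
    (hω : ω' = ω) (hR : ∀ τ lam, R' τ lam = R τ lam) : CrumState α F' s' t' ω' R' := by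
  have : R' = R := by
    ext τ lam
    exact hR τ lam
  subst hF hs ht hω this
  exact h

/-- Seeds are appended one at a time, those of the first kind before those of the second. Distinct
eigenvalues within a kind and `α` not an integer keep every new transformed seed from losing its
leading term. -/
theorem GoodSeeds.crumState {α : ℝ} (hα : NonInt α) {A B : List ((ℝ → ℂ) × ℂ × ℂ)}
    (hA : GoodSeeds α false A) (hB : GoodSeeds α true B) :
    CrumState α (A.map Prod.fst ++ B.map Prod.fst) A.length B.length (crumOmega α A B)
      (crumR α A B) := by
  induction B using List.reverseRecOn with
  | nil =>
    induction A using List.reverseRecOn with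
    | nil =>
      refine (crumState_nil α).congr (by simp) rfl rfl (by simp [crumOmega, vdm]) fun τ lam => ?_
      cases τ <;> simp [crumR]
    | append_singleton A p ih =>
      have hp : p ∈ A ++ [p] := by simp
      have h1 := (ih hA.of_append).snoc hα (hA.eig p hp) (hA.germ p hp) (hA.ne p hp) (by
        simp only [crumR, List.length_nil, Finset.prod_range_zero, mul_one]
        exact div_ne_zero hA.prod_ne_zero (hα.prod_first _))
      refine h1.congr (by simp) (by simp) (by simp) ?_ fun τ lam => ?_
      · simp only [crumOmega, crumR, List.map_append, List.map_cons, List.map_nil,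
          vdm_append_singleton, List.prod_append, List.length_append, List.length_singleton,
          Finset.prod_range_succ, List.map_map, Function.comp_def]
        have := hα.prod_first A.length
        have := Finset.prod_ne_zero_iff.2 fun i (_ : i ∈ Finset.range A.length) => hα.prod_first i
        simp [vdm]
        field_simp
      · have hd := two_expo_add_ne hα A.length 0 false
        have := hα.prod_first A.length
        cases τ
        · simp only [crumR, List.map_append, List.map_cons, List.map_nil, List.prod_append,
            List.length_append, List.length_singleton, Finset.prod_range_succ, stepFac]
          simp [expo] at hd ⊢
          rw [add_right_comm] at hd
          field_simp
        · simp only [crumR, List.map_append, List.map_cons, List.map_nil, List.prod_append,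
            List.length_append, List.length_singleton, Finset.prod_range_succ, stepFac]
          simp [expo]
  | append_singleton B p ih =>
    have hp : p ∈ B ++ [p] := by simp
    have h1 := (ih hB.of_append).snoc hα (hB.eig p hp) (hB.germ p hp) (hB.ne p hp) (by
      simp only [crumR, if_true]
      exact div_ne_zero (mul_ne_zero (hα.prod_neg_sub _) hB.prod_ne_zero) (hα.prod_second _ _))
    refine h1.congr (by simp) (by simp) (by simp) ?_ fun τ lam => ?_
    · simp only [crumOmega, crumR, List.map_append, List.map_cons, List.map_nil,
        vdm_append_singleton, List.prod_append, List.length_append, List.length_singleton,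
        Finset.prod_range_succ, List.map_map, Function.comp_def, if_true]
      simp only [pow_succ]
      simp only [List.prod_cons, List.prod_nil, mul_one]
      ring
    · have hd := two_expo_add_ne hα A.length B.length true
      have := hα.prod_first A.length
      have := hα.prod_second A.length B.length
      cases τ
      · simp only [crumR, List.map_append, List.map_cons, List.map_nil, List.prod_append,
          List.length_append, List.length_singleton, Finset.prod_range_succ, stepFac]
        simp [expo]
        ring
      · simp only [crumR, List.map_append, List.map_cons, List.map_nil, List.prod_append,
          List.length_append, List.length_singleton, Finset.prod_range_succ, stepFac, if_true]
        have e : 2 * (expo α A.length B.length true : ℂ) + α + 1 + A.length + B.length =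
            1 - α - A.length + B.length := by
          simp [expo]
          ring
        rw [e] at hd ⊢
        simp
        field_simp

/-- The seed functions of the first kind at `0`, with eigenvalues and leading coefficients. -/
noncomputable def seedsA (α : ℝ) (M₁ M₂ : MayaDiagram) : List ((ℝ → ℂ) × ℂ × ℂ) :=
  (decr M₁.filled).map (fun n => ((fun x => laguerreL α n x), (n : ℂ), lagVal α n)) ++
  (decr M₂.filled).map (fun m => ((fun x => (Real.exp x : ℂ) * laguerreL α m (-x)),
    -(α : ℂ) - 1 - m, lagVal α m))

/-- The seed functions of the second kind at `0`, with eigenvalues and leading coefficients. -/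
noncomputable def seedsB (α : ℝ) (M₁ M₂ : MayaDiagram) : List ((ℝ → ℂ) × ℂ × ℂ) :=
  (decr M₂.empty).map (fun m => ((fun x => ((x ^ (-α) : ℝ) : ℂ) * laguerreL (-α) m x),
    (m : ℂ) - α, lagVal (-α) m)) ++
  (decr M₁.empty).map (fun n => ((fun x => (Real.exp x : ℂ) * ((x ^ (-α) : ℝ) : ℂ) *
    laguerreL (-α) n (-x)), -1 - (n : ℂ), lagVal (-α) n))

theorem seeds_eq (α : ℝ) (M₁ M₂ : MayaDiagram) : seeds α M₁ M₂ =
    (seedsA α M₁ M₂).map Prod.fst ++ (seedsB α M₁ M₂).map Prod.fst := by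
  simp [seeds, seedsA, seedsB, Function.comp_def]

theorem decr_length (s : Finset ℕ) : (decr s).length = s.card := Finset.length_sort _

theorem mem_decr {s : Finset ℕ} {n : ℕ} : n ∈ decr s ↔ n ∈ s := Finset.mem_sort _

theorem decr_nodup (s : Finset ℕ) : (decr s).Nodup := Finset.sort_nodup _ _

theorem seedsA_length (α : ℝ) (M₁ M₂ : MayaDiagram) :
    (seedsA α M₁ M₂).length = num₁ M₁ + num₂ M₂ := by
  simp [seedsA, decr_length, num₁, num₂]

theorem seedsB_length (α : ℝ) (M₁ M₂ : MayaDiagram) :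
    (seedsB α M₁ M₂).length = num₃ M₂ + num₄ M₁ := by
  simp [seedsB, decr_length, num₃, num₄]

/-- A coincidence of eigenvalues between the two families, `n = -α-1-m`, would make `α` an integer;
within a family the eigenvalues are injective in the index. -/
theorem goodSeeds_seedsA {α : ℝ} (hα : NonInt α) (M₁ M₂ : MayaDiagram) :
    GoodSeeds α false (seedsA α M₁ M₂) := by
  have hex : expo α 0 0 false = 0 := by simp [expo]
  refine ⟨fun p hp => ?_, fun p hp => ?_, fun p hp => ?_, ?_⟩
  · rcases List.mem_append.1 hp with hp | hp <;> obtain ⟨n, -, rfl⟩ := List.mem_map.1 hp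
    · exact fun x _ => ⟨laguerreL_analyticAt α n x, laguerreL_kEq hα n x⟩
    · refine fun x _ => ⟨(exp_analyticAt_ofReal x).mul (laguerreL_neg_analyticAt α n x), ?_⟩
      have := KEq.exp_mul (laguerreL_analyticAt α n (-x)) (laguerreL_kEq hα n (-x))
      simpa [sub_eq_add_neg, add_comm, add_left_comm] using this
  · rw [hex]
    rcases List.mem_append.1 hp with hp | hp <;> obtain ⟨n, -, rfl⟩ := List.mem_map.1 hp
    · have := hasGerm_of_analyticAt (laguerreL_analyticAt α n 0)
      rwa [laguerreL_zero hα] at this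
    · have := hasGerm_of_analyticAt (exp_mul_laguerreL_analyticAt α n 0)
      simpa [laguerreL_zero hα] using this
  · rcases List.mem_append.1 hp with hp | hp <;> obtain ⟨n, -, rfl⟩ := List.mem_map.1 hp <;>
      exact lagVal_ne_zero hα n
  · simp only [seedsA, List.map_append, List.map_map, Function.comp_def]
    refine List.Nodup.append ((decr_nodup _).map fun a b h => by simpa using h)
      ((decr_nodup _).map fun a b h => by simpa using h) ?_
    intro z h1 h2
    obtain ⟨n, -, rfl⟩ := List.mem_map.1 h1
    obtain ⟨m, -, h⟩ := List.mem_map.1 h2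
    have := hα.add_ne (1 + m + n)
    push_cast at this
    exact this (by linear_combination -h)

theorem goodSeeds_seedsB {α : ℝ} (hα : NonInt α) (M₁ M₂ : MayaDiagram) :
    GoodSeeds α true (seedsB α M₁ M₂) := by
  have hex : expo α 0 0 true = -α := by simp [expo]
  have hk : ∀ (n : ℕ) (x : ℝ), KEq (-α) (n : ℂ) (laguerreL (-α) n) x := laguerreL_kEq hα.neg
  refine ⟨fun p hp => ?_, fun p hp => ?_, fun p hp => ?_, ?_⟩
  · rcases List.mem_append.1 hp with hp | hp <;> obtain ⟨n, -, rfl⟩ := List.mem_map.1 hp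
    · refine fun x hx => ⟨(rpow_analyticAt _ hx).mul (laguerreL_analyticAt _ n x),
        KEq.rpow_mul hx (laguerreL_analyticAt _ n x) ?_⟩
      simpa using hk n x
    · refine fun x hx => ⟨((exp_analyticAt_ofReal x).mul (rpow_analyticAt _ hx)).mul
        (laguerreL_neg_analyticAt _ n x), ?_⟩
      have h1 := KEq.exp_mul (laguerreL_analyticAt _ n (-x)) (hk n (-x))
      have h2 := KEq.rpow_mul (lam := -1 - (n : ℂ)) hx
        (exp_mul_laguerreL_analyticAt (-α) n x) (by
          convert h1 using 1
          push_cast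
          ring)
      convert h2 using 1
      ext u
      ring
  · rw [hex]
    rcases List.mem_append.1 hp with hp | hp <;> obtain ⟨n, -, rfl⟩ := List.mem_map.1 hp
    · have := (hasGerm_rpow (-α)).mul (hasGerm_of_analyticAt (laguerreL_analyticAt (-α) n 0))
      simpa [laguerreL_zero hα.neg] using this
    · have := (hasGerm_rpow (-α)).mul (hasGerm_of_analyticAt
        (exp_mul_laguerreL_analyticAt (-α) n 0))
      simp only [add_zero, neg_zero, Real.exp_zero, Complex.ofReal_one, one_mul,
        laguerreL_zero hα.neg] at this
      refine this.congr (Eventually.of_forall fun x => ?_)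
      ring
  · rcases List.mem_append.1 hp with hp | hp <;> obtain ⟨n, -, rfl⟩ := List.mem_map.1 hp <;>
      exact lagVal_ne_zero hα.neg n
  · simp only [seedsB, List.map_append, List.map_map, Function.comp_def]
    refine List.Nodup.append ((decr_nodup _).map fun a b h => by simpa using h)
      ((decr_nodup _).map fun a b h => by simpa using h) ?_
    intro z h1 h2
    obtain ⟨n, -, rfl⟩ := List.mem_map.1 h1
    obtain ⟨m, -, h⟩ := List.mem_map.1 h2
    have := hα.sub_ne (1 + m + n)
    push_cast at this
    exact this (by linear_combination -h)

theorem seeds_crumState {α : ℝ} (hα : NonInt α) (M₁ M₂ : MayaDiagram) :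
    CrumState α (seeds α M₁ M₂) (num₁ M₁ + num₂ M₂) (num₃ M₂ + num₄ M₁)
      (crumOmega α (seedsA α M₁ M₂) (seedsB α M₁ M₂))
      (crumR α (seedsA α M₁ M₂) (seedsB α M₁ M₂)) :=
  ((goodSeeds_seedsA hα M₁ M₂).crumState hα (goodSeeds_seedsB hα M₁ M₂)).congr
    (seeds_eq α M₁ M₂) (seedsA_length α M₁ M₂).symm (seedsB_length α M₁ M₂).symm rfl
    fun _ _ => rfl


/-! ### Values at the origin in terms of Gamma functions -/

/-- Vandermonde product of a finite set. -/
noncomputable def vand (S : Finset ℕ) : ℂ := ∏ b ∈ S, ∏ a ∈ S.filter (· < b), ((b : ℂ) - a)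

/-- The translate of a set of indices by one. -/
def succs (S : Finset ℕ) : Finset ℕ := S.map (addRightEmbedding 1)

theorem prod_succs (S : Finset ℕ) (f : ℕ → ℂ) : ∏ n ∈ succs S, f n = ∏ n ∈ S, f (n + 1) := by
  simp [succs]

theorem zero_notMem_succs (S : Finset ℕ) : 0 ∉ succs S := by simp [succs]

theorem card_succs (S : Finset ℕ) : (succs S).card = S.card := by simp [succs]

theorem prod_insert_succs (S : Finset ℕ) (f : ℕ → ℂ) :
    ∏ n ∈ insert 0 (succs S), f n = f 0 * ∏ n ∈ S, f (n + 1) := by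
  rw [Finset.prod_insert (zero_notMem_succs S), prod_succs]

theorem card_insert_succs (S : Finset ℕ) : (insert 0 (succs S)).card = S.card + 1 := by
  rw [Finset.card_insert_of_notMem (zero_notMem_succs S), card_succs]

theorem vand_succs (S : Finset ℕ) : vand (succs S) = vand S := by
  simp only [vand]
  rw [prod_succs]
  refine Finset.prod_congr rfl fun b _ => ?_
  have : (succs S).filter (· < b + 1) = succs (S.filter (· < b)) := by
    ext n
    simp only [succs, Finset.mem_filter, Finset.mem_map, addRightEmbedding_apply]
    constructor
    · rintro ⟨⟨a, ha, rfl⟩, h⟩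
      exact ⟨a, ⟨ha, by omega⟩, rfl⟩
    · rintro ⟨a, ⟨ha, h⟩, rfl⟩
      exact ⟨⟨a, ha, rfl⟩, by omega⟩
  rw [this, prod_succs]
  refine Finset.prod_congr rfl fun a _ => ?_
  push_cast
  ring

theorem vand_insert_succs (S : Finset ℕ) :
    vand (insert 0 (succs S)) = vand S * ∏ n ∈ S, ((n : ℂ) + 1) := by
  rw [← vand_succs S]
  have h0 : ∀ b ∈ succs S, (insert 0 (succs S)).filter (· < b) =
      insert 0 ((succs S).filter (· < b)) := fun b hb => by
    rw [Finset.filter_insert, if_pos]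
    rcases Nat.eq_zero_or_pos b with rfl | h
    · exact absurd hb (zero_notMem_succs S)
    · exact h
  have h1 : ∀ b ∈ succs S, ∏ a ∈ (insert 0 (succs S)).filter (· < b), ((b : ℂ) - a) =
      b * ∏ a ∈ (succs S).filter (· < b), ((b : ℂ) - a) := fun b hb => by
    rw [h0 b hb, Finset.prod_insert]
    · simp
    · simp [zero_notMem_succs]
  simp only [vand]
  rw [Finset.prod_insert (zero_notMem_succs S), Finset.prod_congr rfl h1, Finset.prod_mul_distrib,
    prod_succs S fun n : ℕ => (n : ℂ)]
  simp
  ring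

theorem vand_insert_max {S : Finset ℕ} {a : ℕ} (h : ∀ b ∈ S, b < a) :
    vand (insert a S) = (∏ b ∈ S, ((a : ℂ) - b)) * vand S := by
  have ha : a ∉ S := fun h0 => (h a h0).false
  simp only [vand]
  rw [Finset.prod_insert ha]
  congr 1
  · refine Finset.prod_congr ?_ fun _ _ => rfl
    ext b
    simp only [Finset.mem_filter, Finset.mem_insert]
    constructor
    · rintro ⟨rfl | hb, h1⟩
      · omega
      · exact hb
    · exact fun hb => ⟨Or.inr hb, h b hb⟩
  · refine Finset.prod_congr rfl fun b hb => Finset.prod_congr ?_ fun _ _ => rfl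
    rw [Finset.filter_insert, if_neg]
    have := h b hb
    omega

theorem decr_prod (S : Finset ℕ) (f : ℕ → ℂ) : ((decr S).map f).prod = ∏ n ∈ S, f n := by
  rw [Finset.prod_eq_multiset_prod, ← Finset.sort_eq S (fun a b => b ≤ a), Multiset.map_coe,
    Multiset.prod_coe]
  rfl

theorem vdm_sorted {l : List ℕ} (h : l.Pairwise (· > ·)) :
    vdm (l.map fun n : ℕ => (n : ℂ)) = vand l.toFinset := by
  induction l with
  | nil => simp [vdm, vand]
  | cons a l ih =>
    rw [List.pairwise_cons] at h
    have hl : l.Nodup := h.2.imp fun h => Nat.ne_of_gt h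
    rw [List.toFinset_cons, vand_insert_max fun b hb => h.1 b (List.mem_toFinset.1 hb),
      ← ih h.2, List.prod_toFinset _ hl]
    simp [vdm, Function.comp_def]

theorem vdm_decr (S : Finset ℕ) : vdm ((decr S).map fun n : ℕ => (n : ℂ)) = vand S := by
  have h : (decr S).Pairwise (· > ·) := by
    have h1 : (decr S).Pairwise (fun a b => b ≤ a) := Finset.pairwise_sort _ _
    have h2 : (decr S).Pairwise (fun a b => a ≠ b) := decr_nodup S
    exact (h1.and h2).imp fun h => lt_of_le_of_ne h.1 h.2.symm
  rw [vdm_sorted h]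
  congr 1
  ext n
  simp [mem_decr]

theorem vdm_map_sub_const (l : List ℕ) (c : ℂ) :
    vdm (l.map fun n : ℕ => (n : ℂ) - c) = vdm (l.map fun n : ℕ => (n : ℂ)) := by
  induction l with
  | nil => rfl
  | cons a l ih => simp [vdm, ih, Function.comp_def]

/-- Seeds with a factor `e^x` have eigenvalues that decrease with the index; each of the binomially
many differences changes sign. -/
theorem vdm_map_const_sub (l : List ℕ) (c : ℂ) : vdm (l.map fun n : ℕ => c - (n : ℂ)) =
    (-1) ^ l.length.choose 2 * vdm (l.map fun n : ℕ => (n : ℂ)) := by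
  induction l with
  | nil => simp [vdm]
  | cons a l ih =>
    simp only [List.map_cons, vdm, ih, List.map_map, Function.comp_def, List.length_cons]
    rw [show (l.length + 1).choose 2 = l.length + l.length.choose 2 by
      rw [Nat.choose_succ_succ' l.length 1, Nat.choose_one_right]]
    have : (l.map fun x : ℕ => c - (a : ℂ) - (c - (x : ℂ))).prod =
        (-1) ^ l.length * (l.map fun x : ℕ => (a : ℂ) - (x : ℂ)).prod := by
      clear ih
      induction l with
      | nil => simp
      | cons b l ih =>
        simp only [List.map_cons, List.prod_cons, ih, List.length_cons, pow_succ]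
        ring
    rw [this, pow_add]
    ring

theorem rising_eq_prod (x : ℂ) (n : ℕ) : rising x n = ∏ k ∈ Finset.range n, (x + k) := by
  induction n with
  | zero => simp [rising_zero]
  | succ n ih => rw [rising_succ, ih, Finset.prod_range_succ]

theorem prod_sub_eq_rising (y : ℂ) (n : ℕ) :
    ∏ k ∈ Finset.range n, (y - k) = rising (y + 1 - n) n := by
  rw [rising_eq_prod, ← Finset.prod_range_reflect]
  refine Finset.prod_congr rfl fun k hk => ?_
  have hk := Finset.mem_range.1 hk
  have : ((n - 1 - k : ℕ) : ℂ) = n - 1 - k := by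
    rw [Nat.cast_sub (by omega), Nat.cast_sub (by omega)]
    simp
  rw [this]
  ring

/-- No integer translate of `z` vanishes. -/
def NonIntC (z : ℂ) : Prop := ∀ k : ℤ, z + k ≠ 0

theorem NonInt.toC {α : ℝ} (h : NonInt α) : NonIntC α := h.add_ne

theorem NonIntC.add_int {z : ℂ} (h : NonIntC z) (m : ℤ) : NonIntC (z + m) := fun k => by
  have := h (m + k)
  push_cast at this
  rwa [add_assoc]

theorem NonIntC.neg {z : ℂ} (h : NonIntC z) : NonIntC (-z) := fun k h0 =>
  h (-k) (by push_cast; linear_combination -h0)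

theorem NonIntC.add_nat {z : ℂ} (h : NonIntC z) (m : ℕ) : NonIntC (z + m) := by
  simpa using h.add_int m

theorem NonIntC.add_one {z : ℂ} (h : NonIntC z) : NonIntC (z + 1) := by
  simpa using h.add_int 1

theorem NonIntC.ne_zero {z : ℂ} (h : NonIntC z) : z ≠ 0 := by simpa using h 0

theorem NonIntC.gamma_ne_zero {z : ℂ} (h : NonIntC z) : Complex.Gamma z ≠ 0 :=
  Complex.Gamma_ne_zero fun m h0 => h m (by rw [h0]; simp)

theorem NonIntC.gamma_add {z : ℂ} (h : NonIntC z) (n : ℕ) :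
    Complex.Gamma (z + n) = rising z n * Complex.Gamma z := by
  induction n with
  | zero => simp [rising_zero]
  | succ n ih =>
    push_cast
    rw [← add_assoc, Complex.Gamma_add_one _ (h.add_nat n).ne_zero, ih, rising_succ]
    ring

theorem NonIntC.rising_ne_zero {z : ℂ} (h : NonIntC z) (n : ℕ) : rising z n ≠ 0 :=
  ExceptionalLaguerre.rising_ne_zero (fun k => (h.add_nat k).ne_zero) n

/-- The contribution of the indices of the seed functions of one kind. -/
noncomputable def blk (a : ℂ) (X Y : Finset ℕ) : ℂ :=
  vand X * vand Y / ((∏ x ∈ X, (x.factorial : ℂ)) * ∏ y ∈ Y, (y.factorial : ℂ)) *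
    ((∏ x ∈ X, Complex.Gamma (a + 1 + x)) * ∏ y ∈ Y, Complex.Gamma (a + 1 + y)) *
    ∏ x ∈ X, ∏ y ∈ Y, ((x : ℂ) + y + a + 1)

theorem blk_comm (a : ℂ) (X Y : Finset ℕ) : blk a X Y = blk a Y X := by
  unfold blk
  rw [Finset.prod_comm (s := X) (t := Y), mul_comm (vand X), mul_comm (∏ x ∈ X, (x.factorial : ℂ)),
    mul_comm (∏ x ∈ X, Complex.Gamma (a + 1 + x))]
  congr 1
  refine Finset.prod_congr rfl fun x _ => Finset.prod_congr rfl fun y _ => ?_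
  ring

/-- Raising the indices in `X` and lowering `a` leaves `a + x` unchanged. Thus the differences
within `X`, the Gamma factors of `X` and the cross terms persist, and only the factorials of `X` and
the Gamma factors of `Y` change. -/
theorem blk_succs {a : ℂ} (ha : NonIntC a) (X Y : Finset ℕ) :
    blk (a - 1) (succs X) Y * ((∏ x ∈ X, ((x : ℂ) + 1)) * ∏ y ∈ Y, (a + y)) = blk a X Y := by
  unfold blk
  rw [vand_succs, prod_succs, prod_succs, prod_succs]
  have e1 : ∏ y ∈ Y, Complex.Gamma (a + 1 + y) =
      (∏ y ∈ Y, (a + y)) * ∏ y ∈ Y, Complex.Gamma (a - 1 + 1 + y) := by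
    rw [← Finset.prod_mul_distrib]
    refine Finset.prod_congr rfl fun y _ => ?_
    rw [show a + 1 + y = a + y + 1 by ring, Complex.Gamma_add_one _ (ha.add_nat y).ne_zero]
    congr 2
    ring
  have e2 : ∏ x ∈ X, (((x + 1).factorial : ℕ) : ℂ) =
      (∏ x ∈ X, ((x : ℂ) + 1)) * ∏ x ∈ X, (x.factorial : ℂ) := by
    rw [← Finset.prod_mul_distrib]
    refine Finset.prod_congr rfl fun x _ => ?_
    rw [Nat.factorial_succ]
    push_cast
    ring
  have e3 : ∏ x ∈ X, Complex.Gamma (a - 1 + 1 + ((x + 1 : ℕ) : ℂ)) =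
      ∏ x ∈ X, Complex.Gamma (a + 1 + x) := by
    refine Finset.prod_congr rfl fun x _ => ?_
    congr 1
    push_cast
    ring
  have e4 : ∏ x ∈ X, ∏ y ∈ Y, (((x + 1 : ℕ) : ℂ) + y + (a - 1) + 1) =
      ∏ x ∈ X, ∏ y ∈ Y, ((x : ℂ) + y + a + 1) := by
    refine Finset.prod_congr rfl fun x _ => Finset.prod_congr rfl fun y _ => ?_
    push_cast
    ring
  rw [e1, e2, e3, e4]
  have n1 : ∏ x ∈ X, ((x : ℂ) + 1) ≠ 0 :=
    Finset.prod_ne_zero_iff.2 fun x _ => by exact_mod_cast x.succ_ne_zero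
  have n2 : ∏ x ∈ X, (x.factorial : ℂ) ≠ 0 :=
    Finset.prod_ne_zero_iff.2 fun x _ => by exact_mod_cast x.factorial_ne_zero
  have n3 : ∏ x ∈ Y, (x.factorial : ℂ) ≠ 0 :=
    Finset.prod_ne_zero_iff.2 fun x _ => by exact_mod_cast x.factorial_ne_zero
  field_simp

/-- The new index 0 contributes exactly the products by which `blk_succs` is off: `∏ (x+1)` to the
Vandermonde product and `∏ (a+y)` to the cross terms, besides its own factor `Γ(a)`. -/
theorem blk_insert_succs {a : ℂ} (ha : NonIntC a) (X Y : Finset ℕ) :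
    blk (a - 1) (insert 0 (succs X)) Y = blk a X Y * Complex.Gamma a := by
  rw [← blk_succs ha]
  unfold blk
  rw [vand_insert_succs, vand_succs, prod_insert_succs, prod_insert_succs, prod_insert_succs,
    prod_succs, prod_succs, prod_succs]
  have e1 : ∏ y ∈ Y, (((0 : ℕ) : ℂ) + y + (a - 1) + 1) = ∏ y ∈ Y, (a + y) :=
    Finset.prod_congr rfl fun y _ => by push_cast; ring
  rw [e1]
  simp
  ring

/-- The contribution of the numbers of seed functions. -/
noncomputable def ker (a : ℂ) (s t : ℕ) : ℂ :=
  (∏ i ∈ Finset.range s, ∏ j ∈ Finset.range t, (a + i - j)) /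
    ((∏ i ∈ Finset.range s, Complex.Gamma (a + 1 + i)) *
      ∏ j ∈ Finset.range t, Complex.Gamma (1 - a + j))

theorem ker_neg (a : ℂ) (s t : ℕ) : ker (-a) t s = (-1) ^ (s * t) * ker a s t := by
  unfold ker
  rw [Finset.prod_comm, mul_comm (∏ i ∈ Finset.range t, _)]
  have e : ∏ i ∈ Finset.range s, ∏ j ∈ Finset.range t, (-a + j - i) =
      (-1) ^ (s * t) * ∏ i ∈ Finset.range s, ∏ j ∈ Finset.range t, (a + i - j) := by
    rw [mul_comm s t, pow_mul]
    have : ∀ i ∈ Finset.range s, ∏ j ∈ Finset.range t, (-a + j - i) =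
        (-1) ^ t * ∏ j ∈ Finset.range t, (a + i - j) := fun i _ => by
      have := Finset.prod_neg (s := Finset.range t) (fun j : ℕ => a + i - (j : ℂ))
      rw [Finset.card_range] at this
      rw [← this]
      exact Finset.prod_congr rfl fun j _ => by ring
    rw [Finset.prod_congr rfl this, Finset.prod_mul_distrib, Finset.prod_const, Finset.card_range]
  rw [e, mul_div_assoc]
  congr 3
  · refine Finset.prod_congr rfl fun i _ => ?_
    congr 1
    ring
  · refine Finset.prod_congr rfl fun i _ => ?_
    congr 1
    ring

theorem ker_succ_left {a : ℂ} (ha : NonIntC a) (s t : ℕ) :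
    ker (a - 1) (s + 1) t * Complex.Gamma a = (-1) ^ t * ker a s t := by
  unfold ker
  rw [Finset.prod_range_succ', Finset.prod_range_succ' (fun i => Complex.Gamma _)]
  have e1 : ∏ j ∈ Finset.range t, Complex.Gamma (1 - (a - 1) + j) =
      (∏ j ∈ Finset.range t, (1 - a + j)) * ∏ j ∈ Finset.range t, Complex.Gamma (1 - a + j) := by
    rw [← Finset.prod_mul_distrib]
    refine Finset.prod_congr rfl fun j _ => ?_
    have : NonIntC (1 - a + j) := by
      have := (ha.neg.add_one).add_nat j
      rwa [neg_add_eq_sub] at this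
    rw [← Complex.Gamma_add_one _ this.ne_zero]
    congr 1
    ring
  have e2 : ∏ j ∈ Finset.range t, (a - 1 + ((0 : ℕ) : ℂ) - j) =
      (-1) ^ t * ∏ j ∈ Finset.range t, (1 - a + j) := by
    have := Finset.prod_neg (s := Finset.range t) (fun j : ℕ => 1 - a + (j : ℂ))
    rw [Finset.card_range] at this
    rw [← this]
    exact Finset.prod_congr rfl fun j _ => by push_cast; ring
  have e3 : ∏ i ∈ Finset.range s, Complex.Gamma (a - 1 + 1 + ((i + 1 : ℕ) : ℂ)) =
      ∏ i ∈ Finset.range s, Complex.Gamma (a + 1 + i) := by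
    refine Finset.prod_congr rfl fun i _ => ?_
    congr 1
    push_cast
    ring
  have e4 : ∏ i ∈ Finset.range s, ∏ j ∈ Finset.range t, (a - 1 + ((i + 1 : ℕ) : ℂ) - j) =
      ∏ i ∈ Finset.range s, ∏ j ∈ Finset.range t, (a + i - j) := by
    refine Finset.prod_congr rfl fun i _ => Finset.prod_congr rfl fun j _ => ?_
    push_cast
    ring
  rw [e1, e2, e3, e4]
  have n1 := ha.gamma_ne_zero
  have n2 : ∏ j ∈ Finset.range t, (1 - a + j) ≠ 0 := by
    refine Finset.prod_ne_zero_iff.2 fun j _ => ?_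
    have := (ha.neg.add_one).add_nat j
    rw [neg_add_eq_sub] at this
    exact this.ne_zero
  have n3 : a - 1 + 1 + ((0 : ℕ) : ℂ) = a := by push_cast; ring
  rw [n3]
  field_simp

/-- The symmetry `ker_neg` exchanges the two arguments, so this is `ker_succ_left` at `1 - a`. -/
theorem ker_succ_right {a : ℂ} (ha : NonIntC a) (s t : ℕ) :
    ker a s (t + 1) * Complex.Gamma (1 - a) = ker (a - 1) s t := by
  have h := ker_succ_left ((ha.neg).add_one) t s
  have h1 := ker_neg (a - 1) s t
  have h2 := ker_neg a s (t + 1)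
  rw [show -a + 1 - 1 = -a by ring, show -a + 1 = 1 - a by ring] at h
  rw [show -(a - 1) = 1 - a by ring] at h1
  rw [h1, h2, Nat.mul_succ, pow_add] at h
  have hs : (-1 : ℂ) ^ (s * t) * (-1) ^ s ≠ 0 :=
    mul_ne_zero (pow_ne_zero _ (by norm_num)) (pow_ne_zero _ (by norm_num))
  refine mul_left_cancel₀ hs ?_
  linear_combination h


theorem NonIntC.lag {a : ℂ} (h : NonIntC a) (X : Finset ℕ) :
    ∏ n ∈ X, (rising (a + 1) n / n.factorial) =
      (∏ n ∈ X, Complex.Gamma (a + 1 + n)) /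
        (Complex.Gamma (a + 1) ^ X.card * ∏ n ∈ X, (n.factorial : ℂ)) := by
  rw [← Finset.prod_const, ← Finset.prod_mul_distrib, ← Finset.prod_div_distrib]
  refine Finset.prod_congr rfl fun n _ => ?_
  rw [h.add_one.gamma_add]
  have := h.add_one.gamma_ne_zero
  have : (n.factorial : ℂ) ≠ 0 := by exact_mod_cast n.factorial_ne_zero
  field_simp

theorem NonIntC.prod_rising {a : ℂ} (h : NonIntC a) (s : ℕ) :
    ∏ i ∈ Finset.range s, rising a i =
      (∏ i ∈ Finset.range s, Complex.Gamma (a + i)) / Complex.Gamma a ^ s := by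
  have := h.gamma_ne_zero
  rw [eq_div_iff (pow_ne_zero _ this)]
  nth_rewrite 2 [← Finset.card_range s]
  rw [← Finset.prod_const, ← Finset.prod_mul_distrib]
  exact Finset.prod_congr rfl fun i _ => (h.gamma_add i).symm

/-- For each `j` the two products are parts of the rising factorial of length `s + j` at `1 - a -
s`, split once after `s` and once after `j` factors. Equating the splittings turns the quotient into
the product over `i < s`, up to sign, and a quotient of Gamma values. -/
theorem NonIntC.prod_mixed {a : ℂ} (h : NonIntC a) (s t : ℕ) :
    (∏ k ∈ Finset.range s, (-a - k)) ^ t /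
      (∏ j ∈ Finset.range t, ∏ l ∈ Finset.range j, (1 - a - s + l)) =
    (-1) ^ (s * t) * (∏ i ∈ Finset.range s, ∏ j ∈ Finset.range t, (a + i - j)) *
      Complex.Gamma (1 - a) ^ t / ∏ j ∈ Finset.range t, Complex.Gamma (1 - a + j) := by
  have h1 : NonIntC (1 - a) := by simpa [neg_add_eq_sub] using h.neg.add_one
  have h2 : NonIntC (1 - a - s) := by simpa [sub_eq_add_neg] using h1.add_int (-s)
  have key : ∀ j : ℕ, (∏ k ∈ Finset.range s, (-a - k)) / ∏ l ∈ Finset.range j, (1 - a - s + l) =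
      (∏ i ∈ Finset.range s, (-(a + i - j))) * (Complex.Gamma (1 - a) / Complex.Gamma (1 - a + j)) :=
    fun j => by
    have e1 : ∏ i ∈ Finset.range s, (-(a + i - j)) = ∏ i ∈ Finset.range s, ((j - a) - i) :=
      Finset.prod_congr rfl fun i _ => by ring
    rw [e1, prod_sub_eq_rising, prod_sub_eq_rising, ← rising_eq_prod, h1.gamma_add]
    have g0 := h1.gamma_ne_zero
    have r0 := h1.rising_ne_zero j
    have r1 := h2.rising_ne_zero j
    have k1 := rising_add (1 - a - s) s j
    have k2 := rising_add (1 - a - s) j s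
    rw [add_comm j s] at k2
    rw [show (1 : ℂ) - a - s + s = 1 - a by ring] at k1
    rw [show -a + 1 - (s : ℂ) = 1 - a - s by ring,
      show (j : ℂ) - a + 1 - s = 1 - a - s + j by ring]
    field_simp
    linear_combination k2 - k1
  have e2 : (∏ k ∈ Finset.range s, (-a - k)) ^ t = ∏ _j ∈ Finset.range t,
      ∏ k ∈ Finset.range s, (-a - k) := by
    rw [Finset.prod_const, Finset.card_range]
  rw [e2, ← Finset.prod_div_distrib, Finset.prod_congr rfl fun j _ => key j,
    Finset.prod_mul_distrib, Finset.prod_div_distrib, Finset.prod_const, Finset.card_range]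
  have e3 : ∏ j ∈ Finset.range t, ∏ i ∈ Finset.range s, (-(a + i - j)) =
      (-1) ^ (s * t) * ∏ i ∈ Finset.range s, ∏ j ∈ Finset.range t, (a + i - j) := by
    have : ∀ j ∈ Finset.range t, ∏ i ∈ Finset.range s, (-(a + i - (j : ℂ))) =
        (-1) ^ s * ∏ i ∈ Finset.range s, (a + i - j) := fun j _ => by
      have := Finset.prod_neg (s := Finset.range s) (fun i : ℕ => a + i - (j : ℂ))
      rwa [Finset.card_range] at this
    rw [Finset.prod_congr rfl this, Finset.prod_mul_distrib, Finset.prod_const, Finset.card_range,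
      ← pow_mul, Finset.prod_comm]
  rw [e3]
  ring

/-- The Wronskian of the seed functions at the origin, up to sign. -/
noncomputable def omForm (a : ℂ) (N P P' N' : Finset ℕ) : ℂ :=
  blk a N P * blk (-a) P' N' * ker a (N.card + P.card) (P'.card + N'.card)

/-- The value at the origin of the solution of the first kind, up to sign. -/
noncomputable def valForm (a lam : ℂ) (N P P' N' : Finset ℕ) : ℂ :=
  omForm a N P P' N' * ((∏ n ∈ N, (n - lam)) * ∏ m ∈ P, (m + a + 1 + lam)) *
    (Complex.Gamma (a + 1) /
      Complex.Gamma (a + 1 + ((N.card : ℤ) + P.card - P'.card - N'.card : ℤ)))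

/-- The sign relating `crumOmega` to `omForm`. -/
noncomputable def omSign (M₁ M₂ : MayaDiagram) : ℕ :=
  (num₂ M₂).choose 2 + (num₄ M₁).choose 2 + (num₁ M₁ + num₂ M₂) * (num₃ M₂ + num₄ M₁)

theorem vdm_seedsA (α : ℝ) (M₁ M₂ : MayaDiagram) :
    vdm ((seedsA α M₁ M₂).map fun p => p.2.1) = (-1) ^ (num₂ M₂).choose 2 *
      (vand M₁.filled * vand M₂.filled *
        ∏ n ∈ M₁.filled, ∏ m ∈ M₂.filled, ((n : ℂ) + m + α + 1)) := by
  simp only [seedsA, List.map_append, List.map_map, Function.comp_def]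
  rw [vdm_append, vdm_decr, vdm_map_const_sub, vdm_decr, decr_length]
  simp only [List.map_map, Function.comp_def, decr_prod]
  rw [num₂]
  have : ∏ n ∈ M₁.filled, ∏ m ∈ M₂.filled, ((n : ℂ) - (-(α : ℂ) - 1 - m)) =
      ∏ n ∈ M₁.filled, ∏ m ∈ M₂.filled, ((n : ℂ) + m + α + 1) :=
    Finset.prod_congr rfl fun n _ => Finset.prod_congr rfl fun m _ => by ring
  rw [this]
  ring

theorem vdm_seedsB (α : ℝ) (M₁ M₂ : MayaDiagram) :
    vdm ((seedsB α M₁ M₂).map fun p => p.2.1) = (-1) ^ (num₄ M₁).choose 2 *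
      (vand M₂.empty * vand M₁.empty *
        ∏ m ∈ M₂.empty, ∏ n ∈ M₁.empty, ((m : ℂ) + n + -α + 1)) := by
  simp only [seedsB, List.map_append, List.map_map, Function.comp_def]
  rw [vdm_append, vdm_map_sub_const, vdm_decr, vdm_map_const_sub, vdm_decr, decr_length]
  simp only [List.map_map, Function.comp_def, decr_prod]
  rw [num₄]
  have : ∏ n ∈ M₂.empty, ∏ m ∈ M₁.empty, ((n : ℂ) - α - (-1 - m)) =
      ∏ m ∈ M₂.empty, ∏ n ∈ M₁.empty, ((m : ℂ) + n + -α + 1) :=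
    Finset.prod_congr rfl fun n _ => Finset.prod_congr rfl fun m _ => by ring
  rw [this]
  ring

theorem crumOmega_eq {α : ℝ} (hα : NonInt α) (M₁ M₂ : MayaDiagram) :
    crumOmega α (seedsA α M₁ M₂) (seedsB α M₁ M₂) =
      (-1) ^ omSign M₁ M₂ * omForm α M₁.filled M₂.filled M₂.empty M₁.empty := by
  have hC := hα.toC
  have hB := hC.neg
  unfold crumOmega
  rw [vdm_seedsA, vdm_seedsB, seedsA_length, seedsB_length, mul_div_assoc (_ * (_ * _)),
    show (((num₁ M₁ + num₂ M₂ : ℕ) : ℂ)) = ((num₁ M₁ + num₂ M₂ : ℕ) : ℂ) from rfl,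
    hC.prod_mixed]
  have e0 : ∏ i ∈ Finset.range (num₁ M₁ + num₂ M₂), ∏ k ∈ Finset.range i, ((α : ℂ) + 1 + k) =
      ∏ i ∈ Finset.range (num₁ M₁ + num₂ M₂), rising (α + 1) i :=
    Finset.prod_congr rfl fun i _ => (rising_eq_prod _ _).symm
  rw [e0, hC.add_one.prod_rising]
  simp only [seedsA, seedsB, List.map_append, List.map_map, Function.comp_def, List.prod_append,
    decr_prod, lagVal]
  rw [hC.lag, hC.lag]
  push_cast
  rw [hB.lag, hB.lag]
  unfold omForm omSign blk ker
  rw [show num₁ M₁ = M₁.filled.card from rfl, show num₂ M₂ = M₂.filled.card from rfl,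
    show num₃ M₂ = M₂.empty.card from rfl, show num₄ M₁ = M₁.empty.card from rfl,
    show -(α : ℂ) + 1 = 1 - α by ring]
  have g1 := hC.add_one.gamma_ne_zero
  have g2 := hB.add_one.gamma_ne_zero
  rw [show -(α : ℂ) + 1 = 1 - α by ring] at g2
  have f : ∀ X : Finset ℕ, ∏ n ∈ X, (n.factorial : ℂ) ≠ 0 := fun X =>
    Finset.prod_ne_zero_iff.2 fun x _ => by exact_mod_cast x.factorial_ne_zero
  have f1 := f M₁.filled
  have f2 := f M₂.filled
  have f3 := f M₂.empty
  have f4 := f M₁.empty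
  have k1 : ∏ i ∈ Finset.range (M₁.filled.card + M₂.filled.card),
      Complex.Gamma ((α : ℂ) + 1 + i) ≠ 0 :=
    Finset.prod_ne_zero_iff.2 fun i _ => (hC.add_one.add_nat i).gamma_ne_zero
  have k2 : ∏ i ∈ Finset.range (M₂.empty.card + M₁.empty.card),
      Complex.Gamma (1 - (α : ℂ) + i) ≠ 0 :=
    Finset.prod_ne_zero_iff.2 fun i _ => by
      have := (hB.add_one.add_nat i).gamma_ne_zero
      rwa [show -(α : ℂ) + 1 = 1 - α by ring] at this
  rw [pow_add (-1 : ℂ), pow_add (-1 : ℂ), pow_add (Complex.Gamma ((α : ℂ) + 1)),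
    pow_add (Complex.Gamma (1 - (α : ℂ)))]
  generalize ∏ i ∈ Finset.range (M₁.filled.card + M₂.filled.card),
      ∏ j ∈ Finset.range (M₂.empty.card + M₁.empty.card), ((α : ℂ) + i - j) = X
  generalize ∏ i ∈ Finset.range (M₁.filled.card + M₂.filled.card),
      Complex.Gamma ((α : ℂ) + 1 + i) = X1 at *
  generalize ∏ i ∈ Finset.range (M₂.empty.card + M₁.empty.card),
      Complex.Gamma (1 - (α : ℂ) + i) = X2 at *
  have q1 := pow_ne_zero M₁.filled.card g1
  have q2 := pow_ne_zero M₂.filled.card g1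
  have q3 := pow_ne_zero M₂.empty.card g2
  have q4 := pow_ne_zero M₁.empty.card g2
  generalize Complex.Gamma ((α : ℂ) + 1) ^ M₁.filled.card = y1 at *
  generalize Complex.Gamma ((α : ℂ) + 1) ^ M₂.filled.card = y2 at *
  generalize Complex.Gamma (1 - (α : ℂ)) ^ M₂.empty.card = y3 at *
  generalize Complex.Gamma (1 - (α : ℂ)) ^ M₁.empty.card = y4 at *
  generalize ∏ n ∈ M₁.filled, (n.factorial : ℂ) = z1 at *
  generalize ∏ n ∈ M₂.filled, (n.factorial : ℂ) = z2 at *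
  generalize ∏ n ∈ M₂.empty, (n.factorial : ℂ) = z3 at *
  generalize ∏ n ∈ M₁.empty, (n.factorial : ℂ) = z4 at *
  generalize (-1 : ℂ) ^ (M₂.filled.card).choose 2 = c1
  generalize (-1 : ℂ) ^ (M₁.empty.card).choose 2 = c2
  generalize (-1 : ℂ) ^ ((M₁.filled.card + M₂.filled.card) * (M₂.empty.card + M₁.empty.card)) = c3
  generalize ∏ n ∈ M₁.filled, ∏ m ∈ M₂.filled, ((n : ℂ) + m + α + 1) = d1
  generalize ∏ m ∈ M₂.empty, ∏ n ∈ M₁.empty, ((m : ℂ) + n + -α + 1) = d2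
  generalize ∏ n ∈ M₁.filled, Complex.Gamma ((α : ℂ) + 1 + n) = h1
  generalize ∏ n ∈ M₂.filled, Complex.Gamma ((α : ℂ) + 1 + n) = h2
  generalize ∏ n ∈ M₂.empty, Complex.Gamma (1 - (α : ℂ) + n) = h3
  generalize ∏ n ∈ M₁.empty, Complex.Gamma (1 - (α : ℂ) + n) = h4
  clear f hC hB hα g1 g2
  generalize vand M₁.filled = v1
  generalize vand M₂.filled = v2
  generalize vand M₂.empty = v3
  generalize vand M₁.empty = v4
  -- The powers of `Γ(α+1)` and `Γ(1-α)` introduced by the values of the Laguerre polynomials cancel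
  -- against those from the products of rising factorials.
  have A1 : h1 / (y1 * z1) * (h2 / (y2 * z2)) / (X1 / (y1 * y2)) = h1 * h2 / (z1 * z2 * X1) := by
    field_simp
  have A2 : h3 / (y3 * z3) * (h4 / (y4 * z4)) * (y3 * y4 / X2) = h3 * h4 / (z3 * z4 * X2) := by
    field_simp
  linear_combination (c1 * (v1 * v2 * d1)) * (c2 * (v3 * v4 * d2) * c3 * X) *
    (h3 / (y3 * z3) * (h4 / (y4 * z4)) * (y3 * y4 / X2)) * A1 +
    (c1 * (v1 * v2 * d1)) * (c2 * (v3 * v4 * d2) * c3 * X) * (h1 * h2 / (z1 * z2 * X1)) * A2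

/-- The products over `j < t` and `k < s` collapse to a quotient of Gamma values that depends only
on `s - t`, the total charge. Together with `α`, this is unaffected by shifts of the diagrams. -/
theorem crumR_false_eq {α : ℝ} (hα : NonInt α) (lam : ℂ) (M₁ M₂ : MayaDiagram) :
    crumR α (seedsA α M₁ M₂) (seedsB α M₁ M₂) false lam =
      (-1) ^ num₂ M₂ * (((∏ n ∈ M₁.filled, (n - lam)) * ∏ m ∈ M₂.filled, (m + α + 1 + lam)) *
      (Complex.Gamma (α + 1) / Complex.Gamma (α + 1 +
        ((M₁.filled.card : ℤ) + M₂.filled.card - M₂.empty.card - M₁.empty.card : ℤ)))) := by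
  have hC := hα.toC
  unfold crumR
  rw [seedsA_length, seedsB_length]
  simp only [Bool.false_eq_true, if_false]
  simp only [seedsA, List.map_append, List.map_map, Function.comp_def, List.prod_append, decr_prod]
  set s := num₁ M₁ + num₂ M₂ with hs
  set t := num₃ M₂ + num₄ M₁ with ht
  have e1 : ∏ m ∈ M₂.filled, (-(α : ℂ) - 1 - m - lam) =
      (-1) ^ num₂ M₂ * ∏ m ∈ M₂.filled, (m + α + 1 + lam) := by
    rw [num₂, ← Finset.prod_neg]
    exact Finset.prod_congr rfl fun m _ => by ring
  have e2 : (α : ℂ) + 1 + ((M₁.filled.card : ℤ) + M₂.filled.card - M₂.empty.card - M₁.empty.card : ℤ)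
      = α + s + 1 - t := by
    simp [hs, ht, num₁, num₂, num₃, num₄]
    ring
  have hst : NonIntC ((α : ℂ) + s + 1 - t) := by
    have := ((hC.add_nat s).add_one).add_int (-t)
    simpa [sub_eq_add_neg] using this
  have e3 : (∏ j ∈ Finset.range t, ((α : ℂ) + s - j)) * Complex.Gamma (α + s + 1 - t) =
      (∏ k ∈ Finset.range s, ((α : ℂ) + 1 + k)) * Complex.Gamma (α + 1) := by
    rw [prod_sub_eq_rising, ← hst.gamma_add, ← rising_eq_prod, ← hC.add_one.gamma_add]
    congr 1
    ring
  rw [e1, e2]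
  have n1 := hα.prod_first s
  have n2 := hst.gamma_ne_zero
  rw [div_mul_eq_mul_div, div_eq_iff n1]
  field_simp
  linear_combination ((∏ n ∈ M₁.filled, (n - lam)) *
    ∏ m ∈ M₂.filled, (m + α + 1 + lam)) * e3

/-- Arranged so that, up to sign, the right side is that of `crumR_false_eq` after `α ↦ -α`, `λ ↦
-1-λ` and the exchange of filled and empty places. This is what allows `D` to be obtained from `C`.
-/
theorem crumR_true_eq {α : ℝ} (hα : NonInt α) (lam : ℂ) (M₁ M₂ : MayaDiagram) :
    crumR α (seedsA α M₁ M₂) (seedsB α M₁ M₂) true lam =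
      (-1) ^ num₄ M₁ *
      (((∏ n ∈ M₁.empty, (n - (-1 - lam))) * ∏ m ∈ M₂.empty, (m + -α + 1 + (-1 - lam))) *
      (Complex.Gamma (-α + 1) / Complex.Gamma (-α + 1 +
        ((M₁.empty.card : ℤ) + M₂.empty.card - M₂.filled.card - M₁.filled.card : ℤ)))) := by
  have hC := hα.toC.neg
  unfold crumR
  rw [seedsA_length, seedsB_length]
  simp only [if_true]
  simp only [seedsB, List.map_append, List.map_map, Function.comp_def, List.prod_append, decr_prod]
  set s := num₁ M₁ + num₂ M₂ with hs
  set t := num₃ M₂ + num₄ M₁ with ht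
  have e1 : ∏ n ∈ M₁.empty, (-1 - (n : ℂ) - lam) =
      (-1) ^ num₄ M₁ * ∏ n ∈ M₁.empty, ((n : ℂ) - (-1 - lam)) := by
    rw [num₄, ← Finset.prod_neg]
    exact Finset.prod_congr rfl fun m _ => by ring
  have e4 : ∏ m ∈ M₂.empty, ((m : ℂ) - α - lam) =
      ∏ m ∈ M₂.empty, ((m : ℂ) + -α + 1 + (-1 - lam)) :=
    Finset.prod_congr rfl fun m _ => by ring
  have e2 : -(α : ℂ) + 1 + ((M₁.empty.card : ℤ) + M₂.empty.card - M₂.filled.card -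
      M₁.filled.card : ℤ) = 1 - α - s + t := by
    simp [hs, ht, num₁, num₂, num₃, num₄]
    ring
  have hst : NonIntC (1 - (α : ℂ) - s) := by
    have := (hC.add_one).add_int (-s)
    rw [show -(α : ℂ) + 1 = 1 - α by ring] at this
    simpa [sub_eq_add_neg] using this
  have e3 : (∏ k ∈ Finset.range s, (-(α : ℂ) - k)) * Complex.Gamma (1 - α - s + t) =
      (∏ j ∈ Finset.range t, (1 - (α : ℂ) - s + j)) * Complex.Gamma (-α + 1) := by
    rw [prod_sub_eq_rising, hst.gamma_add, ← rising_eq_prod,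
      show -(α : ℂ) + 1 = 1 - α - s + s by ring, hst.gamma_add]
    rw [show 1 - (α : ℂ) - s + s - s = 1 - α - s by ring]
    ring
  rw [e1, e2, e4]
  have n1 := hα.prod_second s t
  have n2 := (hst.add_nat t).gamma_ne_zero
  rw [div_eq_iff n1]
  field_simp
  linear_combination ((∏ n ∈ M₁.empty, ((n : ℂ) - (-1 - lam))) *
    ∏ m ∈ M₂.empty, ((m : ℂ) + -α + 1 + (-1 - lam))) * e3


/-! ### Symmetries of the values at the origin, and their change under a shift by one. -/

/-- The symmetry of the index sets behind the substitution `y(x) = e^x g(-x)`: it exchanges the two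
diagrams and `λ` with `-α-1-λ`. -/
theorem valForm_swap (a lam : ℂ) (N P P' N' : Finset ℕ) :
    valForm a (-a - 1 - lam) P N N' P' = valForm a lam N P P' N' := by
  unfold valForm omForm
  rw [blk_comm a P N, blk_comm (-a) N' P', add_comm P.card, add_comm N'.card]
  have e1 : ∏ m ∈ P, ((m : ℂ) - (-a - 1 - lam)) = ∏ m ∈ P, (m + a + 1 + lam) :=
    Finset.prod_congr rfl fun m _ => by ring
  have e2 : ∏ n ∈ N, ((n : ℂ) + a + 1 + (-a - 1 - lam)) = ∏ n ∈ N, ((n : ℂ) - lam) :=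
    Finset.prod_congr rfl fun m _ => by ring
  rw [e1, e2, mul_comm (∏ m ∈ P, _)]
  congr 4
  push_cast
  ring

theorem omForm_neg (a : ℂ) (N P P' N' : Finset ℕ) : omForm (-a) N' P' P N =
    (-1) ^ ((N.card + P.card) * (P'.card + N'.card)) * omForm a N P P' N' := by
  unfold omForm
  rw [add_comm N'.card, add_comm P.card, ker_neg, neg_neg, blk_comm (-a), blk_comm a]
  ring

/-- The constant `C₃` as a function of the four sets of indices. -/
noncomputable def crossForm (a : ℂ) (N P P' N' : Finset ℕ) : ℂ :=
  (∏ n ∈ N, ∏ m' ∈ P', ((m' : ℂ) - a - n)) * (∏ m ∈ P, ∏ n' ∈ N', ((n' : ℂ) - a - m)) *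
  (∏ n ∈ N, ∏ n' ∈ N', ((n : ℂ) + n' + 1)) * (∏ m ∈ P, ∏ m' ∈ P', ((m : ℂ) + m' + 1))

theorem crossForm_swap (a : ℂ) (N P P' N' : Finset ℕ) :
    crossForm a P N N' P' = crossForm a N P P' N' := by
  unfold crossForm
  ring

theorem crossForm_insert (a : ℂ) (N P P' N' : Finset ℕ) :
    crossForm (a - 1) (insert 0 (succs N)) P P' N' =
      crossForm a N P P' (succs N') * ((∏ m ∈ P', (1 - a + m)) * ∏ n ∈ N', ((n : ℂ) + 1)) := by
  unfold crossForm
  simp only [prod_insert_succs (f := fun n => ∏ m' ∈ P', ((m' : ℂ) - (a - 1) - n)),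
    prod_insert_succs (f := fun n => ∏ n' ∈ N', ((n : ℂ) + n' + 1)), prod_succs]
  have e1 : ∏ m' ∈ P', ((m' : ℂ) - (a - 1) - ((0 : ℕ) : ℂ)) = ∏ m ∈ P', (1 - a + m) :=
    Finset.prod_congr rfl fun m _ => by push_cast; ring
  have e2 : ∏ n ∈ N, ∏ m' ∈ P', ((m' : ℂ) - (a - 1) - ((n + 1 : ℕ) : ℂ)) =
      ∏ n ∈ N, ∏ m' ∈ P', ((m' : ℂ) - a - n) :=
    Finset.prod_congr rfl fun n _ => Finset.prod_congr rfl fun m _ => by push_cast; ring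
  have e3 : ∏ m ∈ P, ∏ n' ∈ N', ((n' : ℂ) - (a - 1) - m) =
      ∏ m ∈ P, ∏ n' ∈ N', (((n' + 1 : ℕ) : ℂ) - a - m) :=
    Finset.prod_congr rfl fun n _ => Finset.prod_congr rfl fun m _ => by push_cast; ring
  have e4 : ∏ n' ∈ N', (((0 : ℕ) : ℂ) + n' + 1) = ∏ n ∈ N', ((n : ℂ) + 1) :=
    Finset.prod_congr rfl fun m _ => by push_cast; ring
  have e5 : ∏ n ∈ N, ∏ n' ∈ N', (((n + 1 : ℕ) : ℂ) + n' + 1) =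
      ∏ n ∈ N, ∏ n' ∈ N', ((n : ℂ) + ((n' + 1 : ℕ) : ℂ) + 1) :=
    Finset.prod_congr rfl fun n _ => Finset.prod_congr rfl fun m _ => by push_cast; ring
  rw [e1, e2, e3, e4, e5]
  ring

theorem crossForm_succs (a : ℂ) (N P P' N' : Finset ℕ) :
    crossForm a N P P' (insert 0 (succs N')) = crossForm (a - 1) (succs N) P P' N' *
      ((-1) ^ P.card * ((∏ m ∈ P, (a + m)) * ∏ n ∈ N, ((n : ℂ) + 1))) := by
  unfold crossForm
  have e1 : ∏ m ∈ P, ∏ n' ∈ insert 0 (succs N'), ((n' : ℂ) - a - m) =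
      ((-1) ^ P.card * ∏ m ∈ P, (a + m)) * ∏ m ∈ P, ∏ n' ∈ N', ((n' : ℂ) - (a - 1) - m) := by
    rw [← Finset.prod_neg, ← Finset.prod_mul_distrib]
    refine Finset.prod_congr rfl fun m _ => ?_
    rw [prod_insert_succs (f := fun n' : ℕ => ((n' : ℂ) - a - m))]
    congr 1
    · push_cast
      ring
    · exact Finset.prod_congr rfl fun m _ => by push_cast; ring
  have e2 : ∏ n ∈ N, ∏ n' ∈ insert 0 (succs N'), ((n : ℂ) + n' + 1) =
      (∏ n ∈ N, ((n : ℂ) + 1)) * ∏ n ∈ succs N, ∏ n' ∈ N', ((n : ℂ) + n' + 1) := by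
    rw [prod_succs, ← Finset.prod_mul_distrib]
    refine Finset.prod_congr rfl fun n _ => ?_
    rw [prod_insert_succs (f := fun n' : ℕ => ((n : ℂ) + n' + 1))]
    congr 1
    · push_cast
      ring
    · exact Finset.prod_congr rfl fun m _ => by push_cast; ring
  have e3 : ∏ n ∈ succs N, ∏ m' ∈ P', ((m' : ℂ) - (a - 1) - n) =
      ∏ n ∈ N, ∏ m' ∈ P', ((m' : ℂ) - a - n) := by
    rw [prod_succs]
    exact Finset.prod_congr rfl fun n _ => Finset.prod_congr rfl fun m _ => by push_cast; ring
  rw [e1, e2, e3]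
  ring

/-- The shift by one when the box `-1` is filled: it becomes the filled place 0, and the empty
places move down by one. The extra index contributes `-(λ+1)`, the source of the zero at `λ = -1`.
-/
theorem valForm_insert {a : ℂ} (ha : NonIntC a) (lam : ℂ) (N P P' N' : Finset ℕ) :
    valForm (a - 1) (lam + 1) (insert 0 (succs N)) P P' N' * a =
      (-1) ^ (P'.card + N'.card + 1) * (valForm a lam N P P' (succs N') * (lam + 1) *
        ((∏ m ∈ P', (1 - a + m)) * ∏ n ∈ N', ((n : ℂ) + 1))) := by
  have hb : NonIntC (-a + 1) := ha.neg.add_one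
  unfold valForm omForm
  have b1 := blk_insert_succs ha N P
  have b2 := blk_succs hb N' P'
  rw [blk_comm, blk_comm _ N'] at b2
  rw [show -a + 1 - 1 = -a by ring] at b2
  have k := ker_succ_left ha (N.card + P.card) (P'.card + N'.card)
  have c1 : (insert 0 (succs N)).card + P.card = N.card + P.card + 1 := by
    rw [card_insert_succs]
    ring
  have e1 : ∏ m ∈ P, ((m : ℂ) + (a - 1) + 1 + (lam + 1)) = ∏ m ∈ P, (m + a + 1 + lam) :=
    Finset.prod_congr rfl fun m _ => by ring
  have e2 : ∏ n ∈ N, (((n + 1 : ℕ) : ℂ) - (lam + 1)) = ∏ n ∈ N, ((n : ℂ) - lam) :=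
    Finset.prod_congr rfl fun m _ => by push_cast; ring
  have e3 : a - 1 + 1 + (((insert 0 (succs N)).card : ℤ) + P.card - P'.card - N'.card : ℤ) =
      a + 1 + ((N.card : ℤ) + P.card - P'.card - (succs N').card : ℤ) := by
    rw [card_insert_succs, card_succs]
    push_cast
    ring
  have e4 : -(a - 1) = -a + 1 := by ring
  have e5 : ∏ m ∈ P', (-a + 1 + (m : ℂ)) = ∏ m ∈ P', (1 - a + m) :=
    Finset.prod_congr rfl fun m _ => by ring
  rw [e5] at b2
  rw [prod_insert_succs (f := fun n : ℕ => (n : ℂ) - (lam + 1)), e1, e2, e3, e4, c1, b1, ← b2,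
    card_succs, Complex.Gamma_add_one a ha.ne_zero, sub_add_cancel]
  push_cast
  linear_combination (-(lam + 1) * (blk a N P * blk (-a) P' (succs N') *
    ((∏ x ∈ N', ((x : ℂ) + 1)) * ∏ m ∈ P', (1 - a + (m : ℂ))) *
    ((∏ n ∈ N, ((n : ℂ) - lam)) * ∏ m ∈ P, ((m : ℂ) + a + 1 + lam)) * (a * Complex.Gamma a /
      Complex.Gamma (a + 1 + (N.card + P.card - P'.card - N'.card))))) * k

/-- The shift by one when the box `-1` is empty: the empty place 0 disappears, and no factor
containing `λ` is gained or lost. -/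
theorem valForm_succs {a : ℂ} (ha : NonIntC a) (lam : ℂ) (N P P' N' : Finset ℕ) :
    valForm (a - 1) (lam + 1) (succs N) P P' N' *
        (a * ((∏ m ∈ P, (a + m)) * ∏ n ∈ N, ((n : ℂ) + 1))) =
      valForm a lam N P P' (insert 0 (succs N')) := by
  have hb : NonIntC (-a + 1) := ha.neg.add_one
  unfold valForm omForm
  have b1 := blk_succs ha N P
  have b2 := blk_insert_succs hb N' P'
  rw [blk_comm, blk_comm _ N'] at b2
  rw [show -a + 1 - 1 = -a by ring] at b2
  have k := ker_succ_right ha (N.card + P.card) (P'.card + N'.card)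
  have c1 : P'.card + (insert 0 (succs N')).card = P'.card + N'.card + 1 := by
    rw [card_insert_succs]
    ring
  have e1 : ∏ m ∈ P, ((m : ℂ) + (a - 1) + 1 + (lam + 1)) = ∏ m ∈ P, (m + a + 1 + lam) :=
    Finset.prod_congr rfl fun m _ => by ring
  have e2 : ∏ n ∈ succs N, ((n : ℂ) - (lam + 1)) = ∏ n ∈ N, ((n : ℂ) - lam) := by
    rw [prod_succs]
    exact Finset.prod_congr rfl fun m _ => by push_cast; ring
  have e3 : a - 1 + 1 + (((succs N).card : ℤ) + P.card - P'.card - N'.card : ℤ) =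
      a + 1 + ((N.card : ℤ) + P.card - P'.card - (insert 0 (succs N')).card : ℤ) := by
    rw [card_insert_succs, card_succs]
    push_cast
    ring
  have e4 : -(a - 1) = -a + 1 := by ring
  rw [e1, e2, e3, e4, c1, ← b1, b2, card_succs, ← k, Complex.Gamma_add_one a ha.ne_zero,
    sub_add_cancel, show (1 : ℂ) - a = -a + 1 by ring]
  ring


/-! ### Shifts of Maya diagrams -/

theorem MayaDiagram.ext_carrier {M M' : MayaDiagram} (h : M.carrier = M'.carrier) : M = M' := by
  cases M
  cases M'
  simp only at h
  subst h
  rfl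

theorem mem_filled {M : MayaDiagram} {n : ℕ} : n ∈ M.filled ↔ (n : ℤ) ∈ M.carrier := by
  simp [MayaDiagram.filled]

theorem mem_empty {M : MayaDiagram} {n : ℕ} : n ∈ M.empty ↔ -(n : ℤ) - 1 ∉ M.carrier := by
  simp [MayaDiagram.empty]

theorem mem_shift {M : MayaDiagram} {t k : ℤ} : k ∈ (M.shift t).carrier ↔ k - t ∈ M.carrier :=
  Iff.rfl

theorem shift_shift (M : MayaDiagram) (a b : ℤ) : (M.shift a).shift b = M.shift (a + b) :=
  MayaDiagram.ext_carrier (by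
    ext k
    simp only [mem_shift]
    rw [sub_sub, add_comm b a])

theorem shift_zero (M : MayaDiagram) : M.shift 0 = M :=
  MayaDiagram.ext_carrier (by
    ext k
    simp [mem_shift])

theorem canShift_eq {M : MayaDiagram} {t : ℤ} (h : (M.shift t).IsCanonical) : M.canShift = t := by
  have h' := M.canShift_spec
  have a1 := h.2
  have a2 := h'.2
  rw [mem_shift, zero_sub] at a1 a2
  rcases lt_trichotomy M.canShift t with hlt | heq | hlt
  · have := h'.1 (-t + M.canShift) (by omega)
    rw [mem_shift] at this
    exact absurd (by simpa using this) a1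
  · exact heq
  · have := h.1 (-M.canShift + t) (by omega)
    rw [mem_shift] at this
    exact absurd (by simpa using this) a2

theorem canShift_shift (M : MayaDiagram) (a : ℤ) : (M.shift a).canShift = M.canShift - a := by
  refine canShift_eq ?_
  rw [shift_shift, add_sub_cancel]
  exact M.canShift_spec

/-- A shift by one carries only the box `-1` across the origin; its being filled or empty gives the
two cases of all later computations. -/
theorem filled_shift_one_of_mem {M : MayaDiagram} (h : -1 ∈ M.carrier) :
    (M.shift 1).filled = insert 0 (succs M.filled) := by
  ext n
  cases n with
  | zero => simpa [mem_filled, mem_shift] using h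
  | succ n => simp [mem_filled, mem_shift, succs]

theorem empty_of_mem {M : MayaDiagram} (h : -1 ∈ M.carrier) :
    M.empty = succs (M.shift 1).empty := by
  ext n
  cases n with
  | zero => simpa [mem_empty, mem_shift, succs] using h
  | succ n =>
    simp only [mem_empty, mem_shift, succs, Finset.mem_map, addRightEmbedding_apply, add_left_inj,
      exists_eq_right]
    rw [show -((n + 1 : ℕ) : ℤ) - 1 = -(n : ℤ) - 1 - 1 by push_cast; ring]

theorem filled_shift_one_of_notMem {M : MayaDiagram} (h : -1 ∉ M.carrier) :
    (M.shift 1).filled = succs M.filled := by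
  ext n
  cases n with
  | zero => simpa [mem_filled, mem_shift, succs] using h
  | succ n => simp [mem_filled, mem_shift, succs]

theorem empty_of_notMem {M : MayaDiagram} (h : -1 ∉ M.carrier) :
    M.empty = insert 0 (succs (M.shift 1).empty) := by
  ext n
  cases n with
  | zero => simpa [mem_empty, mem_shift, succs] using h
  | succ n =>
    simp only [mem_empty, mem_shift, succs, Finset.mem_map, addRightEmbedding_apply, add_left_inj,
      exists_eq_right, Finset.mem_insert, Nat.add_eq_zero_iff, one_ne_zero, and_false, false_or]
    rw [show -((n + 1 : ℕ) : ℤ) - 1 = -(n : ℤ) - 1 - 1 by push_cast; ring]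

theorem empty_of_canShift_eq_zero {M : MayaDiagram} (h : M.canShift = 0) : M.empty = ∅ := by
  have h1 := M.canShift_spec
  rw [h, shift_zero] at h1
  ext n
  simp only [mem_empty, Finset.notMem_empty, iff_false, not_not]
  exact h1.1 _ (by omega)

theorem neg_one_mem_of_canShift {M : MayaDiagram} (h : M.canShift ≤ 0) : -1 ∈ M.carrier := by
  have h1 := M.canShift_spec.1 (-1 + M.canShift) (by omega)
  rw [mem_shift] at h1
  simpa using h1

/-- The charge of a Maya diagram. -/
noncomputable def charge (M : MayaDiagram) : ℤ := M.filled.card - M.empty.card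

theorem charge_shift_one (M : MayaDiagram) : charge (M.shift 1) = charge M + 1 := by
  unfold charge
  by_cases h : -1 ∈ M.carrier
  · rw [filled_shift_one_of_mem h, empty_of_mem h, card_insert_succs, card_succs]
    push_cast
    ring
  · rw [filled_shift_one_of_notMem h, empty_of_notMem h, card_insert_succs, card_succs]
    push_cast
    ring

theorem charge_shift (M : MayaDiagram) (a : ℤ) : charge (M.shift a) = charge M + a := by
  induction a using Int.induction_on with
  | zero => simp [shift_zero]
  | succ n ih =>
    rw [← shift_shift, charge_shift_one, ih]
    ring
  | pred n ih =>
    have := charge_shift_one (M.shift (-(n : ℤ) - 1))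
    rw [shift_shift, sub_add_cancel, ih] at this
    linarith

theorem card_filled_canShift (M : MayaDiagram) :
    ((M.shift M.canShift).filled.card : ℤ) = charge M + M.canShift := by
  have h := charge_shift M M.canShift
  have h0 : (M.shift M.canShift).empty = ∅ := empty_of_canShift_eq_zero (by
    rw [canShift_shift, sub_self])
  rw [charge, h0] at h
  simpa using h

/-- The canonical form has no empty negative box, so its number of filled places is the charge plus
the shift; the shifts then cancel against those in `α'`. -/
theorem bAlpha_eq (α : ℝ) (M₁ M₂ : MayaDiagram) : bAlpha α M₁ M₂ =
    α + (num₁ M₁ + num₂ M₂ : ℕ) - (num₃ M₂ + num₄ M₁ : ℕ) := by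
  have h1 := card_filled_canShift M₁
  have h2 := card_filled_canShift M₂
  have h1' : ((M₁.shift M₁.canShift).filled.card : ℝ) = charge M₁ + M₁.canShift := by
    exact_mod_cast h1
  have h2' : ((M₂.shift M₂.canShift).filled.card : ℝ) = charge M₂ + M₂.canShift := by
    exact_mod_cast h2
  simp only [bAlpha, alphaCan, h1', h2', charge, num₁, num₂, num₃, num₄]
  push_cast
  ring

/-! ### The constants `C` and `D` -/

theorem falling_zero (x : ℂ) : falling x 0 = 1 := by simp [falling]

theorem falling_succ_left (x : ℂ) (n : ℕ) : falling x (n + 1) = x * falling (x - 1) n := by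
  simp [falling, descPochhammer_succ_left]

/-- The value at the origin of the solution of the first kind, up to sign. -/
noncomputable def valM (α : ℝ) (lam : ℂ) (M₁ M₂ : MayaDiagram) : ℂ :=
  valForm α lam M₁.filled M₂.filled M₂.empty M₁.empty

/-- `valM` for the canonical forms. -/
noncomputable def valCan (α : ℝ) (lam : ℂ) (M₁ M₂ : MayaDiagram) : ℂ :=
  valM (alphaCan α M₁ M₂) (lam + M₁.canShift) (M₁.shift M₁.canShift) (M₂.shift M₂.canShift)

/-- The denominator of `C₁` does not vanish. -/
def RegC (lam : ℂ) (M : MayaDiagram) : Prop :=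
  ∀ k : ℕ, (k : ℤ) < M.canShift → k ∉ M.empty → -lam - k - 1 ≠ 0

/-- The identity `C Ω_{μ,ν}[h](0) = ± Ω_{M₁,M₂}[h](0)`. -/
def ConstIdent (M₁ M₂ : MayaDiagram) : Prop :=
  ∃ ε : ℤˣ, ∀ (α : ℝ) (lam : ℂ), NonInt α → RegC lam M₁ → RegC (-α - 1 - lam) M₂ →
    constC α lam M₁ M₂ * valCan α lam M₁ M₂ = ((ε : ℤ) : ℂ) * valM α lam M₁ M₂

theorem constC₃_eq (α : ℝ) (M₁ M₂ : MayaDiagram) :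
    constC₃ α M₁ M₂ = crossForm α M₁.filled M₂.filled M₂.empty M₁.empty := rfl

/-- The canonical forms and their parameters do not notice the simultaneous shift of `M₁`, `α` and
`λ`. In the induction only `C` and the value for the pair itself change. -/
theorem valCan_shift_one (α : ℝ) (lam : ℂ) (M₁ M₂ : MayaDiagram) :
    valCan (α - 1) (lam + 1) (M₁.shift 1) M₂ = valCan α lam M₁ M₂ := by
  unfold valCan alphaCan
  rw [canShift_shift, shift_shift, add_sub_cancel]
  push_cast
  congr 1
  · ring
  · ring

/-- `C₂` depends on `α`, `λ` and `t₁` only through `α - t₁` and `α + λ`. -/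
theorem constC₂_shift_one (α : ℝ) (lam : ℂ) (M₁ M₂ : MayaDiagram) :
    constC₂ (α - 1) (lam + 1) (M₁.shift 1) M₂ = constC₂ α lam M₁ M₂ := by
  unfold constC₂
  rw [canShift_shift]
  push_cast
  rw [show (α : ℂ) - 1 + 1 + (lam + 1) = α + 1 + lam by ring,
    show (α : ℂ) - 1 - (M₁.canShift - 1) = α - M₁.canShift by ring,
    show lam + 1 + ((α : ℂ) - 1) = lam + α by ring]

/-- Both nontrivial formulas for `C₁` give 1 at `t₁ = 0`, so unit shifts from or to 0 need no
separate treatment. -/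
theorem constC₁_of_nonneg (α : ℝ) (lam : ℂ) {M : MayaDiagram} (h : 0 ≤ M.canShift) :
    constC₁ α lam M = falling α M.canShift.natAbs /
      ∏ k ∈ Finset.range M.canShift.natAbs \ M.empty, (-lam - k - 1) := by
  unfold constC₁
  rw [if_neg (by omega)]
  split_ifs with h0
  · simp [h0, falling_zero]
  · rfl

theorem constC₁_of_nonpos (α : ℝ) (lam : ℂ) {M : MayaDiagram} (h : M.canShift ≤ 0) :
    constC₁ α lam M = rising (-lam) M.canShift.natAbs / rising (α + 1) M.canShift.natAbs := by
  unfold constC₁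
  split_ifs with h1 h0
  · rfl
  · simp [h0, rising_zero]
  · omega

theorem prod_range_sdiff_of_mem (u : ℕ) (E : Finset ℕ) (f : ℕ → ℂ) :
    ∏ k ∈ Finset.range (u + 1) \ succs E, f k =
      f 0 * ∏ k ∈ Finset.range u \ E, f (k + 1) := by
  rw [← prod_insert_succs]
  refine Finset.prod_congr ?_ fun _ _ => rfl
  ext n
  cases n <;> simp [succs]

theorem prod_range_sdiff_of_notMem (u : ℕ) (E : Finset ℕ) (f : ℕ → ℂ) :
    ∏ k ∈ Finset.range (u + 1) \ insert 0 (succs E), f k =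
      ∏ k ∈ Finset.range u \ E, f (k + 1) := by
  rw [← prod_succs]
  refine Finset.prod_congr ?_ fun _ _ => rfl
  ext n
  cases n <;> simp [succs]

-- The index 0 occurs in the denominator of `C₁` precisely when the box `-1` is filled; this is the
-- factor `-λ-1`.
open Classical in
theorem constC₁_shift_one_of_pos (α : ℝ) {lam : ℂ} {M : MayaDiagram} (h : 0 < M.canShift)
    (hr : RegC lam M) : constC₁ α lam M * (if -1 ∈ M.carrier then -lam - 1 else 1) =
      α * constC₁ (α - 1) (lam + 1) (M.shift 1) := by
  rw [constC₁_of_nonneg _ _ h.le, constC₁_of_nonneg _ _ (by rw [canShift_shift]; omega),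
    canShift_shift]
  obtain ⟨u, hu⟩ : ∃ u : ℕ, M.canShift = u + 1 := ⟨(M.canShift - 1).toNat, by omega⟩
  rw [hu]
  rw [show ((u : ℤ) + 1).natAbs = u + 1 by omega, show ((u : ℤ) + 1 - 1).natAbs = u by omega,
    falling_succ_left]
  have e : ∀ E : Finset ℕ, ∏ k ∈ Finset.range u \ E, (-lam - ((k + 1 : ℕ) : ℂ) - 1) =
      ∏ k ∈ Finset.range u \ E, (-(lam + 1) - k - 1) := fun E =>
    Finset.prod_congr rfl fun k _ => by push_cast; ring
  split_ifs with hm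
  · have h0 : -lam - 1 ≠ 0 := by
      have := hr 0 (by simpa using h) (by simpa [mem_empty] using hm)
      simpa using this
    rw [empty_of_mem hm, prod_range_sdiff_of_mem, e]
    push_cast
    rw [sub_zero, mul_comm (-lam - 1), div_mul_eq_mul_div, mul_div_mul_right _ _ h0, mul_div_assoc]
  · rw [empty_of_notMem hm, prod_range_sdiff_of_notMem, e, mul_one, mul_div_assoc]
    push_cast
    rfl

theorem RegC.shift_one {lam : ℂ} {M : MayaDiagram} (hr : RegC lam M) :
    RegC (lam + 1) (M.shift 1) := by
  intro k hk hk'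
  rw [canShift_shift] at hk
  have h1 : k + 1 ∉ M.empty := by
    by_cases hm : -1 ∈ M.carrier
    · rw [empty_of_mem hm]
      simpa [succs] using hk'
    · rw [empty_of_notMem hm]
      simpa [succs] using hk'
  have := hr (k + 1) (by push_cast; omega) h1
  push_cast at this
  intro h0
  exact this (by linear_combination h0)

theorem constC₁_shift_one_of_nonpos {α : ℝ} (hα : NonInt α) (lam : ℂ) {M : MayaDiagram}
    (h : M.canShift ≤ 0) :
    constC₁ (α - 1) (lam + 1) (M.shift 1) * α = (-lam - 1) * constC₁ α lam M := by
  rw [constC₁_of_nonpos _ _ h, constC₁_of_nonpos _ _ (by rw [canShift_shift]; omega),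
    canShift_shift]
  rw [show (M.canShift - 1).natAbs = M.canShift.natAbs + 1 by omega, rising_succ_left,
    rising_succ_left]
  have h1 := hα.ne_zero
  have h2 := rising_ne_zero hα.first M.canShift.natAbs
  push_cast
  rw [show -(lam + 1) + 1 = -lam by ring, sub_add_cancel]
  field_simp
  ring

/-- For `t₁ > 0` the identity is pulled back from the shifted diagram. If the box `-1` is filled, a
factor `λ + 1` has to be cancelled, and it is nonzero by `RegC` at index 0. The sign depends only on
numbers of boxes. -/
theorem ConstIdent.of_shift_one {M₁ M₂ : MayaDiagram} (h : ConstIdent (M₁.shift 1) M₂)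
    (hpos : 0 < M₁.canShift) : ConstIdent M₁ M₂ := by
  obtain ⟨ε, h⟩ := h
  by_cases hm : -1 ∈ M₁.carrier
  · refine ⟨ε * (-1) ^ (M₂.empty.card + (M₁.shift 1).empty.card), fun α lam hα h1 h2 => ?_⟩
    have hT := h (α - 1) (lam + 1) hα.sub_one h1.shift_one (by
      convert h2 using 1
      push_cast
      ring)
    have c1 := constC₁_shift_one_of_pos α hpos h1
    rw [if_pos hm] at c1
    have v := valForm_insert hα.toC lam M₁.filled M₂.filled M₂.empty (M₁.shift 1).empty
    have c := crossForm_insert α M₁.filled M₂.filled M₂.empty (M₁.shift 1).empty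
    rw [valCan_shift_one] at hT
    unfold constC at hT ⊢
    rw [constC₂_shift_one, constC₃_eq] at hT
    rw [constC₃_eq]
    unfold valM at hT ⊢
    rw [filled_shift_one_of_mem hm] at hT
    push_cast at hT ⊢
    rw [c] at hT
    rw [empty_of_mem hm]
    have h0 : -lam - 1 ≠ 0 := by
      have := h1 0 (by simpa using hpos) (by simpa [mem_empty] using hm)
      simpa using this
    have hX : (∏ m ∈ M₂.empty, (1 - (α : ℂ) + m)) * ∏ n ∈ (M₁.shift 1).empty, ((n : ℂ) + 1) ≠ 0 :=
      mul_ne_zero (Finset.prod_ne_zero_iff.2 fun m _ => hα.second m)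
        (Finset.prod_ne_zero_iff.2 fun m _ => by exact_mod_cast m.succ_ne_zero)
    refine mul_right_cancel₀ (mul_ne_zero h0 hX) ?_
    rw [pow_succ] at v
    generalize (∏ m ∈ M₂.empty, (1 - (α : ℂ) + m)) * ∏ n ∈ (M₁.shift 1).empty, ((n : ℂ) + 1) = X at *
    linear_combination (constC₂ α lam M₁ M₂ * crossForm α M₁.filled M₂.filled M₂.empty
      (succs (M₁.shift 1).empty) * valCan α lam M₁ M₂ * X) * c1 + α * hT + ((ε : ℤ) : ℂ) * v
  · refine ⟨ε * (-1) ^ M₂.filled.card, fun α lam hα h1 h2 => ?_⟩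
    have hT := h (α - 1) (lam + 1) hα.sub_one h1.shift_one (by
      convert h2 using 1
      push_cast
      ring)
    have c1 := constC₁_shift_one_of_pos α hpos h1
    rw [if_neg hm, mul_one] at c1
    have v := valForm_succs hα.toC lam M₁.filled M₂.filled M₂.empty (M₁.shift 1).empty
    have c := crossForm_succs α M₁.filled M₂.filled M₂.empty (M₁.shift 1).empty
    rw [valCan_shift_one] at hT
    unfold constC at hT ⊢
    rw [constC₂_shift_one, constC₃_eq] at hT
    rw [constC₃_eq]
    unfold valM at hT ⊢
    rw [filled_shift_one_of_notMem hm] at hT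
    push_cast at hT ⊢
    rw [empty_of_notMem hm, c, c1, ← v]
    generalize (∏ m ∈ M₂.filled, ((α : ℂ) + m)) * ∏ n ∈ M₁.filled, ((n : ℂ) + 1) = X at *
    linear_combination (α * (-1) ^ M₂.filled.card * X) * hT

/-- For `t₁ ≤ 0` the identity is pushed forward instead. Only `α` has to be cancelled in this
direction, whereas the converse would divide by `λ + 1`, which `RegC` does not control here. -/
theorem ConstIdent.shift_one {M₁ M₂ : MayaDiagram} (h : ConstIdent M₁ M₂)
    (hpos : M₁.canShift ≤ 0) : ConstIdent (M₁.shift 1) M₂ := by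
  obtain ⟨ε, h⟩ := h
  have hm := neg_one_mem_of_canShift hpos
  refine ⟨ε * (-1) ^ (M₂.empty.card + (M₁.shift 1).empty.card), fun α' lam' hα' _ h2 => ?_⟩
  obtain ⟨α, rfl⟩ : ∃ α, α' = α - 1 := ⟨α' + 1, by ring⟩
  obtain ⟨lam, rfl⟩ : ∃ lam, lam' = lam + 1 := ⟨lam' - 1, by ring⟩
  have hα : NonInt α := by simpa using hα'.add_one
  have hT := h α lam hα (fun k hk => by omega) (by
    convert h2 using 1
    push_cast
    ring)
  have c1 := constC₁_shift_one_of_nonpos hα lam hpos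
  have v := valForm_insert hα.toC lam M₁.filled M₂.filled M₂.empty (M₁.shift 1).empty
  have c := crossForm_insert α M₁.filled M₂.filled M₂.empty (M₁.shift 1).empty
  rw [valCan_shift_one]
  unfold constC at hT ⊢
  rw [constC₂_shift_one, constC₃_eq]
  rw [constC₃_eq] at hT
  unfold valM at hT ⊢
  rw [filled_shift_one_of_mem hm]
  rw [empty_of_mem hm] at hT
  push_cast at hT ⊢
  rw [c]
  refine mul_right_cancel₀ hα.ne_zero ?_
  rw [pow_succ] at v
  have hs : ((-1 : ℂ) ^ (M₂.empty.card + (M₁.shift 1).empty.card)) ^ 2 = 1 := by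
    rw [← pow_mul, mul_comm, pow_mul]
    simp
  generalize (∏ m ∈ M₂.empty, (1 - (α : ℂ) + m)) * ∏ n ∈ (M₁.shift 1).empty, ((n : ℂ) + 1) = X at *
  generalize (-1 : ℂ) ^ (M₂.empty.card + (M₁.shift 1).empty.card) = sg at *
  linear_combination (constC₂ α lam M₁ M₂ * crossForm α M₁.filled M₂.filled M₂.empty
      (succs (M₁.shift 1).empty) * X * valCan α lam M₁ M₂) * c1 + (-lam - 1) * X * hT -
      ((ε : ℤ) : ℂ) * sg * v + (((ε : ℤ) : ℂ) * valForm α lam M₁.filled M₂.filled M₂.empty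
      (succs (M₁.shift 1).empty) * (lam + 1) * X) * hs

/-- Induction on `|t₁|`, always from the diagram whose canonical shift is closer to 0. -/
theorem constIdent_of_base {M₂ : MayaDiagram}
    (h : ∀ M₁ : MayaDiagram, M₁.canShift = 0 → ConstIdent M₁ M₂) (M₁ : MayaDiagram) :
    ConstIdent M₁ M₂ := by
  induction hn : M₁.canShift.natAbs generalizing M₁ with
  | zero => exact h M₁ (by omega)
  | succ n ih =>
    rcases lt_or_gt_of_ne (show M₁.canShift ≠ 0 by omega) with h0 | h0
    · have h1 := ih (M₁.shift (-1)) (by rw [canShift_shift]; omega)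
      have h2 := h1.shift_one (by rw [canShift_shift]; omega)
      rwa [shift_shift, neg_add_cancel, shift_zero] at h2
    · exact (ih (M₁.shift 1) (by rw [canShift_shift]; omega)).of_shift_one h0

theorem constIdent_of_zero {M₁ M₂ : MayaDiagram} (h₁ : M₁.canShift = 0) (h₂ : M₂.canShift = 0) :
    ConstIdent M₁ M₂ := by
  refine ⟨1, fun α lam _ _ _ => ?_⟩
  unfold valCan constC constC₁ constC₂ alphaCan
  rw [constC₃_eq, h₁, h₂, shift_zero, shift_zero, empty_of_canShift_eq_zero h₁,
    empty_of_canShift_eq_zero h₂]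
  simp [crossForm]

/-- `C₁` and `C₂` are not symmetric in the two diagrams, since `C₂` contains `α - t₁`; for `t₁ = 0`
the asymmetry disappears and `valForm_swap` applies. -/
theorem ConstIdent.swap {M₁ M₂ : MayaDiagram} (h : ConstIdent M₂ M₁) (h₁ : M₁.canShift = 0) :
    ConstIdent M₁ M₂ := by
  obtain ⟨ε, h⟩ := h
  refine ⟨ε, fun α lam hα r1 r2 => ?_⟩
  have := h α (-α - 1 - lam) hα r2 (by simpa using r1)
  have e0 : ∀ (α : ℝ) (lam : ℂ) (M₁ M₂ : MayaDiagram),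
      valM α (-α - 1 - lam) M₂ M₁ = valM α lam M₁ M₂ := fun α lam M₁ M₂ =>
    valForm_swap α lam _ _ _ _
  have e1 : valCan α (-α - 1 - lam) M₂ M₁ = valCan α lam M₁ M₂ := by
    unfold valCan
    rw [← e0]
    congr 1
    · unfold alphaCan
      ring
    · unfold alphaCan
      rw [h₁]
      push_cast
      ring
  have e2 : constC α (-α - 1 - lam) M₂ M₁ = constC α lam M₁ M₂ := by
    unfold constC
    rw [constC₃_eq, constC₃_eq, crossForm_swap]
    congr 1
    unfold constC₁ constC₂
    rw [h₁]
    simp only [lt_self_iff_false, if_false, if_true, mul_one, one_mul, Int.cast_zero, sub_zero]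
    rw [show -(-(α : ℂ) - 1 - lam) = α + 1 + lam by ring]
    have : ∀ k : ℕ, (α : ℂ) + 1 + lam - k - 1 = lam + α - k := fun k => by ring
    simp only [this]
  rwa [e0, e1, e2] at this

/-- `M₁` is reduced to canonical form, the diagrams are exchanged, and `M₂` is reduced by the same
induction. When both are canonical there are no empty places, and `C = 1`. -/
theorem constIdent (M₁ M₂ : MayaDiagram) : ConstIdent M₁ M₂ :=
  constIdent_of_base (fun _ h₁ =>
    (constIdent_of_base (fun _ h₂ => constIdent_of_zero h₂ h₁) M₂).swap h₁) M₁


/-! ### Conjugate diagrams and the constant `D`. -/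

/-- The conjugate Maya diagram: filled and empty places are exchanged and the order is reversed. -/
def conj (M : MayaDiagram) : MayaDiagram where
  carrier := {k | -1 - k ∉ M.carrier}
  finite_filled := by
    convert M.finite_empty using 4
    ring_nf
  finite_empty := by
    convert M.finite_filled using 3 with n
    simp only [Set.mem_ofPred_eq, not_not]
    rw [show -1 - (-(n : ℤ) - 1) = n by ring]

theorem mem_conj {M : MayaDiagram} {k : ℤ} : k ∈ (conj M).carrier ↔ -1 - k ∉ M.carrier := Iff.rfl

theorem conj_filled (M : MayaDiagram) : (conj M).filled = M.empty := by
  ext n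
  rw [mem_filled, mem_empty, mem_conj, show -1 - (n : ℤ) = -n - 1 by ring]

theorem conj_empty (M : MayaDiagram) : (conj M).empty = M.filled := by
  ext n
  rw [mem_filled, mem_empty, mem_conj, show -1 - (-(n : ℤ) - 1) = n by ring, not_not]

theorem conj_shift (M : MayaDiagram) (a : ℤ) : conj (M.shift a) = (conj M).shift (-a) :=
  MayaDiagram.ext_carrier (by
    ext k
    rw [mem_conj, mem_shift, mem_shift, mem_conj, show -1 - k - a = -1 - (k - -a) by ring])

theorem conj_canShift (M : MayaDiagram) : (conj M).canShift = -M.conjShift := by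
  refine canShift_eq ?_
  rw [← conj_shift]
  have h := M.conjShift_spec
  refine ⟨fun k hk => ?_, ?_⟩
  · rw [mem_conj]
    exact h.1 _ (by omega)
  · rw [mem_conj, not_not]
    simpa using h.2

/-- Conjugation exchanges filled and empty places and sends `t'` to `-t`, so the definition of `D`
becomes that of `C` at `-α` and `-1-λ`. No second induction is needed. -/
theorem constD_eq (α : ℝ) (lam : ℂ) (M₁ M₂ : MayaDiagram) :
    constD α lam M₁ M₂ = constC (-α) (-1 - lam) (conj M₁) (conj M₂) := by
  unfold constD constC
  congr 1
  · congr 1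
    · unfold constD₁ constC₁
      rw [conj_canShift, conj_empty, Int.natAbs_neg]
      rcases lt_trichotomy M₁.conjShift 0 with h | h | h
      · rw [if_pos h, if_neg (by omega), if_neg (by omega)]
        push_cast
        congr 1
        exact Finset.prod_congr rfl fun k _ => by ring
      · simp [h]
      · rw [if_neg (by omega), if_neg (by omega), if_pos (by omega)]
        push_cast
        rw [show -(-1 - lam) = lam + 1 by ring, show -(α : ℂ) + 1 = 1 - α by ring]
    · unfold constD₂ constC₂
      rw [conj_canShift, conj_canShift, conj_empty, Int.natAbs_neg]
      rcases lt_trichotomy M₂.conjShift 0 with h | h | h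
      · rw [if_pos h, if_neg (by omega), if_neg (by omega)]
        push_cast
        rw [sub_neg_eq_add]
        congr 1
        exact Finset.prod_congr rfl fun k _ => by ring
      · simp [h]
      · rw [if_neg (by omega), if_neg (by omega), if_pos (by omega)]
        push_cast
        rw [show -(α : ℂ) + 1 + (-1 - lam) = -lam - α by ring,
          show -(α : ℂ) - -(M₁.conjShift : ℂ) + 1 = 1 - α + M₁.conjShift by ring]
  · unfold constD₃ constC₃
    rw [conj_empty, conj_empty, conj_filled, conj_filled]
    push_cast
    rw [Finset.prod_comm (s := M₁.empty) (t := M₂.filled), Finset.prod_comm (s := M₂.empty)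
      (t := M₁.filled), Finset.prod_comm (s := M₁.empty) (t := M₁.filled),
      Finset.prod_comm (s := M₂.empty) (t := M₂.filled)]
    have e1 : ∏ n ∈ M₁.filled, ∏ m' ∈ M₂.empty, ((n : ℂ) + α - m') =
        ∏ y ∈ M₁.filled, ∏ x ∈ M₂.empty, ((y : ℂ) - -α - x) :=
      Finset.prod_congr rfl fun n _ => Finset.prod_congr rfl fun m _ => by ring
    have e2 : ∏ n ∈ M₂.filled, ∏ m' ∈ M₁.empty, ((n : ℂ) + α - m') =
        ∏ y ∈ M₂.filled, ∏ x ∈ M₁.empty, ((y : ℂ) - -α - x) :=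
      Finset.prod_congr rfl fun n _ => Finset.prod_congr rfl fun m _ => by ring
    have e3 : ∏ n ∈ M₁.filled, ∏ m' ∈ M₁.empty, ((n : ℂ) + m' + 1) =
        ∏ y ∈ M₁.filled, ∏ x ∈ M₁.empty, ((x : ℂ) + y + 1) :=
      Finset.prod_congr rfl fun n _ => Finset.prod_congr rfl fun m _ => by ring
    have e4 : ∏ n ∈ M₂.filled, ∏ m' ∈ M₂.empty, ((n : ℂ) + m' + 1) =
        ∏ y ∈ M₂.filled, ∏ x ∈ M₂.empty, ((x : ℂ) + y + 1) :=
      Finset.prod_congr rfl fun n _ => Finset.prod_congr rfl fun m _ => by ring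
    rw [e1, e2, e3, e4]
    ring

/-- The value at the origin of the solution of the second kind, up to sign. -/
noncomputable def valM' (α : ℝ) (lam : ℂ) (M₁ M₂ : MayaDiagram) : ℂ :=
  valM (-α) (-1 - lam) (conj M₁) (conj M₂)

theorem constD_identity (M₁ M₂ : MayaDiagram) : ∃ ε : ℤˣ, ∀ (α : ℝ) (lam : ℂ), NonInt α →
    RegC (-1 - lam) (conj M₁) → RegC (α + lam) (conj M₂) →
    constD α lam M₁ M₂ * valM' (alphaConj α M₁ M₂) (lam + M₁.conjShift) (M₁.shift M₁.conjShift)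
      (M₂.shift M₂.conjShift) = ((ε : ℤ) : ℂ) * valM' α lam M₁ M₂ := by
  obtain ⟨ε, h⟩ := constIdent (conj M₁) (conj M₂)
  refine ⟨ε, fun α lam hα h1 h2 => ?_⟩
  have h3 : RegC (-((-α : ℝ) : ℂ) - 1 - (-1 - lam)) (conj M₂) := by
    rwa [show -((-α : ℝ) : ℂ) - 1 - (-1 - lam) = α + lam by push_cast; ring]
  have key := h (-α) (-1 - lam) hα.neg h1 h3
  have e1 : -alphaConj α M₁ M₂ = alphaCan (-α) (conj M₁) (conj M₂) := by
    unfold alphaConj alphaCan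
    rw [conj_canShift, conj_canShift]
    push_cast
    ring
  have e2 : -1 - (lam + M₁.conjShift) = -1 - lam + ((conj M₁).canShift : ℂ) := by
    rw [conj_canShift]
    push_cast
    ring
  rw [constD_eq]
  unfold valM'
  rw [e1, e2, conj_shift, conj_shift, ← conj_canShift M₁, ← conj_canShift M₂]
  exact key

/-! ### Values of the transformed solutions at the origin -/

theorem crumOmega_mul_crumR_false {α : ℝ} (hα : NonInt α) (lam : ℂ) (M₁ M₂ : MayaDiagram) :
    crumOmega α (seedsA α M₁ M₂) (seedsB α M₁ M₂) *
      crumR α (seedsA α M₁ M₂) (seedsB α M₁ M₂) false lam =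
    (-1) ^ (omSign M₁ M₂ + num₂ M₂) * valM α lam M₁ M₂ := by
  rw [crumOmega_eq hα, crumR_false_eq hα, valM, valForm, pow_add]
  ring

theorem crumOmega_mul_crumR_true {α : ℝ} (hα : NonInt α) (lam : ℂ) (M₁ M₂ : MayaDiagram) :
    crumOmega α (seedsA α M₁ M₂) (seedsB α M₁ M₂) *
      crumR α (seedsA α M₁ M₂) (seedsB α M₁ M₂) true lam =
    (-1) ^ (omSign M₁ M₂ + num₄ M₁ + (M₁.filled.card + M₂.filled.card) *
      (M₂.empty.card + M₁.empty.card)) * valM' α lam M₁ M₂ := by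
  rw [crumOmega_eq hα, crumR_true_eq hα, valM', valM, valForm, conj_filled, conj_filled,
    conj_empty, conj_empty]
  push_cast
  rw [omForm_neg, pow_add, pow_add]
  have hs : ((-1 : ℂ) ^ ((M₁.filled.card + M₂.filled.card) *
      (M₂.empty.card + M₁.empty.card))) ^ 2 = 1 := by
    rw [← pow_mul, mul_comm, pow_mul]
    simp
  generalize (-1 : ℂ) ^ ((M₁.filled.card + M₂.filled.card) *
      (M₂.empty.card + M₁.empty.card)) = sg at *
  generalize Complex.Gamma (-(α : ℂ) + 1) / Complex.Gamma _ = G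
  generalize ((∏ n ∈ M₁.empty, ((n : ℂ) - (-1 - lam))) *
    ∏ m ∈ M₂.empty, ((m : ℂ) + -α + 1 + (-1 - lam))) = E
  linear_combination -((-1) ^ omSign M₁ M₂ * (-1) ^ num₄ M₁ *
    omForm α M₁.filled M₂.filled M₂.empty M₁.empty * E * G) * hs

theorem expFactor_germ (M₁ M₂ : MayaDiagram) : HasGerm 0 1 (expFactor M₁ M₂) := by
  have h : AnalyticAt ℝ (expFactor M₁ M₂) 0 := by
    have h1 : AnalyticAt ℝ (fun x : ℝ => Real.exp (-((num₂ M₂ : ℝ) + num₄ M₁) * x)) 0 := by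
      fun_prop
    exact AnalyticAt.fun_comp (g := fun x : ℝ => (x : ℂ)) (Complex.ofRealCLM.analyticAt _) h1
  have := hasGerm_of_analyticAt h
  simpa [expFactor] using this

theorem hFun_isEig {α : ℝ} (hα : NonInt α) (lam : ℂ) : IsEig α lam (hFun α lam) := fun x _ =>
  ⟨hFun_analyticAt hα lam x, kummerM_kEq hα lam x⟩

theorem hTilde_isEig {α : ℝ} (hα : NonInt α) (lam : ℂ) : IsEig α lam (hTilde α lam) := fun _ hx =>
  ⟨hTilde_analyticAt hα lam hx, hTilde_kEq hα lam hx⟩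

theorem hFun_germ {α : ℝ} (hα : NonInt α) (lam : ℂ) :
    HasGerm (expo α 0 0 false) 1 (hFun α lam) := by
  have := hasGerm_of_analyticAt (hFun_analyticAt hα lam 0)
  rw [hFun_zero] at this
  simpa [expo] using this

theorem hTilde_germ {α : ℝ} (hα : NonInt α) (lam : ℂ) :
    HasGerm (expo α 0 0 true) 1 (hTilde α lam) := by
  have := (hasGerm_rpow (-α)).mul (hasGerm_of_analyticAt (hFun_analyticAt hα.neg (lam + α) 0))
  rw [hFun_zero, add_zero, one_mul] at this
  rw [hTilde_eq]
  simpa [expo] using this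

theorem CrumState.wronskian_germ {α : ℝ} {F : List (ℝ → ℂ)} {s t : ℕ} {ω : ℂ}
    {R : Bool → ℂ → ℂ} (h : CrumState α F s t ω R) {τ : Bool} {lam c : ℂ} {y : ℝ → ℂ}
    (hy : IsEig α lam y) (hyg : HasGerm (expo α 0 0 τ) c y) :
    HasGerm (-((α + s) * t) + expo α s t τ) (ω * (c * R τ lam)) (wronskian (F ++ [y])) := by
  refine (h.wr.mul (h.val τ lam c y hy hyg)).congr ?_
  filter_upwards [h.eventually_ne] with x hx
  rw [crumOp, mul_div_cancel₀ _ hx]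

/-- The value `Ω(0)`. -/
noncomputable def om0 (α : ℝ) (M₁ M₂ : MayaDiagram) : ℂ :=
  crumOmega α (seedsA α M₁ M₂) (seedsB α M₁ M₂)

/-- The values at `0` of the solutions of the first (`τ = false`) and second kind. -/
noncomputable def sol0 (α : ℝ) (τ : Bool) (lam : ℂ) (M₁ M₂ : MayaDiagram) : ℂ :=
  om0 α M₁ M₂ * crumR α (seedsA α M₁ M₂) (seedsB α M₁ M₂) τ lam

theorem om0_ne_zero {α : ℝ} (hα : NonInt α) (M₁ M₂ : MayaDiagram) : om0 α M₁ M₂ ≠ 0 :=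
  (seeds_crumState hα M₁ M₂).ne

/-- The power of `x` in front of the Wronskian is opposite to the exponent of its germ, so the germ
has exponent 0 and the limit at 0 is the leading coefficient. The same holds for both kinds of
solutions. -/
theorem Om_germ {α : ℝ} (hα : NonInt α) (M₁ M₂ : MayaDiagram) :
    HasGerm 0 (om0 α M₁ M₂) (Om α M₁ M₂) := by
  have h := ((expFactor_germ M₁ M₂).mul (hasGerm_rpow
    ((α + num₁ M₁ + num₂ M₂) * (num₃ M₂ + num₄ M₁)))).mul (seeds_crumState hα M₁ M₂).wr
  convert h using 1
  · push_cast
    ring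
  · rw [one_mul, one_mul]
    rfl
  · rfl

theorem OmFirst_germ {α : ℝ} (hα : NonInt α) (lam : ℂ) (M₁ M₂ : MayaDiagram) :
    HasGerm 0 (sol0 α false lam M₁ M₂) (OmFirst α lam M₁ M₂) := by
  have h := ((expFactor_germ M₁ M₂).mul (hasGerm_rpow
    ((α + num₁ M₁ + num₂ M₂ + 1) * (num₃ M₂ + num₄ M₁)))).mul
    ((seeds_crumState hα M₁ M₂).wronskian_germ (hFun_isEig hα lam) (hFun_germ hα lam))
  convert h using 1
  · simp only [expo]
    push_cast
    simp
    ring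
  · rw [one_mul, one_mul, one_mul]
    rfl
  · rfl

theorem OmSecond_germ {α : ℝ} (hα : NonInt α) (lam : ℂ) (M₁ M₂ : MayaDiagram) :
    HasGerm 0 (sol0 α true lam M₁ M₂) (OmSecond α lam M₁ M₂) := by
  have h := ((expFactor_germ M₁ M₂).mul (hasGerm_rpow
    ((α + num₁ M₁ + num₂ M₂) * (num₃ M₂ + num₄ M₁ + 1)))).mul
    ((seeds_crumState hα M₁ M₂).wronskian_germ (hTilde_isEig hα lam) (hTilde_germ hα lam))
  convert h using 1
  · simp only [expo]
    push_cast
    simp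
    ring
  · rw [one_mul, one_mul, one_mul]
    rfl
  · rfl

theorem HasGerm.valZero {c : ℂ} {y : ℝ → ℂ} (h : HasGerm 0 c y) : valZero y = c :=
  h.tendsto.limUnder_eq

theorem HasGerm.hasNonzeroValZero {c : ℂ} {y : ℝ → ℂ} (h : HasGerm 0 c y) (hc : c ≠ 0) :
    HasNonzeroValZero y := ⟨c, hc, h.tendsto⟩

theorem NonInt.alphaCan {α : ℝ} (hα : NonInt α) (M₁ M₂ : MayaDiagram) :
    NonInt (alphaCan α M₁ M₂) := by
  have := hα.add_int (-M₁.canShift - M₂.canShift)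
  unfold ExceptionalLaguerre.alphaCan
  push_cast at this
  convert this using 1
  ring

theorem NonInt.alphaConj {α : ℝ} (hα : NonInt α) (M₁ M₂ : MayaDiagram) :
    NonInt (alphaConj α M₁ M₂) := by
  have := hα.add_int (-M₁.conjShift - M₂.conjShift)
  unfold ExceptionalLaguerre.alphaConj
  push_cast at this
  convert this using 1
  ring

/-- A zero of the denominator at index `k < t` is the integer `-k-1`, which lies between the first
empty box `-t` and the origin. -/
theorem Admissible.regC {α : ℝ} {lam : ℂ} {M₁ M₂ : MayaDiagram} (h : Admissible α lam M₁ M₂) :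
    RegC lam M₁ ∧ RegC (-α - 1 - lam) M₂ := by
  refine ⟨fun k hk _ h0 => h.1 (-k - 1) (by omega) (by omega) ?_,
    fun k hk _ h0 => h.2 (-k - 1) (by omega) (by omega) ?_⟩
  · push_cast
    linear_combination -h0
  · push_cast
    linear_combination -h0

theorem Admissible.regC_conj {α : ℝ} {lam : ℂ} {M₁ M₂ : MayaDiagram}
    (h : Admissible α lam M₁ M₂) : RegC (-1 - lam) (conj M₁) ∧ RegC (α + lam) (conj M₂) := by
  refine ⟨fun k hk _ h0 => h.1 k (by omega) ?_ ?_, fun k hk _ h0 => h.2 k (by omega) ?_ ?_⟩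
  · rw [conj_canShift] at hk
    omega
  · push_cast
    linear_combination h0
  · rw [conj_canShift] at hk
    omega
  · push_cast
    linear_combination h0

theorem lt_of_mem_filled {M : MayaDiagram} {n : ℕ} (h : n ∈ M.filled) : (n : ℤ) < -M.conjShift := by
  by_contra hn
  have := M.conjShift_spec.1 (n + M.conjShift) (by omega)
  rw [mem_shift, add_sub_cancel_right] at this
  exact this (mem_filled.1 h)

theorem lt_of_mem_empty {M : MayaDiagram} {n : ℕ} (h : n ∈ M.empty) : (n : ℤ) < M.canShift := by
  have := lt_of_mem_filled (M := conj M) (n := n) (by rwa [conj_filled])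
  have h2 := conj_canShift (conj M)
  have h3 : conj (conj M) = M := MayaDiagram.ext_carrier (by
    ext k
    rw [mem_conj, mem_conj, not_not]
    simp)
  rw [h3] at h2
  omega

/-- The only factors that can vanish are differences of `λ` and eigenvalues of seeds. The filled
places lie below `-t'` and the empty ones below `t`, so these eigenvalues are among the excluded
values. -/
theorem sol0_ne_zero {α : ℝ} (hα : NonInt α) {lam : ℂ} {M₁ M₂ : MayaDiagram}
    (h : Admissible α lam M₁ M₂) (τ : Bool) : sol0 α τ lam M₁ M₂ ≠ 0 := by
  refine mul_ne_zero (om0_ne_zero hα M₁ M₂) ?_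
  unfold crumR
  cases τ
  · simp only [Bool.false_eq_true, if_false]
    refine mul_ne_zero (div_ne_zero ?_ (hα.prod_first _)) (hα.prod_add_sub _ _)
    refine List.prod_ne_zero fun h0 => ?_
    obtain ⟨p, hp, hp0⟩ := List.mem_map.1 h0
    rcases List.mem_append.1 hp with hp | hp <;> obtain ⟨n, hn, rfl⟩ := List.mem_map.1 hp <;>
      have := lt_of_mem_filled (mem_decr.1 hn)
    · exact h.1 n (by omega) (by omega) (by push_cast; linear_combination -hp0)
    · exact h.2 n (by omega) (by omega) (by push_cast; linear_combination hp0)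
  · simp only [if_true]
    refine div_ne_zero (mul_ne_zero (hα.prod_neg_sub _) ?_) (hα.prod_second _ _)
    refine List.prod_ne_zero fun h0 => ?_
    obtain ⟨p, hp, hp0⟩ := List.mem_map.1 h0
    rcases List.mem_append.1 hp with hp | hp <;> obtain ⟨n, hn, rfl⟩ := List.mem_map.1 hp <;>
      have := lt_of_mem_empty (mem_decr.1 hn)
    · exact h.2 (-n - 1) (by omega) (by omega) (by push_cast; linear_combination hp0)
    · exact h.1 (-n - 1) (by omega) (by omega) (by push_cast; linear_combination -hp0)

/-- Three signs are multiplied: that of `constIdent` and those relating the actual values to `valM`,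
once for the given diagrams and once for their canonical forms. None involves `α` or `λ`. -/
theorem exists_sign_first (M₁ M₂ : MayaDiagram) : ∃ ε : ℤˣ, ∀ (α : ℝ) (lam : ℂ), NonInt α →
    Admissible α lam M₁ M₂ → constC α lam M₁ M₂ * valZero (OmFirstCan α lam M₁ M₂) =
      ((ε : ℤ) : ℂ) * sol0 α false lam M₁ M₂ := by
  obtain ⟨ε, h⟩ := constIdent M₁ M₂
  set N₁ := M₁.shift M₁.canShift
  set N₂ := M₂.shift M₂.canShift
  refine ⟨ε * (-1) ^ (omSign N₁ N₂ + num₂ N₂) * (-1) ^ (omSign M₁ M₂ + num₂ M₂),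
    fun α lam hα had => ?_⟩
  have h1 := h α lam hα had.regC.1 had.regC.2
  rw [OmFirstCan, (OmFirst_germ (hα.alphaCan M₁ M₂) _ _ _).valZero, sol0, sol0, om0, om0,
    crumOmega_mul_crumR_false (hα.alphaCan M₁ M₂), crumOmega_mul_crumR_false hα]
  have hs : ((-1 : ℂ) ^ (omSign M₁ M₂ + num₂ M₂)) ^ 2 = 1 := by
    rw [← pow_mul, mul_comm, pow_mul]
    simp
  push_cast
  unfold valCan at h1
  generalize (-1 : ℂ) ^ (omSign M₁ M₂ + num₂ M₂) = sg at *
  linear_combination (-1) ^ (omSign N₁ N₂ + num₂ N₂) * h1 -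
    (-1) ^ (omSign N₁ N₂ + num₂ N₂) * ((ε : ℤ) : ℂ) * valM α lam M₁ M₂ * hs

theorem exists_sign_second (M₁ M₂ : MayaDiagram) : ∃ ε : ℤˣ, ∀ (α : ℝ) (lam : ℂ), NonInt α →
    Admissible α lam M₁ M₂ → constD α lam M₁ M₂ * valZero (OmSecondConj α lam M₁ M₂) =
      ((ε : ℤ) : ℂ) * sol0 α true lam M₁ M₂ := by
  obtain ⟨ε, h⟩ := constD_identity M₁ M₂
  set N₁ := M₁.shift M₁.conjShift
  set N₂ := M₂.shift M₂.conjShift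
  set a := omSign N₁ N₂ + num₄ N₁ + (N₁.filled.card + N₂.filled.card) *
      (N₂.empty.card + N₁.empty.card) with ha
  set b := omSign M₁ M₂ + num₄ M₁ + (M₁.filled.card + M₂.filled.card) *
      (M₂.empty.card + M₁.empty.card) with hb
  refine ⟨ε * (-1) ^ a * (-1) ^ b, fun α lam hα had => ?_⟩
  have h1 := h α lam hα had.regC_conj.1 had.regC_conj.2
  rw [OmSecondConj, (OmSecond_germ (hα.alphaConj M₁ M₂) _ _ _).valZero, sol0, sol0, om0, om0,
    crumOmega_mul_crumR_true (hα.alphaConj M₁ M₂), crumOmega_mul_crumR_true hα, ← ha, ← hb]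
  have hs : ((-1 : ℂ) ^ b) ^ 2 = 1 := by
    rw [← pow_mul, mul_comm, pow_mul]
    simp
  push_cast
  linear_combination (-1) ^ a * h1 - (-1) ^ a * ((ε : ℤ) : ℂ) * valM' α lam M₁ M₂ * hs


/-! ### The equation of the transforms on the half-line -/

/-- The equation of the transforms, cleared of denominators. -/
noncomputable def bilin (α lam : ℂ) (N : ℕ) (W Y : ℝ → ℂ) (x : ℝ) : ℂ :=
  x * W x * deriv (deriv Y) x + (α + 1 + N - x) * W x * deriv Y x - 2 * x * deriv W x * deriv Y x +
    x * deriv (deriv W) x * Y x - (α + N - x) * deriv W x * Y x + (lam - N) * W x * Y x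

theorem bilin_eq_zero_of_ne {α : ℝ} {lam : ℂ} {F : List (ℝ → ℂ)} {y : ℝ → ℂ} {x : ℝ}
    (hF : AnaAt F x) (hy : AnalyticAt ℝ y x) (h0 : wronskian F x ≠ 0)
    (h : DEq α F.length (crumPot F) lam (crumOp F y) x) :
    bilin α lam F.length (wronskian F) (wronskian (F ++ [y])) x = 0 := by
  set W := wronskian F
  set Y := wronskian (F ++ [y])
  have hW : AnalyticAt ℝ W x := hF.wronskian
  have hY : AnalyticAt ℝ Y x := (hF.append_singleton hy).wronskian
  have hne : ∀ᶠ u in 𝓝 x, W u ≠ 0 := hW.continuousAt.eventually_ne h0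
  have hz : ∀ᶠ u in 𝓝 x, HasDerivAt (crumOp F y)
      ((deriv Y u * W u - Y u * deriv W u) / W u ^ 2) u := by
    filter_upwards [hW.eventually_analyticAt, hY.eventually_analyticAt, hne] with u h1 h2 h3
    exact (analyticAt_hasDerivAt h2).div (analyticAt_hasDerivAt h1) h3
  have hz2 := ((((analyticAt_hasDerivAt hY.deriv).mul (analyticAt_hasDerivAt hW)).sub
    ((analyticAt_hasDerivAt hY).mul (analyticAt_hasDerivAt hW.deriv))).div
      ((analyticAt_hasDerivAt hW).pow 2) (pow_ne_zero 2 h0))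
  have hz2' := hz2.congr_of_eventuallyEq (hz.mono fun u hu => hu.deriv)
  have hV : deriv (logW F) x = (deriv (deriv W) x * W x - deriv W x * deriv W x) / W x ^ 2 :=
    ((analyticAt_hasDerivAt hW.deriv).div (analyticAt_hasDerivAt hW) h0).deriv
  simp only [DEq, crumPot] at h
  rw [hz2'.deriv, hz.self_of_nhds.deriv, hV] at h
  simp only [crumOp, logW, Pi.sub_apply, Pi.mul_apply, Pi.pow_apply] at h
  change _ * _ + _ + (_ + deriv W x / W x + _ + _) * (Y x / W x) = 0 at h
  simp only [bilin]
  clear_value W Y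
  push_cast at h
  generalize deriv (deriv Y) x = Y2 at *
  generalize deriv (deriv W) x = W2 at *
  generalize deriv Y x = Y1 at *
  generalize deriv W x = W1 at *
  generalize Y x = Y0 at *
  generalize W x = W0 at *
  field_simp at h
  refine mul_left_cancel₀ h0 ?_
  linear_combination h

/-- The equation is known only near 0, where the Wronskian of the seeds is nonzero. Without
denominators it is analytic on the whole half-line, and the identity theorem carries it past all
zeros of that Wronskian. -/
theorem bilin_eq_zero {α : ℝ} {F : List (ℝ → ℂ)} {s t : ℕ} {ω : ℂ} {R : Bool → ℂ → ℂ}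
    (h : CrumState α F s t ω R) {lam : ℂ} {y : ℝ → ℂ} (hy : IsEig α lam y) {x : ℝ} (hx : 0 < x) :
    bilin α lam F.length (wronskian F) (wronskian (F ++ [y])) x = 0 := by
  set W := wronskian F
  set Y := wronskian (F ++ [y])
  have hev : ∀ᶠ u in 𝓝[>] (0 : ℝ), bilin α lam F.length W Y u = 0 := by
    filter_upwards [h.ode, h.eventually_ne, self_mem_nhdsWithin] with u h1 h2 h3
    exact bilin_eq_zero_of_ne (h.ana u h3) (hy u h3).1 h2 (h1 lam y hy)
  have hana : AnalyticOnNhd ℝ (bilin α lam F.length W Y) (Ioi 0) := by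
    intro u hu
    have hW : AnalyticAt ℝ W u := (h.ana u hu).wronskian
    have hY : AnalyticAt ℝ Y u := ((h.ana u hu).append_singleton (hy u hu).1).wronskian
    have hx := analyticAt_ofReal u
    have hc : ∀ c : ℂ, AnalyticAt ℝ (fun _ : ℝ => c) u := fun c => analyticAt_const
    exact (((((hx.mul hW).mul hY.deriv.deriv).add ((((hc (α + 1 + F.length)).sub hx).mul hW).mul
      hY.deriv)).sub ((((hc 2).mul hx).mul hW.deriv).mul hY.deriv)).add
      ((hx.mul hW.deriv.deriv).mul hY)).sub ((((hc (α + F.length)).sub hx).mul hW.deriv).mul hY)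
      |>.add (((hc (lam - F.length)).mul hW).mul hY)
  obtain ⟨u, hu0, hu⟩ := ((eventually_nhds_of_nhdsGT hev).and self_mem_nhdsWithin).exists
  exact hana.eqOn_zero_of_preconnected_of_eventuallyEq_zero (convex_Ioi 0).isPreconnected hu hu0 hx

/-- Multiplication by `e^{-k x} x^β`. -/
noncomputable def gauge (k β : ℝ) (w : ℝ → ℂ) (x : ℝ) : ℂ :=
  (Real.exp (-k * x) : ℂ) * ((x ^ β : ℝ) : ℂ) * w x

theorem gauge_hasDerivAt (k β : ℝ) {w : ℝ → ℂ} {w' : ℂ} {x : ℝ} (hx : 0 < x)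
    (hw : HasDerivAt w w' x) : HasDerivAt (gauge k β w)
      ((Real.exp (-k * x) : ℂ) * ((x ^ β : ℝ) : ℂ) * (w' + (-k + β / x) * w x)) x := by
  have hx' : (x : ℂ) ≠ 0 := by exact_mod_cast hx.ne'
  have h1 : HasDerivAt (fun x : ℝ => (Real.exp (-k * x) : ℂ))
      ((Real.exp (-k * x) : ℂ) * (-k)) x := by
    have := ((hasDerivAt_id x).const_mul (-k)).exp.ofReal_comp
    refine this.congr_deriv ?_
    push_cast
    simp
  refine ((h1.mul (hasDerivAt_rpow_ofReal β hx)).mul hw).congr_deriv ?_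
  simp only [Pi.mul_apply]
  rw [← rpow_mul_self_ofReal β hx]
  field_simp
  ring

theorem gauge_deriv (k β : ℝ) {w : ℝ → ℂ} {x : ℝ} (hx : 0 < x) (hw : AnalyticAt ℝ w x) :
    deriv (gauge k β w) =ᶠ[𝓝 x] gauge k β fun u => deriv w u + (-k + β / u) * w u := by
  filter_upwards [hw.eventually_analyticAt, Ioi_mem_nhds hx] with u h1 h2
  exact (gauge_hasDerivAt k β h2 (analyticAt_hasDerivAt h1)).deriv

theorem gauge_deriv_deriv (k β : ℝ) {w : ℝ → ℂ} {x : ℝ} (hx : 0 < x) (hw : AnalyticAt ℝ w x) :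
    deriv (deriv (gauge k β w)) x = (Real.exp (-k * x) : ℂ) * ((x ^ β : ℝ) : ℂ) *
      (deriv (deriv w) x + 2 * (-k + β / x) * deriv w x +
        ((-k + β / x) ^ 2 - β / x ^ 2) * w x) := by
  have hx' : (x : ℂ) ≠ 0 := by exact_mod_cast hx.ne'
  rw [(gauge_deriv k β hx hw).deriv_eq]
  have hid : HasDerivAt (fun u : ℝ => (u : ℂ)) 1 x :=
    (Complex.ofRealCLM.hasDerivAt (x := x)).congr_deriv (by simp)
  have h := (analyticAt_hasDerivAt hw.deriv).add ((((hid.inv hx').const_mul (β : ℂ)).const_add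
    (-k : ℂ)).mul (analyticAt_hasDerivAt hw))
  have e : (fun u : ℝ => deriv w u + (-k + β / u) * w u) =
      (deriv w + (fun u : ℝ => -(k : ℂ) + β * (u : ℂ)⁻¹) * w) := by
    ext u
    simp [div_eq_mul_inv]
  have h' : HasDerivAt (deriv w + (fun u : ℝ => -(k : ℂ) + β * (u : ℂ)⁻¹) * w) _ x := h
  rw [e, (gauge_hasDerivAt k β hx h').deriv]
  simp only [Pi.add_apply, Pi.mul_apply, Pi.inv_apply]
  field_simp
  ring

theorem Om_eq_gauge (α : ℝ) (M₁ M₂ : MayaDiagram) :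
    Om α M₁ M₂ = gauge (num₂ M₂ + num₄ M₁) ((α + num₁ M₁ + num₂ M₂) * (num₃ M₂ + num₄ M₁))
      (wronskian (seeds α M₁ M₂)) := rfl

theorem darboux_eq_gauge (α : ℝ) (M₁ M₂ : MayaDiagram) (y : ℝ → ℂ) :
    darboux α M₁ M₂ y = gauge (num₂ M₂ + num₄ M₁)
      ((α + num₁ M₁ + num₂ M₂ + 1) * (num₃ M₂ + num₄ M₁)) (wronskian (seeds α M₁ M₂ ++ [y])) := rfl

theorem seeds_anaAt {α : ℝ} (hα : NonInt α) (M₁ M₂ : MayaDiagram) {x : ℝ} (hx : 0 < x) :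
    AnaAt (seeds α M₁ M₂) x := (seeds_crumState hα M₁ M₂).ana x hx

theorem gauge_analyticAt (k β : ℝ) {w : ℝ → ℂ} {x : ℝ} (hx : 0 < x) (hw : AnalyticAt ℝ w x) :
    AnalyticAt ℝ (gauge k β w) x := by
  have h1 : AnalyticAt ℝ (fun x : ℝ => Real.exp (-k * x)) x := by fun_prop
  exact ((AnalyticAt.fun_comp (g := fun x : ℝ => (x : ℂ)) (Complex.ofRealCLM.analyticAt _) h1).mul
    (rpow_analyticAt β hx)).mul hw

theorem Om_analyticAt {α : ℝ} (hα : NonInt α) (M₁ M₂ : MayaDiagram) {x : ℝ} (hx : 0 < x) :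
    AnalyticAt ℝ (Om α M₁ M₂) x := gauge_analyticAt _ _ hx (seeds_anaAt hα M₁ M₂ hx).wronskian

theorem darboux_analyticAt {α : ℝ} (hα : NonInt α) (M₁ M₂ : MayaDiagram) {y : ℝ → ℂ} {x : ℝ}
    (hx : 0 < x) (hy : AnalyticAt ℝ y x) : AnalyticAt ℝ (darboux α M₁ M₂ y) x :=
  gauge_analyticAt _ _ hx ((seeds_anaAt hα M₁ M₂ hx).append_singleton hy).wronskian

/-- The factors `e^(-kx) x^β` of `Ω` and of the transform are taken out; the exponents `β` differ by
`r₃ + r₄`. What remains is the bilinear equation divided by the Wronskian of the seeds. -/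
theorem Lexpr_darboux {α : ℝ} (hα : NonInt α) {M₁ M₂ : MayaDiagram} {lam : ℂ} {y : ℝ → ℂ}
    (hy : IsEig α lam y) {x : ℝ} (hx : 0 < x) (h0 : Om α M₁ M₂ x ≠ 0) :
    Lexpr α M₁ M₂ (darboux α M₁ M₂ y) x = lam * darboux α M₁ M₂ y x := by
  have hC := seeds_crumState hα M₁ M₂
  have hb := bilin_eq_zero hC hy hx
  rw [hC.len] at hb
  have hx' : (x : ℂ) ≠ 0 := by exact_mod_cast hx.ne'
  have hW := (seeds_anaAt hα M₁ M₂ hx).wronskian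
  have hY := ((seeds_anaAt hα M₁ M₂ hx).append_singleton (hy x hx).1).wronskian
  have hW0 : wronskian (seeds α M₁ M₂) x ≠ 0 := right_ne_zero_of_mul h0
  simp only [Lexpr, bAlpha_eq]
  rw [Om_eq_gauge, darboux_eq_gauge, gauge_deriv_deriv _ _ hx hW, gauge_deriv_deriv _ _ hx hY,
    (gauge_deriv _ _ hx hW).self_of_nhds, (gauge_deriv _ _ hx hY).self_of_nhds]
  simp only [gauge]
  simp only [bilin] at hb
  have hP : ((x ^ ((α + num₁ M₁ + num₂ M₂) * (num₃ M₂ + num₄ M₁)) : ℝ) : ℂ) ≠ 0 := by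
    exact_mod_cast (Real.rpow_pos_of_pos hx _).ne'
  push_cast at hb ⊢
  generalize deriv (deriv (wronskian (seeds α M₁ M₂ ++ [y]))) x = Y2 at *
  generalize deriv (deriv (wronskian (seeds α M₁ M₂))) x = W2 at *
  generalize deriv (wronskian (seeds α M₁ M₂ ++ [y])) x = Y1 at *
  generalize deriv (wronskian (seeds α M₁ M₂)) x = W1 at *
  generalize wronskian (seeds α M₁ M₂ ++ [y]) x = Y0 at *
  generalize wronskian (seeds α M₁ M₂) x = W0 at *
  generalize hEE : Complex.exp _ = E at *
  generalize ((x ^ ((α + num₁ M₁ + num₂ M₂) * (num₃ M₂ + num₄ M₁)) : ℝ) : ℂ) = P at *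
  generalize ((x ^ ((α + num₁ M₁ + num₂ M₂ + 1) * (num₃ M₂ + num₄ M₁)) : ℝ) : ℂ) = P' at *
  generalize (num₁ M₁ : ℂ) = r1 at *
  generalize (num₂ M₂ : ℂ) = r2 at *
  generalize (num₃ M₂ : ℂ) = r3 at *
  generalize (num₄ M₁ : ℂ) = r4 at *
  generalize (x : ℂ) = X at *
  generalize (α : ℂ) = a at *
  have hE' : E ≠ 0 := hEE ▸ Complex.exp_ne_zero _
  rw [← sub_eq_zero]
  have key : ∀ {U V Z Q : ℂ}, W0 * Z = 0 → U - V = -(Q * Z) → U - V = 0 := by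
    intro U V Z Q h1 h2
    rw [h2, (mul_eq_zero.1 h1).resolve_left hW0, mul_zero, neg_zero]
  rw [mul_div_mul_left _ _ (mul_ne_zero hE' hP), mul_div_mul_left _ _ (mul_ne_zero hE' hP)]
  refine key (Q := E * P') (Z := (X * W0 * Y2 + (a + 1 + (r1 + r2 + (r3 + r4)) - X) * W0 * Y1 - 2 * X * W1 * Y1 +
    X * W2 * Y0 - (a + (r1 + r2 + (r3 + r4)) - X) * W1 * Y0 + (lam - (r1 + r2 + (r3 + r4))) * W0 * Y0) / W0) (by rw [mul_div_cancel₀ _ hW0]; exact hb) ?_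
  field_simp
  ring

/-! ### The transform of Tricomi's function as a combination of the two solutions. -/

/-- The cofactors of the last column of the Wronskian of `l ++ [y]`. -/
noncomputable def wcoef (l : List (ℝ → ℂ)) (x : ℝ) (i : Fin (l.length + 1)) : ℂ :=
  (-1) ^ ((i : ℕ) + l.length) *
    (Matrix.of fun a b : Fin l.length => jet l x (i.succAbove a) b).det

/-- Expansion along the last column shows the Wronskian to be a linear differential operator in its
last entry; locality and additivity follow. -/
theorem wronskian_append_eq_sum (l : List (ℝ → ℂ)) (y : ℝ → ℂ) (x : ℝ) :
    wronskian (l ++ [y]) x =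
      ∑ i : Fin (l.length + 1), wcoef l x i * iteratedDeriv (i : ℕ) y x := by
  rw [wronskian_eq_leadDet, List.length_append, List.length_singleton, leadDet,
    Matrix.det_succ_column _ (Fin.last _)]
  refine Finset.sum_congr rfl fun i _ => ?_
  have h : (Matrix.of fun i j : Fin (l.length + 1) => jet (l ++ [y]) x i j).submatrix i.succAbove
      (Fin.last l.length).succAbove =
      Matrix.of fun a b : Fin l.length => jet l x (i.succAbove a) b := by
    ext a b
    simp only [Matrix.submatrix_apply, Matrix.of_apply, Fin.succAbove_last, Fin.val_castSucc]
    exact jet_append_left x _ b.2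
  rw [h, wcoef, Matrix.of_apply, Fin.val_last, jet_append_last]
  ring

theorem wronskian_append_congr (l : List (ℝ → ℂ)) {y y' : ℝ → ℂ} {x : ℝ} (h : y =ᶠ[𝓝 x] y') :
    wronskian (l ++ [y]) x = wronskian (l ++ [y']) x := by
  simp only [wronskian_append_eq_sum, h.iteratedDeriv_eq]

theorem wronskian_append_add (l : List (ℝ → ℂ)) {y y' : ℝ → ℂ} {x : ℝ} (a b : ℂ)
    (h : AnalyticAt ℝ y x) (h' : AnalyticAt ℝ y' x) :
    wronskian (l ++ [fun u => a * y u + b * y' u]) x =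
      a * wronskian (l ++ [y]) x + b * wronskian (l ++ [y']) x := by
  simp only [wronskian_append_eq_sum, Finset.mul_sum, ← Finset.sum_add_distrib]
  refine Finset.sum_congr rfl fun i _ => ?_
  have h1 : iteratedDeriv (i : ℕ) (fun u => a * y u + b * y' u) x =
      a * iteratedDeriv (i : ℕ) y x + b * iteratedDeriv (i : ℕ) y' x := by
    rw [iteratedDeriv_fun_add (contDiffAt_const.mul h.contDiffAt)
      (contDiffAt_const.mul h'.contDiffAt), iteratedDeriv_const_mul_field,
      iteratedDeriv_const_mul_field]
  rw [h1]
  ring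

/-- The two connection coefficients of Tricomi's function. -/
noncomputable def con (α : ℝ) (τ : Bool) (lam : ℂ) : ℂ :=
  if τ then Complex.Gamma α * (Complex.Gamma (-lam))⁻¹
  else Complex.Gamma (-α) * (Complex.Gamma (-lam - α))⁻¹

theorem chi_eq_darboux_triF {α : ℝ} (hα : NonInt α) (lam : ℂ) (M₁ M₂ : MayaDiagram) {x : ℝ}
    (hx : 0 < x) : chi α lam M₁ M₂ x = darboux α M₁ M₂ (triF α lam) x := by
  simp only [chi, darboux]
  rw [wronskian_append_congr]
  filter_upwards [Ioi_mem_nhds hx] with u hu using tricomiU_eq hα lam hu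

theorem darboux_hFun (α : ℝ) (lam : ℂ) (M₁ M₂ : MayaDiagram) (x : ℝ) :
    darboux α M₁ M₂ (hFun α lam) x = OmFirst α lam M₁ M₂ x := rfl

/-- `A` and `OmSecond` carry different powers of `x`, and their quotient is the factor `x^(-𝛂)` that
appears in `u₂`. -/
theorem darboux_hTilde (α : ℝ) (lam : ℂ) (M₁ M₂ : MayaDiagram) {x : ℝ} (hx : 0 < x) :
    darboux α M₁ M₂ (hTilde α lam) x =
      ((x ^ (-bAlpha α M₁ M₂) : ℝ) : ℂ) * OmSecond α lam M₁ M₂ x := by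
  have h : (α + num₁ M₁ + num₂ M₂ + 1) * (num₃ M₂ + num₄ M₁) = -bAlpha α M₁ M₂ +
      (α + num₁ M₁ + num₂ M₂) * (num₃ M₂ + num₄ M₁ + 1) := by
    rw [bAlpha_eq]
    push_cast
    ring
  rw [darboux, OmSecond, h, rpow_add_ofReal hx]
  ring

theorem chi_eq {α : ℝ} (hα : NonInt α) (lam : ℂ) (M₁ M₂ : MayaDiagram) {x : ℝ}
    (hx : 0 < x) : chi α lam M₁ M₂ x = con α false lam * OmFirst α lam M₁ M₂ x +
      con α true lam * (((x ^ (-bAlpha α M₁ M₂) : ℝ) : ℂ) * OmSecond α lam M₁ M₂ x) := by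
  rw [chi_eq_darboux_triF hα lam M₁ M₂ hx, ← darboux_hFun, ← darboux_hTilde _ _ _ _ hx]
  simp only [darboux]
  have := wronskian_append_add (seeds α M₁ M₂) (con α false lam) (con α true lam)
    (hFun_analyticAt hα lam x) (hTilde_analyticAt hα lam hx)
  have e : triF α lam = fun u => con α false lam * hFun α lam u + con α true lam * hTilde α lam u :=
    rfl
  rw [e, this]
  ring

theorem triF_isEig {α : ℝ} (hα : NonInt α) (lam : ℂ) : IsEig α lam (triF α lam) := fun x hx => by
  refine ⟨triF_analyticAt hα lam hx, ?_⟩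
  obtain ⟨h1, h2⟩ := (isTricomiU_triF hα lam).1 x hx
  simp only [KEq]
  linear_combination h2.2

theorem chi_eventuallyEq {α : ℝ} (hα : NonInt α) (lam : ℂ) (M₁ M₂ : MayaDiagram) {x : ℝ}
    (hx : 0 < x) : chi α lam M₁ M₂ =ᶠ[𝓝 x] darboux α M₁ M₂ (triF α lam) := by
  filter_upwards [Ioi_mem_nhds hx] with u hu using chi_eq_darboux_triF hα lam M₁ M₂ hu

theorem chi_analyticAt {α : ℝ} (hα : NonInt α) (lam : ℂ) (M₁ M₂ : MayaDiagram) {x : ℝ}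
    (hx : 0 < x) : AnalyticAt ℝ (chi α lam M₁ M₂) x :=
  (darboux_analyticAt hα M₁ M₂ hx (triF_analyticAt hα lam hx)).congr
    (chi_eventuallyEq hα lam M₁ M₂ hx).symm

theorem Lexpr_congr (α : ℝ) (M₁ M₂ : MayaDiagram) {y y' : ℝ → ℂ} {x : ℝ} (h : y =ᶠ[𝓝 x] y') :
    Lexpr α M₁ M₂ y x = Lexpr α M₁ M₂ y' x := by
  simp only [Lexpr]
  rw [h.deriv.deriv_eq, h.deriv_eq, h.self_of_nhds]

theorem Lexpr_chi {α : ℝ} (hα : NonInt α) (lam : ℂ) (M₁ M₂ : MayaDiagram) {x : ℝ}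
    (hx : 0 < x) (h0 : Om α M₁ M₂ x ≠ 0) :
    Lexpr α M₁ M₂ (chi α lam M₁ M₂) x = lam * chi α lam M₁ M₂ x := by
  have h := chi_eventuallyEq hα lam M₁ M₂ hx
  rw [Lexpr_congr α M₁ M₂ h, h.self_of_nhds, Lexpr_darboux hα (triF_isEig hα lam) hx h0]


/-! ### Quasi-polynomials -/

/-- On `(0, ∞)`, `f` is `e^{kx} x^a` times a real polynomial. -/
def QPoly (k a : ℝ) (f : ℝ → ℂ) : Prop :=
  ∃ P : Polynomial ℝ, ∀ x : ℝ, 0 < x → f x = ((Real.exp (k * x) * x ^ a * P.eval x : ℝ) : ℂ)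

theorem QPoly.deriv {k a : ℝ} {f : ℝ → ℂ} (h : QPoly k a f) : QPoly k (a - 1) (deriv f) := by
  obtain ⟨P, hP⟩ := h
  refine ⟨Polynomial.X * P.derivative + (Polynomial.C k * Polynomial.X + Polynomial.C a) * P,
    fun x hx => ?_⟩
  have h1 : HasDerivAt (fun x : ℝ => Real.exp (k * x) * x ^ a * P.eval x) _ x :=
    ((((hasDerivAt_id x).const_mul k).exp).mul
      (Real.hasDerivAt_rpow_const (p := a) (Or.inl hx.ne'))).mul (P.hasDerivAt x)
  have h2 : f =ᶠ[𝓝 x] fun x => ((Real.exp (k * x) * x ^ a * P.eval x : ℝ) : ℂ) := by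
    filter_upwards [Ioi_mem_nhds hx] with u hu using hP u hu
  rw [h2.deriv_eq, h1.ofReal_comp.deriv]
  congr 1
  have h3 : x ^ a = x ^ (a - 1) * x := by
    rw [← Real.rpow_add_one hx.ne']
    ring_nf
  simp only [Polynomial.eval_add, Polynomial.eval_mul, Polynomial.eval_X, Polynomial.eval_C, id,
    Pi.mul_apply, h3]
  ring

theorem QPoly.iteratedDeriv {k a : ℝ} {f : ℝ → ℂ} (h : QPoly k a f) (i : ℕ) :
    QPoly k (a - i) (iteratedDeriv i f) := by
  induction i with
  | zero => simpa using h
  | succ i ih =>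
    rw [iteratedDeriv_succ]
    have := ih.deriv
    push_cast
    rwa [← sub_sub]

theorem expGrowth_polynomial (P : Polynomial ℝ) : ExpGrowth 0 fun x : ℝ => ((P.eval x : ℝ) : ℂ) := by
  refine ⟨P.natDegree, ?_⟩
  have h := Polynomial.isBigO_atTop_of_degree_le P (Polynomial.X ^ P.natDegree)
    (by simp)
  simp only [Polynomial.eval_pow, Polynomial.eval_X] at h
  refine (IsBigO.of_norm_left (h.norm_left.congr_left fun x => ?_)).congr_right fun x => by simp
  simp

theorem QPoly.expGrowth {k a : ℝ} {f : ℝ → ℂ} (h : QPoly k a f) : ExpGrowth k f := by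
  obtain ⟨P, hP⟩ := h
  have := ((expGrowth_exp k).mul (expGrowth_rpow a)).mul (expGrowth_polynomial P)
  rw [add_zero, add_zero] at this
  refine this.congr fun x hx => ?_
  rw [hP x hx]
  push_cast
  ring

theorem QPoly.mul {k a k' a' : ℝ} {f f' : ℝ → ℂ} (h : QPoly k a f) (h' : QPoly k' a' f') :
    QPoly (k + k') (a + a') fun x => f x * f' x := by
  obtain ⟨P, hP⟩ := h
  obtain ⟨P', hP'⟩ := h'
  refine ⟨P * P', fun x hx => ?_⟩
  simp only [hP x hx, hP' x hx]
  rw [← Complex.ofReal_mul, Real.rpow_add hx, add_mul, Real.exp_add,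
    Polynomial.eval_mul]
  congr 1
  ring

theorem qPoly_const (c : ℝ) : QPoly 0 0 fun _ => (c : ℂ) := ⟨Polynomial.C c, fun x _ => by simp⟩

theorem QPoly.sum {ι : Type*} {k a : ℝ} {f : ι → ℝ → ℂ} (s : Finset ι)
    (h : ∀ i ∈ s, QPoly k a (f i)) : QPoly k a fun x => ∑ i ∈ s, f i x := by
  choose! P hP using h
  refine ⟨∑ i ∈ s, P i, fun x hx => ?_⟩
  rw [Polynomial.eval_finsetSum, Finset.mul_sum, Complex.ofReal_sum]
  exact Finset.sum_congr rfl fun i hi => hP i hi x hx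

theorem QPoly.prod {ι : Type*} {k a : ι → ℝ} {f : ι → ℝ → ℂ} (s : Finset ι)
    (h : ∀ i ∈ s, QPoly (k i) (a i) (f i)) :
    QPoly (∑ i ∈ s, k i) (∑ i ∈ s, a i) fun x => ∏ i ∈ s, f i x := by
  classical
  induction s using Finset.induction_on with
  | empty => simpa using qPoly_const 1
  | insert b s hb ih =>
    simp only [Finset.prod_insert hb, Finset.sum_insert hb]
    exact (h b (Finset.mem_insert_self b s)).mul
      (ih fun i hi => h i (Finset.mem_insert_of_mem hi))

theorem ExpGrowth.det {n : ℕ} {k : Fin n → ℝ} {m : ℝ → Fin n → Fin n → ℂ}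
    (h : ∀ i j, ExpGrowth (k j) fun x => m x i j) :
    ExpGrowth (∑ j, k j) fun x => (Matrix.of (m x)).det := by
  simp only [Matrix.det_apply', Matrix.of_apply]
  exact ExpGrowth.sum _ fun σ _ => (ExpGrowth.prod _ fun i _ => h (σ i) i).const_mul _

/-- The list of seed functions with the exponents `k`, `a` of their factors `e^{kx} x^a`. -/
noncomputable def qseeds (α : ℝ) (M₁ M₂ : MayaDiagram) : List (ℝ × ℝ × (ℝ → ℂ)) :=
  (decr M₁.filled).map (fun n => (0, 0, fun x => laguerreL α n x)) ++
  (decr M₂.filled).map (fun m => (1, 0, fun x => (Real.exp x : ℂ) * laguerreL α m (-x))) ++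
  (decr M₂.empty).map (fun m => (0, -α, fun x => ((x ^ (-α) : ℝ) : ℂ) * laguerreL (-α) m x)) ++
  (decr M₁.empty).map
    (fun n => (1, -α, fun x => (Real.exp x : ℂ) * ((x ^ (-α) : ℝ) : ℂ) * laguerreL (-α) n (-x)))

theorem qseeds_map (α : ℝ) (M₁ M₂ : MayaDiagram) :
    (qseeds α M₁ M₂).map (fun p => p.2.2) = seeds α M₁ M₂ := by
  simp [qseeds, seeds, List.map_map, Function.comp_def]

theorem qseeds_sum_fst (α : ℝ) (M₁ M₂ : MayaDiagram) :
    ((qseeds α M₁ M₂).map fun p => p.1).sum = num₂ M₂ + num₄ M₁ := by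
  simp [qseeds, List.map_map, Function.comp_def, decr_length, num₂, num₄]

theorem laguerreL_eq_polynomial (α : ℝ) (n : ℕ) :
    ∃ P : Polynomial ℝ, ∀ x : ℝ, laguerreL α n x = ((P.eval x : ℝ) : ℂ) := by
  refine ⟨∑ k ∈ Finset.range (n + 1), Polynomial.C ((-1) ^ k *
    ((ascPochhammer ℝ (n - k)).eval (α + k + 1) / (n - k).factorial) / k.factorial) *
      Polynomial.X ^ k, fun x => ?_⟩
  rw [Polynomial.eval_finsetSum, Complex.ofReal_sum]
  refine Finset.sum_congr rfl fun k _ => ?_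
  have h : rising ((α : ℂ) + k + 1) (n - k) =
      (((ascPochhammer ℝ (n - k)).eval (α + k + 1) : ℝ) : ℂ) := by
    rw [rising, ← ascPochhammer_map Complex.ofRealHom, Polynomial.eval_map]
    have := Polynomial.eval₂_at_apply Complex.ofRealHom (p := ascPochhammer ℝ (n - k)) (α + k + 1)
    simpa using this
  rw [h]
  simp only [Polynomial.eval_mul, Polynomial.eval_C, Polynomial.eval_pow, Polynomial.eval_X]
  push_cast
  ring

theorem qseeds_qPoly (α : ℝ) (M₁ M₂ : MayaDiagram) :
    ∀ p ∈ qseeds α M₁ M₂, QPoly p.1 p.2.1 p.2.2 := by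
  intro p hp
  simp only [qseeds, List.mem_append, List.mem_map] at hp
  rcases hp with ((⟨n, -, rfl⟩ | ⟨n, -, rfl⟩) | ⟨n, -, rfl⟩) | ⟨n, -, rfl⟩
  · obtain ⟨P, hP⟩ := laguerreL_eq_polynomial α n
    exact ⟨P, fun x _ => by simp [hP]⟩
  · obtain ⟨P, hP⟩ := laguerreL_eq_polynomial α n
    exact ⟨P.comp (-Polynomial.X), fun x _ => by simp [hP]⟩
  · obtain ⟨P, hP⟩ := laguerreL_eq_polynomial (-α) n
    exact ⟨P, fun x _ => by simp [hP]⟩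
  · obtain ⟨P, hP⟩ := laguerreL_eq_polynomial (-α) n
    exact ⟨P.comp (-Polynomial.X), fun x _ => by simp [hP]⟩

/-- In the Leibniz expansion the term of `σ` has its power of `x` lowered by `∑ σ(j) = ∑ j`. All
terms share one exponent, and the sum is again a quasi-polynomial. -/
theorem qPoly_wronskian (L : List (ℝ × ℝ × (ℝ → ℂ))) (h : ∀ p ∈ L, QPoly p.1 p.2.1 p.2.2) :
    ∃ b : ℝ, QPoly (L.map fun p => p.1).sum b (wronskian (L.map fun p => p.2.2)) := by
  refine ⟨∑ j : Fin L.length, (L.get j).2.1 - ∑ j : Fin L.length, (j : ℝ), ?_⟩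
  have e : wronskian (L.map fun p => p.2.2) = fun x => ∑ σ : Equiv.Perm (Fin L.length),
      (((Equiv.Perm.sign σ : ℤ) : ℝ) : ℂ) * ∏ j, iteratedDeriv (σ j : ℕ) (L.get j).2.2 x := by
    ext x
    rw [wronskian_eq_leadDet, List.length_map, leadDet, Matrix.det_apply']
    simp [jet]
  have e' : (L.map fun p => p.1).sum = ∑ j : Fin L.length, (L.get j).1 := by
    simp
  rw [e, e']
  refine QPoly.sum _ fun σ _ => ?_
  have hp := QPoly.prod Finset.univ fun (j : Fin L.length) _ =>
    (h _ (L.get_mem j)).iteratedDeriv (σ j : ℕ)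
  have := (qPoly_const ((Equiv.Perm.sign σ : ℤ) : ℝ)).mul hp
  rwa [zero_add, zero_add, Finset.sum_sub_distrib,
    Equiv.sum_comp σ fun j : Fin L.length => ((j : ℕ) : ℝ)] at this

/-- The exponentials of the seeds cancel against the prefactor. Hence `Ω` is real, grows
algebraically and, not being identically zero, has an inverse of algebraic growth. -/
theorem Om_qPoly (α : ℝ) (M₁ M₂ : MayaDiagram) : ∃ b : ℝ, QPoly 0 b (Om α M₁ M₂) := by
  obtain ⟨b, P, hP⟩ := qPoly_wronskian _ (qseeds_qPoly α M₁ M₂)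
  refine ⟨(α + num₁ M₁ + num₂ M₂) * (num₃ M₂ + num₄ M₁) + b, P, fun x hx => ?_⟩
  rw [qseeds_map, qseeds_sum_fst] at hP
  rw [Om, expFactor, hP x hx, ← Complex.ofReal_mul, ← Complex.ofReal_mul, Real.rpow_add hx]
  have : Real.exp (-((num₂ M₂ : ℝ) + num₄ M₁) * x) * Real.exp (((num₂ M₂ : ℝ) + num₄ M₁) * x) =
      1 := by
    rw [← Real.exp_add, ← Real.exp_zero]
    ring_nf
  congr 1
  rw [zero_mul, Real.exp_zero, one_mul]
  linear_combination (x ^ ((α + num₁ M₁ + num₂ M₂) * (num₃ M₂ + num₄ M₁)) * x ^ b * P.eval x) * this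

theorem Om_expGrowth (α : ℝ) (M₁ M₂ : MayaDiagram) : ExpGrowth 0 (Om α M₁ M₂) :=
  (Om_qPoly α M₁ M₂).choose_spec.expGrowth

theorem Om_real (α : ℝ) (M₁ M₂ : MayaDiagram) {x : ℝ} (hx : 0 < x) :
    ((‖Om α M₁ M₂ x‖ : ℝ) : ℂ) ^ 2 = Om α M₁ M₂ x ^ 2 := by
  obtain ⟨b, P, hP⟩ := Om_qPoly α M₁ M₂
  rw [hP x hx, Complex.norm_real, ← Complex.ofReal_pow, ← Complex.ofReal_pow, Real.norm_eq_abs,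
    sq_abs]

/-- The polynomial factor is not zero because `Ω(0) ≠ 0`, and the inverse of a nonzero polynomial is
bounded at infinity. -/
theorem Om_inv_expGrowth {α : ℝ} (hα : NonInt α) (M₁ M₂ : MayaDiagram) :
    ExpGrowth 0 fun x => (Om α M₁ M₂ x)⁻¹ := by
  obtain ⟨b, P, hP⟩ := Om_qPoly α M₁ M₂
  have hP0 : P ≠ 0 := by
    rintro rfl
    obtain ⟨x, hx, hx0⟩ := (((Om_germ hα M₁ M₂).eventually_ne (om0_ne_zero hα M₁ M₂)).and
      self_mem_nhdsWithin).exists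
    exact hx (by rw [hP x hx0]; simp)
  have h := Polynomial.isBigO_atTop_of_degree_le (1 : Polynomial ℝ) P (by
    rw [Polynomial.degree_one]
    exact Polynomial.zero_le_degree_iff.2 hP0)
  have h1 : ExpGrowth 0 fun x : ℝ => (((P.eval x)⁻¹ : ℝ) : ℂ) := by
    obtain ⟨C, hC⟩ := h.bound
    refine ⟨0, IsBigO.of_bound C ?_⟩
    filter_upwards [hC] with x hx
    simp only [Polynomial.eval_one, norm_one, Real.norm_eq_abs] at hx
    have hpos : 0 < |P.eval x| := (abs_nonneg _).lt_of_ne fun h0 => by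
      rw [← h0] at hx
      norm_num at hx
    rw [Complex.norm_real, norm_inv, Real.norm_eq_abs]
    simpa using (inv_le_iff_one_le_mul₀ hpos).2 hx
  have := (expGrowth_rpow (-b)).mul h1
  rw [add_zero] at this
  refine this.congr fun x hx => ?_
  rw [hP x hx, Real.rpow_neg hx.le]
  push_cast
  simp [mul_comm]


/-! ### The behaviour of the transformed Tricomi function at the origin -/

theorem bAlpha_ne_zero {α : ℝ} (hα : NonInt α) (M₁ M₂ : MayaDiagram) : bAlpha α M₁ M₂ ≠ 0 := by
  rw [bAlpha_eq]
  intro h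
  refine hα ((num₃ M₂ + num₄ M₁ : ℕ) - (num₁ M₁ + num₂ M₂ : ℕ) : ℤ) ?_
  push_cast at h ⊢
  linarith

theorem chi_local {α : ℝ} (hα : NonInt α) (lam : ℂ) (M₁ M₂ : MayaDiagram) :
    ∃ F G : ℝ → ℂ, AnalyticAt ℝ F 0 ∧ AnalyticAt ℝ G 0 ∧ F 0 = sol0 α false lam M₁ M₂ ∧
      G 0 = sol0 α true lam M₁ M₂ ∧ ∀ᶠ x : ℝ in 𝓝[>] 0,
        chi α lam M₁ M₂ x = con α false lam * F x +
          con α true lam * (((x ^ (-bAlpha α M₁ M₂) : ℝ) : ℂ) * G x) ∧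
        HasDerivAt (chi α lam M₁ M₂) (con α false lam * deriv F x +
          con α true lam * (((x ^ (-bAlpha α M₁ M₂ - 1) : ℝ) : ℂ) *
            (-bAlpha α M₁ M₂ * G x + x * deriv G x))) x := by
  obtain ⟨F, hF, hF0, hFe⟩ := OmFirst_germ hα lam M₁ M₂
  obtain ⟨G, hG, hG0, hGe⟩ := OmSecond_germ hα lam M₁ M₂
  have he : ∀ᶠ x : ℝ in 𝓝[>] 0, chi α lam M₁ M₂ x = con α false lam * F x +
          con α true lam * (((x ^ (-bAlpha α M₁ M₂) : ℝ) : ℂ) * G x) := by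
    filter_upwards [hFe, hGe, self_mem_nhdsWithin] with x h1 h2 hx
    rw [chi_eq hα lam M₁ M₂ hx, h1, h2]
    simp
  refine ⟨F, G, hF, hG, hF0, hG0, ?_⟩
  filter_upwards [he, eventually_nhds_of_nhdsGT he,
    nhdsGT_of_nhds (AnalyticAt.eventually_hasDerivAt' hF),
    nhdsGT_of_nhds (AnalyticAt.eventually_hasDerivAt' hG), self_mem_nhdsWithin]
    with x h1 h2 h3 h4 hx
  refine ⟨h1, ?_⟩
  refine (((h3.const_mul (con α false lam)).add
    ((hasDerivAt_rpow_mul (-bAlpha α M₁ M₂) hx h4).const_mul (con α true lam))).congr_deriv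
    ?_).congr_of_eventuallyEq h2
  push_cast
  rfl

theorem tendsto_rpow_zero {s : ℝ} (hs : 0 < s) :
    Tendsto (fun x : ℝ => ((x ^ s : ℝ) : ℂ)) (𝓝[>] 0) (𝓝 0) := by
  have h := (Real.continuousAt_rpow_const 0 s (Or.inr hs.le)).tendsto
  rw [Real.zero_rpow hs.ne'] at h
  have := (Complex.continuous_ofReal.tendsto 0).comp (h.mono_left (nhdsWithin_le_nhds (s := Ioi 0)))
  simpa [Function.comp_def] using this

theorem AnalyticAt.tendsto_nhdsGT {g : ℝ → ℂ} (hg : AnalyticAt ℝ g 0) :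
    Tendsto g (𝓝[>] 0) (𝓝 (g 0)) := hg.continuousAt.tendsto.mono_left nhdsWithin_le_nhds

theorem weightFactor_tendsto {α : ℝ} (hα : NonInt α) (M₁ M₂ : MayaDiagram) :
    Tendsto (fun x : ℝ => (Real.exp (-x) : ℂ) / Om α M₁ M₂ x ^ 2) (𝓝[>] 0)
      (𝓝 (1 / om0 α M₁ M₂ ^ 2)) := by
  have h : Tendsto (fun x : ℝ => (Real.exp (-x) : ℂ)) (𝓝[>] 0) (𝓝 1) := by
    have : ContinuousAt (fun x : ℝ => (Real.exp (-x) : ℂ)) 0 := by fun_prop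
    simpa using this.tendsto.mono_left nhdsWithin_le_nhds
  exact h.div ((Om_germ hα M₁ M₂).tendsto.pow 2) (pow_ne_zero 2 (om0_ne_zero hα M₁ M₂))

theorem bracket_eq {α : ℝ} (M₁ M₂ : MayaDiagram) (f g : ℝ → ℂ) {x : ℝ} (hx : 0 < x) :
    bracket α M₁ M₂ f g x = (Real.exp (-x) : ℂ) / Om α M₁ M₂ x ^ 2 *
      (((x ^ (bAlpha α M₁ M₂ + 1) : ℝ) : ℂ) * (f x * deriv g x - deriv f x * g x)) := by
  rw [bracket, weight, Real.rpow_add_one hx.ne', ← Om_real α M₁ M₂ hx]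
  push_cast
  ring

/-- Against `x^(-𝛂)` the leading term of the second solution has zero Wronskian. Its remainder is of
order `x^(1-𝛂)` and tends to 0 as `𝛂 < 1`, so only the leading coefficient of the first solution is
seen. -/
theorem hasQuasiDeriv₀_chi {α : ℝ} (hα : NonInt α) (lam : ℂ) (M₁ M₂ : MayaDiagram)
    (h1 : bAlpha α M₁ M₂ < 1) : HasQuasiDeriv₀ α M₁ M₂ (chi α lam M₁ M₂)
      (-(bAlpha α M₁ M₂ * con α false lam * sol0 α false lam M₁ M₂ / om0 α M₁ M₂)) := by
  obtain ⟨F, G, hF, hG, hF0, hG0, he⟩ := chi_local hα lam M₁ M₂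
  have hid : Tendsto (fun x : ℝ => (x : ℂ)) (𝓝[>] 0) (𝓝 0) := by
    simpa using AnalyticAt.tendsto_nhdsGT (analyticAt_ofReal 0)
  have hlim := (weightFactor_tendsto hα M₁ M₂).mul
    (((((AnalyticAt.tendsto_nhdsGT hF).const_mul (-(bAlpha α M₁ M₂ * con α false lam))).sub
      ((hid.mul (AnalyticAt.tendsto_nhdsGT hF.deriv)).const_mul (con α false lam))).sub
      (((tendsto_rpow_zero (sub_pos.2 h1)).mul (AnalyticAt.tendsto_nhdsGT hG.deriv)).const_mul
        (con α true lam))).const_mul (om0 α M₁ M₂))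
  have h0 := om0_ne_zero hα M₁ M₂
  have e : 1 / om0 α M₁ M₂ ^ 2 * (om0 α M₁ M₂ *
      (-(bAlpha α M₁ M₂ * con α false lam) * F 0 - con α false lam * (0 * deriv F 0) -
        con α true lam * (0 * deriv G 0))) =
      -(bAlpha α M₁ M₂ * con α false lam * sol0 α false lam M₁ M₂ / om0 α M₁ M₂) := by
    rw [hF0]
    field_simp
    ring
  rw [e] at hlim
  refine hlim.congr' ?_
  filter_upwards [he, self_mem_nhdsWithin] with x ⟨h2, h3⟩ hx
  have hx : 0 < x := hx
  have hy : HasDerivAt (yTilde₂ α M₁ M₂) (om0 α M₁ M₂ *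
      ((-bAlpha α M₁ M₂ : ℝ) * ((x ^ (-bAlpha α M₁ M₂ - 1) : ℝ) : ℂ))) x := by
    have := (hasDerivAt_rpow_ofReal (-bAlpha α M₁ M₂) hx).const_mul (om0 α M₁ M₂)
    unfold yTilde₂
    rwa [(Om_germ hα M₁ M₂).valZero]
  rw [bracket_eq M₁ M₂ _ _ hx, hy.deriv, h3.deriv, h2, yTilde₂, (Om_germ hα M₁ M₂).valZero]
  set b := bAlpha α M₁ M₂
  have hx' : (x : ℂ) ≠ 0 := by exact_mod_cast hx.ne'
  have e1 : ((x ^ (-b) : ℝ) : ℂ) = ((x ^ (-b - 1) : ℝ) : ℂ) * x := (rpow_mul_self_ofReal _ hx).symm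
  have e2 : ((x ^ (1 - b) : ℝ) : ℂ) = ((x ^ (-b - 1) : ℝ) : ℂ) * x ^ 2 := by
    have := rpow_mul_self_ofReal (1 - b) hx
    rw [← this, show (1 - b - 1 : ℝ) = -b by ring, e1]
    ring
  have e3 : ((x ^ (b + 1) : ℝ) : ℂ) * ((x ^ (-b - 1) : ℝ) : ℂ) = 1 := by
    rw [← rpow_add_ofReal hx, show b + 1 + (-b - 1) = 0 by ring, Real.rpow_zero, Complex.ofReal_one]
  rw [e2, e1]
  push_cast
  generalize ((x ^ (b + 1) : ℝ) : ℂ) = p at *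
  generalize ((x ^ (-b - 1) : ℝ) : ℂ) = q at *
  congr 1
  linear_combination (om0 α M₁ M₂ * (b * (con α false lam * F x) + x * con α false lam * deriv F x +
    con α true lam * (q * x ^ 2 * deriv G x))) * e3

/-- Against a constant only `χ'` matters. The part from the first solution is of order `x^(𝛂+1)`,
which tends to 0 as `𝛂 > -1`, so only the leading coefficient of the second solution is seen. -/
theorem hasQuasiDeriv₁_chi {α : ℝ} (hα : NonInt α) (lam : ℂ) (M₁ M₂ : MayaDiagram)
    (h1 : -1 < bAlpha α M₁ M₂) : HasQuasiDeriv₁ α M₁ M₂ (chi α lam M₁ M₂)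
      (-(con α true lam * sol0 α true lam M₁ M₂ / om0 α M₁ M₂)) := by
  obtain ⟨F, G, hF, hG, hF0, hG0, he⟩ := chi_local hα lam M₁ M₂
  have hid : Tendsto (fun x : ℝ => (x : ℂ)) (𝓝[>] 0) (𝓝 0) := by
    simpa using AnalyticAt.tendsto_nhdsGT (analyticAt_ofReal 0)
  have hb : (bAlpha α M₁ M₂ : ℂ) ≠ 0 := by exact_mod_cast bAlpha_ne_zero hα M₁ M₂
  have hlim := (weightFactor_tendsto hα M₁ M₂).mul
    (((((tendsto_rpow_zero (neg_lt_iff_pos_add.1 h1)).mul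
      (AnalyticAt.tendsto_nhdsGT hF.deriv)).const_mul (con α false lam)).add
      ((((AnalyticAt.tendsto_nhdsGT hG).const_mul (-bAlpha α M₁ M₂ : ℂ)).add
        (hid.mul (AnalyticAt.tendsto_nhdsGT hG.deriv))).const_mul (con α true lam))).const_mul
        (om0 α M₁ M₂ / bAlpha α M₁ M₂))
  have h0 := om0_ne_zero hα M₁ M₂
  have e : 1 / om0 α M₁ M₂ ^ 2 * (om0 α M₁ M₂ / bAlpha α M₁ M₂ *
      (con α false lam * (0 * deriv F 0) + con α true lam *
        (-bAlpha α M₁ M₂ * G 0 + 0 * deriv G 0))) =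
      -(con α true lam * sol0 α true lam M₁ M₂ / om0 α M₁ M₂) := by
    rw [hG0]
    field_simp
    ring
  rw [e] at hlim
  refine hlim.congr' ?_
  filter_upwards [he, self_mem_nhdsWithin] with x ⟨h2, h3⟩ hx
  have hx : 0 < x := hx
  have hy : deriv (yTilde₁ α M₁ M₂) x = 0 := by
    unfold yTilde₁
    simp
  rw [bracket_eq M₁ M₂ _ _ hx, hy, h3.deriv, yTilde₁, (Om_germ hα M₁ M₂).valZero]
  set b := bAlpha α M₁ M₂
  have e3 : ((x ^ (b + 1) : ℝ) : ℂ) * ((x ^ (-b - 1) : ℝ) : ℂ) = 1 := by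
    rw [← rpow_add_ofReal hx, show b + 1 + (-b - 1) = 0 by ring, Real.rpow_zero, Complex.ofReal_one]
  rw [add_comm b 1] at *
  generalize ((x ^ (1 + b) : ℝ) : ℂ) = p at *
  generalize ((x ^ (-b - 1) : ℝ) : ℂ) = q at *
  congr 1
  linear_combination (-om0 α M₁ M₂ / b * (con α true lam * (-b * G x + x * deriv G x))) * e3

/-- As `b ≠ 0`, one of `1` and `x^(-b)` is negligible against the other at 0. The limit gives the
coefficient of the larger one, then that of the smaller. -/
theorem germ_independent {b : ℝ} (hb : b ≠ 0) {F G : ℝ → ℂ} {S T c d : ℂ}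
    (hF : Tendsto F (𝓝[>] 0) (𝓝 S)) (hG : Tendsto G (𝓝[>] 0) (𝓝 T)) (hS : S ≠ 0) (hT : T ≠ 0)
    (h : ∀ᶠ x : ℝ in 𝓝[>] 0, c * F x + d * (((x ^ (-b) : ℝ) : ℂ) * G x) = 0) : c = 0 ∧ d = 0 := by
  rcases lt_or_gt_of_ne hb with hb | hb
  · have h1 := (hF.const_mul c).add
      (((tendsto_rpow_zero (neg_pos.2 hb)).mul hG).const_mul d)
    rw [zero_mul, mul_zero, add_zero] at h1
    have hc : c = 0 := (mul_eq_zero.1 (tendsto_nhds_unique (h1.congr' h)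
      tendsto_const_nhds)).resolve_right hS
    have h2 : Tendsto (fun x => d * G x) (𝓝[>] 0) (𝓝 0) := by
      refine Tendsto.congr' ?_ tendsto_const_nhds
      filter_upwards [h, self_mem_nhdsWithin] with x hx hx0
      have : ((x ^ (-b) : ℝ) : ℂ) ≠ 0 := by exact_mod_cast (Real.rpow_pos_of_pos hx0 _).ne'
      rw [hc, zero_mul, zero_add, mul_left_comm] at hx
      exact ((mul_eq_zero.1 hx).resolve_left this).symm
    exact ⟨hc, (mul_eq_zero.1 (tendsto_nhds_unique (hG.const_mul d) h2)).resolve_right hT⟩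
  · have h1 := (((tendsto_rpow_zero hb).mul hF).const_mul c).add (hG.const_mul d)
    rw [zero_mul, mul_zero, zero_add] at h1
    have h' : ∀ᶠ x : ℝ in 𝓝[>] 0, c * (((x ^ b : ℝ) : ℂ) * F x) + d * G x = 0 := by
      filter_upwards [h, self_mem_nhdsWithin] with x hx hx0
      have : ((x ^ b : ℝ) : ℂ) * ((x ^ (-b) : ℝ) : ℂ) = 1 := by
        rw [← rpow_add_ofReal hx0, add_neg_cancel, Real.rpow_zero, Complex.ofReal_one]
      linear_combination ((x ^ b : ℝ) : ℂ) * hx - d * G x * this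
    have hd : d = 0 := (mul_eq_zero.1 (tendsto_nhds_unique (h1.congr' h')
      tendsto_const_nhds)).resolve_right hT
    have h2 : Tendsto (fun x => c * F x) (𝓝[>] 0) (𝓝 0) := by
      refine Tendsto.congr' ?_ tendsto_const_nhds
      filter_upwards [h] with x hx
      rw [hd, zero_mul, add_zero] at hx
      exact hx.symm
    exact ⟨(mul_eq_zero.1 (tendsto_nhds_unique (hF.const_mul c) h2)).resolve_right hS, hd⟩

theorem chi_ne_zero {α : ℝ} (hα : NonInt α) {lam : ℂ} {M₁ M₂ : MayaDiagram}
    (had : Admissible α lam M₁ M₂) : ∃ x : ℝ, 0 < x ∧ chi α lam M₁ M₂ x ≠ 0 := by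
  by_contra! h
  have h0 := germ_independent (c := con α false lam) (d := con α true lam)
    (bAlpha_ne_zero hα M₁ M₂) (OmFirst_germ hα lam M₁ M₂).tendsto
    (OmSecond_germ hα lam M₁ M₂).tendsto (sol0_ne_zero hα had false) (sol0_ne_zero hα had true) (by
      filter_upwards [self_mem_nhdsWithin] with x hx
      rw [← chi_eq hα lam M₁ M₂ hx, h x hx])
  rcases gamma_coeff_ne_zero hα lam with h1 | h1
  · exact h1 h0.1
  · exact h1 h0.2

theorem units_sq (ε : ℤˣ) : ((ε : ℤ) : ℂ) * ((ε : ℤ) : ℂ) = 1 := by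
  rcases Int.units_eq_one_or ε with h | h <;> simp [h]

theorem sign_mul_frakC {α : ℝ} (hα : NonInt α) {lam : ℂ} {M₁ M₂ : MayaDiagram} {ε : ℤˣ}
    (h : constC α lam M₁ M₂ * valZero (OmFirstCan α lam M₁ M₂) =
      ((ε : ℤ) : ℂ) * sol0 α false lam M₁ M₂) : ((ε : ℤ) : ℂ) * frakC α lam M₁ M₂ =
      -(bAlpha α M₁ M₂ * con α false lam * sol0 α false lam M₁ M₂ / om0 α M₁ M₂) := by
  rw [frakC, (Om_germ hα M₁ M₂).valZero, con, if_neg Bool.false_ne_true, div_eq_mul_inv,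
    div_eq_mul_inv, mul_inv]
  linear_combination (-((ε : ℤ) : ℂ) * bAlpha α M₁ M₂ * Complex.Gamma (-α) *
    (Complex.Gamma (-lam - α))⁻¹ * (om0 α M₁ M₂)⁻¹) * h - (bAlpha α M₁ M₂ * Complex.Gamma (-α) *
    (Complex.Gamma (-lam - α))⁻¹ * (om0 α M₁ M₂)⁻¹ * sol0 α false lam M₁ M₂) * units_sq ε

theorem sign_mul_frakD {α : ℝ} (hα : NonInt α) {lam : ℂ} {M₁ M₂ : MayaDiagram} {ε : ℤˣ}
    (h : constD α lam M₁ M₂ * valZero (OmSecondConj α lam M₁ M₂) =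
      ((ε : ℤ) : ℂ) * sol0 α true lam M₁ M₂) : ((ε : ℤ) : ℂ) * frakD α lam M₁ M₂ =
      -(con α true lam * sol0 α true lam M₁ M₂ / om0 α M₁ M₂) := by
  rw [frakD, (Om_germ hα M₁ M₂).valZero, con, if_pos rfl, div_eq_mul_inv,
    div_eq_mul_inv, mul_inv]
  linear_combination (-((ε : ℤ) : ℂ) * Complex.Gamma α *
    (Complex.Gamma (-lam))⁻¹ * (om0 α M₁ M₂)⁻¹) * h - (Complex.Gamma α *
    (Complex.Gamma (-lam))⁻¹ * (om0 α M₁ M₂)⁻¹ * sol0 α true lam M₁ M₂) * units_sq ε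

theorem chi_eq_combination {α : ℝ} (hα : NonInt α) {lam : ℂ} {M₁ M₂ : MayaDiagram}
    (had : Admissible α lam M₁ M₂) {c d : ℂ}
    (hc : c = -(bAlpha α M₁ M₂ * con α false lam * sol0 α false lam M₁ M₂ / om0 α M₁ M₂))
    (hd : d = -(con α true lam * sol0 α true lam M₁ M₂ / om0 α M₁ M₂)) {x : ℝ} (hx : 0 < x) :
    chi α lam M₁ M₂ x = c * u₁ α lam M₁ M₂ x + d * u₂ α lam M₁ M₂ x := by
  have h0 := om0_ne_zero hα M₁ M₂
  have hb : (bAlpha α M₁ M₂ : ℂ) ≠ 0 := by exact_mod_cast bAlpha_ne_zero hα M₁ M₂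
  have hS := sol0_ne_zero hα had false
  have hT := sol0_ne_zero hα had true
  rw [chi_eq hα lam M₁ M₂ hx, hc, hd, u₁, u₂, (Om_germ hα M₁ M₂).valZero,
    (OmFirst_germ hα lam M₁ M₂).valZero, (OmSecond_germ hα lam M₁ M₂).valZero]
  field_simp


/-! ### Growth at infinity -/

/-- Each column has its own exponential rate, so every minor grows with the sum of the rates
whichever rows are taken. The freedom in `ρ` covers both the Wronskian and its derivative. -/
theorem expGrowth_minor {n : ℕ} (L : List (ℝ × (ℝ → ℂ))) (hn : L.length = n)
    (h : ∀ p ∈ L, ∀ i, ExpGrowth p.1 (iteratedDeriv i p.2)) (ρ : Fin n → ℕ) :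
    ExpGrowth (L.map fun p => p.1).sum fun x =>
      (Matrix.of fun i j : Fin n => jet (L.map fun p => p.2) x (ρ i) j).det := by
  subst hn
  have e : (L.map fun p => p.1).sum = ∑ j : Fin L.length, (L.get j).1 := by simp
  rw [e]
  refine ExpGrowth.det fun i j => ?_
  have := h _ (L.get_mem j) (ρ i)
  simpa [jet] using this

theorem expGrowth_wronskian {L : List (ℝ × (ℝ → ℂ))}
    (h : ∀ p ∈ L, ∀ i, ExpGrowth p.1 (iteratedDeriv i p.2)) :
    ExpGrowth (L.map fun p => p.1).sum (wronskian (L.map fun p => p.2)) := by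
  refine (expGrowth_minor L rfl h fun i => i).congr fun x _ => ?_
  rw [wronskian_eq_leadDet, List.length_map]
  rfl

theorem expGrowth_deriv_wronskian {L : List (ℝ × (ℝ → ℂ))} {k : ℝ} {y : ℝ → ℂ}
    (h : ∀ p ∈ L ++ [(k, y)], ∀ i, ExpGrowth p.1 (iteratedDeriv i p.2))
    (hL : ∀ x : ℝ, 0 < x → AnaAt (L.map fun p => p.2) x) (hy : ∀ x : ℝ, 0 < x → AnalyticAt ℝ y x) :
    ExpGrowth ((L ++ [(k, y)]).map fun p => p.1).sum
      (deriv (wronskian (L.map (fun p => p.2) ++ [y]))) := by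
  refine (expGrowth_minor (n := L.length + 1) (L ++ [(k, y)]) (by simp) h
    fun i => if (i : ℕ) < L.length then i else L.length + 1).congr fun x hx => ?_
  rw [deriv_wronskian_append (hL x hx) (hy x hx), borderDet, List.length_map]
  congr 1
  ext i j
  have hj : (if (j : ℕ) < L.length then (j : ℕ) else L.length) = j := by split_ifs <;> omega
  simp [hj]

theorem seeds_expGrowth (α : ℝ) (M₁ M₂ : MayaDiagram) :
    ∀ p ∈ (qseeds α M₁ M₂).map (fun p : ℝ × ℝ × (ℝ → ℂ) => (p.1, p.2.2)), ∀ i,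
      ExpGrowth p.1 (iteratedDeriv i p.2) := by
  intro p hp i
  obtain ⟨q, hq, rfl⟩ := List.mem_map.1 hp
  exact ((qseeds_qPoly α M₁ M₂ q hq).iteratedDeriv i).expGrowth

theorem seeds_triF_expGrowth {α : ℝ} (hα : NonInt α) (lam : ℂ) (M₁ M₂ : MayaDiagram) :
    ∀ p ∈ (qseeds α M₁ M₂).map (fun p : ℝ × ℝ × (ℝ → ℂ) => (p.1, p.2.2)) ++ [(0, triF α lam)], ∀ i,
      ExpGrowth p.1 (iteratedDeriv i p.2) := by
  intro p hp i
  rcases List.mem_append.1 hp with hp | hp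
  · exact seeds_expGrowth α M₁ M₂ p hp i
  · rw [List.mem_singleton.1 hp]
    exact triF_iteratedDeriv_expGrowth hα lam i

theorem expGrowth_gauge_factor (k β : ℝ) :
    ExpGrowth (-k) fun x : ℝ => (Real.exp (-k * x) : ℂ) * ((x ^ β : ℝ) : ℂ) := by
  simpa using (expGrowth_exp (-k)).mul (expGrowth_rpow β)

/-- `U` and its derivatives grow algebraically, so the rate is the number `r₂ + r₄` of seeds with a
factor `e^x`, which the prefactor of `A` removes. -/
theorem wronskian_triF_expGrowth {α : ℝ} (hα : NonInt α) (lam : ℂ) (M₁ M₂ : MayaDiagram) :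
    ExpGrowth (num₂ M₂ + num₄ M₁) (wronskian (seeds α M₁ M₂ ++ [triF α lam])) ∧
    ExpGrowth (num₂ M₂ + num₄ M₁) (deriv (wronskian (seeds α M₁ M₂ ++ [triF α lam]))) := by
  have h := seeds_triF_expGrowth hα lam M₁ M₂
  have e1 : ((qseeds α M₁ M₂).map (fun p : ℝ × ℝ × (ℝ → ℂ) => (p.1, p.2.2))).map (fun p => p.2) = seeds α M₁ M₂ := by
    rw [List.map_map, ← qseeds_map]
    rfl
  have e2 : (((qseeds α M₁ M₂).map (fun p : ℝ × ℝ × (ℝ → ℂ) => (p.1, p.2.2)) ++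
      [((0 : ℝ), triF α lam)]).map fun p : ℝ × (ℝ → ℂ) => p.1).sum = num₂ M₂ + num₄ M₁ := by
    rw [List.map_append, List.map_map, List.sum_append, ← qseeds_sum_fst α]
    simp [Function.comp_def]
  constructor
  · have := expGrowth_wronskian h
    rwa [e2, List.map_append, e1] at this
  · have := expGrowth_deriv_wronskian h (fun x hx => by rw [e1]; exact seeds_anaAt hα M₁ M₂ hx)
      fun x hx => triF_analyticAt hα lam hx
    rwa [e2, e1] at this

theorem chi_expGrowth {α : ℝ} (hα : NonInt α) (lam : ℂ) (M₁ M₂ : MayaDiagram) :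
    ExpGrowth 0 (chi α lam M₁ M₂) := by
  have := (expGrowth_gauge_factor (num₂ M₂ + num₄ M₁)
    ((α + num₁ M₁ + num₂ M₂ + 1) * (num₃ M₂ + num₄ M₁))).mul (wronskian_triF_expGrowth hα lam M₁ M₂).1
  rw [neg_add_cancel] at this
  exact this.congr fun x hx => chi_eq_darboux_triF hα lam M₁ M₂ hx

theorem deriv_chi_expGrowth {α : ℝ} (hα : NonInt α) (lam : ℂ) (M₁ M₂ : MayaDiagram) :
    ExpGrowth 0 (deriv (chi α lam M₁ M₂)) := by
  set β : ℝ := (α + num₁ M₁ + num₂ M₂ + 1) * (num₃ M₂ + num₄ M₁)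
  obtain ⟨h1, h2⟩ := wronskian_triF_expGrowth hα lam M₁ M₂
  have h3 : ExpGrowth 0 fun x : ℝ => (-((num₂ M₂ + num₄ M₁ : ℝ) : ℂ)) +
      β * ((x ^ (-1 : ℝ) : ℝ) : ℂ) := (expGrowth_const _).add ((expGrowth_rpow (-1)).const_mul _)
  have h4 := h3.mul h1
  rw [zero_add] at h4
  have := (expGrowth_gauge_factor (num₂ M₂ + num₄ M₁) β).mul (h2.add h4)
  rw [neg_add_cancel] at this
  refine this.congr fun x hx => ?_
  have hY := ((seeds_anaAt hα M₁ M₂ hx).append_singleton (triF_analyticAt hα lam hx)).wronskian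
  rw [(chi_eventuallyEq hα lam M₁ M₂ hx).deriv_eq, darboux_eq_gauge,
    (gauge_deriv _ _ hx hY).self_of_nhds, gauge, Real.rpow_neg_one]
  simp only [β]
  push_cast
  rw [div_eq_mul_inv]

theorem weight_pos {α : ℝ} {M₁ M₂ : MayaDiagram} {x : ℝ} (hx : 0 < x) (h : Om α M₁ M₂ x ≠ 0) :
    0 < weight α M₁ M₂ x := by
  have := norm_pos_iff.2 h
  unfold weight
  positivity

theorem weight_ofReal {α : ℝ} {M₁ M₂ : MayaDiagram} {x : ℝ} (hx : 0 < x) :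
    (weight α M₁ M₂ x : ℂ) =
      ((x ^ bAlpha α M₁ M₂ : ℝ) : ℂ) * (Real.exp (-x) : ℂ) / Om α M₁ M₂ x ^ 2 := by
  rw [weight, ← Om_real α M₁ M₂ hx]
  push_cast
  rfl

theorem weight_continuousOn {α : ℝ} (hα : NonInt α) {M₁ M₂ : MayaDiagram}
    (h : ∀ x : ℝ, 0 < x → Om α M₁ M₂ x ≠ 0) : ContinuousOn (weight α M₁ M₂) (Ioi 0) := by
  intro x hx
  have h1 : ContinuousAt (Om α M₁ M₂) x := (Om_analyticAt hα M₁ M₂ hx).continuousAt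
  have h2 : ContinuousAt (fun x : ℝ => x ^ bAlpha α M₁ M₂) x :=
    Real.continuousAt_rpow_const _ _ (Or.inl (ne_of_gt hx))
  have h3 : ContinuousAt (fun x : ℝ => Real.exp (-x)) x := by fun_prop
  exact ((h2.mul h3).div (h1.norm.pow 2)
    (pow_ne_zero 2 (norm_ne_zero_iff.2 (h x hx)))).continuousWithinAt

theorem weight_expGrowth {α : ℝ} (hα : NonInt α) (M₁ M₂ : MayaDiagram) :
    ExpGrowth (-1) fun x => (weight α M₁ M₂ x : ℂ) := by
  have h := Om_inv_expGrowth hα M₁ M₂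
  have := ((expGrowth_rpow (bAlpha α M₁ M₂)).mul (expGrowth_exp (-1))).mul (h.mul h)
  simp only [zero_add, add_zero] at this
  refine this.congr fun x hx => ?_
  rw [weight_ofReal hx, div_eq_mul_inv, sq, mul_inv, neg_one_mul]

theorem weight_inv_expGrowth (α : ℝ) (M₁ M₂ : MayaDiagram) :
    ExpGrowth 1 fun x => ((weight α M₁ M₂ x)⁻¹ : ℂ) := by
  have h := Om_expGrowth α M₁ M₂
  have := ((expGrowth_rpow (-bAlpha α M₁ M₂)).mul (expGrowth_exp 1)).mul (h.mul h)
  simp only [zero_add, add_zero] at this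
  refine this.congr fun x hx => ?_
  rw [weight_ofReal hx, Real.rpow_neg hx.le, one_mul, Real.exp_neg]
  push_cast
  rw [inv_div, div_eq_mul_inv, mul_inv, inv_inv]
  ring

/-! ### Solutions of the exceptional equation -/

/-- The coefficients of the exceptional equation in the form `y'' + Q y' + R y = 0`. -/
noncomputable def exQ (α : ℝ) (M₁ M₂ : MayaDiagram) (x : ℝ) : ℂ :=
  ((bAlpha α M₁ M₂ : ℂ) + 1 - x) / x - 2 * (deriv (Om α M₁ M₂) x / Om α M₁ M₂ x)

noncomputable def exR (α : ℝ) (lam : ℂ) (M₁ M₂ : MayaDiagram) (x : ℝ) : ℂ :=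
  (x * (deriv (deriv (Om α M₁ M₂)) x / Om α M₁ M₂ x) +
      (x - (bAlpha α M₁ M₂ : ℂ)) * (deriv (Om α M₁ M₂) x / Om α M₁ M₂ x) +
      (num₄ M₁ : ℂ) - num₁ M₁ + lam) / x

theorem Lexpr_eq_iff {α : ℝ} {lam : ℂ} {M₁ M₂ : MayaDiagram} {y : ℝ → ℂ} {x : ℝ} (hx : 0 < x) :
    Lexpr α M₁ M₂ y x = lam * y x ↔
      deriv (deriv y) x = -(exQ α M₁ M₂ x * deriv y x + exR α lam M₁ M₂ x * y x) := by
  have hx' : (x : ℂ) ≠ 0 := by exact_mod_cast hx.ne'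
  rw [Lexpr, exQ, exR]
  generalize deriv (Om α M₁ M₂) x / Om α M₁ M₂ x = V
  generalize deriv (deriv (Om α M₁ M₂)) x / Om α M₁ M₂ x = V'
  constructor
  · intro h
    field_simp
    linear_combination -h
  · intro h
    rw [h]
    field_simp
    ring

theorem exQ_continuousOn {α : ℝ} (hα : NonInt α) {M₁ M₂ : MayaDiagram}
    (h : ∀ x : ℝ, 0 < x → Om α M₁ M₂ x ≠ 0) : ContinuousOn (exQ α M₁ M₂) (Ioi 0) := by
  intro x hx
  have hx' : (x : ℂ) ≠ 0 := by exact_mod_cast (ne_of_gt hx)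
  have h1 := Om_analyticAt hα M₁ M₂ hx
  have h2 := (analyticAt_ofReal x).continuousAt
  exact (((continuousAt_const.sub h2).div h2 hx').sub (continuousAt_const.mul
    (h1.deriv.continuousAt.div h1.continuousAt (h x hx)))).continuousWithinAt

theorem exR_continuousOn {α : ℝ} (hα : NonInt α) (lam : ℂ) {M₁ M₂ : MayaDiagram}
    (h : ∀ x : ℝ, 0 < x → Om α M₁ M₂ x ≠ 0) : ContinuousOn (exR α lam M₁ M₂) (Ioi 0) := by
  intro x hx
  have hx' : (x : ℂ) ≠ 0 := by exact_mod_cast (ne_of_gt hx)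
  have h1 := Om_analyticAt hα M₁ M₂ hx
  have h2 := (analyticAt_ofReal x).continuousAt
  exact ((((((h2.mul (h1.deriv.deriv.continuousAt.div h1.continuousAt (h x hx))).add
    ((h2.sub continuousAt_const).mul (h1.deriv.continuousAt.div h1.continuousAt (h x hx)))).add
    continuousAt_const).sub continuousAt_const).add continuousAt_const).div h2
      hx').continuousWithinAt

theorem darboux_linSol {α : ℝ} (hα : NonInt α) {lam : ℂ} {M₁ M₂ : MayaDiagram}
    (h : ∀ x : ℝ, 0 < x → Om α M₁ M₂ x ≠ 0) {y : ℝ → ℂ} (hy : IsEig α lam y) :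
    LinSol (exQ α M₁ M₂) (exR α lam M₁ M₂) (darboux α M₁ M₂ y) (deriv (darboux α M₁ M₂ y)) := by
  intro x hx
  have ha := darboux_analyticAt hα M₁ M₂ hx (hy x hx).1
  refine ⟨analyticAt_hasDerivAt ha, (analyticAt_hasDerivAt ha.deriv).congr_deriv ?_⟩
  exact (Lexpr_eq_iff hx).1 (Lexpr_darboux hα hy hx (h x hx))

/-- The leading coefficient `x^(𝛂+1) e^(-x) / Ω²` of the symmetric form. -/
noncomputable def exP (α : ℝ) (M₁ M₂ : MayaDiagram) (x : ℝ) : ℂ :=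
  ((x ^ (bAlpha α M₁ M₂ + 1) : ℝ) : ℂ) * (Real.exp (-x) : ℂ) / Om α M₁ M₂ x ^ 2

theorem exP_eq {α : ℝ} {M₁ M₂ : MayaDiagram} {x : ℝ} (hx : 0 < x) :
    exP α M₁ M₂ x = ((x * weight α M₁ M₂ x : ℝ) : ℂ) := by
  rw [exP, Real.rpow_add_one hx.ne', Complex.ofReal_mul, Complex.ofReal_mul, weight_ofReal hx]
  ring

theorem exP_hasDerivAt {α : ℝ} (hα : NonInt α) {M₁ M₂ : MayaDiagram} {x : ℝ} (hx : 0 < x)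
    (h : Om α M₁ M₂ x ≠ 0) :
    HasDerivAt (exP α M₁ M₂) (exP α M₁ M₂ x * exQ α M₁ M₂ x) x := by
  have hx' : (x : ℂ) ≠ 0 := by exact_mod_cast hx.ne'
  have h1 := hasDerivAt_rpow_ofReal (bAlpha α M₁ M₂ + 1) hx
  have h2 : HasDerivAt (fun x : ℝ => (Real.exp (-x) : ℂ)) (-(Real.exp (-x) : ℂ)) x := by
    refine ((hasDerivAt_id x).neg).exp.ofReal_comp.congr_deriv ?_
    simp
  have h3 := analyticAt_hasDerivAt (Om_analyticAt hα M₁ M₂ hx)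
  refine ((h1.mul h2).div (h3.pow 2) (pow_ne_zero 2 h)).congr_deriv ?_
  simp only [Pi.mul_apply, Pi.pow_apply]
  rw [exP, exQ, ← rpow_mul_self_ofReal (bAlpha α M₁ M₂ + 1) hx]
  generalize ((x ^ (bAlpha α M₁ M₂ + 1 - 1) : ℝ) : ℂ) = p
  generalize (Real.exp (-x) : ℂ) = E
  push_cast
  field_simp
  ring


/-! ### Local absolute continuity -/

/-- Absolute continuity on the compact subintervals of `(0, ∞)`. -/
def LocAC (f : ℝ → ℂ) : Prop := ∀ a b : ℝ, 0 < a → a ≤ b → AbsolutelyContinuousOnInterval f a b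

theorem LocAC.continuousOn {f : ℝ → ℂ} (h : LocAC f) : ContinuousOn f (Ioi 0) := by
  intro x hx
  have hx : 0 < x := hx
  have h1 := (h (x / 2) (2 * x) (by positivity) (by linarith)).continuousOn
  rw [uIcc_of_le (by linarith)] at h1
  exact (h1.continuousAt (Icc_mem_nhds (by linarith) (by linarith))).continuousWithinAt

theorem LocAC.ae_differentiableAt {f : ℝ → ℂ} (h : LocAC f) :
    ∀ᵐ x : ℝ, 0 < x → DifferentiableAt ℝ f x := by
  have h1 : ∀ᵐ x : ℝ, ∀ n : ℕ, x ∈ uIcc (1 / ((n : ℝ) + 1)) ((n : ℝ) + 1) →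
      DifferentiableAt ℝ f x := by
    refine ae_all_iff.2 fun n => ?_
    refine (h _ _ (by positivity) ?_).boundedVariationOn.ae_differentiableAt_of_mem_uIcc
    rw [div_le_iff₀ (by positivity)]
    nlinarith [n.cast_nonneg (α := ℝ)]
  filter_upwards [h1] with x hx hx0
  obtain ⟨n, hn⟩ := exists_nat_ge (max x x⁻¹)
  have hn1 : x ≤ n := (le_max_left _ _).trans hn
  have hn2 : x⁻¹ ≤ n := (le_max_right _ _).trans hn
  refine hx n ⟨(inf_le_left).trans ?_, le_trans ?_ le_sup_right⟩
  · rw [div_le_iff₀ (by positivity)]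
    rw [inv_le_iff_one_le_mul₀ hx0] at hn2
    nlinarith
  · linarith

theorem contDiffOn_one_of_hasDerivAt {g g' : ℝ → ℂ} (hg : ∀ x : ℝ, 0 < x → HasDerivAt g (g' x) x)
    (hc : ContinuousOn g' (Ioi 0)) : ContDiffOn ℝ 1 g (Ioi 0) := by
  rw [show (1 : WithTop ℕ∞) = 0 + 1 from rfl, contDiffOn_succ_iff_deriv_of_isOpen isOpen_Ioi]
  refine ⟨fun x hx => (hg x hx).differentiableAt.differentiableWithinAt, by simp, ?_⟩
  rw [contDiffOn_zero]
  exact hc.congr fun x hx => (hg x hx).deriv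

theorem locAC_of_contDiffOn {g : ℝ → ℂ} (h : ContDiffOn ℝ 1 g (Ioi 0)) : LocAC g := by
  intro a b ha hab
  refine (h.mono ?_).absolutelyContinuousOnInterval
  rw [uIcc_of_le hab]
  exact fun x hx => lt_of_lt_of_le ha hx.1

/-- The difference of `g` and a primitive of `g'` is absolutely continuous with derivative zero
almost everywhere, hence constant. This turns equations valid almost everywhere into classical ones.
-/
theorem LocAC.hasDerivAt {g g' : ℝ → ℂ} (hg : LocAC g) (hc : ContinuousOn g' (Ioi 0))
    (h : ∀ᵐ x : ℝ, 0 < x → HasDerivAt g (g' x) x) {x : ℝ} (hx : 0 < x) :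
    HasDerivAt g (g' x) x := by
  set G : ℝ → ℂ := fun u => ∫ t in (1 : ℝ)..u, g' t with hG
  have hGd : ∀ u : ℝ, 0 < u → HasDerivAt G (g' u) u := by
    intro u hu
    refine intervalIntegral.integral_hasDerivAt_right ?_
      (hc.stronglyMeasurableAtFilter isOpen_Ioi u hu) (hc.continuousAt (Ioi_mem_nhds hu))
    refine (hc.mono fun y hy => ?_).intervalIntegrable
    exact lt_of_lt_of_le (lt_min one_pos hu) hy.1
  have hGac := locAC_of_contDiffOn (contDiffOn_one_of_hasDerivAt hGd hc)
  have hle : x / 2 ≤ 2 * x := by linarith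
  obtain ⟨C, hC⟩ := ((hg (x / 2) (2 * x) (by positivity) hle).sub
    (hGac (x / 2) (2 * x) (by positivity) hle)).const_of_ae_hasDerivAt_zero (by
      filter_upwards [h] with u hu hu'
      rw [uIcc_of_le hle] at hu'
      have hu0 : 0 < u := lt_of_lt_of_le (by positivity) hu'.1
      simpa using (hu hu0).sub (hGd u hu0))
  refine ((hGd x hx).const_add C).congr_of_eventuallyEq ?_
  filter_upwards [Icc_mem_nhds (show x / 2 < x by linarith) (show x < 2 * x by linarith)] with u hu
  have := hC u (by rwa [uIcc_of_le hle])
  rw [← this]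
  simp

/-! ### The weighted space -/

theorem memLp_weight_iff {α : ℝ} (hα : NonInt α) {M₁ M₂ : MayaDiagram}
    (h : ∀ x : ℝ, 0 < x → Om α M₁ M₂ x ≠ 0) {f : ℝ → ℂ} (hf : ContinuousOn f (Ioi 0)) :
    MemLp f 2 (weightMeasure α M₁ M₂) ↔
      IntegrableOn (fun x => weight α M₁ M₂ x * ‖f x‖ ^ 2) (Ioi 0) := by
  have hw := (weight_continuousOn hα h).aestronglyMeasurable (μ := volume) measurableSet_Ioi
  have hfm := (hf.aestronglyMeasurable (μ := volume) measurableSet_Ioi).mono_ac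
    (withDensity_absolutelyContinuous _ fun x => ENNReal.ofReal (weight α M₁ M₂ x))
  rw [weightMeasure, memLp_two_iff_integrable_sq_norm hfm,
    integrable_withDensity_iff_integrable_smul₀' hw.aemeasurable.ennreal_ofReal (by simp),
    IntegrableOn]
  refine integrable_congr ?_
  filter_upwards [ae_restrict_mem measurableSet_Ioi] with x hx
  rw [ENNReal.toReal_ofReal (weight_pos hx (h x hx)).le, smul_eq_mul]

theorem rpow_isBigO_rpow {s t : ℝ} (h : t ≤ s) :
    (fun x : ℝ => ((x ^ s : ℝ) : ℂ)) =O[𝓝[>] 0] fun x : ℝ => x ^ t := by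
  refine IsBigO.of_bound 1 ?_
  filter_upwards [self_mem_nhdsWithin,
    nhdsGT_of_nhds (eventually_le_nhds (show (0 : ℝ) < 1 from one_pos))] with x hx hx1
  have hx : 0 < x := hx
  rw [one_mul, Complex.norm_real, Real.norm_of_nonneg (by positivity),
    Real.norm_of_nonneg (by positivity)]
  exact Real.rpow_le_rpow_of_exponent_ge hx hx1 h

theorem rpow_mul_rpow_isBigO (s t : ℝ) :
    (fun x : ℝ => x ^ s * x ^ t) =O[𝓝[>] 0] fun x : ℝ => x ^ (s + t) := by
  refine (isBigO_refl _ _).congr' ?_ EventuallyEq.rfl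
  filter_upwards [self_mem_nhdsWithin] with x hx using Real.rpow_add hx _ _

/-- The exponent is `min(0, -𝛂)`, written so that twice it plus `𝛂` is `-|𝛂|`. -/
theorem chi_isBigO_zero {α : ℝ} (hα : NonInt α) (lam : ℂ) (M₁ M₂ : MayaDiagram) :
    chi α lam M₁ M₂ =O[𝓝[>] 0]
      fun x : ℝ => x ^ ((-bAlpha α M₁ M₂ - |bAlpha α M₁ M₂|) / 2) := by
  set b := bAlpha α M₁ M₂
  have h0 : (fun _ : ℝ => (1 : ℂ)) =O[𝓝[>] 0] fun x : ℝ => x ^ ((-b - |b|) / 2) := by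
    have := rpow_isBigO_rpow (s := 0) (t := (-b - |b|) / 2) (by linarith [neg_abs_le b])
    simpa using this
  have h1 : (fun x : ℝ => ((x ^ (-b) : ℝ) : ℂ)) =O[𝓝[>] 0] fun x : ℝ => x ^ ((-b - |b|) / 2) :=
    rpow_isBigO_rpow (by linarith [le_abs_self b])
  have hF := (OmFirst_germ hα lam M₁ M₂).tendsto.isBigO_one ℂ
  have hG := (OmSecond_germ hα lam M₁ M₂).tendsto.isBigO_one ℝ
  have h2 := h1.mul hG
  simp only [mul_one] at h2
  refine (((hF.trans h0).const_mul_left (con α false lam)).add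
    (h2.const_mul_left (con α true lam))).congr' ?_ EventuallyEq.rfl
  filter_upwards [self_mem_nhdsWithin] with x hx using (chi_eq hα lam M₁ M₂ hx).symm

theorem chi_memLp {α : ℝ} (hα : NonInt α) (lam : ℂ) {M₁ M₂ : MayaDiagram}
    (h : ∀ x : ℝ, 0 < x → Om α M₁ M₂ x ≠ 0) (h1 : -1 < bAlpha α M₁ M₂) (h2 : bAlpha α M₁ M₂ < 1) :
    MemLp (chi α lam M₁ M₂) 2 (weightMeasure α M₁ M₂) := by
  have hχc : ContinuousOn (chi α lam M₁ M₂) (Ioi 0) := fun x hx =>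
    (chi_analyticAt hα lam M₁ M₂ hx).continuousAt.continuousWithinAt
  rw [memLp_weight_iff hα h hχc]
  set b := bAlpha α M₁ M₂ with hb
  set H : ℝ → ℝ := fun x => weight α M₁ M₂ x * ‖chi α lam M₁ M₂ x‖ ^ 2 with hH
  have hc : ContinuousOn H (Ioi 0) := (weight_continuousOn hα h).mul (hχc.norm.pow 2)
  have hw : (fun x => (weight α M₁ M₂ x : ℂ)) =O[𝓝[>] 0] fun x : ℝ => x ^ b := by
    have h3 := (rpow_isBigO_rpow (le_refl b)).mul ((weightFactor_tendsto hα M₁ M₂).isBigO_one ℝ)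
    simp only [mul_one] at h3
    refine h3.congr' ?_ EventuallyEq.rfl
    filter_upwards [self_mem_nhdsWithin] with x hx
    rw [weight_ofReal hx, mul_div_assoc]
  have hw' : weight α M₁ M₂ =O[𝓝[>] 0] fun x : ℝ => x ^ b :=
    hw.norm_left.congr_left (fun x => Complex.norm_real _) |>.of_norm_left
  have hχ := (chi_isBigO_zero hα lam M₁ M₂).norm_left
  have hzero : H =O[𝓝[>] 0] fun x : ℝ => x ^ (-|b|) := by
    have h3 := hw'.mul ((hχ.mul hχ).trans (rpow_mul_rpow_isBigO _ _))
    have h4 := h3.trans (rpow_mul_rpow_isBigO _ _)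
    rw [show b + ((-b - |b|) / 2 + (-b - |b|) / 2) = -|b| by ring] at h4
    exact h4.congr_left fun x => by simp only [hH, sq]
  have hinf : H =O[atTop] fun x : ℝ => x ^ (-(2 : ℝ)) := by
    have hχg := chi_expGrowth hα lam M₁ M₂
    obtain ⟨N, hN⟩ := (weight_expGrowth hα M₁ M₂).mul (hχg.mul hχg)
    have h3 : H =O[atTop] fun x : ℝ => x ^ N * Real.exp ((-1 + (0 + 0)) * x) := by
      refine IsBigO.of_norm_left (hN.norm_left.congr_left fun x => ?_)
      simp [hH, sq]
    refine h3.trans ?_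
    have h4 := (isBigO_refl (fun x : ℝ => x ^ N) atTop).mul
      (isLittleO_exp_neg_mul_rpow_atTop one_pos (-(2 : ℝ) - N)).isBigO
    simp only [add_zero]
    refine h4.trans (IsBigO.of_bound 1 ?_)
    filter_upwards [eventually_gt_atTop 0] with x hx
    rw [← Real.rpow_natCast, ← Real.rpow_add hx, one_mul, add_sub_cancel]
  -- Convergence of the Mellin integral at `s = 1` is integrability on `(0, ∞)`; at the origin it
  -- requires `|𝛂| < 1`.
  have := mellin_convergent_of_isBigO_scalar (s := 1) (hc.locallyIntegrableOn measurableSet_Ioi)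
    hinf (by norm_num) hzero (abs_lt.2 ⟨h1, h2⟩)
  simpa using this

theorem isDeficiencyElement_of_eq {α : ℝ} (hα : NonInt α) {lam : ℂ} {M₁ M₂ : MayaDiagram}
    (h : ∀ x : ℝ, 0 < x → Om α M₁ M₂ x ≠ 0) (h1 : -1 < bAlpha α M₁ M₂) (h2 : bAlpha α M₁ M₂ < 1)
    {f : ℝ → ℂ} {c : ℂ} (hf : ∀ x : ℝ, 0 < x → f x = c * chi α lam M₁ M₂ x) :
    IsDeficiencyElement α lam M₁ M₂ f := by
  have hfe : ∀ x : ℝ, 0 < x → f =ᶠ[𝓝 x] fun x => c * chi α lam M₁ M₂ x := fun x hx => by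
    filter_upwards [Ioi_mem_nhds hx] with u hu using hf u hu
  have ha : ∀ x : ℝ, 0 < x → AnalyticAt ℝ f x := fun x hx =>
    (analyticAt_const.mul (chi_analyticAt hα lam M₁ M₂ hx)).congr (hfe x hx).symm
  have hL : ∀ x : ℝ, 0 < x → Lexpr α M₁ M₂ f x = lam * f x := fun x hx => by
    have h3 : Lexpr α M₁ M₂ (fun x => c * chi α lam M₁ M₂ x) x =
        c * Lexpr α M₁ M₂ (chi α lam M₁ M₂) x := by
      have hd : deriv (fun x => c * chi α lam M₁ M₂ x) = fun x => c * deriv (chi α lam M₁ M₂) x := by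
        ext u
        exact deriv_const_mul_field c
      simp only [Lexpr]
      rw [hd, deriv_const_mul_field]
      ring
    rw [Lexpr_congr α M₁ M₂ (hfe x hx), h3, Lexpr_chi hα lam M₁ M₂ hx (h x hx), hf x hx]
    ring
  have hae : ∀ᵐ x ∂(volume.restrict (Ioi (0 : ℝ))), Lexpr α M₁ M₂ f x = lam * f x := by
    filter_upwards [ae_restrict_mem measurableSet_Ioi] with x hx using hL x hx
  have hac : (weightMeasure α M₁ M₂) ≪ volume.restrict (Ioi 0) :=
    withDensity_absolutelyContinuous _ _
  have hmem : MemLp f 2 (weightMeasure α M₁ M₂) := by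
    refine ((chi_memLp hα lam h h1 h2).const_mul c).ae_eq (hac.ae_le ?_)
    filter_upwards [ae_restrict_mem measurableSet_Ioi] with x hx using (hf x hx).symm
  refine ⟨⟨fun a b h3 h4 => ⟨?_, ?_⟩, hmem, (hmem.const_mul lam).ae_eq
    (hac.ae_le (hae.mono fun x hx => hx.symm))⟩, hae⟩
  · refine locAC_of_contDiffOn (fun x hx => ?_) a b h3 h4
    exact (ha x hx).contDiffAt.contDiffWithinAt
  · refine locAC_of_contDiffOn (fun x hx => ?_) a b h3 h4
    exact (ha x hx).deriv.contDiffAt.contDiffWithinAt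

/-- The coefficients are continuous since `Ω` has no zero. First `f`, then `f'`, is differentiable
everywhere, being absolutely continuous with an almost everywhere derivative that is continuous. -/
theorem deficiency_linSol {α : ℝ} (hα : NonInt α) {lam : ℂ} {M₁ M₂ : MayaDiagram}
    (h : ∀ x : ℝ, 0 < x → Om α M₁ M₂ x ≠ 0) {f : ℝ → ℂ} (hf : IsDeficiencyElement α lam M₁ M₂ f) :
    LinSol (exQ α M₁ M₂) (exR α lam M₁ M₂) f (deriv f) := by
  obtain ⟨⟨hac, -, -⟩, he⟩ := hf
  have h1 : LocAC f := fun a b ha hab => (hac a b ha hab).1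
  have h2 : LocAC (deriv f) := fun a b ha hab => (hac a b ha hab).2
  have hc : ContinuousOn (fun x => -(exQ α M₁ M₂ x * deriv f x + exR α lam M₁ M₂ x * f x)) (Ioi 0) :=
    (((exQ_continuousOn hα h).mul h2.continuousOn).add
      ((exR_continuousOn hα lam h).mul h1.continuousOn)).neg
  refine fun x hx => ⟨h1.hasDerivAt h2.continuousOn ?_ hx, h2.hasDerivAt hc ?_ hx⟩
  · filter_upwards [h1.ae_differentiableAt] with u hu hu0 using (hu hu0).hasDerivAt
  · filter_upwards [h2.ae_differentiableAt, (ae_restrict_iff' measurableSet_Ioi).1 he]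
      with u hu hu' hu0
    rw [← (Lexpr_eq_iff hu0).1 (hu' hu0)]
    exact (hu hu0).hasDerivAt

/-- Nothing pointwise is known about `f`, but `|f| ≤ a |f|² + 1/a` with `a = e^(x/2) * weight`. The
first term integrates to at most a constant times `e^(X/2)` by square integrability, and the second
is of the same order because the inverse weight is of order `e^x` up to powers. -/
theorem deficiency_mean_expGrowth {α : ℝ} (hα : NonInt α) {M₁ M₂ : MayaDiagram}
    (h : ∀ x : ℝ, 0 < x → Om α M₁ M₂ x ≠ 0) {f : ℝ → ℂ} (hf : ContinuousOn f (Ioi 0))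
    (hm : MemLp f 2 (weightMeasure α M₁ M₂)) :
    ExpGrowth (1 / 2) fun X => ((∫ x in X..X + 1, ‖f x‖ : ℝ) : ℂ) := by
  rw [memLp_weight_iff hα h hf] at hm
  set w := weight α M₁ M₂
  have hwc : ContinuousOn w (Ioi 0) := weight_continuousOn hα h
  have hwp : ∀ x : ℝ, 0 < x → 0 < w x := fun x hx => weight_pos hx (h x hx)
  -- This is the term `1/a`; the rate `1/2` balances it against `a |f|²`.
  set g : ℝ → ℂ := fun x => (Real.exp (-(1 / 2) * x) : ℂ) * ((w x)⁻¹ : ℂ) with hg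
  have hgc : ContinuousOn g (Ioi 0) := by
    have h1 : Continuous fun x : ℝ => (Real.exp (-(1 / 2) * x) : ℂ) := by fun_prop
    refine h1.continuousOn.mul (ContinuousOn.inv₀ ?_ fun x hx => ?_)
    · exact Complex.continuous_ofReal.comp_continuousOn hwc
    · exact_mod_cast (hwp x hx).ne'
  have hgg : ExpGrowth (1 / 2) g := by
    have := (expGrowth_exp (-(1 / 2))).mul (weight_inv_expGrowth α M₁ M₂)
    rwa [show -(1 / 2) + 1 = (1 / 2 : ℝ) by norm_num] at this
  have hmean := mean_expGrowth (by norm_num) hgc hgg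
  set I := ∫ x in Ioi (0 : ℝ), w x * ‖f x‖ ^ 2 with hI
  have h2 : ExpGrowth (1 / 2) fun X => ((Real.exp (1 / 2 * X) : ℝ) : ℂ) * (Real.exp (1 / 2) * I) := by
    have := (expGrowth_exp (1 / 2)).mul (expGrowth_const (Real.exp (1 / 2) * I))
    rwa [add_zero] at this
  obtain ⟨N, hN⟩ := h2.add hmean
  refine ⟨N, IsBigO.trans (IsBigO.of_bound 1 ?_) hN⟩
  filter_upwards [eventually_gt_atTop 0] with X hX
  have hsub : uIcc X (X + 1) ⊆ Ioi 0 := by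
    rw [uIcc_of_le (by linarith)]
    exact fun x hx => lt_of_lt_of_le hX hx.1
  have hwf : ContinuousOn (fun x => w x * ‖f x‖ ^ 2) (Ioi 0) := hwc.mul (hf.norm.pow 2)
  have i1 : IntervalIntegrable (fun x => ‖f x‖) volume X (X + 1) :=
    (hf.norm.mono hsub).intervalIntegrable
  have i2 : IntervalIntegrable (fun x => w x * ‖f x‖ ^ 2) volume X (X + 1) :=
    (hwf.mono hsub).intervalIntegrable
  have i3 : IntervalIntegrable (fun x => ‖g x‖) volume X (X + 1) :=
    (hgc.norm.mono hsub).intervalIntegrable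
  have hle : ∫ x in X..X + 1, ‖f x‖ ≤
      ∫ x in X..X + 1, (Real.exp (1 / 2 * (X + 1)) * (w x * ‖f x‖ ^ 2) + ‖g x‖) := by
    refine intervalIntegral.integral_mono_on (by linarith) i1 ((i2.const_mul _).add i3)
      fun x hx => ?_
    have hx0 : 0 < x := lt_of_lt_of_le hX hx.1
    have hw0 := hwp x hx0
    have hgn : ‖g x‖ = Real.exp (-(1 / 2) * x) * (w x)⁻¹ := by
      rw [hg, norm_mul, Complex.norm_real, norm_inv, Complex.norm_real,
        Real.norm_of_nonneg (Real.exp_pos _).le, Real.norm_of_nonneg hw0.le]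
    have hE : Real.exp (-(1 / 2) * x) = (Real.exp (1 / 2 * x))⁻¹ := by
      rw [← Real.exp_neg]
      ring_nf
    have hmono : Real.exp (1 / 2 * x) ≤ Real.exp (1 / 2 * (X + 1)) :=
      Real.exp_le_exp.2 (by linarith [hx.2])
    rw [hgn, hE]
    refine le_trans ?_ (add_le_add_left (mul_le_mul_of_nonneg_right hmono (by positivity)) _)
    have hEp := Real.exp_pos (1 / 2 * x)
    set a := Real.exp (1 / 2 * x) * w x with ha
    have ha0 : 0 < a := by positivity
    rw [← mul_inv, ← ha, ← mul_assoc, ← ha]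
    have h3 : 0 ≤ a⁻¹ * ((a * ‖f x‖ - 1) ^ 2 + a * ‖f x‖) := by positivity
    have h4 : a⁻¹ * ((a * ‖f x‖ - 1) ^ 2 + a * ‖f x‖) = a * ‖f x‖ ^ 2 + a⁻¹ - ‖f x‖ := by
      field_simp
      ring
    linarith
  rw [intervalIntegral.integral_add (i2.const_mul _) i3, intervalIntegral.integral_const_mul] at hle
  have hI0 : 0 ≤ ∫ x in X..X + 1, ‖f x‖ :=
    intervalIntegral.integral_nonneg (by linarith) fun x _ => norm_nonneg _
  have hJ : ∫ x in X..X + 1, w x * ‖f x‖ ^ 2 ≤ I := by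
    rw [intervalIntegral.integral_of_le (by linarith)]
    refine setIntegral_mono_set hm ?_ (Eventually.of_forall fun x hx => lt_trans hX hx.1)
    filter_upwards [ae_restrict_mem measurableSet_Ioi] with x hx
    have := hwp x hx
    positivity
  rw [one_mul, Complex.norm_real, Real.norm_of_nonneg hI0, ← Complex.ofReal_mul,
    ← Complex.ofReal_mul, ← Complex.ofReal_add, Complex.norm_real]
  refine (hle.trans ?_).trans (le_abs_self _)
  refine add_le_add_left ?_ _
  rw [mul_add, mul_one, Real.exp_add, mul_assoc]
  gcongr


/-! ### Deficiency elements are multiples of the transformed Tricomi function. -/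

/-- Computed from the germs at 0. The limit is nonzero for admissible `λ`, so the two transformed
solutions form a basis of solutions on the half-line. -/
theorem darboux_wronskian_tendsto {α : ℝ} (hα : NonInt α) (lam : ℂ) (M₁ M₂ : MayaDiagram) :
    Tendsto (fun x => exP α M₁ M₂ x * (darboux α M₁ M₂ (hFun α lam) x *
        deriv (darboux α M₁ M₂ (hTilde α lam)) x - deriv (darboux α M₁ M₂ (hFun α lam)) x *
        darboux α M₁ M₂ (hTilde α lam) x)) (𝓝[>] 0)
      (𝓝 (1 / om0 α M₁ M₂ ^ 2 * -(bAlpha α M₁ M₂ * sol0 α false lam M₁ M₂ *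
        sol0 α true lam M₁ M₂))) := by
  obtain ⟨F, hF, hF0, hFe⟩ := OmFirst_germ hα lam M₁ M₂
  obtain ⟨G, hG, hG0, hGe⟩ := OmSecond_germ hα lam M₁ M₂
  have h1 : ∀ᶠ x in 𝓝[>] (0 : ℝ), darboux α M₁ M₂ (hFun α lam) x = F x := by
    filter_upwards [hFe] with x hx
    rw [darboux_hFun, hx]
    simp
  have h2 : ∀ᶠ x in 𝓝[>] (0 : ℝ), darboux α M₁ M₂ (hTilde α lam) x =
      ((x ^ (-bAlpha α M₁ M₂) : ℝ) : ℂ) * G x := by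
    filter_upwards [hGe, self_mem_nhdsWithin] with x hx hx0
    rw [darboux_hTilde _ _ _ _ hx0, hx]
    simp
  have hid : Tendsto (fun x : ℝ => (x : ℂ)) (𝓝[>] 0) (𝓝 0) := by
    simpa using AnalyticAt.tendsto_nhdsGT (analyticAt_ofReal 0)
  have tF := AnalyticAt.tendsto_nhdsGT hF
  have tG := AnalyticAt.tendsto_nhdsGT hG
  have hlim := (weightFactor_tendsto hα M₁ M₂).mul ((tF.mul ((tG.const_mul
    (-bAlpha α M₁ M₂ : ℂ)).add (hid.mul (AnalyticAt.tendsto_nhdsGT hG.deriv)))).sub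
    (hid.mul ((AnalyticAt.tendsto_nhdsGT hF.deriv).mul tG)))
  have e : F 0 * (-bAlpha α M₁ M₂ * G 0 + 0 * deriv G 0) - 0 * (deriv F 0 * G 0) =
      -(bAlpha α M₁ M₂ * sol0 α false lam M₁ M₂ * sol0 α true lam M₁ M₂) := by
    rw [hF0, hG0]
    ring
  rw [e] at hlim
  refine hlim.congr' ?_
  filter_upwards [h1, h2, eventually_nhds_of_nhdsGT h1, eventually_hasDerivAt_of_germ hG h2,
    self_mem_nhdsWithin] with x e1 e2 e3 e4 hx
  have hx : 0 < x := hx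
  have e3 : darboux α M₁ M₂ (hFun α lam) =ᶠ[𝓝 x] F := e3
  rw [e1, e2, e3.deriv_eq, e4.deriv, exP]
  set b := bAlpha α M₁ M₂
  have e5 : ((x ^ (-b) : ℝ) : ℂ) = ((x ^ (-b - 1) : ℝ) : ℂ) * x := (rpow_mul_self_ofReal _ hx).symm
  have e6 : ((x ^ (b + 1) : ℝ) : ℂ) * ((x ^ (-b - 1) : ℝ) : ℂ) = 1 := by
    rw [← rpow_add_ofReal hx, show b + 1 + (-b - 1) = 0 by ring, Real.rpow_zero, Complex.ofReal_one]
  rw [e5]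
  push_cast
  generalize ((x ^ (b + 1) : ℝ) : ℂ) = p at *
  generalize ((x ^ (-b - 1) : ℝ) : ℂ) = q at *
  rw [mul_div_assoc, mul_comm p, mul_assoc]
  congr 1
  linear_combination -(F x * (-b * G x + x * deriv G x) - x * (deriv F x * G x)) * e6

theorem solution_eq_combination {α : ℝ} (hα : NonInt α) {lam : ℂ} {M₁ M₂ : MayaDiagram}
    (had : Admissible α lam M₁ M₂) (h : ∀ x : ℝ, 0 < x → Om α M₁ M₂ x ≠ 0) {f f' : ℝ → ℂ}
    (hf : LinSol (exQ α M₁ M₂) (exR α lam M₁ M₂) f f') :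
    ∃ c : ℂ, c ≠ 0 ∧ (∀ x : ℝ, 0 < x → exP α M₁ M₂ x * (darboux α M₁ M₂ (hFun α lam) x *
        deriv (darboux α M₁ M₂ (hTilde α lam)) x - deriv (darboux α M₁ M₂ (hFun α lam)) x *
        darboux α M₁ M₂ (hTilde α lam) x) = c) ∧
      ∃ A B : ℂ, ∀ x : ℝ, 0 < x → f x = A * darboux α M₁ M₂ (hFun α lam) x +
        B * darboux α M₁ M₂ (hTilde α lam) x := by
  have l1 := darboux_linSol hα h (hFun_isEig hα lam)
  have l2 := darboux_linSol hα h (hTilde_isEig hα lam)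
  have hp : ∀ x : ℝ, 0 < x → HasDerivAt (exP α M₁ M₂) (exP α M₁ M₂ x * exQ α M₁ M₂ x) x :=
    fun x hx => exP_hasDerivAt hα hx (h x hx)
  obtain ⟨c, hc⟩ := l1.abel l2 hp
  have hb : (bAlpha α M₁ M₂ : ℂ) ≠ 0 := by exact_mod_cast bAlpha_ne_zero hα M₁ M₂
  have hc0 : c ≠ 0 := by
    have := tendsto_nhds_unique (tendsto_const_nhds.congr' (by
      filter_upwards [self_mem_nhdsWithin] with x hx using (hc x hx).symm))
      (darboux_wronskian_tendsto hα lam M₁ M₂)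
    rw [this]
    exact mul_ne_zero (one_div_ne_zero (pow_ne_zero 2 (om0_ne_zero hα M₁ M₂)))
      (neg_ne_zero.2 (mul_ne_zero (mul_ne_zero hb (sol0_ne_zero hα had false))
        (sol0_ne_zero hα had true)))
  exact ⟨c, hc0, hc, l1.eq_of_wronskian l2 hf hp hc0 hc⟩

/-- In the basis of transformed solutions, the weighted Wronskian of `f` and `χ` is a nonzero
constant times the determinant of their coordinates. The growth criterion makes it vanish, so the
coordinates are proportional; those of `χ` are not both zero. -/
theorem deficiency_eq_multiple {α : ℝ} (hα : NonInt α) {lam : ℂ} {M₁ M₂ : MayaDiagram}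
    (had : Admissible α lam M₁ M₂) (h : ∀ x : ℝ, 0 < x → Om α M₁ M₂ x ≠ 0) {f : ℝ → ℂ}
    (hf : IsDeficiencyElement α lam M₁ M₂ f) :
    ∃ k : ℂ, ∀ x : ℝ, 0 < x → f x = k * chi α lam M₁ M₂ x := by
  have hfs := deficiency_linSol hα h hf
  obtain ⟨c, hc0, hc, A, B, hAB⟩ := solution_eq_combination hα had h hfs
  set y₁ := darboux α M₁ M₂ (hFun α lam)
  set y₂ := darboux α M₁ M₂ (hTilde α lam)
  have hχ : ∀ x : ℝ, 0 < x → chi α lam M₁ M₂ x = con α false lam * y₁ x + con α true lam * y₂ x :=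
    fun x hx => by rw [chi_eq hα lam M₁ M₂ hx, ← darboux_hTilde _ _ _ _ hx]; rfl
  have hd : ∀ {g : ℝ → ℂ} {a b : ℂ}, (∀ x : ℝ, 0 < x → g x = a * y₁ x + b * y₂ x) →
      ∀ x : ℝ, 0 < x → deriv g x = a * deriv y₁ x + b * deriv y₂ x := by
    intro g a b hg x hx
    have h1 : HasDerivAt y₁ (deriv y₁ x) x :=
      analyticAt_hasDerivAt (darboux_analyticAt hα M₁ M₂ hx (hFun_analyticAt hα lam x))
    have h2 : HasDerivAt y₂ (deriv y₂ x) x :=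
      analyticAt_hasDerivAt (darboux_analyticAt hα M₁ M₂ hx (hTilde_analyticAt hα lam hx))
    refine (((h1.const_mul a).add (h2.const_mul b)).congr_of_eventuallyEq ?_).deriv
    filter_upwards [Ioi_mem_nhds hx] with u hu using hg u hu
  -- The determinant of the coordinates of `f` and `χ`.
  set D := A * con α true lam - B * con α false lam with hD
  have hW : ∀ x : ℝ, 0 < x → ((x * weight α M₁ M₂ x : ℝ) : ℂ) *
      (f x * deriv (chi α lam M₁ M₂) x - deriv f x * chi α lam M₁ M₂ x) = D * c := by
    intro x hx
    rw [← exP_eq hx, hd hAB x hx, hd hχ x hx, hAB x hx, hχ x hx, ← hc x hx, hD]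
    ring
  have hana : ∀ x : ℝ, 0 < x → AnalyticAt ℝ (chi α lam M₁ M₂) x := fun x hx =>
    chi_analyticAt hα lam M₁ M₂ hx
  have hpg : ExpGrowth (-1) fun x => ((x * weight α M₁ M₂ x : ℝ) : ℂ) := by
    have := (expGrowth_rpow 1).mul (weight_expGrowth hα M₁ M₂)
    rw [zero_add] at this
    exact this.congr fun x _ => by simp
  have hfc : ContinuousOn f (Ioi 0) := fun x hx => (hfs x hx).1.continuousAt.continuousWithinAt
  have h0 : D * c = 0 := wronskian_eq_zero_of_expGrowth (p := fun x => x * weight α M₁ M₂ x)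
    (fun x hx => (hfs x hx).1) (fun x hx => analyticAt_hasDerivAt (hana x hx))
    (fun x hx => (hana x hx).deriv.continuousAt.continuousWithinAt)
    (fun x hx => mul_pos hx (weight_pos hx (h x hx)))
    (continuousOn_id.mul (weight_continuousOn hα h)) hW (chi_expGrowth hα lam M₁ M₂)
    (deriv_chi_expGrowth hα lam M₁ M₂) hpg (deficiency_mean_expGrowth hα h hfc hf.1.2.1)
  obtain ⟨k, hk1, hk2⟩ := exists_multiple_of_det_eq_zero
    ((mul_eq_zero.1 h0).resolve_right hc0) (gamma_coeff_ne_zero hα lam)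
  refine ⟨k, fun x hx => ?_⟩
  rw [hAB x hx, hχ x hx, hk1, hk2]
  simp only [con]
  simp
  ring

theorem hasNonzeroValZero_of_product {y : ℝ → ℂ} {C S c : ℂ} {ε : ℤˣ}
    (hy : HasGerm 0 c y) (h : C * valZero y = ((ε : ℤ) : ℂ) * S) (hS : S ≠ 0) :
    HasNonzeroValZero y := by
  refine hy.hasNonzeroValZero ?_
  rw [hy.valZero] at h
  refine right_ne_zero_of_mul (a := C) ?_
  rw [h]
  exact mul_ne_zero (left_ne_zero_of_mul_eq_one (units_sq ε)) hS

end ExceptionalLaguerre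

theorem mainTheorem7 (M₁ M₂ : MayaDiagram) :
    ∃ ε₁ ε₂ : ℤˣ, ∀ (α : ℝ) (lam : ℂ), (∀ k : ℤ, α ≠ k) → Admissible α lam M₁ M₂ →
      (HasNonzeroValZero (Om α M₁ M₂) ∧
        HasNonzeroValZero (OmFirst α lam M₁ M₂) ∧
        HasNonzeroValZero (OmSecond α lam M₁ M₂) ∧
        HasNonzeroValZero (OmFirstCan α lam M₁ M₂) ∧
        HasNonzeroValZero (OmSecondConj α lam M₁ M₂)) ∧
      (∃ x : ℝ, 0 < x ∧ chi α lam M₁ M₂ x ≠ 0) ∧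
      (∀ x : ℝ, 0 < x → Om α M₁ M₂ x ≠ 0 →
        Lexpr α M₁ M₂ (chi α lam M₁ M₂) x = lam * chi α lam M₁ M₂ x) ∧
      (∀ x : ℝ, 0 < x →
        chi α lam M₁ M₂ x =
          ((ε₁ : ℤ) : ℂ) * frakC α lam M₁ M₂ * u₁ α lam M₁ M₂ x +
          ((ε₂ : ℤ) : ℂ) * frakD α lam M₁ M₂ * u₂ α lam M₁ M₂ x) ∧
      (-1 < bAlpha α M₁ M₂ → bAlpha α M₁ M₂ < 1 →
        HasQuasiDeriv₀ α M₁ M₂ (chi α lam M₁ M₂) (((ε₁ : ℤ) : ℂ) * frakC α lam M₁ M₂) ∧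
        HasQuasiDeriv₁ α M₁ M₂ (chi α lam M₁ M₂) (((ε₂ : ℤ) : ℂ) * frakD α lam M₁ M₂) ∧
        ((∀ x : ℝ, 0 < x → Om α M₁ M₂ x ≠ 0) →
          ∀ f : ℝ → ℂ, IsDeficiencyElement α lam M₁ M₂ f ↔
            ∃ c : ℂ, ∀ x : ℝ, 0 < x → f x = c * chi α lam M₁ M₂ x)) := by
  obtain ⟨ε₁, h₁⟩ := exists_sign_first M₁ M₂
  obtain ⟨ε₂, h₂⟩ := exists_sign_second M₁ M₂
  refine ⟨ε₁, ε₂, fun α lam hα had => ?_⟩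
  have hα : NonInt α := hα
  have s₁ := h₁ α lam hα had
  have s₂ := h₂ α lam hα had
  have hC := sign_mul_frakC hα s₁
  have hD := sign_mul_frakD hα s₂
  have n₁ := sol0_ne_zero hα had false
  have n₂ := sol0_ne_zero hα had true
  refine ⟨⟨(Om_germ hα M₁ M₂).hasNonzeroValZero (om0_ne_zero hα M₁ M₂),
    (OmFirst_germ hα lam M₁ M₂).hasNonzeroValZero n₁,
    (OmSecond_germ hα lam M₁ M₂).hasNonzeroValZero n₂,
    hasNonzeroValZero_of_product (OmFirst_germ (hα.alphaCan M₁ M₂) _ _ _) s₁ n₁,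
    hasNonzeroValZero_of_product (OmSecond_germ (hα.alphaConj M₁ M₂) _ _ _) s₂ n₂⟩,
    chi_ne_zero hα had, fun x hx h0 => Lexpr_chi hα lam M₁ M₂ hx h0,
    fun x hx => chi_eq_combination hα had hC hD hx, fun hb hb' => ⟨?_, ?_, fun h f => ⟨?_, ?_⟩⟩⟩
  · rw [hC]
    exact hasQuasiDeriv₀_chi hα lam M₁ M₂ hb'
  · rw [hD]
    exact hasQuasiDeriv₁_chi hα lam M₁ M₂ hb
  · exact fun hf => deficiency_eq_multiple hα had h hf
  · exact fun ⟨c, hc⟩ => isDeficiencyElement_of_eq hα h hb hb' hc
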